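/- **Setting.** Let $\phi:J_1\to J_2$ be an increasing homeomorphism between open intervals containing $0$, $\phi(0)=0$, $J_2=(\varrho_-,\varrho_+)$, $h:=\phi^{-1}$; let $g:\mathbb R\to\mathbb R$ be continuous with $g(0)=0$ and $g(s)s>0$ for $s\ne0$; let $0=t_0<s_0<t_1<s_1<\dots<t_m<s_m=L$, $\mu_i>0$, and let $a(t)=\mu_i$ on $[t_i,s_i]$ $(0\le i\le m)$, $a(t)=0$ on $(s_i,t_{i+1})$ $(0\le i\le m-1)$. Put $\tau_i=s_i-t_i$, $\varsigma_i=t_{i+1}-s_i$. Let $\lambda<0$. Assume that the initial value problems in $\mathbb R\times(\varrho_-,\varrho_+)$ for $x'=h(y),\ y'=-\lambda x-\mu_i g(x)$ $(0\le i\le m)$ and for $x'=h(y),\ y'=-\lambda x$ have unique solutions (forward and backward in time). Put $$H(y)=\int_0^y h,\quad G(x)=\int_0^x g,\quad F_i(x)=\tfrac\lambda2x^2+\mu_iG(x),\quad \mathcal H_i(x,y)=H(y)+F_i(x),$$ and let $H_+^{-1},H_-^{-1}$ be the inverses of $H$ restricted to $[0,\varrho_+)$, $(\varrho_-,0]$,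 and $G_+^{-1},G_-^{-1}$ those of $G$ restricted to $[0,\infty)$, $(-\infty,0]$. Let $H^*=\min\{\lim_{y\to\varrho_-}H(y),\lim_{y\to\varrho_+}H(y)\}$. **Annuli.** For each $i\in\{0,\dots,m\}$ let $0<c_{1,i}<c_{2,i}$ be such that for every $c\in[c_{1,i},c_{2,i}]$ there are $x_{-}^i(c)<0<x_{+}^i(c)$ with $F_i(x_\pm^i(c))=c$, $F_i<c$ on $(x_-^i(c),x_+^i(c))$ and $F_i'(x_-^i(c))<0<F_i'(x_+^i(c))$, and such that $c_{2,i}-F_i(x)<H^*$ for all $x\in[x_-^i(c_{2,i}),x_+^i(c_{2,i})]$. Let $$\mathcal A_i=\{(x,y): x_-^i(c_{2,i})\le x\le x_+^i(c_{2,i}),\ y\in(\varrho_-,\varrho_+),\ c_{1,i}\le\mathcal H_i(x,y)\le c_{2,i}\},$$ and for a quadrant $\kappa\in\{I,II,III,IV\}$ let $\mathcal A_{i,\kappa}$ be the intersection of $\mathcal A_i$ with the closed quadrant $\kappa$. Put $y_\pm(c)=H_\pm^{-1}(c)$. Quadrants are counted cyclically in the clockwise order $IV\prec III\prec II\prec I\prec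 IV$; thus $I+1=IV$, $I-1=II$, $III+1=II$, $III-1=IV$. **Twist conditions.** The crossing times of the quadrants along $\mathcal H_i=c$ are $$\mathcal T_{i,I}(c)=\int_0^{x_+^i(c)}\frac{dx}{h(H_+^{-1}(c-F_i(x)))},\qquad \mathcal T_{i,IV}(c)=\int_0^{x_+^i(c)}\frac{dx}{-h(H_-^{-1}(c-F_i(x)))},$$ $$\mathcal T_{i,II}(c)=\int_{x_-^i(c)}^0\frac{dx}{h(H_+^{-1}(c-F_i(x)))},\qquad \mathcal T_{i,III}(c)=\int_{x_-^i(c)}^0\frac{dx}{-h(H_-^{-1}(c-F_i(x)))},$$ and $\mathcal T_i(c)$ is their sum. Assume that for every $i\in\{0,\dots,m\}$ there are integers $0\le\alpha_i<\beta_i$ and levels $d_i,e_i$ with $\{d_i,e_i\}=\{c_{1,i},c_{2,i}\}$ such that, for $\kappa\in\{I,III\}$, $$\mathcal T_{i,\kappa+1}(d_i)+\mathcal T_{i,\kappa+2}(d_i)+\alpha_i\mathcal T_i(d_i)>\tau_i,\qquad \mathcal T_{i,\kappa}(e_i)+\mathcal T_{i,\kappa+1}(e_i)+\beta_i\mathcal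 T_i(e_i)<\tau_i .$$ **Transition times.** For $i\in\{0,\dots,m-1\}$ put $y_{+,i}=\min\{y_+(c_{1,i}),y_+(c_{1,i+1})\}$, $y_{-,i}=\max\{y_-(c_{1,i}),y_-(c_{1,i+1})\}$, $x_{+,i}=\min\{x_+^i(c_{1,i}),x_+^{i+1}(c_{1,i+1})\}$, $x_{-,i}=\max\{x_-^i(c_{1,i}),x_-^{i+1}(c_{1,i+1})\}$, and, for $k\in\{i,i+1\}$, $$p^\pm_k=G_\pm^{-1}\!\big(\mu_k^{-1}[c_{2,k}-H(y_{+,i})]\big),\qquad q^\pm_k=G_\pm^{-1}\!\big(\mu_k^{-1}[c_{2,k}-H(y_{-,i})]\big),$$ $$r^\pm_k=G_\pm^{-1}\!\Big(G(x^k_\pm(c_{2,k}))+\tfrac{\lambda}{2\mu_k}\big[x^k_\pm(c_{2,k})^2-x_{\pm,i}^2\big]\Big).$$ Define $$\mathcal S_{i,II\to I}=\int_{p^-_i}^{p^+_{i+1}}\frac{dx}{h(H_+^{-1}(H(y_{+,i})-\frac\lambda2x^2))},\qquad \mathcal S_{i,IV\to III}=\int_{q^-_{i+1}}^{q^+_i}\frac{dx}{-h(H_-^{-1}(H(y_{-,i})-\frac\lambda2x^2))},$$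 $$\mathcal S_{i,IV\to I}=\int_{x_{+,i}}^{r^+_{i+1}}\frac{dx}{h(H_+^{-1}(\frac\lambda2(x_{+,i}^2-x^2)))}+\int_{x_{+,i}}^{r^+_i}\frac{dx}{-h(H_-^{-1}(\frac\lambda2(x_{+,i}^2-x^2)))},$$ $$\mathcal S_{i,II\to III}=\int_{r^-_i}^{x_{-,i}}\frac{dx}{h(H_+^{-1}(\frac\lambda2(x_{-,i}^2-x^2)))}+\int_{r^-_{i+1}}^{x_{-,i}}\frac{dx}{-h(H_-^{-1}(\frac\lambda2(x_{-,i}^2-x^2)))},$$ and assume that all four are $\le\varsigma_i$, for every $i\in\{0,\dots,m-1\}$. **Boundary conditions.** Let $\kappa_0\in\{I,III\}$, $\kappa_L\in\{II,IV\}$, let $r_0$ be an arc contained in $\mathcal A_{0,\kappa_0}$ joining the inner boundary $\mathcal H_0=c_{1,0}$ to the outer boundary $\mathcal H_0=c_{2,0}$, and $r_L$ an arc contained in $\mathcal A_{m,\kappa_L}$ joining $\mathcal H_m=c_{1,m}$ to $\mathcal H_m=c_{2,m}$ (an arc is a homeomorphic image of $[0,1]$). **Theorem.** For each such choice of $r_0$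 and $r_L$, the problem $$x'=h(y),\qquad y'=-\lambda x-a(t)g(x)\quad\text{on }[0,L],\qquad (x(0),y(0))\in r_0,\quad (x(L),y(L))\in r_L$$ has at least $4^m\prod_{i=0}^m(\beta_i-\alpha_i)$ nodal solutions, i.e. solutions whose component $x$ changes sign in $(0,L)$ and has finitely many zeros in $[0,L]$, all simple ($y\ne0$ there). Moreover, call itinerary any choice of $\kappa_i\in\{I,III\}$, $\kappa_i'\in\{II,IV\}$ and $j_i\in\{1,\dots,\beta_i-\alpha_i\}$ $(0\le i\le m)$, with $\kappa_0$ the given one and $\kappa_m'=\kappa_L$. There are exactly $4^m\prod_{i=0}^m(\beta_i-\alpha_i)$ itineraries, and to each of them one can assign a nodal solution of the problem, different itineraries having different solutions, such that: 1. for every $i\in\{0,\dots,m\}$: $(x,y)(t_i)\in\mathcal A_{i,\kappa_i}$ and $(x,y)(s_i)\in\mathcal A_{i,\kappa'_i}$; $x$ has exactly $n_i$ zeros in $(t_i,s_i)$ and $y$ has exactly $n_i+1$ zeros in $[t_i,s_i]$, where $n_i=2(\alpha_i+j_i)-1$ if $\kappa_i'=\kappa_i-1$ and $n_i=2(\alpha_i+j_i)$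 if $\kappa_i'=\kappa_i+1$; 2. for every $i\in\{0,\dots,m-1\}$: if $(\kappa_i',\kappa_{i+1})\in\{(II,I),(IV,III)\}$, then in $[s_i,t_{i+1}]$ $x$ has exactly one zero, lying in $(s_i,t_{i+1})$, and $y$ has none; if $(\kappa_i',\kappa_{i+1})\in\{(IV,I),(II,III)\}$, then in $[s_i,t_{i+1}]$ $y$ has exactly one zero, lying in $(s_i,t_{i+1})$, and $x$ has none. -/

import Mathlib

open Set

noncomputable section

/-- The four quadrants of the phase plane. -/
inductive Quadrant
  | I
  | II
  | III
  | IV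
  deriving DecidableEq

namespace Quadrant

/-- The successor `κ + 1` in the cyclic clockwise order `IV ≺ III ≺ II ≺ I ≺ IV`. -/
def next : Quadrant → Quadrant
  | I => IV
  | IV => III
  | III => II
  | II => I

/-- The predecessor `κ - 1` in the cyclic clockwise order `IV ≺ III ≺ II ≺ I ≺ IV`. -/
def prev : Quadrant → Quadrant
  | I => II
  | II => III
  | III => IV
  | IV => I

/-- The closed quadrant as a subset of the plane. -/
def region : Quadrant → Set (ℝ × ℝ)
  | I => {p | 0 ≤ p.1 ∧ 0 ≤ p.2}
  | II => {p | p.1 ≤ 0 ∧ 0 ≤ p.2}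
  | III => {p | p.1 ≤ 0 ∧ p.2 ≤ 0}
  | IV => {p | 0 ≤ p.1 ∧ p.2 ≤ 0}

end Quadrant

/-- The data of the equation `-(φ(u'))' = λ u + a(t) g(u)` on `[0, L]` with a stepwise weight:
`φ` is an increasing homeomorphism of the open interval `J₁ ∋ 0` onto its image, `φ 0 = 0`;
`g` is continuous with `g 0 = 0` and `g(s) s > 0` for `s ≠ 0`;
`0 = t₀ < s₀ < t₁ < s₁ < ... < t_m < s_m = L`, and the weight equals `μ_i > 0` on `[t_i, s_i]`
and vanishes on the gaps `(s_i, t_{i+1})`. -/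
structure SwitchedProblem (m : ℕ) where
  J₁ : Set ℝ
  J₁_isOpen : IsOpen J₁
  J₁_ordConnected : J₁.OrdConnected
  zero_mem_J₁ : (0 : ℝ) ∈ J₁
  φ : ℝ → ℝ
  φ_continuousOn : ContinuousOn φ J₁
  φ_strictMonoOn : StrictMonoOn φ J₁
  φ_zero : φ 0 = 0
  g : ℝ → ℝ
  g_continuous : Continuous g
  g_zero : g 0 = 0
  g_sign : ∀ x, x ≠ 0 → 0 < g x * x
  lam : ℝ
  t : Fin (m + 1) → ℝ
  s : Fin (m + 1) → ℝ
  μ : Fin (m + 1) → ℝ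
  t_zero : t 0 = 0
  t_lt_s : ∀ i, t i < s i
  s_lt_t : ∀ i : Fin m, s i.castSucc < t i.succ
  μ_pos : ∀ i, 0 < μ i

namespace SwitchedProblem

variable {m : ℕ} (P : SwitchedProblem m)

/-- The length of the time interval, `L = s_m`. -/
def L : ℝ := P.s (Fin.last m)

/-- The stepwise weight `a(t)`. -/
def weight (r : ℝ) : ℝ := ∑ i, (Icc (P.t i) (P.s i)).indicator (fun _ => P.μ i) r

/-- `τ_i = s_i - t_i`. -/
def tau (i : Fin (m + 1)) : ℝ := P.s i - P.t i

/-- `ς_i = t_{i+1} - s_i`. -/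
def gap (i : Fin m) : ℝ := P.t i.succ - P.s i.castSucc

/-- The open interval `J₂ = φ(J₁) = (ϱ₋, ϱ₊)`, the range of the second phase variable. -/
def J₂ : Set ℝ := P.φ '' P.J₁

/-- `h = φ⁻¹ : J₂ → J₁` (only its values on `J₂` are meaningful). -/
def h : ℝ → ℝ := Function.invFunOn P.φ P.J₁

/-- `H(y) = ∫₀^y h`. -/
def H (y : ℝ) : ℝ := ∫ r in (0 : ℝ)..y, P.h r

/-- `G(x) = ∫₀^x g`. -/
def G (x : ℝ) : ℝ := ∫ r in (0 : ℝ)..x, P.g r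

/-- The inverse of `H` restricted to `[0, ϱ₊)`. -/
def HinvPos : ℝ → ℝ := Function.invFunOn P.H (P.J₂ ∩ Ici 0)

/-- The inverse of `H` restricted to `(ϱ₋, 0]`. -/
def HinvNeg : ℝ → ℝ := Function.invFunOn P.H (P.J₂ ∩ Iic 0)

/-- The inverse of `G` restricted to `[0, ∞)`. -/
def GinvPos : ℝ → ℝ := Function.invFunOn P.G (Ici 0)

/-- The inverse of `G` restricted to `(-∞, 0]`. -/
def GinvNeg : ℝ → ℝ := Function.invFunOn P.G (Iic 0)

/-- `c < H* = min {H(ϱ₋), H(ϱ₊)}`, where `H(ϱ_±)` is the limit (equivalently, the supremum, which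
is not attained) of `H` at the end `ϱ_±` of `J₂`. -/
def BelowHStar (c : ℝ) : Prop :=
  (∃ y ∈ P.J₂, 0 < y ∧ c < P.H y) ∧ (∃ y ∈ P.J₂, y < 0 ∧ c < P.H y)

/-- `f_{i,λ}(x) = λ x + μ_i g(x)`. -/
def f (i : Fin (m + 1)) (x : ℝ) : ℝ := P.lam * x + P.μ i * P.g x

/-- `F_{i,λ}(x) = ∫₀^x f_{i,λ} = λ x² / 2 + μ_i G(x)`. -/
def F (i : Fin (m + 1)) (x : ℝ) : ℝ := P.lam / 2 * x ^ 2 + P.μ i * P.G x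

/-- The Hamiltonian `ℋ_{i,λ}(x, y) = H(y) + F_{i,λ}(x)` of the nonlinear system. -/
def ham (i : Fin (m + 1)) (p : ℝ × ℝ) : ℝ := P.H p.2 + P.F i p.1

/-- `x₊(c)`: the first positive solution of `F_{i,λ}(x) = c`. -/
def xPos (i : Fin (m + 1)) (c : ℝ) : ℝ := sInf {x | 0 < x ∧ P.F i x = c}

/-- `x₋(c)`: the first solution of `F_{i,λ}(x) = c` to the left of the origin. -/
def xNeg (i : Fin (m + 1)) (c : ℝ) : ℝ := sSup {x | x < 0 ∧ P.F i x = c}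

/-- The level `c` is regular: `x₋(c) < 0 < x₊(c)`, `F(x_±(c)) = c`, `F < c` in between, and
`F'(x₋(c)) < 0 < F'(x₊(c))`. -/
def RegularLevel (i : Fin (m + 1)) (c : ℝ) : Prop :=
  P.xNeg i c < 0 ∧ 0 < P.xPos i c ∧
  P.F i (P.xNeg i c) = c ∧ P.F i (P.xPos i c) = c ∧
  (∀ x ∈ Ioo (P.xNeg i c) (P.xPos i c), P.F i x < c) ∧
  P.f i (P.xNeg i c) < 0 ∧ 0 < P.f i (P.xPos i c)

/-- `y₊(c)`, the positive ordinate at which the level line `ℋ = c` meets the `y`-axis. -/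
def yPos (c : ℝ) : ℝ := P.HinvPos c

/-- `y₋(c)`, the negative ordinate at which the level line `ℋ = c` meets the `y`-axis. -/
def yNeg (c : ℝ) : ℝ := P.HinvNeg c

/-- The levels `c₁ < c₂` define an annulus of periodic orbits of the `i`-th nonlinear system: all
levels in between are regular, and the closed orbits lie in the strip `ℝ × (ϱ₋, ϱ₊)` where the
system is defined, i.e. the value `H(y) = c₂ - F(x)` on the outer orbit stays below `H*`
(at `x = 0` this is `c₂ < H*`). -/
def IsAnnulus (i : Fin (m + 1)) (c₁ c₂ : ℝ) : Prop :=
  0 < c₁ ∧ c₁ < c₂ ∧ (∀ c ∈ Icc c₁ c₂, P.RegularLevel i c) ∧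
  ∀ x ∈ Icc (P.xNeg i c₂) (P.xPos i c₂), P.BelowHStar (c₂ - P.F i x)

/-- The annulus `𝒜_i`: the union of the closed orbits `ℋ = c` around the origin, `c₁ ≤ c ≤ c₂`.
(The bound on the first coordinate discards other components of `{c₁ ≤ ℋ ≤ c₂}`.) -/
def annulus (i : Fin (m + 1)) (c₁ c₂ : ℝ) : Set (ℝ × ℝ) :=
  {p | p.2 ∈ P.J₂ ∧ p.1 ∈ Icc (P.xNeg i c₂) (P.xPos i c₂) ∧ P.ham i p ∈ Icc c₁ c₂}

/-- `𝒜_{i,κ}`: the part of the annulus in the closed quadrant `κ`. -/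
def annulusPart (i : Fin (m + 1)) (c₁ c₂ : ℝ) (κ : Quadrant) : Set (ℝ × ℝ) :=
  P.annulus i c₁ c₂ ∩ κ.region

/-- `r` is an arc (a homeomorphic image of `[0, 1]`) contained in `𝒜_{i,κ}` that joins the inner
boundary `ℋ = c₁` with the outer boundary `ℋ = c₂`. -/
def IsLinkingArc (i : Fin (m + 1)) (c₁ c₂ : ℝ) (κ : Quadrant) (r : Set (ℝ × ℝ)) : Prop :=
  ∃ γ : ℝ → ℝ × ℝ, ContinuousOn γ (Icc 0 1) ∧ InjOn γ (Icc 0 1) ∧ γ '' Icc 0 1 = r ∧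
    r ⊆ P.annulusPart i c₁ c₂ κ ∧ P.ham i (γ 0) = c₁ ∧ P.ham i (γ 1) = c₂

/-- `𝒯_{i,κ}(c)`: the time needed to cross the quadrant `κ` along the orbit `ℋ_{i,λ} = c`. -/
def quarterTime (i : Fin (m + 1)) (κ : Quadrant) (c : ℝ) : ℝ :=
  match κ with
  | .I => ∫ x in (0 : ℝ)..(P.xPos i c), 1 / P.h (P.HinvPos (c - P.F i x))
  | .IV => ∫ x in (0 : ℝ)..(P.xPos i c), 1 / (-P.h (P.HinvNeg (c - P.F i x)))
  | .III => ∫ x in (P.xNeg i c)..(0 : ℝ), 1 / (-P.h (P.HinvNeg (c - P.F i x)))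
  | .II => ∫ x in (P.xNeg i c)..(0 : ℝ), 1 / P.h (P.HinvPos (c - P.F i x))

/-- `𝒯_i(c)`: the period of the orbit `ℋ_{i,λ} = c`. -/
def period (i : Fin (m + 1)) (c : ℝ) : ℝ :=
  P.quarterTime i .I c + P.quarterTime i .IV c + P.quarterTime i .III c + P.quarterTime i .II c

/-- The twist condition in the quadrant `κ`, with levels `d`, `e` and integers `α < β`. -/
def Twist (i : Fin (m + 1)) (α β : ℕ) (d e : ℝ) (κ : Quadrant) : Prop :=
  P.tau i < P.quarterTime i κ.next d + P.quarterTime i κ.next.next d + α * P.period i d ∧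
  P.quarterTime i κ e + P.quarterTime i κ.next e + β * P.period i e < P.tau i

section Transition

variable (c₁ c₂ : Fin (m + 1) → ℝ) (i : Fin m)

/-- `y_{+,i} = min {y₊(c_{1,i}), y₊(c_{1,i+1})}`. -/
def yLinkPos : ℝ := min (P.yPos (c₁ i.castSucc)) (P.yPos (c₁ i.succ))

/-- `y_{-,i} = max {y₋(c_{1,i}), y₋(c_{1,i+1})}`. -/
def yLinkNeg : ℝ := max (P.yNeg (c₁ i.castSucc)) (P.yNeg (c₁ i.succ))

/-- `x_{+,i} = min {x₊(c_{1,i}), x₊(c_{1,i+1})}`. -/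
def xLinkPos : ℝ := min (P.xPos i.castSucc (c₁ i.castSucc)) (P.xPos i.succ (c₁ i.succ))

/-- `x_{-,i} = max {x₋(c_{1,i}), x₋(c_{1,i+1})}`. -/
def xLinkNeg : ℝ := max (P.xNeg i.castSucc (c₁ i.castSucc)) (P.xNeg i.succ (c₁ i.succ))

/-- The abscissa in `x ≥ 0` at which the line `ℰ = ℰ(0, y)` meets the orbit `ℋ_{k,λ} = c`. -/
def meetPosY (k : Fin (m + 1)) (y c : ℝ) : ℝ := P.GinvPos ((P.μ k)⁻¹ * (c - P.H y))

/-- The abscissa in `x ≤ 0` at which the line `ℰ = ℰ(0, y)` meets the orbit `ℋ_{k,λ} = c`. -/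
def meetNegY (k : Fin (m + 1)) (y c : ℝ) : ℝ := P.GinvNeg ((P.μ k)⁻¹ * (c - P.H y))

/-- The abscissa in `x ≥ 0` at which the line `ℰ = ℰ(ξ, 0)` meets the orbit `ℋ_{k,λ} = c`. -/
def meetPosX (k : Fin (m + 1)) (ξ c : ℝ) : ℝ :=
  P.GinvPos (P.G (P.xPos k c) + P.lam / (2 * P.μ k) * (P.xPos k c ^ 2 - ξ ^ 2))

/-- The abscissa in `x ≤ 0` at which the line `ℰ = ℰ(ξ, 0)` meets the orbit `ℋ_{k,λ} = c`. -/
def meetNegX (k : Fin (m + 1)) (ξ c : ℝ) : ℝ :=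
  P.GinvNeg (P.G (P.xNeg k c) + P.lam / (2 * P.μ k) * (P.xNeg k c ^ 2 - ξ ^ 2))

/-- The transition time `𝒮_{i, II → I}` along `ℰ = ℰ(0, y_{+,i})`, where
`ℰ(x, y) = H(y) + λ x² / 2`. -/
def timeIItoI : ℝ :=
  ∫ x in (P.meetNegY i.castSucc (P.yLinkPos c₁ i) (P.H (P.yPos (c₂ i.castSucc))))..
      (P.meetPosY i.succ (P.yLinkPos c₁ i) (P.H (P.yPos (c₂ i.succ)))),
    1 / P.h (P.HinvPos (P.H (P.yLinkPos c₁ i) - P.lam / 2 * x ^ 2))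

/-- The transition time `𝒮_{i, IV → III}` along `ℰ = ℰ(0, y_{-,i})`. -/
def timeIVtoIII : ℝ :=
  ∫ x in (P.meetNegY i.succ (P.yLinkNeg c₁ i) (P.H (P.yNeg (c₂ i.succ))))..
      (P.meetPosY i.castSucc (P.yLinkNeg c₁ i) (P.H (P.yNeg (c₂ i.castSucc)))),
    1 / (-P.h (P.HinvNeg (P.H (P.yLinkNeg c₁ i) - P.lam / 2 * x ^ 2)))

/-- The transition time `𝒮_{i, IV → I}` along `ℰ = ℰ(x_{+,i}, 0)`. -/
def timeIVtoI : ℝ :=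
  (∫ x in (P.xLinkPos c₁ i)..(P.meetPosX i.succ (P.xLinkPos c₁ i) (c₂ i.succ)),
    1 / P.h (P.HinvPos (P.lam / 2 * (P.xLinkPos c₁ i ^ 2 - x ^ 2)))) +
  ∫ x in (P.xLinkPos c₁ i)..(P.meetPosX i.castSucc (P.xLinkPos c₁ i) (c₂ i.castSucc)),
    1 / (-P.h (P.HinvNeg (P.lam / 2 * (P.xLinkPos c₁ i ^ 2 - x ^ 2))))

/-- The transition time `𝒮_{i, II → III}` along `ℰ = ℰ(x_{-,i}, 0)`. -/
def timeIItoIII : ℝ :=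
  (∫ x in (P.meetNegX i.castSucc (P.xLinkNeg c₁ i) (c₂ i.castSucc))..(P.xLinkNeg c₁ i),
    1 / P.h (P.HinvPos (P.lam / 2 * (P.xLinkNeg c₁ i ^ 2 - x ^ 2)))) +
  ∫ x in (P.meetNegX i.succ (P.xLinkNeg c₁ i) (c₂ i.succ))..(P.xLinkNeg c₁ i),
    1 / (-P.h (P.HinvNeg (P.lam / 2 * (P.xLinkNeg c₁ i ^ 2 - x ^ 2))))

end Transition

/-- `(x, y)` solves the autonomous system `x' = h(y)`, `y' = -k(x)` on `[0, T]`. -/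
def SolvesAutonomous (k : ℝ → ℝ) (T : ℝ) (x y : ℝ → ℝ) : Prop :=
  ∀ r ∈ Icc 0 T, y r ∈ P.J₂ ∧ HasDerivWithinAt x (P.h (y r)) (Icc 0 T) r ∧
    HasDerivWithinAt y (-k (x r)) (Icc 0 T) r

/-- Uniqueness of the solutions of the initial value problems of `x' = h(y)`, `y' = -k(x)` in
`ℝ × (ϱ₋, ϱ₊)` (forward and backward in time). -/
def UniqueIVP (k : ℝ → ℝ) : Prop :=
  ∀ (T : ℝ) (x y u v : ℝ → ℝ), P.SolvesAutonomous k T x y → P.SolvesAutonomous k T u v →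
    ∀ r₀ ∈ Icc 0 T, x r₀ = u r₀ → y r₀ = v r₀ → EqOn x u (Icc 0 T) ∧ EqOn y v (Icc 0 T)

/-- `(x, y)` solves `x' = h(y)`, `y' = -λ x - a(t) g(x)` on `[0, L]`. As the weight is a step
function, the Carathéodory solutions are the continuous pairs for which the first equation holds
everywhere and the second one away from the switching times `t_i`, `s_i`. -/
def IsSolution (x y : ℝ → ℝ) : Prop :=
  ContinuousOn y (Icc 0 P.L) ∧
  ∀ r ∈ Icc 0 P.L, y r ∈ P.J₂ ∧ HasDerivWithinAt x (P.h (y r)) (Icc 0 P.L) r ∧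
    ((∀ i, r ≠ P.t i ∧ r ≠ P.s i) →
      HasDerivWithinAt y (-P.lam * x r - P.weight r * P.g (x r)) (Icc 0 P.L) r)

/-- A nodal solution of the boundary value problem: a solution with `(x(0), y(0)) ∈ r₀` and
`(x(L), y(L)) ∈ r_L` whose first component changes sign in `(0, L)` and has finitely many zeros
in `[0, L]`, all of them simple. -/
def IsNodalSolution (r₀ rL : Set (ℝ × ℝ)) (x y : ℝ → ℝ) : Prop :=
  P.IsSolution x y ∧ (x 0, y 0) ∈ r₀ ∧ (x P.L, y P.L) ∈ rL ∧
  (∃ r ∈ Ioo 0 P.L, x r < 0) ∧ (∃ r ∈ Ioo 0 P.L, 0 < x r) ∧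
  {r ∈ Icc 0 P.L | x r = 0}.Finite ∧ ∀ r ∈ Icc 0 P.L, x r = 0 → y r ≠ 0

/-- The set of nodal solutions, as functions on `[0, L]`. -/
def nodalSolutions (r₀ rL : Set (ℝ × ℝ)) : Set (Icc (0 : ℝ) P.L → ℝ × ℝ) :=
  {z | ∃ x y, P.IsNodalSolution r₀ rL x y ∧ z = (Icc 0 P.L).domRestrict fun r => (x r, y r)}

end SwitchedProblem

/-- An itinerary in the transition diagram with all four links `II → I`, `II → III`, `IV → III`,
`IV → I` between consecutive annuli: on the `i`-th annulus one enters in the quadrant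
`entry i ∈ {I, III}` and leaves from the quadrant `exit i ∈ {II, IV}`, using the crossing number
`j_i = lap i + 1 ∈ {1, ..., β_i - α_i}`; the first entry and the last exit are prescribed. -/
structure Itinerary {m : ℕ} (α β : Fin (m + 1) → ℕ) (κ₀ κL : Quadrant) where
  entry : Fin (m + 1) → Quadrant
  exit : Fin (m + 1) → Quadrant
  lap : (i : Fin (m + 1)) → Fin (β i - α i)
  entry_mem : ∀ i, entry i = .I ∨ entry i = .III
  exit_mem : ∀ i, exit i = .II ∨ exit i = .IV
  entry_zero : entry 0 = κ₀
  exit_last : exit (Fin.last m) = κL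

/-- The number of zeros of `u` in `A`. -/
def zeroCount (u : ℝ → ℝ) (A : Set ℝ) : ℕ∞ := {r ∈ A | u r = 0}.encard

namespace Itinerary

variable {m : ℕ} {α β : Fin (m + 1) → ℕ} {κ₀ κL : Quadrant} (w : Itinerary α β κ₀ κL)

/-- The number of zeros of `x` in `(t_i, s_i)`: `2(α_i + j_i) - 1` if one passes from the quadrant
`κ` to `κ - 1`, and `2(α_i + j_i)` if one passes from `κ` to `κ + 1`. -/
def nodes (i : Fin (m + 1)) : ℕ :=
  if w.exit i = (w.entry i).prev then 2 * (α i + (w.lap i + 1)) - 1 else 2 * (α i + (w.lap i + 1))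

/-- Whether the link to the next annulus is `II → I` or `IV → III`; otherwise it is `IV → I` or
`II → III`. -/
def CrossesYAxis (i : Fin m) : Prop := w.exit i.castSucc = (w.entry i.succ).prev

instance (i : Fin m) : Decidable (w.CrossesYAxis i) :=
  inferInstanceAs (Decidable (w.exit i.castSucc = (w.entry i.succ).prev))

end Itinerary

/-- The solution `(x, y)` follows the itinerary `w`: it visits the prescribed parts of the annuli at
the times `t_i`, `s_i` and has exactly the nodal behaviour which `w` encodes.
On `(t_i, s_i)`, `x` has `w.nodes i` zeros, and on `[t_i, s_i]`, `y` has one more.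
On the gap `[s_i, t_{i+1}]`, either `x` has exactly one zero, which is interior, and `y` has none
(links `II → I`, `IV → III`), or conversely (links `IV → I`, `II → III`). -/
def SwitchedProblem.Follows {m : ℕ} (P : SwitchedProblem m) (c₁ c₂ : Fin (m + 1) → ℝ)
    {α β : Fin (m + 1) → ℕ} {κ₀ κL : Quadrant} (w : Itinerary α β κ₀ κL) (x y : ℝ → ℝ) : Prop :=
  (∀ i, (x (P.t i), y (P.t i)) ∈ P.annulusPart i (c₁ i) (c₂ i) (w.entry i) ∧
    (x (P.s i), y (P.s i)) ∈ P.annulusPart i (c₁ i) (c₂ i) (w.exit i) ∧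
    zeroCount x (Ioo (P.t i) (P.s i)) = w.nodes i ∧
    zeroCount y (Icc (P.t i) (P.s i)) = w.nodes i + 1) ∧
  ∀ i : Fin m,
    zeroCount x (Icc (P.s i.castSucc) (P.t i.succ)) = (if w.CrossesYAxis i then 1 else 0) ∧
    zeroCount x (Ioo (P.s i.castSucc) (P.t i.succ)) = (if w.CrossesYAxis i then 1 else 0) ∧
    zeroCount y (Icc (P.s i.castSucc) (P.t i.succ)) = (if w.CrossesYAxis i then 0 else 1) ∧
    zeroCount y (Ioo (P.s i.castSucc) (P.t i.succ)) = (if w.CrossesYAxis i then 0 else 1)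

end

open Filter Topology MeasureTheory
open scoped NNReal


/-! On `[t_i, s_i]` the motion is Hamiltonian: trajectories in the annulus run clockwise on closed
level lines, and the time spent in a quadrant is an integral of `dx / x'`. The twist condition says
that one boundary orbit turns too slowly and the other fast enough. Take an arc in quadrant I or III
joining the two boundaries, and measure the angle clockwise from the ray at which this quadrant
begins. For each `n` with `2α + 1 ≤ n ≤ 2β`, the angle at time `τ_i` is at most `(2n+1)π/2` at one
end of the arc and at least `(2n+2)π/2` at the other. A subarc is therefore carried onto a path
which joins the axes inside a single quadrant, II or IV according to the parity of `n`. Since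
multiples of `π/2` are crossed only upwards, the angle counts the zeros of `x` and `y`. This is
`exists_stretching_across_annulus`.

In a gap, `λ < 0` makes the origin a saddle with first integral `H(y) - N(x)`, `N(x) = -λx²/2`.
Consider the link II → I. The points of a path joining the axes in II have `H - N ≥ min c₁` on the
`y`-axis and `H - N ≤ 0` on the `x`-axis. The points at the level `min c₁` have time to pass beyond
the outer boundary of the next annulus: this is the bound on the transition time. The points at the
level `0` never reach the `y`-axis, since only the origin has this level there. By continuity a
subpath arrives as a path in I from the inner to the outer boundary of the next annulus
(`exists_linking_reparametrization`). The other links follow by exchanging the coordinates and by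
the half-turn `p ↦ -p`. Crossings and links thus compose along any itinerary
(`IsStrip.exists_path`). The last path joins the axes inside the sector of `r_L`, which `r_L` links
from boundary to boundary, so they meet by a planar crossing argument with angles
(`IsStrip.exists_mem_arc`). The quadrants at the times `t_i`, `s_i` and the zero counts determine
the itinerary, so different itineraries have different solutions (`Follows.itinerary_eq`).

Two points of rigour shape the proof. The fields are merely continuous, so existence and continuous
dependence come from compactness and uniqueness. Moreover `h` lives on `J₂` only and level sets of
`F_i` may have further components, so `h` and `f_i` are extended by constants outside the range of
the annuli, and the trajectories used are shown to stay where nothing was changed. -/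

/-! ### Solutions of autonomous systems with continuous right-hand side -/

/-- `z` is an integral curve of the autonomous vector field `V` on `[0, T]`. -/
def IsFlowLine {E : Type*} [NormedAddCommGroup E] [NormedSpace ℝ E] (V : E → E) (T : ℝ)
    (z : ℝ → E) : Prop :=
  ∀ t ∈ Icc 0 T, HasDerivWithinAt z (V (z t)) (Icc 0 T) t

section FlowLines

variable {E : Type*} [NormedAddCommGroup E] [NormedSpace ℝ E] {V : E → E} {T : ℝ} {z : ℝ → E}

theorem IsFlowLine.continuousOn (hz : IsFlowLine V T z) : ContinuousOn z (Icc 0 T) :=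
  fun t ht => (hz t ht).continuousWithinAt

theorem IsFlowLine.hasDerivAt (hz : IsFlowLine V T z) {t : ℝ} (ht : t ∈ Ioo 0 T) :
    HasDerivAt z (V (z t)) t :=
  (hz t (Ioo_subset_Icc_self ht)).hasDerivAt (Icc_mem_nhds ht.1 ht.2)

theorem IsFlowLine.mono (hz : IsFlowLine V T z) {T' : ℝ} (h : T' ≤ T) : IsFlowLine V T' z :=
  fun t ht => (hz t ⟨ht.1, ht.2.trans h⟩).mono (Icc_subset_Icc_right h)

theorem IsFlowLine.lipschitzOnWith (hz : IsFlowLine V T z) {M : ℝ≥0} (hM : ∀ p, ‖V p‖ ≤ M) :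
    LipschitzOnWith M z (Icc 0 T) :=
  (convex_Icc 0 T).lipschitzOnWith_of_nnnorm_hasDerivWithin_le hz fun t _ => hM (z t)

theorem IsFlowLine.eq_integral [CompleteSpace E] (hz : IsFlowLine V T z) (hV : Continuous V)
    {t : ℝ} (ht : t ∈ Icc 0 T) : z t = z 0 + ∫ s in (0 : ℝ)..t, V (z s) := by
  have hsub : Icc 0 t ⊆ Icc 0 T := Icc_subset_Icc_right ht.2
  rw [intervalIntegral.integral_eq_sub_of_hasDerivAt_of_le ht.1 (hz.continuousOn.mono hsub)
    (fun s hs => hz.hasDerivAt ⟨hs.1, hs.2.trans_le ht.2⟩)]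
  · abel
  · refine ContinuousOn.intervalIntegrable ?_
    rw [uIcc_of_le ht.1]
    exact hV.comp_continuousOn (hz.continuousOn.mono hsub)

/-- The integral equation passes to uniform limits while derivatives do not; with
`IsFlowLine.eq_integral` it allows limits of flow lines to be taken. -/
theorem isFlowLine_of_eq_integral [CompleteSpace E] (hV : Continuous V)
    (hz : ContinuousOn z (Icc 0 T)) {p : E}
    (h : ∀ t ∈ Icc 0 T, z t = p + ∫ s in (0 : ℝ)..t, V (z s)) : IsFlowLine V T z := by
  intro t ht
  have h0 : (0 : ℝ) ∈ Icc 0 T := ⟨le_rfl, ht.1.trans ht.2⟩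
  have := ODE.hasDerivWithinAt_picard_Icc (f := fun _ => V) (u := univ) h0
    (by exact (hV.comp continuous_snd).continuousOn) hz (fun _ _ => mem_univ _) p ht
  exact this.congr (fun s hs => h s hs) (h t ht)

theorem IsFlowLine.congr (hz : IsFlowLine V T z) {w : ℝ → E} (h : EqOn w z (Icc 0 T)) :
    IsFlowLine V T w := fun t ht => by
  rw [h ht]
  exact (hz t ht).congr (fun s hs => h hs) (h ht)

/-- Bounded sequences of integral curves of fields converging to `V` have limit points, which are
integral curves of `V`. -/
theorem exists_subseq_tendsto_isFlowLine [ProperSpace E] (hT : 0 ≤ T) (hV : Continuous V)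
    {W : ℕ → E → E} (hWc : ∀ n, Continuous (W n)) {M : ℝ≥0} (hM : ∀ n p, ‖W n p‖ ≤ M)
    (hW : ∀ (φ : ℕ → ℕ) (q : ℕ → E) (p : E), StrictMono φ → Tendsto q atTop (𝓝 p) →
      Tendsto (fun n => W (φ n) (q n)) atTop (𝓝 (V p)))
    {z : ℕ → ℝ → E} (hz : ∀ n, IsFlowLine (W n) T (z n)) {p : E}
    (h0 : Tendsto (fun n => z n 0) atTop (𝓝 p)) :
    ∃ φ : ℕ → ℕ, StrictMono φ ∧ ∃ w : ℝ → E, IsFlowLine V T w ∧ w 0 = p ∧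
      TendstoUniformlyOn (fun n => z (φ n)) w atTop (Icc 0 T) := by
  have : CompleteSpace E := inferInstance
  obtain ⟨R, hR⟩ := (Metric.isBounded_range_of_tendsto _ h0).subset_closedBall 0
  have hzc : ∀ n, ContinuousOn (z n) (Icc 0 T) := fun n => (hz n).continuousOn
  let f : ℕ → BoundedContinuousFunction (Icc (0 : ℝ) T) E := fun n =>
    BoundedContinuousFunction.mkOfCompact ⟨fun t => z n t,
      continuousOn_iff_continuous_domRestrict.1 (hzc n)⟩
  -- The compact set for Arzelà–Ascoli: the common bound `M` of the fields is a Lipschitz constant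
  -- for all the curves, and `R` bounds their convergent initial values.
  let A : Set (BoundedContinuousFunction (Icc (0 : ℝ) T) E) :=
    {g | (∀ s t, dist (g s) (g t) ≤ M * dist s t) ∧ ∀ t, g t ∈ Metric.closedBall (0 : E) (R + M * T)}
  have hA : IsCompact A := by
    refine BoundedContinuousFunction.arzela_ascoli₂ (Metric.closedBall (0 : E) (R + M * T))
      (isCompact_closedBall _ _) A ?_ (fun g t hg => hg.2 t) ?_
    · simp only [A, ofPred_and, ofPred_forall]
      refine IsClosed.inter ?_ ?_
      · refine isClosed_iInter fun s => isClosed_iInter fun t => isClosed_le ?_ continuous_const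
        exact (continuous_eval_const s).dist
          (continuous_eval_const t)
      · refine isClosed_iInter fun t => ?_
        exact Metric.isClosed_closedBall.preimage
          (continuous_eval_const t)
    · refine Metric.equicontinuous_of_continuity_modulus (fun x => M * x) ?_ _ ?_
      · have : Tendsto (fun x : ℝ => (M : ℝ) * x) (𝓝 0) (𝓝 (M * 0)) :=
          tendsto_const_nhds.mul tendsto_id
        simpa using this
      · exact fun s t g => g.2.1 s t
  have hfA : ∀ n, f n ∈ A := by
    intro n
    have hl := (hz n).lipschitzOnWith (hM n)
    refine ⟨fun s t => hl.dist_le_mul _ s.2 _ t.2, fun t => ?_⟩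
    have h1 := hl.dist_le_mul _ t.2 0 ⟨le_rfl, hT⟩
    have h2 : dist (z n 0) 0 ≤ R := hR (mem_range_self n)
    have h3 : dist (t : ℝ) 0 ≤ T := by
      rw [Real.dist_eq, sub_zero, abs_of_nonneg t.2.1]; exact t.2.2
    have h4 : (M : ℝ) * dist (t : ℝ) 0 ≤ M * T := mul_le_mul_of_nonneg_left h3 M.2
    have h5 := dist_triangle (z n t) (z n 0) 0
    rw [Metric.mem_closedBall]
    change dist (z n t) 0 ≤ _
    linarith
  obtain ⟨g, -, φ, hφ, hg⟩ := hA.tendsto_subseq hfA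
  have hu := BoundedContinuousFunction.tendsto_iff_tendstoUniformly.1 hg
  let w : ℝ → E := fun t => g (projIcc 0 T hT t)
  have hwc : Continuous w := g.continuous.comp continuous_projIcc
  have hzw : TendstoUniformlyOn (fun n => z (φ n)) w atTop (Icc 0 T) := by
    rw [Metric.tendstoUniformlyOn_iff]
    intro ε hε
    filter_upwards [Metric.tendstoUniformly_iff.1 hu ε hε] with n hn t ht
    have := hn ⟨t, ht⟩
    simp only [w, projIcc_of_mem hT ht]
    exact this
  have hpt : ∀ t ∈ Icc 0 T, Tendsto (fun n => z (φ n) t) atTop (𝓝 (w t)) := fun t ht =>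
    hzw.tendsto_at ht
  have hw0 : w 0 = p := tendsto_nhds_unique (hpt 0 ⟨le_rfl, hT⟩) (h0.comp hφ.tendsto_atTop)
  refine ⟨φ, hφ, w, isFlowLine_of_eq_integral hV hwc.continuousOn (p := p) ?_, hw0, hzw⟩
  intro t ht
  refine tendsto_nhds_unique (hpt t ht) ?_
  have hE : (fun n => z (φ n) t) = fun n => z (φ n) 0 + ∫ s in (0 : ℝ)..t, W (φ n) (z (φ n) s) := by
    funext n
    exact (hz (φ n)).eq_integral (hWc _) ht
  rw [hE]
  refine (h0.comp hφ.tendsto_atTop).add ?_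
  refine intervalIntegral.tendsto_integral_filter_of_dominated_convergence (fun _ => (M : ℝ))
    (Eventually.of_forall fun n => ?_) (Eventually.of_forall fun n => ?_)
    intervalIntegrable_const ?_
  · refine ContinuousOn.aestronglyMeasurable ?_ measurableSet_uIoc
    refine (hWc _).comp_continuousOn ((hzc _).mono ?_)
    rw [uIoc_of_le ht.1]
    exact Ioc_subset_Icc_self.trans (Icc_subset_Icc_right ht.2)
  · exact Eventually.of_forall fun s _ => hM _ _
  · refine Eventually.of_forall fun s hs => ?_
    rw [uIoc_of_le ht.1] at hs
    exact hW φ _ _ hφ (hpt s ⟨hs.1.le, hs.2.trans ht.2⟩)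

/-- Global existence for bounded Lipschitz fields. -/
theorem exists_isFlowLine_of_lipschitz [CompleteSpace E] (hT : 0 ≤ T) {K M : ℝ≥0}
    (hV : LipschitzWith K V) (hM : ∀ p, ‖V p‖ ≤ M) (p : E) :
    ∃ z, IsFlowLine V T z ∧ z 0 = p := by
  -- The field is bounded by `M` everywhere, so no curve leaves the ball of radius `M * T` and
  -- Picard–Lindelöf gives the whole interval at once.
  have hP : IsPicardLindelof (fun _ => V) (⟨0, le_rfl, hT⟩ : Icc (0 : ℝ) T) p
      (M * ⟨T, hT⟩) 0 M K :=
    { lipschitzOnWith := fun _ _ => hV.lipschitzOnWith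
      continuousOn := fun _ _ => continuousOn_const
      norm_le := fun _ _ x _ => hM x
      mul_max_le := by
        rw [sub_zero, sub_zero, max_eq_left hT, NNReal.coe_zero, sub_zero]
        exact le_rfl }
  obtain ⟨z, h0, h⟩ := hP.exists_eq_forall_mem_Icc_hasDerivWithinAt₀
  exact ⟨z, h, h0⟩

end FlowLines

/-! ### Lipschitz approximation of continuous functions by moving averages -/

/-- The moving average of `h` over intervals of length `1 / (n + 1)`. -/
noncomputable def movingAverage (h : ℝ → ℝ) (n : ℕ) (y : ℝ) : ℝ :=
  (n + 1) * ∫ s in y..(y + 1 / ((n : ℝ) + 1)), h s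

section MovingAverage

variable {h : ℝ → ℝ}

/-- An average of values `ε`-close to `c` is `ε`-close to `c`. The choice `c = 0` gives boundedness,
`c = h y` gives convergence. -/
theorem abs_movingAverage_sub_le (hh : Continuous h) (n : ℕ) (y c ε : ℝ)
    (hε : ∀ s ∈ Icc y (y + 1 / ((n : ℝ) + 1)), |h s - c| ≤ ε) :
    |movingAverage h n y - c| ≤ ε := by
  have hn : (0 : ℝ) < n + 1 := by positivity
  have hle : y ≤ y + 1 / ((n : ℝ) + 1) := by have := one_div_pos.2 hn; linarith
  have h1 : movingAverage h n y - c =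
      (n + 1) * ∫ s in y..(y + 1 / ((n : ℝ) + 1)), (h s - c) := by
    rw [intervalIntegral.integral_sub (hh.intervalIntegrable _ _) intervalIntegrable_const,
      intervalIntegral.integral_const, movingAverage, smul_eq_mul]
    field_simp
    ring
  have h2 : ‖∫ s in y..(y + 1 / ((n : ℝ) + 1)), (h s - c)‖ ≤
      ε * |y + 1 / ((n : ℝ) + 1) - y| := by
    refine intervalIntegral.norm_integral_le_of_norm_le_const fun s hs => ?_
    rw [uIoc_of_le hle] at hs
    exact hε s (Ioc_subset_Icc_self hs)
  rw [h1, abs_mul, abs_of_pos hn]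
  rw [add_sub_cancel_left, abs_of_pos (one_div_pos.2 hn), Real.norm_eq_abs] at h2
  calc _ ≤ ((n : ℝ) + 1) * (ε * (1 / ((n : ℝ) + 1))) := mul_le_mul_of_nonneg_left h2 hn.le
    _ = ε := by field_simp

theorem abs_movingAverage_le (hh : Continuous h) {M : ℝ} (hM : ∀ y, |h y| ≤ M) (n : ℕ) (y : ℝ) :
    |movingAverage h n y| ≤ M := by
  simpa using abs_movingAverage_sub_le hh n y 0 M fun s _ => by simpa using hM s

/-- Moving the window changes the integral only near its two ends, by at most `M * |x - y|` at each;
the normalization contributes the factor `n + 1`. -/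
theorem lipschitzWith_movingAverage (hh : Continuous h) {M : ℝ≥0} (hM : ∀ y, |h y| ≤ M) (n : ℕ) :
    LipschitzWith ((n + 1) * (2 * M)) (movingAverage h n) := by
  refine LipschitzWith.of_dist_le_mul fun x y => ?_
  have hn : (0 : ℝ) < n + 1 := by positivity
  have hi : ∀ a b, IntervalIntegrable h volume a b := fun a b => hh.intervalIntegrable a b
  have hb : ∀ a b, |∫ s in a..b, h s| ≤ M * |b - a| := fun a b => by
    simpa using intervalIntegral.norm_integral_le_of_norm_le_const (a := a) (b := b)
      (f := h) (C := M) fun s _ => by simpa using hM s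
  set δ := 1 / ((n : ℝ) + 1)
  have h1 : (∫ s in x..(x + δ), h s) - ∫ s in y..(y + δ), h s =
      (∫ s in x..y, h s) - ∫ s in (x + δ)..(y + δ), h s := by
    rw [intervalIntegral.integral_interval_sub_interval_comm (hi _ _) (hi _ _) (hi _ _)]
  rw [Real.dist_eq, Real.dist_eq, movingAverage, movingAverage, ← mul_sub, h1, abs_mul,
    abs_of_pos hn]
  have h2 := hb x y
  have h3 := hb (x + δ) (y + δ)
  rw [show y + δ - (x + δ) = y - x by ring] at h3
  rw [abs_sub_comm x y]
  push_cast
  rw [mul_assoc]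
  refine mul_le_mul_of_nonneg_left ?_ hn.le
  have := abs_sub (∫ s in x..y, h s) (∫ s in (x + δ)..(y + δ), h s)
  linarith

theorem tendsto_movingAverage (hh : Continuous h) {φ : ℕ → ℕ} (hφ : StrictMono φ) {q : ℕ → ℝ}
    {y : ℝ} (hq : Tendsto q atTop (𝓝 y)) :
    Tendsto (fun n => movingAverage h (φ n) (q n)) atTop (𝓝 (h y)) := by
  rw [Metric.tendsto_atTop]
  intro ε hε
  obtain ⟨δ, hδ, hδ'⟩ := Metric.continuous_iff.1 hh y (ε / 2) (half_pos hε)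
  have h1 : ∀ᶠ n in atTop, dist (q n) y < δ / 2 := Metric.tendsto_nhds.1 hq _ (half_pos hδ)
  have h2 : ∀ᶠ n in atTop, 1 / ((φ n : ℝ) + 1) < δ / 2 :=
    (tendsto_one_div_add_atTop_nhds_zero_nat.comp hφ.tendsto_atTop).eventually_lt_const
      (half_pos hδ)
  obtain ⟨N, hN⟩ := eventually_atTop.1 (h1.and h2)
  refine ⟨N, fun n hn => ?_⟩
  obtain ⟨h1, h2⟩ := hN n hn
  rw [Real.dist_eq]
  refine lt_of_le_of_lt (abs_movingAverage_sub_le hh _ _ _ (ε / 2) fun s hs => ?_) (half_lt_self hε)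
  rw [← Real.dist_eq]
  refine (hδ' s ?_).le
  rw [Real.dist_eq, abs_lt] at h1 ⊢
  constructor <;> linarith [hs.1, hs.2]

end MovingAverage

/-! ### Planar systems `x' = h(y)`, `y' = -k(x)` -/

/-- The vector field of the planar system `x' = h(y)`, `y' = -k(x)`. -/
def sepField (h k : ℝ → ℝ) (p : ℝ × ℝ) : ℝ × ℝ := (h p.2, -k p.1)

section SepField

variable {h k : ℝ → ℝ} {T : ℝ}

theorem continuous_sepField (hh : Continuous h) (hk : Continuous k) :
    Continuous (sepField h k) := by
  unfold sepField; fun_prop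

theorem norm_sepField_le {M : ℝ} (hh : ∀ y, |h y| ≤ M) (hk : ∀ x, |k x| ≤ M) (p : ℝ × ℝ) :
    ‖sepField h k p‖ ≤ M := by
  rw [Prod.norm_def]
  exact max_le (hh _) (by simpa [sepField] using hk p.1)

/-- Peano's theorem: averaging `h` and `k` gives bounded Lipschitz fields, and a limit point of
their flow lines solves the original system. -/
theorem exists_isFlowLine_of_bounded (hT : 0 ≤ T) (hh : Continuous h) (hk : Continuous k)
    {M : ℝ≥0} (hhM : ∀ y, |h y| ≤ M) (hkM : ∀ x, |k x| ≤ M) (p : ℝ × ℝ) :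
    ∃ z, IsFlowLine (sepField h k) T z ∧ z 0 = p := by
  have hex : ∀ n : ℕ, ∃ z, IsFlowLine (sepField (movingAverage h n) (movingAverage k n)) T z ∧
      z 0 = p := fun n => by
    have hl : LipschitzWith ((n + 1) * (2 * M))
        (sepField (movingAverage h n) (movingAverage k n)) := by
      have h1 := (lipschitzWith_movingAverage hh hhM n).comp
        (LipschitzWith.prod_snd (α := ℝ) (β := ℝ))
      have h2 := ((lipschitzWith_movingAverage hk hkM n).comp
        (LipschitzWith.prod_fst (α := ℝ) (β := ℝ))).neg
      have h3 := h1.prodMk h2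
      simp only [mul_one, max_self] at h3
      exact h3
    exact exists_isFlowLine_of_lipschitz hT hl (norm_sepField_le
      (abs_movingAverage_le hh hhM n) (abs_movingAverage_le hk hkM n)) p
  choose z hz hz0 using hex
  have hc : ∀ n, Continuous (movingAverage h n) := fun n =>
    (lipschitzWith_movingAverage hh hhM n).continuous
  have hc' : ∀ n, Continuous (movingAverage k n) := fun n =>
    (lipschitzWith_movingAverage hk hkM n).continuous
  obtain ⟨φ, -, w, hw, hw0, -⟩ := exists_subseq_tendsto_isFlowLine (p := p) hT
    (continuous_sepField hh hk) (fun n => continuous_sepField (hc n) (hc' n))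
    (fun n => norm_sepField_le
      (abs_movingAverage_le hh hhM n) (abs_movingAverage_le hk hkM n)) (by
      intro φ q p hφ hq
      have h1 := tendsto_movingAverage hh hφ ((continuous_snd.tendsto p).comp hq)
      have h2 := (tendsto_movingAverage hk hφ ((continuous_fst.tendsto p).comp hq)).neg
      exact h1.prodMk_nhds h2) hz (by simp [hz0])
  exact ⟨w, hw, hw0⟩

/-- Along a path of initial points with unique solutions, the solutions depend continuously on the
parameter. -/
theorem exists_continuousOn_flow_of_bounded (hT : 0 ≤ T) (hh : Continuous h) (hk : Continuous k)
    {M : ℝ≥0} (hhM : ∀ y, |h y| ≤ M) (hkM : ∀ x, |k x| ≤ M) {γ : ℝ → ℝ × ℝ} {I : Set ℝ}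
    (hγ : ContinuousOn γ I)
    (huniq : ∀ θ ∈ I, ∀ z w, IsFlowLine (sepField h k) T z → IsFlowLine (sepField h k) T w →
      z 0 = γ θ → w 0 = γ θ → EqOn z w (Icc 0 T)) :
    ∃ Z : ℝ → ℝ → ℝ × ℝ, ContinuousOn (fun q : ℝ × ℝ => Z q.1 q.2) (I ×ˢ Icc 0 T) ∧
      ∀ θ, IsFlowLine (sepField h k) T (Z θ) ∧ Z θ 0 = γ θ := by
  choose Z hZ hZ0 using fun θ => exists_isFlowLine_of_bounded hT hh hk hhM hkM (γ θ)
  refine ⟨Z, ?_, fun θ => ⟨hZ θ, hZ0 θ⟩⟩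
  rintro ⟨θ, t⟩ ⟨hθ, ht⟩
  rw [ContinuousWithinAt, tendsto_iff_seq_tendsto]
  intro u hu
  obtain ⟨hu1, hu2⟩ := tendsto_nhdsWithin_iff.1 hu
  refine tendsto_of_subseq_tendsto fun ψ hψ => ?_
  obtain ⟨ρ, hρ, hmem⟩ : ∃ ρ : ℕ → ℕ, Tendsto ρ atTop atTop ∧
      ∀ n, u (ψ (ρ n)) ∈ I ×ˢ Icc 0 T := by
    obtain ⟨N, hN⟩ := eventually_atTop.1 (hψ.eventually hu2)
    exact ⟨fun n => n + N, tendsto_add_atTop_nat N, fun n => hN _ (Nat.le_add_left _ _)⟩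
  have hv : Tendsto (fun n => u (ψ (ρ n))) atTop (𝓝 (θ, t)) := hu1.comp (hψ.comp hρ)
  have hv1 : Tendsto (fun n => (u (ψ (ρ n))).1) atTop (𝓝[I] θ) :=
    tendsto_nhdsWithin_iff.2 ⟨(continuous_fst.tendsto (θ, t)).comp hv,
      Eventually.of_forall fun n => (hmem n).1⟩
  have hv2 : Tendsto (fun n => (u (ψ (ρ n))).2) atTop (𝓝[Icc 0 T] t) :=
    tendsto_nhdsWithin_iff.2 ⟨(continuous_snd.tendsto (θ, t)).comp hv,
      Eventually.of_forall fun n => (hmem n).2⟩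
  -- Any limit of the flow lines starts at `γ θ`, hence is `Z θ` by uniqueness. So every sequence
  -- has a subsequence with the correct limit, which gives continuity.
  obtain ⟨φ, hφ, w, hw, hw0, hunif⟩ := exists_subseq_tendsto_isFlowLine (p := γ θ) hT
    (continuous_sepField hh hk) (W := fun _ => sepField h k)
    (fun n => continuous_sepField hh hk)
    (fun n => norm_sepField_le hhM hkM)
    (fun φ q p _ hq => ((continuous_sepField hh hk).tendsto p).comp hq)
    (z := fun n => Z (u (ψ (ρ n))).1) (fun n => hZ _)
    (by simp only [hZ0]; exact (hγ θ hθ).tendsto.comp hv1)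
  have heq := huniq θ hθ w (Z θ) hw (hZ θ) hw0 (hZ0 θ)
  refine ⟨fun n => ρ (φ n), ?_⟩
  have := hunif.tendsto_comp (g := fun n => (u (ψ (ρ (φ n)))).2) (x := t)
    (hw.continuousOn t ht) (hv2.comp hφ.tendsto_atTop)
  rw [heq ht] at this
  exact this

theorem isFlowLine_sepField_iff {x y : ℝ → ℝ} :
    IsFlowLine (sepField h k) T (fun t => (x t, y t)) ↔
      ∀ t ∈ Icc 0 T, HasDerivWithinAt x (h (y t)) (Icc 0 T) t ∧
        HasDerivWithinAt y (-k (x t)) (Icc 0 T) t := by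
  refine ⟨fun H t ht => ⟨?_, ?_⟩, fun H t ht => (H t ht).1.prodMk (H t ht).2⟩
  · exact (hasFDerivAt_fst.comp_hasDerivWithinAt t (H t ht) :)
  · exact (hasFDerivAt_snd.comp_hasDerivWithinAt t (H t ht) :)

theorem IsFlowLine.fst {z : ℝ → ℝ × ℝ} (H : IsFlowLine (sepField h k) T z) {t : ℝ}
    (ht : t ∈ Icc 0 T) : HasDerivWithinAt (fun t => (z t).1) (h (z t).2) (Icc 0 T) t :=
  (isFlowLine_sepField_iff.1 H t ht).1

theorem IsFlowLine.snd {z : ℝ → ℝ × ℝ} (H : IsFlowLine (sepField h k) T z) {t : ℝ}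
    (ht : t ∈ Icc 0 T) : HasDerivWithinAt (fun t => (z t).2) (-k (z t).1) (Icc 0 T) t :=
  (isFlowLine_sepField_iff.1 H t ht).2

/-- Truncation of a function outside `[-R, R]`. -/
def truncate (k : ℝ → ℝ) (R : ℝ) (x : ℝ) : ℝ := k (max (-R) (min R x))

theorem truncate_eq {R x : ℝ} (hx : |x| ≤ R) : truncate k R x = k x := by
  rw [abs_le] at hx
  rw [truncate, min_eq_right hx.2, max_eq_right hx.1]

/-- Continuous dependence when only `h` is bounded. -/
theorem exists_continuousOn_flow (hT : 0 ≤ T) (hh : Continuous h) (hk : Continuous k)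
    {M : ℝ} (hhM : ∀ y, |h y| ≤ M) {γ : ℝ → ℝ × ℝ} {I : Set ℝ} (hI : IsCompact I)
    (hγ : ContinuousOn γ I)
    (huniq : ∀ θ ∈ I, ∀ z w, IsFlowLine (sepField h k) T z → IsFlowLine (sepField h k) T w →
      z 0 = γ θ → w 0 = γ θ → EqOn z w (Icc 0 T)) :
    ∃ Z : ℝ → ℝ → ℝ × ℝ, ContinuousOn (fun q : ℝ × ℝ => Z q.1 q.2) (I ×ˢ Icc 0 T) ∧
      ∀ θ ∈ I, IsFlowLine (sepField h k) T (Z θ) ∧ Z θ 0 = γ θ := by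
  obtain ⟨R₀, hR₀⟩ := (hI.image_of_continuousOn hγ).isBounded.exists_norm_le
  have hM0 : 0 ≤ M := (abs_nonneg _).trans (hhM 0)
  -- As `|x'| = |h(y)| ≤ M`, trajectories from `γ` satisfy `|x| ≤ R` up to time `T` whatever `k` is.
  -- Truncating `k` at `R` therefore changes none of them.
  set R := |R₀| + M * T with hRdef
  have hR : 0 ≤ R := by positivity
  have hkt : Continuous (truncate k R) := by unfold truncate; fun_prop
  obtain ⟨C, hC⟩ := (isCompact_Icc (a := -R) (b := R)).exists_bound_of_continuousOn hk.continuousOn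
  have hCb : ∀ x, |truncate k R x| ≤ C := fun x =>
    hC _ ⟨le_max_left _ _, max_le (by linarith) (min_le_left _ _)⟩
  have hfl : ∀ k', ∀ z, IsFlowLine (sepField h k') T z → ∀ θ ∈ I, z 0 = γ θ →
      ∀ t ∈ Icc 0 T, |(z t).1| ≤ R := by
    intro k' z hz θ hθ h0 t ht
    have h1 := (convex_Icc 0 T).norm_image_sub_le_of_norm_hasDerivWithin_le
      (f := fun t => (z t).1) (C := M) (fun s hs => hz.fst hs) (fun s _ => hhM _)
      ⟨le_rfl, hT⟩ ht
    have h2 : |(z 0).1| ≤ |R₀| :=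
      (le_max_left _ _).trans ((hR₀ _ ⟨θ, hθ, h0.symm⟩).trans (le_abs_self _))
    rw [Real.norm_eq_abs, Real.norm_eq_abs, sub_zero, abs_of_nonneg ht.1] at h1
    have h3 : M * t ≤ M * T := mul_le_mul_of_nonneg_left ht.2 hM0
    have h4 := abs_add_le (((z t).1) - (z 0).1) (z 0).1
    rw [sub_add_cancel] at h4
    linarith
  have hiff : ∀ z, ∀ θ ∈ I, z 0 = γ θ →
      (IsFlowLine (sepField h (truncate k R)) T z ↔ IsFlowLine (sepField h k) T z) := by
    intro z θ hθ h0
    constructor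
    · intro hz t ht
      have := hz t ht
      rwa [sepField, truncate_eq (hfl _ z hz θ hθ h0 t ht)] at this
    · intro hz t ht
      have := hz t ht
      rwa [sepField, ← truncate_eq (k := k) (hfl _ z hz θ hθ h0 t ht)] at this
  have hCM : ∀ y, |h y| ≤ ((Real.toNNReal (max C M) : ℝ≥0) : ℝ) := fun y =>
    (hhM y).trans ((le_max_right _ _).trans (Real.le_coe_toNNReal _))
  have hCM' : ∀ x, |truncate k R x| ≤ ((Real.toNNReal (max C M) : ℝ≥0) : ℝ) := fun x =>
    (hCb x).trans ((le_max_left _ _).trans (Real.le_coe_toNNReal _))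
  obtain ⟨Z, hZc, hZ⟩ := exists_continuousOn_flow_of_bounded hT hh hkt hCM hCM' hγ
    (fun θ hθ z w hz hw h0 h0' => huniq θ hθ z w ((hiff z θ hθ h0).1 hz) ((hiff w θ hθ h0').1 hw)
      h0 h0')
  exact ⟨Z, hZc, fun θ hθ => ⟨(hiff _ θ hθ (hZ θ).2).1 (hZ θ).1, (hZ θ).2⟩⟩

end SepField


/-! ### Intermediate values -/

section IntermediateValues

variable {f : ℝ → ℝ} {a b : ℝ}

/-- `b'` is the first point where `f ≥ q` and `a'` the last point before it where `f ≤ p`. This cuts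
out of a path the piece crossing a strip. -/
theorem exists_subinterval_increasing (hab : a ≤ b) (hf : ContinuousOn f (Icc a b)) {p q : ℝ}
    (hpq : p < q) (ha : f a ≤ p) (hb : q ≤ f b) :
    ∃ a' b', a ≤ a' ∧ a' < b' ∧ b' ≤ b ∧ f a' = p ∧ f b' = q ∧
      ∀ x ∈ Icc a' b', f x ∈ Icc p q := by
  have hK : IsCompact (Icc a b ∩ f ⁻¹' Ici q) :=
    isCompact_Icc.of_isClosed_subset (hf.preimage_isClosed_of_isClosed isClosed_Icc isClosed_Ici)
      inter_subset_left
  obtain ⟨b', ⟨hb'I, hb'q⟩, hb'min⟩ := hK.exists_isLeast ⟨b, ⟨hab, le_rfl⟩, hb⟩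
  have hfb : ContinuousOn f (Icc a b') := hf.mono (Icc_subset_Icc_right hb'I.2)
  have hK' : IsCompact (Icc a b' ∩ f ⁻¹' Iic p) :=
    isCompact_Icc.of_isClosed_subset (hfb.preimage_isClosed_of_isClosed isClosed_Icc isClosed_Iic)
      inter_subset_left
  obtain ⟨a', ⟨ha'I, ha'p⟩, ha'max⟩ := hK'.exists_isGreatest ⟨a, ⟨le_rfl, hb'I.1⟩, ha⟩
  simp only [mem_preimage, mem_Ici, mem_Iic] at hb'q ha'p
  have hlt : a' < b' := lt_of_le_of_ne ha'I.2 (by rintro rfl; linarith)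
  have hlt_q : ∀ x ∈ Icc a b', x < b' → f x < q := fun x hx hxb => by
    by_contra! h
    exact absurd (hb'min ⟨⟨hx.1, hx.2.trans hb'I.2⟩, h⟩) (not_le.2 hxb)
  have hgt_p : ∀ x ∈ Icc a' b', a' < x → p < f x := fun x hx hxa => by
    by_contra! h
    exact absurd (ha'max ⟨⟨ha'I.1.trans hx.1, hx.2⟩, h⟩) (not_le.2 hxa)
  have hfab : ContinuousOn f (Icc a' b') := hfb.mono (Icc_subset_Icc_left ha'I.1)
  refine ⟨a', b', ha'I.1, hlt, hb'I.2, ?_, ?_, fun x hx => ⟨?_, ?_⟩⟩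
  · by_contra hne
    obtain ⟨x, hx, hxp⟩ := intermediate_value_Icc hlt.le hfab
      (show p ∈ Icc (f a') (f b') from ⟨ha'p, by linarith⟩)
    rcases hx.1.eq_or_lt with h | h
    · exact hne (by rw [h]; exact hxp)
    · exact absurd hxp (hgt_p x hx h).ne'
  · by_contra hne
    obtain ⟨x, hx, hxq⟩ := intermediate_value_Icc hlt.le hfab
      (show q ∈ Icc (f a') (f b') from ⟨by linarith, hb'q⟩)
    rcases hx.2.eq_or_lt with h | h
    · exact hne (by rw [← h]; exact hxq)
    · exact absurd hxq (hlt_q x ⟨ha'I.1.trans hx.1, hx.2⟩ h).ne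
  · by_contra! h
    obtain ⟨y, hy, hyp⟩ := intermediate_value_Icc hx.2 (hfab.mono (Icc_subset_Icc_left hx.1))
      (show p ∈ Icc (f x) (f b') from ⟨h.le, by linarith⟩)
    have : a' < y := lt_of_le_of_lt hx.1 (lt_of_le_of_ne hy.1 (by rintro rfl; linarith))
    exact absurd hyp (hgt_p y ⟨this.le, hy.2⟩ this).ne'
  · by_contra! h
    obtain ⟨y, hy, hyp⟩ := intermediate_value_Icc hx.1 (hfab.mono (Icc_subset_Icc_right hx.2))
      (show q ∈ Icc (f a') (f x) from ⟨by linarith, h.le⟩)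
    have : y < b' := lt_of_lt_of_le (lt_of_le_of_ne hy.2 (by rintro rfl; linarith)) hx.2
    exact absurd hyp (hlt_q y ⟨ha'I.1.trans hy.1, this.le⟩ this).ne

theorem exists_subinterval_decreasing (hab : a ≤ b) (hf : ContinuousOn f (Icc a b)) {p q : ℝ}
    (hpq : p < q) (ha : q ≤ f a) (hb : f b ≤ p) :
    ∃ a' b', a ≤ a' ∧ a' < b' ∧ b' ≤ b ∧ f a' = q ∧ f b' = p ∧
      ∀ x ∈ Icc a' b', f x ∈ Icc p q := by
  obtain ⟨a', b', h1, h2, h3, h4, h5, h6⟩ := exists_subinterval_increasing (f := fun x => -f x)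
    hab hf.neg (neg_lt_neg hpq) (neg_le_neg ha) (neg_le_neg hb)
  exact ⟨a', b', h1, h2, h3, neg_injective h4, neg_injective h5, fun x hx =>
    ⟨neg_le_neg_iff.1 (h6 x hx).2, neg_le_neg_iff.1 (h6 x hx).1⟩⟩

theorem exists_first_zero (hab : a ≤ b) (hf : ContinuousOn f (Icc a b)) (ha : 0 < f a)
    (hb : f b ≤ 0) : ∃ c ∈ Ioc a b, f c = 0 ∧ ∀ x ∈ Ico a c, 0 < f x := by
  have hK : IsCompact (Icc a b ∩ f ⁻¹' Iic 0) :=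
    isCompact_Icc.of_isClosed_subset (hf.preimage_isClosed_of_isClosed isClosed_Icc isClosed_Iic)
      inter_subset_left
  obtain ⟨c, ⟨hcI, hc0⟩, hcmin⟩ := hK.exists_isLeast ⟨b, ⟨hab, le_rfl⟩, hb⟩
  simp only [mem_preimage, mem_Iic] at hc0
  have hpos : ∀ x ∈ Ico a c, 0 < f x := fun x hx => by
    by_contra! h
    exact absurd (hcmin ⟨⟨hx.1, hx.2.le.trans hcI.2⟩, h⟩) (not_le.2 hx.2)
  have hac : a < c := lt_of_le_of_ne hcI.1 (by rintro rfl; linarith)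
  refine ⟨c, ⟨hac, hcI.2⟩, ?_, hpos⟩
  by_contra hne
  obtain ⟨x, hx, hx0⟩ := intermediate_value_Icc' hac.le (hf.mono (Icc_subset_Icc_right hcI.2))
    (show (0 : ℝ) ∈ Icc (f c) (f a) from ⟨hc0, ha.le⟩)
  rcases hx.2.eq_or_lt with h | h
  · exact hne (by rw [← h]; exact hx0)
  · exact absurd hx0 (hpos x ⟨hx.1, h⟩).ne'

theorem lt_of_avoids (hab : a ≤ b) (hf : ContinuousOn f (Icc a b)) {v : ℝ}
    (hv : ∀ x ∈ Icc a b, f x ≠ v) (ha : f a < v) : f b < v := by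
  by_contra! h
  obtain ⟨x, hx, hxv⟩ := intermediate_value_Icc hab hf (show v ∈ Icc (f a) (f b) from ⟨ha.le, h⟩)
  exact hv x hx hxv

theorem gt_of_avoids (hab : a ≤ b) (hf : ContinuousOn f (Icc a b)) {v : ℝ}
    (hv : ∀ x ∈ Icc a b, f x ≠ v) (ha : v < f a) : v < f b := by
  by_contra! h
  obtain ⟨x, hx, hxv⟩ := intermediate_value_Icc' hab hf (show v ∈ Icc (f b) (f a) from ⟨h, ha.le⟩)
  exact hv x hx hxv

end IntermediateValues

/-! ### Continuous angles -/

/-- The function `Y + iX` has no zeros and lifts through the covering `exp` of the punctured plane.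
Projecting the plane onto the rectangle makes the domain simply connected. Putting `Y` in the real
part measures the angle clockwise from the positive `y`-axis. -/
theorem exists_continuousOn_angle {a b c d : ℝ} (hab : a ≤ b) (hcd : c ≤ d) {X Y : ℝ × ℝ → ℝ}
    (hX : ContinuousOn X (Icc a b ×ˢ Icc c d)) (hY : ContinuousOn Y (Icc a b ×ˢ Icc c d))
    (h0 : ∀ p ∈ Icc a b ×ˢ Icc c d, X p ≠ 0 ∨ Y p ≠ 0) :
    ∃ ϑ : ℝ × ℝ → ℝ, ContinuousOn ϑ (Icc a b ×ˢ Icc c d) ∧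
      ∀ p ∈ Icc a b ×ˢ Icc c d, ∃ ρ > 0, X p = ρ * Real.sin (ϑ p) ∧ Y p = ρ * Real.cos (ϑ p) := by
  let π' : ℝ × ℝ → ℝ × ℝ := fun p => (projIcc a b hab p.1, projIcc c d hcd p.2)
  have hπc : Continuous π' :=
    ((continuous_subtype_val.comp continuous_projIcc).comp continuous_fst).prodMk
      ((continuous_subtype_val.comp continuous_projIcc).comp continuous_snd)
  have hπm : ∀ p, π' p ∈ Icc a b ×ˢ Icc c d := fun p => ⟨Subtype.prop _, Subtype.prop _⟩
  have hπe : ∀ p ∈ Icc a b ×ˢ Icc c d, π' p = p := by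
    rintro ⟨s, t⟩ ⟨hs, ht⟩
    simp only [π', projIcc_of_mem hab hs, projIcc_of_mem hcd ht]
  let F : ℝ × ℝ → ℂ := fun p => ⟨Y (π' p), X (π' p)⟩
  have hF : Continuous F := by
    have h1 : Continuous fun p => X (π' p) := hX.comp_continuous hπc hπm
    have h2 : Continuous fun p => Y (π' p) := hY.comp_continuous hπc hπm
    have : F = fun p => (Y (π' p) : ℂ) + (X (π' p) : ℂ) * Complex.I := by
      funext p
      apply Complex.ext <;> simp [F]
    rw [this]
    exact (Complex.continuous_ofReal.comp h2).add
      ((Complex.continuous_ofReal.comp h1).mul continuous_const)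
  have hF0 : ∀ p, F p ≠ 0 := fun p hp => by
    have h1 := congrArg Complex.re hp
    have h2 := congrArg Complex.im hp
    rcases h0 _ (hπm p) with h | h
    · exact h h2
    · exact h h1
  obtain ⟨L, ⟨-, hL⟩, -⟩ := Complex.isCoveringMapOn_exp.existsUnique_continuousMap_lifts
    ⟨F, hF⟩ (Complex.exp_log (hF0 (a, c))) hF0
  replace hL : ∀ p, Complex.exp (L p) = F p := fun p => congrFun hL p
  refine ⟨fun p => (L p).im, ?_, fun p hp => ⟨Real.exp (L p).re, Real.exp_pos _, ?_, ?_⟩⟩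
  · exact (Complex.continuous_im.comp L.continuous).continuousOn
  · have := congrArg Complex.im (hL p)
    simp only [Complex.exp_im, F, hπe p hp] at this
    exact this.symm
  · have := congrArg Complex.re (hL p)
    simp only [Complex.exp_re, F, hπe p hp] at this
    exact this.symm

theorem abs_le_pi_div_two_of_cos_nonneg {x : ℝ} (h1 : -Real.pi ≤ x) (h2 : x ≤ Real.pi)
    (hc : 0 ≤ Real.cos x) : -(Real.pi / 2) ≤ x ∧ x ≤ Real.pi / 2 := by
  have hpi := Real.pi_pos
  constructor
  · by_contra! h
    have := Real.cos_neg_of_pi_div_two_lt_of_lt (x := -x) (by linarith) (by linarith)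
    rw [Real.cos_neg] at this
    linarith
  · by_contra! h
    have := Real.cos_neg_of_pi_div_two_lt_of_lt (x := x) h (by linarith)
    linarith

/-- A planar crossing lemma, in terms of the difference `D` of two paths. -/
theorem exists_common_zero_of_boundary {D₁ D₂ : ℝ × ℝ → ℝ}
    (h₁ : ContinuousOn D₁ (Icc 0 1 ×ˢ Icc 0 1)) (h₂ : ContinuousOn D₂ (Icc 0 1 ×ˢ Icc 0 1))
    (hbot : ∀ s ∈ Icc (0 : ℝ) 1, 0 ≤ D₁ (s, 0)) (htop : ∀ s ∈ Icc (0 : ℝ) 1, D₁ (s, 1) ≤ 0)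
    (hleft : ∀ t ∈ Icc (0 : ℝ) 1, D₁ (0, t) = 0 → D₂ (0, t) ≤ 0)
    (hright : ∀ t ∈ Icc (0 : ℝ) 1, D₁ (1, t) = 0 → 0 ≤ D₂ (1, t)) :
    ∃ p ∈ Icc (0 : ℝ) 1 ×ˢ Icc (0 : ℝ) 1, D₁ p = 0 ∧ D₂ p = 0 := by
  by_contra! hne
  -- If `(D₂, D₁)` has no zero it has a continuous angle, with `D₁` as the cosine. The two ways
  -- around the square from `(0, 0)` to `(1, 1)` then conflict: via the left and top edges the last
  -- angle is negative, via the bottom and right edges it exceeds `-π/2`, whereas its cosine is not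
  -- positive.
  obtain ⟨ψ, hψ, hψ'⟩ := exists_continuousOn_angle zero_le_one zero_le_one h₂ h₁ fun p hp => by
    by_cases h : D₁ p = 0
    · exact Or.inl (hne p hp h)
    · exact Or.inr h
  have hpi := Real.pi_pos
  have I0 : (0 : ℝ) ∈ Icc (0 : ℝ) 1 := ⟨le_rfl, zero_le_one⟩
  have I1 : (1 : ℝ) ∈ Icc (0 : ℝ) 1 := ⟨zero_le_one, le_rfl⟩
  obtain ⟨k, hk⟩ : ∃ k : ℤ, |ψ (0, 0) - k * (2 * Real.pi)| ≤ Real.pi := by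
    refine ⟨round (ψ (0, 0) / (2 * Real.pi)), ?_⟩
    have := abs_sub_round (ψ (0, 0) / (2 * Real.pi))
    rw [show ψ (0, 0) - round (ψ (0, 0) / (2 * Real.pi)) * (2 * Real.pi) =
      (ψ (0, 0) / (2 * Real.pi) - round (ψ (0, 0) / (2 * Real.pi))) * (2 * Real.pi) by
        field_simp, abs_mul, abs_of_pos (by linarith : 0 < 2 * Real.pi)]
    nlinarith
  let φ : ℝ × ℝ → ℝ := fun p => ψ p - k * (2 * Real.pi)
  have hφ : ContinuousOn φ (Icc 0 1 ×ˢ Icc 0 1) := hψ.sub continuousOn_const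
  have hφ' : ∀ p ∈ Icc (0 : ℝ) 1 ×ˢ Icc (0 : ℝ) 1, ∃ ρ > 0, D₂ p = ρ * Real.sin (φ p) ∧
      D₁ p = ρ * Real.cos (φ p) := fun p hp => by
    obtain ⟨ρ, hρ, h1, h2⟩ := hψ' p hp
    exact ⟨ρ, hρ, by rw [Real.sin_sub_int_mul_two_pi]; exact h1,
      by rw [Real.cos_sub_int_mul_two_pi]; exact h2⟩
  have hcos0 : ∀ p ∈ Icc (0 : ℝ) 1 ×ˢ Icc (0 : ℝ) 1, 0 ≤ D₁ p → 0 ≤ Real.cos (φ p) := by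
    intro p hp h
    obtain ⟨ρ, hρ, -, h2⟩ := hφ' p hp
    rw [h2] at h
    exact nonneg_of_mul_nonneg_right h hρ
  have hcos1 : ∀ p ∈ Icc (0 : ℝ) 1 ×ˢ Icc (0 : ℝ) 1, D₁ p ≤ 0 → Real.cos (φ p) ≤ 0 := by
    intro p hp h
    obtain ⟨ρ, hρ, -, h2⟩ := hφ' p hp
    rw [h2] at h
    by_contra! hc
    linarith [mul_pos hρ hc]
  have hedge1 : ∀ s ∈ Icc (0 : ℝ) 1, ContinuousOn (fun t => φ (s, t)) (Icc 0 1) := fun s hs =>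
    hφ.comp (by fun_prop) fun t ht => ⟨hs, ht⟩
  have hedge2 : ∀ t ∈ Icc (0 : ℝ) 1, ContinuousOn (fun s => φ (s, t)) (Icc 0 1) := fun t ht =>
    hφ.comp (by fun_prop) fun s hs => ⟨hs, ht⟩
  obtain ⟨h00a, h00b⟩ := abs_le_pi_div_two_of_cos_nonneg (abs_le.1 hk).1 (abs_le.1 hk).2
    (hcos0 (0, 0) ⟨I0, I0⟩ (hbot 0 I0))
  change -(Real.pi / 2) ≤ φ (0, 0) at h00a
  change φ (0, 0) ≤ Real.pi / 2 at h00b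
  -- bottom edge
  have b1 : φ (1, 0) < Real.pi := lt_of_avoids zero_le_one (hedge2 0 I0) (fun s hs h => by
    have := hcos0 (s, 0) ⟨hs, I0⟩ (hbot s hs)
    rw [h, Real.cos_pi] at this
    linarith) (by linarith)
  have b2 : -Real.pi < φ (1, 0) := gt_of_avoids zero_le_one (hedge2 0 I0) (fun s hs h => by
    have := hcos0 (s, 0) ⟨hs, I0⟩ (hbot s hs)
    rw [h, Real.cos_neg, Real.cos_pi] at this
    linarith) (by linarith)
  obtain ⟨h10a, -⟩ := abs_le_pi_div_two_of_cos_nonneg b2.le b1.le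
    (hcos0 (1, 0) ⟨I1, I0⟩ (hbot 1 I1))
  -- left edge
  have l0 : ∀ t ∈ Icc (0 : ℝ) 1, φ (0, t) ≠ Real.pi / 2 := fun t ht h => by
    obtain ⟨ρ, hρ, h1, h2⟩ := hφ' (0, t) ⟨I0, ht⟩
    rw [h, Real.cos_pi_div_two, mul_zero] at h2
    rw [h, Real.sin_pi_div_two, mul_one] at h1
    linarith [hleft t ht h2]
  have l0' : ∀ t ∈ Icc (0 : ℝ) 1, φ (0, t) ≠ Real.pi / 2 - 2 * Real.pi := fun t ht h => by
    obtain ⟨ρ, hρ, h1, h2⟩ := hφ' (0, t) ⟨I0, ht⟩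
    rw [h, Real.cos_sub_two_pi, Real.cos_pi_div_two, mul_zero] at h2
    rw [h, Real.sin_sub_two_pi, Real.sin_pi_div_two, mul_one] at h1
    linarith [hleft t ht h2]
  have l1 : φ (0, 1) < Real.pi / 2 := lt_of_avoids zero_le_one (hedge1 0 I0) l0
    (lt_of_le_of_ne h00b (l0 0 I0))
  have l2 : Real.pi / 2 - 2 * Real.pi < φ (0, 1) := gt_of_avoids zero_le_one (hedge1 0 I0) l0'
    (by linarith)
  have h01 : φ (0, 1) ≤ -(Real.pi / 2) := by
    by_contra! h
    linarith [hcos1 (0, 1) ⟨I0, I1⟩ (htop 0 I0), Real.cos_pos_of_mem_Ioo ⟨h, l1⟩]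
  -- top edge
  have t1 : φ (1, 1) < 0 := lt_of_avoids zero_le_one (hedge2 1 I1) (fun s hs h => by
    have := hcos1 (s, 1) ⟨hs, I1⟩ (htop s hs)
    rw [h, Real.cos_zero] at this
    linarith) (by linarith)
  -- right edge
  have r0 : ∀ t ∈ Icc (0 : ℝ) 1, φ (1, t) ≠ -(Real.pi / 2) := fun t ht h => by
    obtain ⟨ρ, hρ, h1, h2⟩ := hφ' (1, t) ⟨I1, ht⟩
    rw [h, Real.cos_neg, Real.cos_pi_div_two, mul_zero] at h2
    rw [h, Real.sin_neg, Real.sin_pi_div_two] at h1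
    linarith [hright t ht h2]
  have r1 : -(Real.pi / 2) < φ (1, 1) := gt_of_avoids zero_le_one (hedge1 1 I1) r0
    (lt_of_le_of_ne h10a (r0 0 I0).symm)
  linarith [hcos1 (1, 1) ⟨I1, I1⟩ (htop 1 I1),
    Real.cos_pos_of_mem_Ioo (x := φ (1, 1)) ⟨r1, by linarith⟩]

/-! ### Upward crossings of levels -/

/-- Near each point of `[0, T]` where `ϑ` takes the value `v`, it crosses it upwards. -/
def CrossesUp (ϑ : ℝ → ℝ) (T v : ℝ) : Prop :=
  ∀ t ∈ Icc 0 T, ϑ t = v → ∃ ε > 0, ∀ s ∈ Icc 0 T, |s - t| < ε →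
    (t < s → v < ϑ s) ∧ (s < t → ϑ s < v)

section CrossesUp

variable {ϑ : ℝ → ℝ} {T v : ℝ}

/-- Once above `v`, the first return to `v` would be approached from above, which an upward crossing
forbids. -/
theorem CrossesUp.lt_of_lt (h : CrossesUp ϑ T v) (hc : ContinuousOn ϑ (Icc 0 T)) {t s : ℝ}
    (ht : t ∈ Icc 0 T) (hs : s ∈ Icc 0 T) (hts : t < s) (hv : v ≤ ϑ t) : v < ϑ s := by
  by_contra! hle
  obtain ⟨t', ht', hpos⟩ : ∃ t' ∈ Ico t s, ∀ r ∈ Ioo t t', v < ϑ r := ⟨t, ⟨le_rfl, hts⟩, by simp⟩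
  obtain ⟨t₁, ht₁, hgt⟩ : ∃ t₁ ∈ Ioo t s, ∀ r ∈ Ioc t t₁, v < ϑ r ∨ v < ϑ t := by
    rcases hv.eq_or_lt with heq | hlt
    · obtain ⟨ε, hε, H⟩ := h t ht heq.symm
      refine ⟨min (t + ε / 2) ((t + s) / 2), ⟨lt_min (by linarith) (by linarith),
        (min_le_right _ _).trans_lt (by linarith)⟩, fun r hr => Or.inl ?_⟩
      have h1 := hr.2.trans (min_le_left _ _)
      have h2 := hr.2.trans (min_le_right _ _)
      exact (H r ⟨ht.1.trans hr.1.le, by linarith [hs.2]⟩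
        (by rw [abs_lt]; constructor <;> linarith [hr.1])).1 hr.1
    · exact ⟨(t + s) / 2, ⟨by linarith, by linarith⟩, fun r _ => Or.inr hlt⟩
  have hstart : ∃ a ∈ Ico t s, v < ϑ a := by
    rcases hgt t₁ ⟨ht₁.1, le_rfl⟩ with h' | h'
    · exact ⟨t₁, ⟨ht₁.1.le, ht₁.2⟩, h'⟩
    · exact ⟨t, ⟨le_rfl, hts⟩, h'⟩
  obtain ⟨a, ha, hav⟩ := hstart
  have hsub : Icc a s ⊆ Icc 0 T := Icc_subset_Icc (ht.1.trans ha.1) hs.2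
  obtain ⟨c, hc', hc0, hcpos⟩ := exists_first_zero (f := fun r => ϑ r - v) ha.2.le
    ((hc.mono hsub).sub continuousOn_const) (sub_pos.2 hav) (sub_nonpos.2 hle)
  obtain ⟨ε, hε, H⟩ := h c (hsub ⟨hc'.1.le, hc'.2⟩) (sub_eq_zero.1 hc0)
  let r := max ((a + c) / 2) (c - ε / 2)
  have hr1 : r < c := max_lt (by linarith [hc'.1]) (by linarith)
  have hr2 : a < r := lt_of_lt_of_le (by linarith [hc'.1]) (le_max_left _ _)
  have hr3 : c - ε / 2 ≤ r := le_max_right _ _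
  have h1 := (H r (hsub ⟨hr2.le, hr1.le.trans hc'.2⟩)
    (by rw [abs_lt]; constructor <;> linarith)).2 hr1
  linarith [hcpos r ⟨hr2.le, hr1⟩]

theorem CrossesUp.lt_of_gt (h : CrossesUp ϑ T v) (hc : ContinuousOn ϑ (Icc 0 T)) {t s : ℝ}
    (ht : t ∈ Icc 0 T) (hs : s ∈ Icc 0 T) (hst : s < t) (hv : ϑ t ≤ v) : ϑ s < v := by
  by_contra! hle
  exact absurd (h.lt_of_lt hc hs ht hst hle) (not_lt.2 hv)

/-- Near `t` one has `|ϑ - v| < π`, so `ϑ - v` has the sign of `sin (ϑ - v)`, that is of `q`, and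
`q` increases through `0` because `q' > 0`. In use, `q` is `±X` or `±Y`; the angle itself need not
be differentiated. -/
theorem crossesUp_of_hasDerivWithinAt (hc : ContinuousOn ϑ (Icc 0 T))
    (h : ∀ t ∈ Icc 0 T, ϑ t = v → ∃ (q : ℝ → ℝ) (q' : ℝ), 0 < q' ∧
      HasDerivWithinAt q q' (Icc 0 T) t ∧
      ∀ s ∈ Icc 0 T, ∃ ρ > 0, q s = ρ * Real.sin (ϑ s - v)) : CrossesUp ϑ T v := by
  intro t ht htv
  obtain ⟨q, q', hq', hq, hρ⟩ := h t ht htv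
  have hqt : q t = 0 := by
    obtain ⟨ρ, -, h⟩ := hρ t ht
    rw [h, htv, sub_self, Real.sin_zero, mul_zero]
  have h1 : ∀ᶠ s in 𝓝[Icc 0 T \ {t}] t, 0 < slope q t s :=
    (hasDerivWithinAt_iff_tendsto_slope.1 hq).eventually_const_lt hq'
  have h2 : ∀ᶠ s in 𝓝[Icc 0 T] t, dist (ϑ s) (ϑ t) < Real.pi :=
    Metric.tendsto_nhds.1 (hc t ht) _ Real.pi_pos
  obtain ⟨ε₁, hε₁, H1⟩ := Metric.mem_nhdsWithin_iff.1 h1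
  obtain ⟨ε₂, hε₂, H2⟩ := Metric.mem_nhdsWithin_iff.1 h2
  refine ⟨min ε₁ ε₂, lt_min hε₁ hε₂, fun s hs hst => ?_⟩
  have hs2 : dist (ϑ s) (ϑ t) < Real.pi := H2 ⟨hst.trans_le (min_le_right _ _), hs⟩
  have hs1 : s ≠ t → 0 < slope q t s := fun hne =>
    H1 ⟨hst.trans_le (min_le_left _ _), hs, hne⟩
  obtain ⟨ρ, hρ0, hρs⟩ := hρ s hs
  rw [htv, Real.dist_eq, abs_lt] at hs2
  rw [slope_def_field, hqt, sub_zero] at hs1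
  constructor
  · intro hlt
    by_contra! hle
    have h3 : Real.sin (ϑ s - v) ≤ 0 :=
      Real.sin_nonpos_of_nonpos_of_neg_pi_le (by linarith) (by linarith)
    have h4 := hs1 hlt.ne'
    rw [hρs] at h4
    have := div_nonpos_of_nonpos_of_nonneg (mul_nonpos_of_nonneg_of_nonpos hρ0.le h3)
      (sub_nonneg.2 hlt.le)
    linarith
  · intro hlt
    by_contra! hle
    have h3 : 0 ≤ Real.sin (ϑ s - v) :=
      Real.sin_nonneg_of_nonneg_of_le_pi (by linarith) (by linarith)
    have h4 := hs1 hlt.ne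
    rw [hρs] at h4
    have := div_nonpos_of_nonneg_of_nonpos (mul_nonneg hρ0.le h3) (sub_nonpos.2 hlt.le)
    linarith

end CrossesUp


/-! ### Planar curves turning clockwise across the axes -/

/-- `ϑ` is a continuous angle, measured clockwise from the positive `y`-axis, along the planar curve
`(X, Y)` on `[0, T]`, and every multiple of `π / 2` is crossed upwards. -/
structure IsClockwiseAngle (X Y ϑ : ℝ → ℝ) (T : ℝ) : Prop where
  continuousOn : ContinuousOn ϑ (Icc 0 T)
  polar : ∀ t ∈ Icc 0 T, ∃ ρ > 0, X t = ρ * Real.sin (ϑ t) ∧ Y t = ρ * Real.cos (ϑ t)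
  crossesUp : ∀ j : ℤ, CrossesUp ϑ T (j * (Real.pi / 2))

theorem isClockwiseAngle_of_hasDerivWithinAt {X Y ϑ X' Y' : ℝ → ℝ} {T : ℝ}
    (hϑ : ContinuousOn ϑ (Icc 0 T))
    (hpolar : ∀ t ∈ Icc 0 T, ∃ ρ > 0, X t = ρ * Real.sin (ϑ t) ∧ Y t = ρ * Real.cos (ϑ t))
    (hX : ∀ t ∈ Icc 0 T, HasDerivWithinAt X (X' t) (Icc 0 T) t)
    (hY : ∀ t ∈ Icc 0 T, HasDerivWithinAt Y (Y' t) (Icc 0 T) t)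
    (h0 : ∀ t ∈ Icc 0 T, X t = 0 → 0 < Y t → 0 < X' t)
    (h1 : ∀ t ∈ Icc 0 T, Y t = 0 → 0 < X t → Y' t < 0)
    (h2 : ∀ t ∈ Icc 0 T, X t = 0 → Y t < 0 → X' t < 0)
    (h3 : ∀ t ∈ Icc 0 T, Y t = 0 → X t < 0 → 0 < Y' t) : IsClockwiseAngle X Y ϑ T := by
  refine ⟨hϑ, hpolar, fun j => ?_⟩
  refine crossesUp_of_hasDerivWithinAt hϑ fun t ht htj => ?_
  obtain ⟨ρ, hρ, hXt, hYt⟩ := hpolar t ht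
  -- Modulo full turns there are only four half-axes, one for each residue `r`; on them `X`, `-Y`,
  -- `-X`, `Y` are the increasing functions.
  obtain ⟨q, r, hr0, hr4, rfl⟩ : ∃ q r : ℤ, 0 ≤ r ∧ r < 4 ∧ j = r + 4 * q :=
    ⟨j / 4, j % 4, Int.emod_nonneg _ (by norm_num), Int.emod_lt_of_pos _ (by norm_num),
      (Int.emod_add_mul_ediv j 4).symm⟩
  have hval : (((r + 4 * q : ℤ)) : ℝ) * (Real.pi / 2) = r * (Real.pi / 2) + q * (2 * Real.pi) := by
    push_cast; ring
  rw [hval] at htj ⊢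
  have hsin : ∀ x, Real.sin (x - (r * (Real.pi / 2) + q * (2 * Real.pi))) =
      Real.sin (x - r * (Real.pi / 2)) := fun x => by
    rw [← sub_sub, Real.sin_sub_int_mul_two_pi]
  simp only [hsin]
  rw [htj, Real.sin_add_int_mul_two_pi] at hXt
  rw [htj, Real.cos_add_int_mul_two_pi] at hYt
  interval_cases r
  · simp only [Int.cast_zero, zero_mul, Real.sin_zero, Real.cos_zero, mul_zero, mul_one,
      sub_zero] at hXt hYt ⊢
    exact ⟨X, X' t, h0 t ht hXt (hYt ▸ hρ), hX t ht, fun s hs =>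
      let ⟨ρ, hρ, h, _⟩ := hpolar s hs; ⟨ρ, hρ, h⟩⟩
  · simp only [Int.cast_one, one_mul, Real.sin_pi_div_two, Real.cos_pi_div_two, mul_zero, mul_one,
      Real.sin_sub_pi_div_two] at hXt hYt ⊢
    exact ⟨fun s => -Y s, -Y' t, neg_pos.2 (h1 t ht hYt (hXt ▸ hρ)), (hY t ht).neg, fun s hs =>
      let ⟨ρ, hρ, _, h⟩ := hpolar s hs; ⟨ρ, hρ, by simp only [h]; ring⟩⟩
  · simp only [Int.cast_ofNat, mul_div_cancel₀ Real.pi (two_ne_zero), Real.sin_pi, Real.cos_pi,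
      mul_zero, Real.sin_sub_pi] at hXt hYt ⊢
    exact ⟨fun s => -X s, -X' t, neg_pos.2 (h2 t ht hXt (by linarith)), (hX t ht).neg, fun s hs =>
      let ⟨ρ, hρ, h, _⟩ := hpolar s hs; ⟨ρ, hρ, by simp only [h]; ring⟩⟩
  · have e3 : ((3 : ℤ) : ℝ) * (Real.pi / 2) = Real.pi + Real.pi / 2 := by push_cast; ring
    have es : Real.sin (Real.pi + Real.pi / 2) = -1 := by
      rw [Real.sin_add_pi_div_two, Real.cos_pi]
    have ec : Real.cos (Real.pi + Real.pi / 2) = 0 := by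
      rw [Real.cos_add_pi_div_two, Real.sin_pi, neg_zero]
    rw [e3, es] at hXt
    rw [e3, ec, mul_zero] at hYt
    rw [e3]
    refine ⟨Y, Y' t, h3 t ht hYt (by linarith), hY t ht, fun s hs => ?_⟩
    obtain ⟨ρ, hρ, -, h⟩ := hpolar s hs
    refine ⟨ρ, hρ, ?_⟩
    rw [h, ← sub_sub, Real.sin_sub_pi_div_two, Real.cos_sub_pi, neg_neg]

/-- Zeros are counted through the values of the angle: each of the levels `v a, ..., v b` is taken
at exactly one zero. -/
theorem encard_eq_of_existsUnique {A : Set ℝ} {u ϑ : ℝ → ℝ} {v : ℤ → ℝ} (hv : Function.Injective v)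
    (a b : ℤ) (h1 : ∀ r ∈ A, u r = 0 → ∃ l ∈ Finset.Icc a b, ϑ r = v l)
    (h2 : ∀ l ∈ Finset.Icc a b, ∃ r ∈ A, u r = 0 ∧ ϑ r = v l)
    (h3 : ∀ r ∈ A, ∀ r' ∈ A, u r = 0 → ϑ r = ϑ r' → r = r') :
    {r ∈ A | u r = 0}.encard = (b + 1 - a).toNat := by
  have hbij : BijOn (fun r => ϑ r) {r ∈ A | u r = 0} (v '' (Finset.Icc a b : Set ℤ)) := by
    refine ⟨?_, ?_, ?_⟩
    · rintro r ⟨hr, h0⟩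
      obtain ⟨l, hl, h⟩ := h1 r hr h0
      exact ⟨l, hl, h.symm⟩
    · rintro r ⟨hr, h0⟩ r' ⟨hr', -⟩ h
      exact h3 r hr r' hr' h0 h
    · rintro _ ⟨l, hl, rfl⟩
      obtain ⟨r, hr, h0, h⟩ := h2 l hl
      exact ⟨r, ⟨hr, h0⟩, h⟩
  rw [← hbij.injOn.encard_image, hbij.image_eq, hv.encard_image, encard_coe_eq_coe_finsetCard,
    Int.card_Icc]

namespace IsClockwiseAngle

variable {X Y ϑ : ℝ → ℝ} {T : ℝ}

theorem lt_of_lt (h : IsClockwiseAngle X Y ϑ T) (j : ℤ) {t s : ℝ} (ht : t ∈ Icc 0 T)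
    (hs : s ∈ Icc 0 T) (hts : t < s) (hv : j * (Real.pi / 2) ≤ ϑ t) : j * (Real.pi / 2) < ϑ s :=
  (h.crossesUp j).lt_of_lt h.continuousOn ht hs hts hv

theorem lt_of_gt (h : IsClockwiseAngle X Y ϑ T) (j : ℤ) {t s : ℝ} (ht : t ∈ Icc 0 T)
    (hs : s ∈ Icc 0 T) (hst : s < t) (hv : ϑ t ≤ j * (Real.pi / 2)) : ϑ s < j * (Real.pi / 2) :=
  (h.crossesUp j).lt_of_gt h.continuousOn ht hs hst hv

theorem le_of_le (h : IsClockwiseAngle X Y ϑ T) (j : ℤ) {t s : ℝ} (ht : t ∈ Icc 0 T)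
    (hs : s ∈ Icc 0 T) (hts : t ≤ s) (hv : j * (Real.pi / 2) ≤ ϑ t) : j * (Real.pi / 2) ≤ ϑ s := by
  rcases hts.eq_or_lt with rfl | h'
  · exact hv
  · exact (h.lt_of_lt j ht hs h' hv).le

theorem le_of_ge (h : IsClockwiseAngle X Y ϑ T) (j : ℤ) {t s : ℝ} (ht : t ∈ Icc 0 T)
    (hs : s ∈ Icc 0 T) (hst : s ≤ t) (hv : ϑ t ≤ j * (Real.pi / 2)) : ϑ s ≤ j * (Real.pi / 2) := by
  rcases hst.eq_or_lt with rfl | h'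
  · exact hv
  · exact (h.lt_of_gt j ht hs h' hv).le

theorem eq_of_eq (h : IsClockwiseAngle X Y ϑ T) (j : ℤ) {t s : ℝ} (ht : t ∈ Icc 0 T)
    (hs : s ∈ Icc 0 T) (h1 : ϑ t = j * (Real.pi / 2)) (h2 : ϑ t = ϑ s) : t = s := by
  rcases lt_trichotomy t s with hlt | heq | hgt
  · exact absurd (h.lt_of_lt j ht hs hlt h1.ge) (by rw [← h2, h1]; exact lt_irrefl _)
  · exact heq
  · exact absurd (h.lt_of_gt j ht hs hgt h1.le) (by rw [← h2, h1]; exact lt_irrefl _)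

theorem exists_eq (h : IsClockwiseAngle X Y ϑ T) {v a b : ℝ} (ha : a ∈ Icc 0 T)
    (hb : b ∈ Icc 0 T) (hab : a ≤ b) (h1 : ϑ a ≤ v) (h2 : v ≤ ϑ b) : ∃ t ∈ Icc a b, ϑ t = v :=
  intermediate_value_Icc hab (h.continuousOn.mono (Icc_subset_Icc ha.1 hb.2)) ⟨h1, h2⟩

theorem fst_eq_zero_iff (h : IsClockwiseAngle X Y ϑ T) {t : ℝ} (ht : t ∈ Icc 0 T) :
    X t = 0 ↔ ∃ l : ℤ, ϑ t = l * Real.pi := by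
  obtain ⟨ρ, hρ, h1, -⟩ := h.polar t ht
  rw [h1, mul_eq_zero, or_iff_right hρ.ne', Real.sin_eq_zero_iff]
  exact ⟨fun ⟨n, h⟩ => ⟨n, h.symm⟩, fun ⟨n, h⟩ => ⟨n, h.symm⟩⟩

theorem snd_eq_zero_iff (h : IsClockwiseAngle X Y ϑ T) {t : ℝ} (ht : t ∈ Icc 0 T) :
    Y t = 0 ↔ ∃ l : ℤ, ϑ t = (2 * l + 1) * Real.pi / 2 := by
  obtain ⟨ρ, hρ, -, h1⟩ := h.polar t ht
  rw [h1, mul_eq_zero, or_iff_right hρ.ne', Real.cos_eq_zero_iff]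

/-- Counting the zeros of `X` and `Y` in terms of the total variation of the angle. -/
theorem zeroCount_eq (h : IsClockwiseAngle X Y ϑ T) (hT : 0 ≤ T) {n : ℕ}
    (h0 : 0 ≤ ϑ 0) (h0' : ϑ 0 ≤ Real.pi / 2) (h1 : (2 * n + 1) * (Real.pi / 2) ≤ ϑ T)
    (h1' : ϑ T ≤ (2 * n + 2) * (Real.pi / 2)) :
    zeroCount X (Ioo 0 T) = n ∧ zeroCount Y (Icc 0 T) = n + 1 := by
  have hpi := Real.pi_pos
  have I0 : (0 : ℝ) ∈ Icc 0 T := ⟨le_rfl, hT⟩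
  have IT : T ∈ Icc 0 T := ⟨hT, le_rfl⟩
  constructor
  -- `X` vanishes at the angles `lπ`. On the open interval only `1 ≤ l ≤ n` occur: the angle `0` can
  -- be taken only at time `0` and `(n + 1)π` only at time `T`.
  · have := encard_eq_of_existsUnique (A := Ioo 0 T) (u := X) (ϑ := ϑ) (v := fun l : ℤ => l * Real.pi)
      (fun a b hab => by simpa [hpi.ne'] using hab) 1 n ?_ ?_ ?_
    · simpa [zeroCount] using this
    · intro r hr hXr
      have hrI := Ioo_subset_Icc_self hr
      obtain ⟨l, hl⟩ := (h.fst_eq_zero_iff hrI).1 hXr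
      refine ⟨l, ?_, hl⟩
      have e : ((2 * l : ℤ) : ℝ) * (Real.pi / 2) = l * Real.pi := by push_cast; ring
      have ha := h.lt_of_gt (2 * l) hrI I0 hr.1 (by rw [e, hl])
      have hb := h.lt_of_lt (2 * l) hrI IT hr.2 (by rw [e, hl])
      rw [e] at ha hb
      have ha' : (0 : ℝ) < l := by
        by_contra! hle
        nlinarith
      have hb' : (l : ℝ) < n + 1 := by
        by_contra! hle
        nlinarith
      rw [Finset.mem_Icc]
      constructor
      · exact_mod_cast ha'
      · exact Int.lt_add_one_iff.1 (by exact_mod_cast hb')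
    · intro l hl
      rw [Finset.mem_Icc] at hl
      have hl1 : (1 : ℝ) ≤ l := by exact_mod_cast hl.1
      have hl2 : (l : ℝ) ≤ n := by exact_mod_cast hl.2
      have e1 : ϑ 0 < l * Real.pi := by nlinarith
      have e2 : l * Real.pi < ϑ T := by nlinarith
      obtain ⟨t, ht, htv⟩ := h.exists_eq I0 IT hT e1.le e2.le
      refine ⟨t, ⟨lt_of_le_of_ne ht.1 ?_, lt_of_le_of_ne ht.2 ?_⟩,
        (h.fst_eq_zero_iff ht).2 ⟨l, htv⟩, htv⟩
      · rintro rfl; linarith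
      · rintro rfl; linarith
    · intro r hr r' hr' hXr hrr'
      obtain ⟨l, hl⟩ := (h.fst_eq_zero_iff (Ioo_subset_Icc_self hr)).1 hXr
      exact h.eq_of_eq (2 * l) (Ioo_subset_Icc_self hr) (Ioo_subset_Icc_self hr')
        (by rw [hl]; push_cast; ring) hrr'
  -- `Y` vanishes at the odd multiples of `π/2`. The extreme ones, `π/2` and `(2n+1)π/2`, may be
  -- taken at the end times, hence the closed interval and the `n + 1` values `0 ≤ l ≤ n`.
  · have := encard_eq_of_existsUnique (A := Icc 0 T) (u := Y) (ϑ := ϑ)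
      (v := fun l : ℤ => (2 * l + 1) * Real.pi / 2)
      (fun a b hab => by
        have : (2 * (a : ℝ) + 1) * Real.pi = (2 * b + 1) * Real.pi := by linarith
        have := mul_right_cancel₀ hpi.ne' this
        have : (a : ℝ) = b := by linarith
        exact_mod_cast this) 0 n ?_ ?_ ?_
    · rw [zeroCount, this, show ((n : ℤ) + 1 - 0).toNat = n + 1 by omega]
      push_cast
      rfl
    · intro r hr hYr
      obtain ⟨l, hl⟩ := (h.snd_eq_zero_iff hr).1 hYr
      refine ⟨l, ?_, hl⟩
      have e : ((2 * l + 1 : ℤ) : ℝ) * (Real.pi / 2) = (2 * l + 1) * Real.pi / 2 := by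
        push_cast; ring
      have ha := h.le_of_ge (2 * l + 1) hr I0 hr.1 (by rw [e, hl])
      have hb := h.le_of_le (2 * l + 1) hr IT hr.2 (by rw [e, hl])
      rw [e] at ha hb
      have ha' : (0 : ℝ) ≤ 2 * l + 1 := by
        by_contra! hlt
        nlinarith
      have hb' : (2 * l + 1 : ℝ) ≤ 2 * n + 2 := by
        by_contra! hlt
        nlinarith
      have ha'' : 0 ≤ 2 * l + 1 := by exact_mod_cast ha'
      have hb'' : 2 * l + 1 ≤ 2 * (n : ℤ) + 2 := by exact_mod_cast hb'
      rw [Finset.mem_Icc]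
      omega
    · intro l hl
      rw [Finset.mem_Icc] at hl
      have hl1 : (0 : ℝ) ≤ l := by exact_mod_cast hl.1
      have hl2 : (l : ℝ) ≤ n := by exact_mod_cast hl.2
      obtain ⟨t, ht, htv⟩ := h.exists_eq (v := (2 * l + 1) * Real.pi / 2) I0 IT hT (by nlinarith)
        (by nlinarith)
      exact ⟨t, ht, (h.snd_eq_zero_iff ht).2 ⟨l, htv⟩, htv⟩
    · intro r hr r' hr' hYr hrr'
      obtain ⟨l, hl⟩ := (h.snd_eq_zero_iff hr).1 hYr
      exact h.eq_of_eq (2 * l + 1) hr hr' (by rw [hl]; push_cast; ring) hrr'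

/-- If the angular sectors `[jπ/2, (j+1)π/2]` are crossed in time at most `q j`, the angle `Jπ/2` is
reached in time at most `∑ j < J, q j`. -/
theorem le_sum_of_angle_le (h : IsClockwiseAngle X Y ϑ T) (h0 : 0 ≤ ϑ 0)
    (h0' : ϑ 0 ≤ Real.pi / 2) {q : ℕ → ℝ} (hq0 : ∀ j, 0 ≤ q j)
    (hq : ∀ j : ℕ, ∀ s ∈ Icc 0 T, ∀ t ∈ Icc 0 T, s ≤ t →
      (∀ r ∈ Icc s t, ϑ r ∈ Icc (j * (Real.pi / 2)) ((j + 1) * (Real.pi / 2))) → t - s ≤ q j)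
    (J : ℕ) : ∀ t ∈ Icc 0 T, ϑ t ≤ J * (Real.pi / 2) → t ≤ ∑ j ∈ Finset.range J, q j := by
  have hpi := Real.pi_pos
  induction J with
  | zero =>
    intro t ht hle
    by_contra! hlt
    rw [Finset.range_zero, Finset.sum_empty] at hlt
    have := h.lt_of_lt 0 ⟨le_rfl, ht.1.trans ht.2⟩ ht hlt (by simpa using h0)
    simp at this hle
    linarith
  | succ J ih =>
    intro t ht hle
    rw [Finset.sum_range_succ]
    have I0 : (0 : ℝ) ∈ Icc 0 T := ⟨le_rfl, ht.1.trans ht.2⟩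
    by_cases hJ : ϑ t ≤ J * (Real.pi / 2)
    · have := ih t ht hJ
      linarith [hq0 J]
    push Not at hJ
    -- `s` is the time at which the sector `J` is entered; for `J = 0` it is the initial time, when
    -- the angle may already be inside the sector.
    obtain ⟨s, hs, hs1, hs2⟩ : ∃ s ∈ Icc 0 t, J * (Real.pi / 2) ≤ ϑ s ∧
        s ≤ ∑ j ∈ Finset.range J, q j := by
      rcases Nat.eq_zero_or_pos J with rfl | hJ0
      · exact ⟨0, ⟨le_rfl, ht.1⟩, by simpa using h0, by simp⟩
      · have hJ1 : (1 : ℝ) ≤ J := by exact_mod_cast hJ0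
        obtain ⟨s, hs, hsv⟩ := h.exists_eq (v := J * (Real.pi / 2)) I0 ht ht.1 (by nlinarith) hJ.le
        exact ⟨s, hs, hsv.ge, ih s ⟨hs.1, hs.2.trans ht.2⟩ hsv.le⟩
    have hsT : s ∈ Icc 0 T := ⟨hs.1, hs.2.trans ht.2⟩
    have := hq J s hsT t ht hs.2 fun r hr => by
      have hrT : r ∈ Icc 0 T := ⟨hs.1.trans hr.1, hr.2.trans ht.2⟩
      constructor
      · have := h.le_of_le J hsT hrT hr.1 (by exact_mod_cast hs1)
        exact_mod_cast this
      · have := h.le_of_ge (J + 1) ht hrT hr.2 (by exact_mod_cast hle)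
        exact_mod_cast this
    linarith

/-- The curve may start anywhere in the sector `0`, which therefore gives no lower bound; only the
sectors `1, ..., J` are fully crossed. This explains `q (j + 1)`. -/
theorem sum_le_of_angle_ge (h : IsClockwiseAngle X Y ϑ T)
    (h0' : ϑ 0 ≤ Real.pi / 2) {q : ℕ → ℝ}
    (hq : ∀ j : ℕ, ∀ s ∈ Icc 0 T, ∀ t ∈ Icc 0 T, s ≤ t →
      (∀ r ∈ Icc s t, ϑ r ∈ Icc (j * (Real.pi / 2)) ((j + 1) * (Real.pi / 2))) →
      ϑ s = j * (Real.pi / 2) → ϑ t = (j + 1) * (Real.pi / 2) → q j ≤ t - s)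
    (J : ℕ) : ∀ t ∈ Icc 0 T, (J + 1) * (Real.pi / 2) ≤ ϑ t → ∑ j ∈ Finset.range J, q (j + 1) ≤ t := by
  have hpi := Real.pi_pos
  induction J with
  | zero => intro t ht _; simpa using ht.1
  | succ J ih =>
    intro t ht hle
    rw [Finset.sum_range_succ]
    have I0 : (0 : ℝ) ∈ Icc 0 T := ⟨le_rfl, ht.1.trans ht.2⟩
    have hJ0 : (0 : ℝ) ≤ J := J.cast_nonneg
    push_cast at hle
    obtain ⟨t', ht', htv⟩ := h.exists_eq (v := (J + 1 + 1) * (Real.pi / 2)) I0 ht ht.1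
      (by nlinarith) hle
    have ht'T : t' ∈ Icc 0 T := ⟨ht'.1, ht'.2.trans ht.2⟩
    obtain ⟨s, hs, hsv⟩ := h.exists_eq (v := (J + 1) * (Real.pi / 2)) I0 ht'T ht'.1
      (by nlinarith) (by nlinarith)
    have hsT : s ∈ Icc 0 T := ⟨hs.1, hs.2.trans ht'T.2⟩
    have h1 := ih s hsT hsv.ge
    have h2 := hq (J + 1) s hsT t' ht'T hs.2 (fun r hr => by
      have hrT : r ∈ Icc 0 T := ⟨hs.1.trans hr.1, hr.2.trans ht'T.2⟩
      constructor
      · have := h.le_of_le (J + 1) hsT hrT hr.1 (by push_cast; exact hsv.ge)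
        push_cast at this ⊢; exact this
      · have := h.le_of_ge (J + 1 + 1) ht'T hrT hr.2 (by push_cast; exact htv.le)
        push_cast at this ⊢; exact this) (by push_cast; exact hsv) (by push_cast; exact htv)
    linarith [ht'.2]

end IsClockwiseAngle

/-- Four consecutive quadrants make a full turn, wherever the summation starts. -/
theorem sum_range_four_mul {q : ℕ → ℝ} (hq : ∀ j, q (j + 4) = q j) (a n : ℕ) :
    ∑ j ∈ Finset.range (4 * n), q (j + a) = n * (q a + q (a + 1) + q (a + 2) + q (a + 3)) := by
  have hq' : ∀ n j, q (j + 4 * n) = q j := fun n => by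
    induction n with
    | zero => simp
    | succ n ih => intro j; rw [mul_add, mul_one, ← add_assoc, hq, ih]
  induction n with
  | zero => simp
  | succ n ih =>
    rw [mul_add, mul_one, Finset.sum_range_succ, Finset.sum_range_succ, Finset.sum_range_succ,
      Finset.sum_range_succ, ih]
    have e : ∀ b, 4 * n + b + a = (a + b) + 4 * n := fun b => by ring
    rw [show 4 * n + a = a + 4 * n by ring, e 1, e 2, e 3, hq', hq', hq', hq']
    push_cast
    ring

/-- Rotating an angle by `jπ/2` moves the point `j` quadrants further. -/
theorem mem_region_iterate_next {ρ : ℝ} (hρ : 0 ≤ ρ) {σ : ℝ} {κ : Quadrant}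
    (hκ : (κ = .I ∧ σ = 1) ∨ (κ = .III ∧ σ = -1)) (j : ℕ) :
    ∀ ϑ ∈ Icc (j * (Real.pi / 2)) ((j + 1) * (Real.pi / 2)),
      (σ * (ρ * Real.sin ϑ), σ * (ρ * Real.cos ϑ)) ∈ (Quadrant.next^[j] κ).region := by
  induction j with
  | zero =>
    intro ϑ hϑ
    simp only [CharP.cast_eq_zero, zero_mul, zero_add, one_mul] at hϑ
    have h1 := mul_nonneg hρ (Real.sin_nonneg_of_nonneg_of_le_pi hϑ.1
      (by linarith [hϑ.2, Real.pi_pos]))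
    have h2 := mul_nonneg hρ (Real.cos_nonneg_of_mem_Icc ⟨by linarith [hϑ.1, Real.pi_pos], hϑ.2⟩)
    rcases hκ with ⟨rfl, rfl⟩ | ⟨rfl, rfl⟩ <;> simp [Quadrant.region] <;> constructor <;> linarith
  | succ j ih =>
    intro ϑ hϑ
    push_cast at hϑ
    have := ih (ϑ - Real.pi / 2) ⟨by linarith [hϑ.1], by linarith [hϑ.2]⟩
    rw [Real.sin_sub_pi_div_two, Real.cos_sub_pi_div_two] at this
    rw [Function.iterate_succ_apply']
    revert this
    generalize Quadrant.next^[j] κ = κ'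
    cases κ' <;> simp [Quadrant.next, Quadrant.region] <;> intros <;> constructor <;> linarith


/-! ### Kinetic functions and time maps -/

/-- `h` is continuous with the sign of its argument and `H` is its primitive. -/
structure IsKinetic (h H : ℝ → ℝ) : Prop where
  continuous : Continuous h
  pos : ∀ y, 0 < y → 0 < h y
  neg : ∀ y, y < 0 → h y < 0
  hasDerivAt : ∀ y, HasDerivAt H (h y) y
  map_zero : H 0 = 0

/-- The inverse of the restriction of `H` to `[0, ∞)`. -/
noncomputable def kineticInv (H : ℝ → ℝ) : ℝ → ℝ := Function.invFunOn H (Ici 0)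

namespace IsKinetic

variable {h H : ℝ → ℝ}

theorem apply_zero (hH : IsKinetic h H) : h 0 = 0 := by
  apply le_antisymm
  · have : Tendsto h (𝓝[<] 0) (𝓝 (h 0)) := hH.continuous.continuousAt.tendsto.mono_left inf_le_left
    exact le_of_tendsto this (eventually_mem_nhdsWithin.mono fun y hy => (hH.neg y hy).le)
  · have : Tendsto h (𝓝[>] 0) (𝓝 (h 0)) := hH.continuous.continuousAt.tendsto.mono_left inf_le_left
    exact ge_of_tendsto this (eventually_mem_nhdsWithin.mono fun y hy => (hH.pos y hy).le)

theorem nonneg (hH : IsKinetic h H) {y : ℝ} (hy : 0 ≤ y) : 0 ≤ h y := by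
  rcases hy.eq_or_lt with rfl | hy
  · exact hH.apply_zero.ge
  · exact (hH.pos y hy).le

theorem continuous_primitive (hH : IsKinetic h H) : Continuous H :=
  continuous_iff_continuousAt.2 fun y => (hH.hasDerivAt y).continuousAt

theorem strictMonoOn (hH : IsKinetic h H) : StrictMonoOn H (Ici 0) := by
  refine strictMonoOn_of_deriv_pos (convex_Ici 0) hH.continuous_primitive.continuousOn ?_
  intro y hy
  rw [interior_Ici] at hy
  rw [(hH.hasDerivAt y).deriv]
  exact hH.pos y hy

/-- The half-turn `p ↦ -p` preserves the class of systems. It reduces the lower half-plane to the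
upper one here and in the later `reflect` lemmas. -/
theorem reflect (hH : IsKinetic h H) : IsKinetic (fun y => -h (-y)) (fun y => H (-y)) where
  continuous := (hH.continuous.comp continuous_neg).neg
  pos y hy := neg_pos.2 (hH.neg _ (neg_neg_iff_pos.2 hy))
  neg y hy := neg_neg_iff_pos.2 (hH.pos _ (neg_pos.2 hy))
  hasDerivAt y := by
    have := (hH.hasDerivAt (-y)).comp y (hasDerivAt_neg y)
    simpa [Function.comp_def] using this
  map_zero := by simpa using hH.map_zero

theorem primitive_pos (hH : IsKinetic h H) {y : ℝ} (hy : y ≠ 0) : 0 < H y := by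
  rcases hy.lt_or_gt with hy | hy
  · have := hH.reflect.strictMonoOn (mem_Ici.2 le_rfl) (mem_Ici.2 (neg_pos.2 hy).le) (neg_pos.2 hy)
    simpa [hH.map_zero] using this
  · have := hH.strictMonoOn (mem_Ici.2 le_rfl) (mem_Ici.2 hy.le) hy
    simpa [hH.map_zero] using this

theorem primitive_nonneg (hH : IsKinetic h H) (y : ℝ) : 0 ≤ H y := by
  rcases eq_or_ne y 0 with rfl | hy
  · exact hH.map_zero.ge
  · exact (hH.primitive_pos hy).le

theorem primitive_eq_zero_iff (hH : IsKinetic h H) {y : ℝ} : H y = 0 ↔ y = 0 :=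
  ⟨fun h0 => by_contra fun hy => (hH.primitive_pos hy).ne' h0, fun hy => hy ▸ hH.map_zero⟩

theorem kineticInv_apply (hH : IsKinetic h H) {y : ℝ} (hy : 0 ≤ y) : kineticInv H (H y) = y :=
  hH.strictMonoOn.injOn.leftInvOn_invFunOn hy

/-- `H` is strictly monotone on `[0, ∞)`, so inequalities between values of `H ∘ Y` give
inequalities between values of `Y`; this yields continuity of the inverse without describing the
range of `H`. -/
theorem continuousOn_of_comp (hH : IsKinetic h H) {S : Set ℝ} {Y : ℝ → ℝ} (hY : ∀ x ∈ S, 0 ≤ Y x)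
    (hc : ContinuousOn (fun x => H (Y x)) S) : ContinuousOn Y S := by
  intro x hx
  refine tendsto_order.2 ⟨fun a ha => ?_, fun b hb => ?_⟩
  · by_cases ha0 : a < 0
    · exact eventually_mem_nhdsWithin.mono fun x' hx' => ha0.trans_le (hY x' hx')
    · push Not at ha0
      have h1 := hH.strictMonoOn ha0 (hY x hx) ha
      filter_upwards [(hc x hx).eventually_const_lt h1, self_mem_nhdsWithin] with x' h2 hx'
      exact (hH.strictMonoOn.lt_iff_lt ha0 (hY x' hx')).1 h2
  · have hb0 : 0 ≤ b := (hY x hx).trans hb.le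
    have h1 := hH.strictMonoOn (hY x hx) hb0 hb
    filter_upwards [(hc x hx).eventually_lt_const h1, self_mem_nhdsWithin] with x' h2 hx'
    exact (hH.strictMonoOn.lt_iff_lt (hY x' hx') hb0).1 h2

theorem exists_eq_of_le (hH : IsKinetic h H) {v y : ℝ} (hv : 0 ≤ v) (hy : 0 ≤ y)
    (hvy : v ≤ H y) : ∃ y' ∈ Icc 0 y, H y' = v :=
  intermediate_value_Icc hy hH.continuous_primitive.continuousOn ⟨by rwa [hH.map_zero], hvy⟩

theorem hasDerivAt_kineticInv (hH : IsKinetic h H) {y : ℝ} (hy : 0 < y) :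
    HasDerivAt (kineticInv H) (h y)⁻¹ (H y) := by
  have hnhds : Icc (H (y / 2)) (H (y + 1)) ∈ 𝓝 (H y) := by
    refine Icc_mem_nhds (hH.strictMonoOn ?_ ?_ ?_) (hH.strictMonoOn ?_ ?_ ?_) <;>
    first | exact mem_Ici.2 (by linarith) | linarith
  have hinv : ∀ v ∈ Icc (H (y / 2)) (H (y + 1)), 0 ≤ kineticInv H v ∧ H (kineticInv H v) = v := by
    intro v hv
    obtain ⟨y', hy', rfl⟩ := hH.exists_eq_of_le ((hH.primitive_nonneg _).trans hv.1)
      (by linarith : 0 ≤ y + 1) hv.2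
    rw [hH.kineticInv_apply hy'.1]
    exact ⟨hy'.1, rfl⟩
  have hc : ContinuousOn (kineticInv H) (Icc (H (y / 2)) (H (y + 1))) :=
    hH.continuousOn_of_comp (fun v hv => (hinv v hv).1)
      (continuousOn_id.congr fun v hv => (hinv v hv).2)
  refine HasDerivAt.of_local_left_inverse (f := H) (hc.continuousAt hnhds) ?_ (hH.pos y hy).ne'
    (by filter_upwards [hnhds] with v hv using (hinv v hv).2)
  rw [hH.kineticInv_apply hy.le]
  exact hH.hasDerivAt y

end IsKinetic

/-! ### Integrands of the time maps and their integrability -/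

/-- The integrand `1 / h(H₊⁻¹(c - K(x)))` of the time maps. -/
noncomputable def timeWeight (h H K : ℝ → ℝ) (c x : ℝ) : ℝ := 1 / h (kineticInv H (c - K x))

section TimeWeight

variable {h H k K : ℝ → ℝ} {a b c : ℝ}

theorem timeWeight_eq (hH : IsKinetic h H) {x y : ℝ} (hy : 0 ≤ y) (hc : H y + K x = c) :
    timeWeight h H K c x = 1 / h y := by
  rw [timeWeight, ← hc, add_sub_cancel_right, hH.kineticInv_apply hy]

theorem timeWeight_nonneg (hH : IsKinetic h H) {x : ℝ} (hx : ∃ y ≥ 0, H y + K x = c) :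
    0 ≤ timeWeight h H K c x := by
  obtain ⟨y, hy, hyc⟩ := hx
  rw [timeWeight_eq hH hy hyc]
  exact one_div_nonneg.2 (hH.nonneg hy)

theorem timeWeight_pos (hH : IsKinetic h H) {x : ℝ} (hx : ∃ y ≥ 0, H y + K x = c) (hK : K x < c) :
    0 < timeWeight h H K c x := by
  obtain ⟨y, hy, hyc⟩ := hx
  rw [timeWeight_eq hH hy hyc]
  refine one_div_pos.2 (hH.pos y (lt_of_le_of_ne hy ?_))
  rintro rfl
  rw [hH.map_zero] at hyc
  linarith

theorem kineticInv_continuousOn_comp (hH : IsKinetic h H) {S : Set ℝ} (hK : ContinuousOn K S)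
    (hx : ∀ x ∈ S, ∃ y ≥ 0, H y + K x = c) :
    ContinuousOn (fun x => kineticInv H (c - K x)) S := by
  have key : ∀ x ∈ S, 0 ≤ kineticInv H (c - K x) ∧ H (kineticInv H (c - K x)) = c - K x := by
    intro x hxS
    obtain ⟨y, hy, hyc⟩ := hx x hxS
    rw [← hyc, add_sub_cancel_right, hH.kineticInv_apply hy]
    exact ⟨hy, rfl⟩
  exact hH.continuousOn_of_comp (fun x hxS => (key x hxS).1)
    ((continuousOn_const.sub hK).congr fun x hxS => (key x hxS).2)

theorem continuousOn_timeWeight (hH : IsKinetic h H) {S : Set ℝ} (hK : ContinuousOn K S)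
    (hx : ∀ x ∈ S, ∃ y ≥ 0, H y + K x = c) (hlt : ∀ x ∈ S, K x < c) :
    ContinuousOn (timeWeight h H K c) S := by
  refine ContinuousOn.div continuousOn_const
    (hH.continuous.comp_continuousOn (kineticInv_continuousOn_comp hH hK hx)) fun x hxS h0 => ?_
  have := timeWeight_pos hH (hx x hxS) (hlt x hxS)
  rw [timeWeight, h0, div_zero] at this
  exact lt_irrefl _ this

/-- The integrand may be singular at `b`, where `K b = c` is allowed. Near `b`, where `k > 0`, its
product with `k` is the nonnegative derivative of the continuous function `-kineticInv H (c - K x)`,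
hence integrable, and dividing by `k` is harmless. -/
theorem intervalIntegrable_timeWeight_of_right (hH : IsKinetic h H) (hk : Continuous k)
    (hK : ∀ x, HasDerivAt K (k x) x) (hab : a < b) (hx : ∀ x ∈ Icc a b, ∃ y ≥ 0, H y + K x = c)
    (hlt : ∀ x ∈ Ico a b, K x < c) (hb : 0 < k b) :
    IntervalIntegrable (timeWeight h H K c) volume a b := by
  have hKc : Continuous K := continuous_iff_continuousAt.2 fun x => (hK x).continuousAt
  obtain ⟨δ, hδ, hδ'⟩ : ∃ δ > 0, ∀ x, b - δ ≤ x → x ≤ b → 0 < k x := by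
    obtain ⟨ε, hε, H'⟩ := Metric.eventually_nhds_iff.1 (hk.continuousAt.eventually_const_lt hb)
    refine ⟨ε / 2, half_pos hε, fun x h1 h2 => H' ?_⟩
    rw [Real.dist_eq, abs_lt]
    constructor <;> linarith
  set m := max a (b - δ) with hm
  have hmb : m < b := max_lt hab (by linarith)
  have ham : a ≤ m := le_max_left _ _
  have hkm : ∀ x ∈ Icc m b, 0 < k x := fun x hx => hδ' x ((le_max_right _ _).trans hx.1) hx.2
  refine IntervalIntegrable.trans (b := m) ?_ ?_
  · refine ContinuousOn.intervalIntegrable ?_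
    rw [uIcc_of_le ham]
    exact continuousOn_timeWeight hH hKc.continuousOn
      (fun x hxm => hx x ⟨hxm.1, hxm.2.trans hmb.le⟩) (fun x hxm => hlt x ⟨hxm.1, hxm.2.trans_lt hmb⟩)
  · have hsub : Icc m b ⊆ Icc a b := Icc_subset_Icc_left ham
    have hYc := kineticInv_continuousOn_comp hH hKc.continuousOn (fun x hxm => hx x (hsub hxm))
    have hint : IntervalIntegrable (fun x => timeWeight h H K c x * k x) volume m b := by
      rw [intervalIntegrable_iff_integrableOn_Ioc_of_le hmb.le]
      refine intervalIntegral.integrableOn_deriv_of_nonneg (g := fun x => -kineticInv H (c - K x))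
        hYc.neg (fun x hxm => ?_) (fun x hxm => ?_)
      · obtain ⟨y, hy, hyc⟩ := hx x (hsub (Ioo_subset_Icc_self hxm))
        have hy0 : 0 < y := lt_of_le_of_ne hy (by
          rintro rfl
          rw [hH.map_zero] at hyc
          linarith [hlt x ⟨ham.trans hxm.1.le, hxm.2⟩])
        have h1 : HasDerivAt (kineticInv H) (h y)⁻¹ (c - K x) := by
          rw [← hyc, add_sub_cancel_right]; exact hH.hasDerivAt_kineticInv hy0
        have h2 := (h1.comp x ((hK x).const_sub c)).neg
        rw [timeWeight_eq hH hy hyc]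
        exact h2.congr_deriv (by ring)
      · exact mul_nonneg (timeWeight_nonneg hH (hx x (hsub (Ioo_subset_Icc_self hxm))))
          (hkm x (Ioo_subset_Icc_self hxm)).le
    have h2 := hint.mul_continuousOn (g := fun x => (k x)⁻¹) (by
      rw [uIcc_of_le hmb.le]
      exact hk.continuousOn.inv₀ fun x hxm => (hkm x hxm).ne')
    refine h2.congr fun x hxm => ?_
    rw [uIoc_of_le hmb.le] at hxm
    have := (hkm x (Ioc_subset_Icc_self hxm)).ne'
    field_simp

theorem timeWeight_comp_neg (x : ℝ) :
    timeWeight h H (fun x => K (-x)) c x = timeWeight h H K c (-x) := rfl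

theorem intervalIntegrable_timeWeight_of_left (hH : IsKinetic h H) (hk : Continuous k)
    (hK : ∀ x, HasDerivAt K (k x) x) (hab : a < b) (hx : ∀ x ∈ Icc a b, ∃ y ≥ 0, H y + K x = c)
    (hlt : ∀ x ∈ Ioc a b, K x < c) (ha : k a < 0) :
    IntervalIntegrable (timeWeight h H K c) volume a b := by
  have := intervalIntegrable_timeWeight_of_right (K := fun x => K (-x)) (k := fun x => -k (-x))
    (a := -b) (b := -a) (c := c) hH (by fun_prop) (fun x => by
      have := (hK (-x)).comp x (hasDerivAt_neg x)
      simpa [Function.comp_def] using this) (by linarith)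
    (fun x hxm => hx (-x) ⟨by linarith [hxm.2], by linarith [hxm.1]⟩)
    (fun x hxm => hlt (-x) ⟨by linarith [hxm.2], by linarith [hxm.1]⟩) (by simpa using ha)
  rw [IntervalIntegrable.iff_comp_neg]
  exact this.symm

/-- The time along a monotone function, in terms of the inverse speed. -/
theorem intervalIntegral_eq_time {x v w : ℝ → ℝ} {s t : ℝ} (hst : s ≤ t)
    (hx : ContinuousOn x (Icc s t)) (hd : ∀ r ∈ Ioo s t, HasDerivAt x (v r) r)
    (hv : ∀ r ∈ Ioo s t, 0 < v r) (hw : ∀ r ∈ Ioo s t, w (x r) = 1 / v r) :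
    x s ≤ x t ∧ ∫ r in (x s)..(x t), w r = t - s := by
  have hmono : x s ≤ x t := by
    have : MonotoneOn x (Icc s t) := by
      refine monotoneOn_of_deriv_nonneg (convex_Icc s t) hx ?_ ?_ <;> rw [interior_Icc]
      · exact fun r hr => (hd r hr).differentiableAt.differentiableWithinAt
      · exact fun r hr => (hd r hr).deriv ▸ (hv r hr).le
    exact this ⟨le_rfl, hst⟩ ⟨hst, le_rfl⟩ hst
  refine ⟨hmono, ?_⟩
  rw [intervalIntegral.integral_of_le hmono, ← integral_Icc_eq_integral_Ioc,
    ← integral_Icc_deriv_smul_of_deriv_nonneg hx hd (fun r hr => (hv r hr).le) hst,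
    integral_Icc_eq_integral_Ioo]
  have : ∫ r in Ioo s t, v r • w (x r) = ∫ r in Ioo s t, (1 : ℝ) :=
    setIntegral_congr_fun measurableSet_Ioo fun r hr => by
      simp only [hw r hr, smul_eq_mul]
      exact mul_one_div_cancel (hv r hr).ne'
  rw [this]
  simp [hst]

end TimeWeight

/-! ### Energy -/

section Energy

variable {h H k K : ℝ → ℝ} {T : ℝ} {z : ℝ → ℝ × ℝ}

theorem IsFlowLine.energy_eq (hH : ∀ y, HasDerivAt H (h y) y) (hK : ∀ x, HasDerivAt K (k x) x)
    (hz : IsFlowLine (sepField h k) T z) {t : ℝ} (ht : t ∈ Icc 0 T) :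
    H (z t).2 + K (z t).1 = H (z 0).2 + K (z 0).1 := by
  have hd : ∀ s ∈ Icc 0 T, HasDerivWithinAt (fun s => H (z s).2 + K (z s).1) 0 (Icc 0 T) s := by
    intro s hs
    have := ((hH _).comp_hasDerivWithinAt s (hz.snd hs)).add
      ((hK _).comp_hasDerivWithinAt s (hz.fst hs))
    exact this.congr_deriv (by ring)
  refine constant_of_has_deriv_right_zero (fun s hs => (hd s hs).continuousWithinAt)
    (fun s hs => ?_) t ht
  exact (hd s (Ico_subset_Icc_self hs)).mono_of_mem_nhdsWithin
    (mem_of_superset (Icc_mem_nhdsGE hs.2) (Icc_subset_Icc_left hs.1))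

theorem IsFlowLine.reflect (hz : IsFlowLine (sepField h k) T z) :
    IsFlowLine (sepField (fun y => -h (-y)) (fun x => -k (-x))) T (fun t => -z t) := by
  intro t ht
  refine (hz t ht).neg.congr_deriv ?_
  simp [sepField]

theorem IsFlowLine.shift (hz : IsFlowLine (sepField h k) T z) {s : ℝ} (hs : 0 ≤ s) :
    IsFlowLine (sepField h k) (T - s) (fun t => z (t + s)) := by
  intro t ht
  have h1 := hz (t + s) ⟨by linarith [ht.1], by linarith [ht.2]⟩
  have h2 : HasDerivWithinAt (fun t : ℝ => t + s) 1 (Icc 0 (T - s)) t :=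
    ((hasDerivAt_id t).add_const s).hasDerivWithinAt
  have := h1.scomp t h2 (fun r (hr : r ∈ Icc 0 (T - s)) =>
    (⟨by linarith [hr.1], by linarith [hr.2]⟩ : r + s ∈ Icc 0 T))
  rw [one_smul] at this
  exact this

/-- The time spent along an arc of the upper half-plane. -/
theorem IsFlowLine.time_eq (hH : IsKinetic h H) (hK : ∀ x, HasDerivAt K (k x) x)
    (hz : IsFlowLine (sepField h k) T z) {s t : ℝ} (hs : 0 ≤ s) (hst : s ≤ t) (ht : t ≤ T)
    (hy : ∀ r ∈ Ioo s t, 0 < (z r).2) :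
    (z s).1 ≤ (z t).1 ∧
      ∫ x in (z s).1..(z t).1, timeWeight h H K (H (z 0).2 + K (z 0).1) x = t - s := by
  have hsub : Icc s t ⊆ Icc 0 T := Icc_subset_Icc hs ht
  have hIoo : ∀ r ∈ Ioo s t, r ∈ Ioo 0 T := fun r hr => ⟨hs.trans_lt hr.1, hr.2.trans_le ht⟩
  refine intervalIntegral_eq_time (x := fun r => (z r).1) (v := fun r => h (z r).2) hst
    ((continuous_fst.comp_continuousOn hz.continuousOn).mono hsub) (fun r hr => ?_)
    (fun r hr => hH.pos _ (hy r hr)) (fun r hr => ?_)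
  · exact (hz.fst (Ioo_subset_Icc_self (hIoo r hr))).hasDerivAt
      (Icc_mem_nhds (hIoo r hr).1 (hIoo r hr).2)
  · exact timeWeight_eq hH (hy r hr).le
      (hz.energy_eq hH.hasDerivAt hK (Ioo_subset_Icc_self (hIoo r hr)))

/-- Comparison of the time spent in the upper half-plane with the time map. -/
theorem IsFlowLine.time_le (hH : IsKinetic h H) (hK : ∀ x, HasDerivAt K (k x) x)
    (hz : IsFlowLine (sepField h k) T z) {a b c s t : ℝ} (hc : H (z 0).2 + K (z 0).1 = c)
    (hab : ∀ x ∈ Icc a b, ∃ y ≥ 0, H y + K x = c)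
    (hint : IntervalIntegrable (timeWeight h H K c) volume a b)
    (hs : 0 ≤ s) (hst : s ≤ t) (ht : t ≤ T)
    (hy : ∀ r ∈ Icc s t, 0 ≤ (z r).2 ∧ (z r).1 ∈ Icc a b)
    (hk : ∀ r ∈ Icc s t, (z r).2 = 0 → k (z r).1 ≠ 0) :
    t - s ≤ ∫ x in a..b, timeWeight h H K c x ∧
      ((z s).1 = a → (z t).1 = b → ∫ x in a..b, timeWeight h H K c x = t - s) := by
  -- An interior zero of `y ≥ 0` would be a local minimum, so `k` would vanish at a point of the
  -- `x`-axis, contrary to `hk`.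
  have hy' : ∀ r ∈ Ioo s t, 0 < (z r).2 := by
    intro r hr
    refine lt_of_le_of_ne (hy r (Ioo_subset_Icc_self hr)).1 fun h0 => ?_
    have hrT : r ∈ Ioo 0 T := ⟨hs.trans_lt hr.1, hr.2.trans_le ht⟩
    have hd : HasDerivAt (fun r => (z r).2) (-k (z r).1) r :=
      (hz.snd (Ioo_subset_Icc_self hrT)).hasDerivAt (Icc_mem_nhds hrT.1 hrT.2)
    have hmin : IsLocalMin (fun r => (z r).2) r := by
      filter_upwards [Ioo_mem_nhds hr.1 hr.2] with r' hr'
      rw [← h0]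
      exact (hy r' (Ioo_subset_Icc_self hr')).1
    exact hk r (Ioo_subset_Icc_self hr) h0.symm (neg_eq_zero.1 (hmin.hasDerivAt_eq_zero hd))
  obtain ⟨h1, h2⟩ := hz.time_eq hH hK hs hst ht hy'
  rw [hc] at h2
  refine ⟨?_, fun e1 e2 => by rw [← e1, ← e2]; exact h2⟩
  have hs' := (hy s ⟨le_rfl, hst⟩).2
  have ht' := (hy t ⟨hst, le_rfl⟩).2
  rw [← h2]
  refine intervalIntegral.integral_mono_interval hs'.1 h1 ht'.2 ?_ hint
  exact (ae_restrict_iff' measurableSet_Ioc).2 (Eventually.of_forall fun x hx =>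
    timeWeight_nonneg hH (hab x (Ioc_subset_Icc_self hx)))

end Energy


/-! ### Potential wells and the annuli around them -/

/-- A kinetic function with bounded derivative whose primitive is unbounded on both sides. -/
structure IsProperKinetic (h H : ℝ → ℝ) : Prop extends IsKinetic h H where
  bounded : ∃ M, ∀ y, |h y| ≤ M
  exists_nonneg_le : ∀ v, ∃ y, 0 ≤ y ∧ v ≤ H y
  exists_nonpos_le : ∀ v, ∃ y, y ≤ 0 ∧ v ≤ H y

theorem IsProperKinetic.reflect {h H : ℝ → ℝ} (hH : IsProperKinetic h H) :
    IsProperKinetic (fun y => -h (-y)) (fun y => H (-y)) where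
  toIsKinetic := hH.toIsKinetic.reflect
  bounded := hH.bounded.imp fun M hM y => by rw [abs_neg]; exact hM _
  exists_nonneg_le v := by
    obtain ⟨y, hy, h⟩ := hH.exists_nonpos_le v
    exact ⟨-y, neg_nonneg.2 hy, by simpa using h⟩
  exists_nonpos_le v := by
    obtain ⟨y, hy, h⟩ := hH.exists_nonneg_le v
    exact ⟨-y, neg_nonpos.2 hy, by simpa using h⟩

theorem IsProperKinetic.exists_nonneg_eq {h H : ℝ → ℝ} (hH : IsProperKinetic h H) {v : ℝ}
    (hv : 0 ≤ v) : ∃ y ≥ 0, H y = v := by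
  obtain ⟨y, hy, hyv⟩ := hH.exists_nonneg_le v
  obtain ⟨y', hy', h⟩ := hH.exists_eq_of_le hv hy hyv
  exact ⟨y', hy'.1, h⟩

/-- The sublevel sets of `K` at the levels `c ∈ [c₁, c₂]` are the intervals `[xN c, xP c]` around
the origin, with nondegenerate ends. -/
structure IsWell (k K : ℝ → ℝ) (c₁ c₂ : ℝ) (xN xP : ℝ → ℝ) : Prop where
  continuous : Continuous k
  hasDerivAt : ∀ x, HasDerivAt K (k x) x
  map_zero : K 0 = 0
  pos : 0 < c₁
  lt : c₁ < c₂
  xN_neg : ∀ c ∈ Icc c₁ c₂, xN c < 0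
  xP_pos : ∀ c ∈ Icc c₁ c₂, 0 < xP c
  map_xN : ∀ c ∈ Icc c₁ c₂, K (xN c) = c
  map_xP : ∀ c ∈ Icc c₁ c₂, K (xP c) = c
  deriv_xN : ∀ c ∈ Icc c₁ c₂, k (xN c) < 0
  deriv_xP : ∀ c ∈ Icc c₁ c₂, 0 < k (xP c)
  lt_of_mem : ∀ c ∈ Icc c₁ c₂, ∀ x ∈ Ioo (xN c) (xP c), K x < c
  gt_of_lt : ∀ c ∈ Icc c₁ c₂, ∀ x < xN c, c < K x
  gt_of_gt : ∀ c ∈ Icc c₁ c₂, ∀ x > xP c, c < K x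

namespace IsWell

variable {k K : ℝ → ℝ} {c₁ c₂ : ℝ} {xN xP : ℝ → ℝ}

theorem reflect (hW : IsWell k K c₁ c₂ xN xP) :
    IsWell (fun x => -k (-x)) (fun x => K (-x)) c₁ c₂ (fun c => -xP c) (fun c => -xN c) where
  continuous := (hW.continuous.comp continuous_neg).neg
  hasDerivAt x := by
    have := (hW.hasDerivAt (-x)).comp x (hasDerivAt_neg x)
    simpa [Function.comp_def] using this
  map_zero := by simpa using hW.map_zero
  pos := hW.pos
  lt := hW.lt
  xN_neg c hc := neg_neg_iff_pos.2 (hW.xP_pos c hc)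
  xP_pos c hc := neg_pos.2 (hW.xN_neg c hc)
  map_xN c hc := by rw [neg_neg]; exact hW.map_xP c hc
  map_xP c hc := by rw [neg_neg]; exact hW.map_xN c hc
  deriv_xN c hc := by rw [neg_neg]; exact neg_neg_iff_pos.2 (hW.deriv_xP c hc)
  deriv_xP c hc := by rw [neg_neg]; exact neg_pos.2 (hW.deriv_xN c hc)
  lt_of_mem c hc x hx := hW.lt_of_mem c hc _ ⟨by linarith [hx.2], by linarith [hx.1]⟩
  gt_of_lt c hc x hx := hW.gt_of_gt c hc _ (by linarith)
  gt_of_gt c hc x hx := hW.gt_of_lt c hc _ (by linarith)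

variable (hW : IsWell k K c₁ c₂ xN xP)
include hW

theorem mem_Icc_of_le {c x : ℝ} (hc : c ∈ Icc c₁ c₂) (hx : K x ≤ c) : x ∈ Icc (xN c) (xP c) := by
  constructor
  · by_contra! h
    exact absurd (hW.gt_of_lt c hc x h) (not_lt.2 hx)
  · by_contra! h
    exact absurd (hW.gt_of_gt c hc x h) (not_lt.2 hx)

theorem le_of_mem {c x : ℝ} (hc : c ∈ Icc c₁ c₂) (hx : x ∈ Icc (xN c) (xP c)) : K x ≤ c := by
  rcases hx.1.eq_or_lt with rfl | h1
  · exact (hW.map_xN c hc).le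
  rcases hx.2.eq_or_lt with rfl | h2
  · exact (hW.map_xP c hc).le
  exact (hW.lt_of_mem c hc x ⟨h1, h2⟩).le

theorem eq_of_eq {c x : ℝ} (hc : c ∈ Icc c₁ c₂) (hx : K x = c) : x = xN c ∨ x = xP c := by
  have h := hW.mem_Icc_of_le hc hx.le
  by_contra! hne
  exact absurd (hW.lt_of_mem c hc x
    ⟨lt_of_le_of_ne h.1 (Ne.symm hne.1), lt_of_le_of_ne h.2 hne.2⟩) hx.ge.not_gt

theorem eq_xP {c x : ℝ} (hc : c ∈ Icc c₁ c₂) (hx : K x = c) (hx0 : 0 ≤ x) : x = xP c := by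
  rcases hW.eq_of_eq hc hx with rfl | h
  · linarith [hW.xN_neg c hc]
  · exact h

theorem eq_xN {c x : ℝ} (hc : c ∈ Icc c₁ c₂) (hx : K x = c) (hx0 : x ≤ 0) : x = xN c := by
  rcases hW.eq_of_eq hc hx with h | rfl
  · exact h
  · linarith [hW.xP_pos c hc]

end IsWell

/-! ### Time spent by trajectories in the quadrants -/

/-- The time needed to cross a quadrant along the orbit of energy `c`. -/
noncomputable def crossingTime (h H K : ℝ → ℝ) (xN xP : ℝ → ℝ) (κ : Quadrant) (c : ℝ) : ℝ :=
  match κ with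
  | .I => ∫ x in (0 : ℝ)..(xP c), timeWeight h H K c x
  | .IV => ∫ x in (0 : ℝ)..(xP c), timeWeight (fun y => -h (-y)) (fun y => H (-y)) K c x
  | .III => ∫ x in (xN c)..(0 : ℝ), timeWeight (fun y => -h (-y)) (fun y => H (-y)) K c x
  | .II => ∫ x in (xN c)..(0 : ℝ), timeWeight h H K c x

/-- The axis on which the clockwise motion enters a quadrant. -/
def Quadrant.firstAxis : Quadrant → Set (ℝ × ℝ)
  | .I => {p | p.1 = 0}
  | .II => {p | p.2 = 0}
  | .III => {p | p.1 = 0}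
  | .IV => {p | p.2 = 0}

section Crossing

variable {h H k K : ℝ → ℝ} {c₁ c₂ : ℝ} {xN xP : ℝ → ℝ} {T c : ℝ} {z : ℝ → ℝ × ℝ}

theorem crossingTime_reflect (κ : Quadrant) :
    crossingTime (fun y => -h (-y)) (fun y => H (-y)) (fun x => K (-x)) (fun c => -xP c)
      (fun c => -xN c) κ c = crossingTime h H K xN xP κ.next.next c := by
  cases κ <;> simp only [crossingTime, Quadrant.next, timeWeight_comp_neg, neg_neg]
  · rw [intervalIntegral.integral_comp_neg]; simp
  · rw [intervalIntegral.integral_comp_neg]; simp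
  · rw [intervalIntegral.integral_comp_neg (fun x => timeWeight h H K c x)]; simp
  · rw [intervalIntegral.integral_comp_neg (fun x => timeWeight h H K c x)]; simp

/-- In the upper half-plane `x` increases with speed `h(y)`, so time is the integral of the inverse
speed over the abscissas covered. These lie in the range of the quadrant, and fill it exactly when
the arc runs from one axis to the other. -/
theorem crossingTime_bounds_upper (hH : IsProperKinetic h H) (hW : IsWell k K c₁ c₂ xN xP)
    (hz : IsFlowLine (sepField h k) T z) (hc : c ∈ Icc c₁ c₂) (hE : H (z 0).2 + K (z 0).1 = c)
    {κ : Quadrant} (hκ : κ = .I ∨ κ = .II) {s t : ℝ} (hs : 0 ≤ s) (hst : s ≤ t) (ht : t ≤ T)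
    (hr : ∀ r ∈ Icc s t, z r ∈ κ.region) :
    t - s ≤ crossingTime h H K xN xP κ c ∧
      (z s ∈ κ.firstAxis → z t ∈ κ.next.firstAxis → crossingTime h H K xN xP κ c = t - s) := by
  have hEr : ∀ r ∈ Icc s t, H (z r).2 + K (z r).1 = c := fun r hr => by
    rw [hz.energy_eq hH.hasDerivAt hW.hasDerivAt ⟨hs.trans hr.1, hr.2.trans ht⟩, hE]
  have hxr : ∀ r ∈ Icc s t, (z r).1 ∈ Icc (xN c) (xP c) := fun r hr =>
    hW.mem_Icc_of_le hc (by linarith [hEr r hr, hH.primitive_nonneg (z r).2])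
  have hrange : ∀ x ∈ Icc (xN c) (xP c), ∃ y ≥ 0, H y + K x = c := fun x hx => by
    obtain ⟨y, hy, h⟩ := hH.exists_nonneg_eq (v := c - K x) (by linarith [hW.le_of_mem hc hx])
    exact ⟨y, hy, by linarith⟩
  -- The orbit meets the `x`-axis only at `xN c` and `xP c`, where `k` does not vanish by regularity
  -- of the level.
  have hk : ∀ r ∈ Icc s t, (z r).2 = 0 → k (z r).1 ≠ 0 := fun r hr h0 => by
    have hK : K (z r).1 = c := by have := hEr r hr; rwa [h0, hH.map_zero, zero_add] at this
    rcases hW.eq_of_eq hc hK with h | h <;> rw [h]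
    · exact (hW.deriv_xN c hc).ne
    · exact (hW.deriv_xP c hc).ne'
  have hN := hW.xN_neg c hc
  have hP := hW.xP_pos c hc
  rcases hκ with rfl | rfl
  · have hsub : Icc 0 (xP c) ⊆ Icc (xN c) (xP c) := Icc_subset_Icc_left hN.le
    have hint := intervalIntegrable_timeWeight_of_right hH.toIsKinetic hW.continuous hW.hasDerivAt
      hP (fun x hx => hrange x (hsub hx))
      (fun x hx => hW.lt_of_mem c hc x ⟨hN.trans_le hx.1, hx.2⟩) (hW.deriv_xP c hc)
    obtain ⟨h1, h2⟩ := hz.time_le hH.toIsKinetic hW.hasDerivAt hE (fun x hx => hrange x (hsub hx))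
      hint hs hst ht (fun r hrI => ⟨(hr r hrI).2, (hr r hrI).1, (hxr r hrI).2⟩) hk
    refine ⟨h1, fun h3 h4 => h2 h3 ?_⟩
    have htI : t ∈ Icc s t := ⟨hst, le_rfl⟩
    have h4' : (z t).2 = 0 := h4
    refine hW.eq_xP hc ?_ (hr t htI).1
    have := hEr t htI
    rwa [h4', hH.map_zero, zero_add] at this
  · have hsub : Icc (xN c) 0 ⊆ Icc (xN c) (xP c) := Icc_subset_Icc_right hP.le
    have hint := intervalIntegrable_timeWeight_of_left hH.toIsKinetic hW.continuous hW.hasDerivAt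
      hN (fun x hx => hrange x (hsub hx))
      (fun x hx => hW.lt_of_mem c hc x ⟨hx.1, hx.2.trans_lt hP⟩) (hW.deriv_xN c hc)
    obtain ⟨h1, h2⟩ := hz.time_le hH.toIsKinetic hW.hasDerivAt hE (fun x hx => hrange x (hsub hx))
      hint hs hst ht (fun r hrI => ⟨(hr r hrI).2, (hxr r hrI).1, (hr r hrI).1⟩) hk
    refine ⟨h1, fun h3 h4 => h2 ?_ h4⟩
    have hsI : s ∈ Icc s t := ⟨le_rfl, hst⟩
    have h3' : (z s).2 = 0 := h3
    refine hW.eq_xN hc ?_ (hr s hsI).1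
    have := hEr s hsI
    rwa [h3', hH.map_zero, zero_add] at this

theorem Quadrant.neg_mem_region {p : ℝ × ℝ} {κ : Quadrant} :
    -p ∈ κ.next.next.region ↔ p ∈ κ.region := by
  cases κ <;> simp [Quadrant.next, Quadrant.region]

theorem Quadrant.neg_mem_firstAxis {p : ℝ × ℝ} {κ : Quadrant} :
    -p ∈ κ.next.next.firstAxis ↔ p ∈ κ.firstAxis := by
  cases κ <;> simp [Quadrant.next, Quadrant.firstAxis]

theorem crossingTime_bounds (hH : IsProperKinetic h H) (hW : IsWell k K c₁ c₂ xN xP)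
    (hz : IsFlowLine (sepField h k) T z) (hc : c ∈ Icc c₁ c₂) (hE : H (z 0).2 + K (z 0).1 = c)
    {κ : Quadrant} {s t : ℝ} (hs : 0 ≤ s) (hst : s ≤ t) (ht : t ≤ T)
    (hr : ∀ r ∈ Icc s t, z r ∈ κ.region) :
    t - s ≤ crossingTime h H K xN xP κ c ∧
      (z s ∈ κ.firstAxis → z t ∈ κ.next.firstAxis → crossingTime h H K xN xP κ c = t - s) := by
  by_cases hκ : κ = .I ∨ κ = .II
  · exact crossingTime_bounds_upper hH hW hz hc hE hκ hs hst ht hr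
  · have hκ' : κ.next.next = .I ∨ κ.next.next = .II := by
      cases κ <;> simp_all [Quadrant.next]
    -- A half-turn moves each quadrant two places, which brings III and IV to the upper half-plane.
    have key := crossingTime_bounds_upper (κ := κ.next.next) hH.reflect hW.reflect hz.reflect hc
      (by simpa using hE) hκ' hs hst ht
      (fun r hrI => Quadrant.neg_mem_region.2 (hr r hrI))
    rw [crossingTime_reflect, show κ.next.next.next.next = κ by cases κ <;> rfl] at key
    exact ⟨key.1, fun h1 h2 => key.2 (Quadrant.neg_mem_firstAxis.2 h1)
      (Quadrant.neg_mem_firstAxis.2 h2)⟩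

theorem crossingTime_nonneg (hH : IsProperKinetic h H) (hW : IsWell k K c₁ c₂ xN xP)
    (hc : c ∈ Icc c₁ c₂) (κ : Quadrant) : 0 ≤ crossingTime h H K xN xP κ c := by
  have hrange : ∀ x ∈ Icc (xN c) (xP c), ∃ y ≥ 0, H y + K x = c := fun x hx => by
    obtain ⟨y, hy, h⟩ := hH.exists_nonneg_eq (v := c - K x) (by linarith [hW.le_of_mem hc hx])
    exact ⟨y, hy, by linarith⟩
  have hrange' : ∀ x ∈ Icc (xN c) (xP c), ∃ y ≥ 0, H (-y) + K x = c := fun x hx => by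
    obtain ⟨y, hy, h⟩ := hH.reflect.exists_nonneg_eq (v := c - K x)
      (by linarith [hW.le_of_mem hc hx])
    exact ⟨y, hy, by linarith⟩
  have hN := hW.xN_neg c hc
  have hP := hW.xP_pos c hc
  cases κ <;> simp only [crossingTime]
  · exact intervalIntegral.integral_nonneg hP.le fun x hx =>
      timeWeight_nonneg hH.toIsKinetic (hrange x ⟨hN.le.trans hx.1, hx.2⟩)
  · exact intervalIntegral.integral_nonneg hN.le fun x hx =>
      timeWeight_nonneg hH.toIsKinetic (hrange x ⟨hx.1, hx.2.trans hP.le⟩)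
  · exact intervalIntegral.integral_nonneg hN.le fun x hx =>
      timeWeight_nonneg hH.toIsKinetic.reflect (hrange' x ⟨hx.1, hx.2.trans hP.le⟩)
  · exact intervalIntegral.integral_nonneg hP.le fun x hx =>
      timeWeight_nonneg hH.toIsKinetic.reflect (hrange' x ⟨hN.le.trans hx.1, hx.2⟩)

end Crossing

theorem mem_firstAxis_iterate_next {ρ σ : ℝ} {κ : Quadrant} (hκ : κ = .I ∨ κ = .III) (j : ℕ) :
    ∀ ϑ : ℝ, ϑ = j * (Real.pi / 2) →
      (σ * (ρ * Real.sin ϑ), σ * (ρ * Real.cos ϑ)) ∈ (Quadrant.next^[j] κ).firstAxis := by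
  induction j with
  | zero =>
    rintro ϑ rfl
    rcases hκ with rfl | rfl <;> simp [Quadrant.firstAxis]
  | succ j ih =>
    intro ϑ hϑ
    push_cast at hϑ
    have := ih (ϑ - Real.pi / 2) (by rw [hϑ]; ring)
    rw [Real.sin_sub_pi_div_two, Real.cos_sub_pi_div_two] at this
    rw [Function.iterate_succ_apply']
    revert this
    generalize Quadrant.next^[j] κ = κ'
    cases κ' <;> simp [Quadrant.next, Quadrant.firstAxis]

/-- A continuous function on `[0, 1]` whose end values lie on different sides of `[p, q]` takes
its values in `[p, q]` along a reparametrized subinterval, with `q` and `p` at its ends. -/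
theorem exists_reparametrization {f : ℝ → ℝ} (hf : ContinuousOn f (Icc 0 1)) {p q : ℝ}
    (hpq : p < q) (h : (f 0 ≤ p ∧ q ≤ f 1) ∨ (q ≤ f 0 ∧ f 1 ≤ p)) :
    ∃ s : ℝ → ℝ, ContinuousOn s (Icc 0 1) ∧ MapsTo s (Icc 0 1) (Icc 0 1) ∧ f (s 0) = q ∧
      f (s 1) = p ∧ ∀ θ ∈ Icc (0 : ℝ) 1, f (s θ) ∈ Icc p q := by
  rcases h with ⟨h0, h1⟩ | ⟨h0, h1⟩
  · obtain ⟨a, b, ha, hab, hb, hfa, hfb, hm⟩ :=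
      exists_subinterval_increasing zero_le_one hf hpq h0 h1
    have hs : ∀ θ ∈ Icc (0 : ℝ) 1, b - θ * (b - a) ∈ Icc a b := fun θ hθ =>
      ⟨by nlinarith [hθ.1, hθ.2], by nlinarith [hθ.1, hθ.2]⟩
    exact ⟨fun θ => b - θ * (b - a), by fun_prop,
      fun θ hθ => Icc_subset_Icc ha hb (hs θ hθ), by simpa using hfb, by simpa using hfa,
      fun θ hθ => hm _ (hs θ hθ)⟩
  · obtain ⟨a, b, ha, hab, hb, hfa, hfb, hm⟩ :=
      exists_subinterval_decreasing zero_le_one hf hpq h0 h1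
    have hs : ∀ θ ∈ Icc (0 : ℝ) 1, a + θ * (b - a) ∈ Icc a b := fun θ hθ =>
      ⟨by nlinarith [hθ.1, hθ.2], by nlinarith [hθ.1, hθ.2]⟩
    exact ⟨fun θ => a + θ * (b - a), by fun_prop,
      fun θ hθ => Icc_subset_Icc ha hb (hs θ hθ), by simpa using hfa, by simpa using hfb,
      fun θ hθ => hm _ (hs θ hθ)⟩


/-! ### Stretching across an annulus -/

theorem zeroCount_const_mul {σ : ℝ} (hσ : σ ≠ 0) (u : ℝ → ℝ) (A : Set ℝ) :
    zeroCount (fun r => σ * u r) A = zeroCount u A := by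
  simp [zeroCount, hσ]

theorem Quadrant.iterate_next_add_four (κ : Quadrant) (j : ℕ) :
    Quadrant.next^[j + 4] κ = Quadrant.next^[j] κ := by
  rw [Function.iterate_add_apply]
  congr 1
  cases κ <;> rfl

/-- A continuous family of planar curves starting in the first quadrant has a continuous family of
angles starting in `[0, π / 2]`. -/
theorem exists_normalized_angle {T : ℝ} (hT : 0 ≤ T) {X Y : ℝ × ℝ → ℝ}
    (hX : ContinuousOn X (Icc 0 1 ×ˢ Icc 0 T)) (hY : ContinuousOn Y (Icc 0 1 ×ˢ Icc 0 T))
    (h0 : ∀ p ∈ Icc 0 1 ×ˢ Icc 0 T, X p ≠ 0 ∨ Y p ≠ 0)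
    (hst : ∀ θ ∈ Icc (0 : ℝ) 1, 0 ≤ X (θ, 0) ∧ 0 ≤ Y (θ, 0)) :
    ∃ ϑ : ℝ × ℝ → ℝ, ContinuousOn ϑ (Icc 0 1 ×ˢ Icc 0 T) ∧
      (∀ p ∈ Icc 0 1 ×ˢ Icc 0 T, ∃ ρ > 0, X p = ρ * Real.sin (ϑ p) ∧ Y p = ρ * Real.cos (ϑ p)) ∧
      ∀ θ ∈ Icc (0 : ℝ) 1, 0 ≤ ϑ (θ, 0) ∧ ϑ (θ, 0) ≤ Real.pi / 2 := by
  have hpi := Real.pi_pos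
  obtain ⟨ψ, hψ, hψ'⟩ := exists_continuousOn_angle zero_le_one hT hX hY h0
  obtain ⟨k, hk⟩ : ∃ k : ℤ, |ψ (0, 0) - k * (2 * Real.pi)| ≤ Real.pi := by
    refine ⟨round (ψ (0, 0) / (2 * Real.pi)), ?_⟩
    have := abs_sub_round (ψ (0, 0) / (2 * Real.pi))
    rw [show ψ (0, 0) - round (ψ (0, 0) / (2 * Real.pi)) * (2 * Real.pi) =
      (ψ (0, 0) / (2 * Real.pi) - round (ψ (0, 0) / (2 * Real.pi))) * (2 * Real.pi) by
        field_simp, abs_mul, abs_of_pos (by linarith : 0 < 2 * Real.pi)]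
    nlinarith
  let φ : ℝ × ℝ → ℝ := fun p => ψ p - k * (2 * Real.pi)
  have hφ : ContinuousOn φ (Icc 0 1 ×ˢ Icc 0 T) := hψ.sub continuousOn_const
  have hφ' : ∀ p ∈ Icc (0 : ℝ) 1 ×ˢ Icc (0 : ℝ) T, ∃ ρ > 0, X p = ρ * Real.sin (φ p) ∧
      Y p = ρ * Real.cos (φ p) := fun p hp => by
    obtain ⟨ρ, hρ, h1, h2⟩ := hψ' p hp
    exact ⟨ρ, hρ, by rw [Real.sin_sub_int_mul_two_pi]; exact h1,
      by rw [Real.cos_sub_int_mul_two_pi]; exact h2⟩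
  have IT : (0 : ℝ) ∈ Icc 0 T := ⟨le_rfl, hT⟩
  have hsc : ∀ θ ∈ Icc (0 : ℝ) 1, 0 ≤ Real.sin (φ (θ, 0)) ∧ 0 ≤ Real.cos (φ (θ, 0)) := by
    intro θ hθ
    obtain ⟨ρ, hρ, h1, h2⟩ := hφ' (θ, 0) ⟨hθ, IT⟩
    obtain ⟨h3, h4⟩ := hst θ hθ
    rw [h1] at h3
    rw [h2] at h4
    exact ⟨nonneg_of_mul_nonneg_right h3 hρ, nonneg_of_mul_nonneg_right h4 hρ⟩
  have hin : ∀ θ ∈ Icc (0 : ℝ) 1, -Real.pi ≤ φ (θ, 0) → φ (θ, 0) ≤ Real.pi →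
      0 ≤ φ (θ, 0) ∧ φ (θ, 0) ≤ Real.pi / 2 := by
    intro θ hθ h1 h2
    obtain ⟨h3, h4⟩ := abs_le_pi_div_two_of_cos_nonneg h1 h2 (hsc θ hθ).2
    refine ⟨?_, h4⟩
    by_contra! hneg
    linarith [(hsc θ hθ).1, Real.sin_neg_of_neg_of_neg_pi_lt hneg (by linarith)]
  have h00 := hin 0 ⟨le_rfl, zero_le_one⟩ (abs_le.1 hk).1 (abs_le.1 hk).2
  refine ⟨φ, hφ, hφ', fun θ hθ => ?_⟩
  have hc : ContinuousOn (fun s => φ (s, 0)) (Icc 0 θ) :=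
    hφ.comp (by fun_prop) fun s hs => ⟨⟨hs.1, hs.2.trans hθ.2⟩, IT⟩
  -- Along the initial points the cosine is nonnegative, so the angle avoids `±π` and stays in the
  -- branch chosen at `θ = 0`.
  have b1 : φ (θ, 0) < Real.pi := lt_of_avoids hθ.1 hc (fun s hs h => by
    have := (hsc s ⟨hs.1, hs.2.trans hθ.2⟩).2
    rw [h, Real.cos_pi] at this
    linarith) (by linarith)
  have b2 : -Real.pi < φ (θ, 0) := gt_of_avoids hθ.1 hc (fun s hs h => by
    have := (hsc s ⟨hs.1, hs.2.trans hθ.2⟩).2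
    rw [h, Real.cos_neg, Real.cos_pi] at this
    linarith) (by linarith)
  exact hin θ hθ b2.le b1.le

section Twist

variable {h H k K : ℝ → ℝ} {c₁ c₂ : ℝ} {xN xP : ℝ → ℝ} {T c : ℝ} {z : ℝ → ℝ × ℝ}

/-- On the `y`-axis `x'` has the sign of `y`. On the `x`-axis conservation of energy leaves only the
ends of the well, where `k` has the sign of `x`. The sign `σ = -1` turns the third quadrant into the
first. -/
theorem isClockwiseAngle_of_isFlowLine (hH : IsProperKinetic h H) (hW : IsWell k K c₁ c₂ xN xP)
    (hz : IsFlowLine (sepField h k) T z) (hc : H (z 0).2 + K (z 0).1 ∈ Icc c₁ c₂) {σ : ℝ}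
    (hσ : σ = 1 ∨ σ = -1) {ϑ : ℝ → ℝ} (hϑ : ContinuousOn ϑ (Icc 0 T))
    (hpolar : ∀ t ∈ Icc 0 T, ∃ ρ > 0, σ * (z t).1 = ρ * Real.sin (ϑ t) ∧
      σ * (z t).2 = ρ * Real.cos (ϑ t)) :
    IsClockwiseAngle (fun t => σ * (z t).1) (fun t => σ * (z t).2) ϑ T := by
  have hE : ∀ t ∈ Icc 0 T, (z t).2 = 0 → ((z t).1 < 0 → k (z t).1 < 0) ∧
      (0 < (z t).1 → 0 < k (z t).1) := fun t ht h0 => by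
    have hK := hz.energy_eq hH.hasDerivAt hW.hasDerivAt ht
    rw [h0, hH.map_zero, zero_add] at hK
    constructor
    · intro hx
      rw [hW.eq_xN hc hK hx.le]
      exact hW.deriv_xN _ hc
    · intro hx
      rw [hW.eq_xP hc hK hx.le]
      exact hW.deriv_xP _ hc
  refine isClockwiseAngle_of_hasDerivWithinAt (X' := fun t => σ * h (z t).2)
    (Y' := fun t => σ * -k (z t).1) hϑ hpolar (fun t ht => (hz.fst ht).const_mul σ)
    (fun t ht => (hz.snd ht).const_mul σ) ?_ ?_ ?_ ?_
  · intro t ht _ hy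
    rcases hσ with rfl | rfl
    · linarith [hH.pos (z t).2 (by linarith)]
    · linarith [hH.neg (z t).2 (by linarith)]
  · intro t ht hy hx
    rcases hσ with rfl | rfl
    · linarith [(hE t ht (by linarith)).2 (by linarith)]
    · linarith [(hE t ht (by linarith)).1 (by linarith)]
  · intro t ht _ hy
    rcases hσ with rfl | rfl
    · linarith [hH.neg (z t).2 (by linarith)]
    · linarith [hH.pos (z t).2 (by linarith)]
  · intro t ht hy hx
    rcases hσ with rfl | rfl
    · linarith [(hE t ht (by linarith)).1 (by linarith)]
    · linarith [(hE t ht (by linarith)).2 (by linarith)]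

/-- With the sector `0` placed at `κ`, the sector `j` is the quadrant `next^[j] κ`, so the quadrant
estimates become estimates per angular sector. -/
theorem sector_bounds (hH : IsProperKinetic h H) (hW : IsWell k K c₁ c₂ xN xP)
    (hz : IsFlowLine (sepField h k) T z) (hc : c ∈ Icc c₁ c₂) (hE : H (z 0).2 + K (z 0).1 = c)
    {σ : ℝ} {κ : Quadrant} (hκ : (κ = .I ∧ σ = 1) ∨ (κ = .III ∧ σ = -1)) {ϑ : ℝ → ℝ}
    (hpolar : ∀ t ∈ Icc 0 T, ∃ ρ > 0, σ * (z t).1 = ρ * Real.sin (ϑ t) ∧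
      σ * (z t).2 = ρ * Real.cos (ϑ t))
    (j : ℕ) {s t : ℝ} (hs : s ∈ Icc 0 T) (ht : t ∈ Icc 0 T) (hst : s ≤ t)
    (hr : ∀ r ∈ Icc s t, ϑ r ∈ Icc (j * (Real.pi / 2)) ((j + 1) * (Real.pi / 2))) :
    t - s ≤ crossingTime h H K xN xP (Quadrant.next^[j] κ) c ∧
      (ϑ s = j * (Real.pi / 2) → ϑ t = (j + 1) * (Real.pi / 2) →
        crossingTime h H K xN xP (Quadrant.next^[j] κ) c ≤ t - s) := by
  have hσσ : σ * σ = 1 := by rcases hκ with ⟨-, rfl⟩ | ⟨-, rfl⟩ <;> norm_num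
  have hzr : ∀ r ∈ Icc 0 T, ∃ ρ > 0, z r =
      (σ * (ρ * Real.sin (ϑ r)), σ * (ρ * Real.cos (ϑ r))) := fun r hr => by
    obtain ⟨ρ, hρ, h1, h2⟩ := hpolar r hr
    refine ⟨ρ, hρ, ?_⟩
    rw [← h1, ← h2, ← mul_assoc, ← mul_assoc, hσσ, one_mul, one_mul]
  obtain ⟨h1, h2⟩ := crossingTime_bounds (κ := Quadrant.next^[j] κ) hH hW hz hc hE hs.1 hst ht.2
    (fun r hrI => by
      obtain ⟨ρ, hρ, h⟩ := hzr r ⟨hs.1.trans hrI.1, hrI.2.trans ht.2⟩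
      rw [h]
      exact mem_region_iterate_next hρ.le hκ j _ (hr r hrI))
  have hκ' : κ = .I ∨ κ = .III := hκ.imp And.left And.left
  refine ⟨h1, fun h3 h4 => (h2 ?_ ?_).le⟩
  · obtain ⟨ρ, hρ, h⟩ := hzr s hs
    rw [h]
    exact mem_firstAxis_iterate_next hκ' j _ h3
  · obtain ⟨ρ, hρ, h⟩ := hzr t ht
    rw [h, ← Function.iterate_succ_apply' Quadrant.next]
    exact mem_firstAxis_iterate_next hκ' (j + 1) _ (by rw [h4]; push_cast; ring)

/-- The time of a full turn. -/
noncomputable def turningTime (h H K : ℝ → ℝ) (xN xP : ℝ → ℝ) (c : ℝ) : ℝ :=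
  crossingTime h H K xN xP .I c + crossingTime h H K xN xP .IV c +
    crossingTime h H K xN xP .III c + crossingTime h H K xN xP .II c

theorem turningTime_eq (κ : Quadrant) : turningTime h H K xN xP c =
    crossingTime h H K xN xP κ c + crossingTime h H K xN xP κ.next c +
      crossingTime h H K xN xP κ.next.next c + crossingTime h H K xN xP κ.next.next.next c := by
  cases κ <;> simp only [turningTime, Quadrant.next] <;> ring

/-- A path joining the boundary components of an annulus inside the quadrant `I` or `III` is
stretched by the flow, under the twist condition, across the annular sectors in the quadrants
`II` and `IV`. -/
theorem exists_stretching_across_annulus (hH : IsProperKinetic h H)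
    (hW : IsWell k K c₁ c₂ xN xP) (hT : 0 ≤ T)
    (huniq : ∀ z w, IsFlowLine (sepField h k) T z → IsFlowLine (sepField h k) T w → z 0 = w 0 →
      H (z 0).2 + K (z 0).1 ∈ Icc c₁ c₂ → EqOn z w (Icc 0 T))
    {κ : Quadrant} (hκ : κ = .I ∨ κ = .III) {γ : ℝ → ℝ × ℝ} (hγ : ContinuousOn γ (Icc 0 1))
    (hγκ : ∀ θ ∈ Icc (0 : ℝ) 1, γ θ ∈ κ.region ∧ H (γ θ).2 + K (γ θ).1 ∈ Icc c₁ c₂)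
    (h0 : H (γ 0).2 + K (γ 0).1 = c₁) (h1 : H (γ 1).2 + K (γ 1).1 = c₂)
    {d e : ℝ} (hde : (d = c₁ ∧ e = c₂) ∨ (d = c₂ ∧ e = c₁)) {α β n : ℕ}
    (hd : T < crossingTime h H K xN xP κ.next d + crossingTime h H K xN xP κ.next.next d +
      α * turningTime h H K xN xP d)
    (he : crossingTime h H K xN xP κ e + crossingTime h H K xN xP κ.next e +
      β * turningTime h H K xN xP e < T)
    (hn : 2 * α + 1 ≤ n) (hn' : n ≤ 2 * β) :
    ∃ ζ : ℝ → ℝ × ℝ, ContinuousOn ζ (Icc 0 1) ∧ (ζ 0).1 = 0 ∧ (ζ 1).2 = 0 ∧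
      ∀ θ ∈ Icc (0 : ℝ) 1, ζ θ ∈ (Quadrant.next^[2 * n + 1] κ).region ∧
        ∃ s ∈ Icc (0 : ℝ) 1, ∃ z, IsFlowLine (sepField h k) T z ∧ z 0 = γ s ∧ z T = ζ θ ∧
          zeroCount (fun t => (z t).1) (Ioo 0 T) = n ∧
          zeroCount (fun t => (z t).2) (Icc 0 T) = n + 1 := by
  have hpi := Real.pi_pos
  obtain ⟨σ, hσκ⟩ : ∃ σ : ℝ, (κ = .I ∧ σ = 1) ∨ (κ = .III ∧ σ = -1) := by
    rcases hκ with h | h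
    · exact ⟨1, Or.inl ⟨h, rfl⟩⟩
    · exact ⟨-1, Or.inr ⟨h, rfl⟩⟩
  have hσ : σ = 1 ∨ σ = -1 := hσκ.imp And.right And.right
  have hσ0 : σ ≠ 0 := by rcases hσ with rfl | rfl <;> norm_num
  obtain ⟨M, hM⟩ := hH.bounded
  obtain ⟨Z, hZc, hZ⟩ := exists_continuousOn_flow hT hH.continuous hW.continuous hM
    (isCompact_Icc (a := (0 : ℝ)) (b := 1)) hγ (fun θ hθ z w hz hw h0 h0' =>
      huniq z w hz hw (h0.trans h0'.symm) (by rw [h0]; exact (hγκ θ hθ).2))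
  have hEZ : ∀ θ ∈ Icc (0 : ℝ) 1, H (Z θ 0).2 + K (Z θ 0).1 ∈ Icc c₁ c₂ := fun θ hθ => by
    rw [(hZ θ hθ).2]; exact (hγκ θ hθ).2
  have hX : ContinuousOn (fun p : ℝ × ℝ => σ * (Z p.1 p.2).1) (Icc 0 1 ×ˢ Icc 0 T) :=
    continuousOn_const.mul (continuous_fst.comp_continuousOn hZc)
  have hY : ContinuousOn (fun p : ℝ × ℝ => σ * (Z p.1 p.2).2) (Icc 0 1 ×ˢ Icc 0 T) :=
    continuousOn_const.mul (continuous_snd.comp_continuousOn hZc)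
  obtain ⟨ϑ, hϑc, hϑ, hϑ0⟩ := exists_normalized_angle hT hX hY (by
    rintro ⟨θ, t⟩ ⟨hθ, ht⟩
    by_contra! hzero
    simp only [mul_eq_zero, hσ0, false_or] at hzero
    have := (hZ θ hθ).1.energy_eq hH.hasDerivAt hW.hasDerivAt ht
    rw [hzero.1, hzero.2, hH.map_zero, hW.map_zero] at this
    linarith [(hEZ θ hθ).1, hW.pos]) (by
    intro θ hθ
    have := (hγκ θ hθ).1
    simp only [(hZ θ hθ).2]
    rcases hσκ with ⟨rfl, rfl⟩ | ⟨rfl, rfl⟩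
    · exact ⟨by linarith [this.1], by linarith [this.2]⟩
    · exact ⟨by linarith [this.1], by linarith [this.2]⟩)
  have hpolar : ∀ θ ∈ Icc (0 : ℝ) 1, ∀ t ∈ Icc 0 T, ∃ ρ > 0,
      σ * (Z θ t).1 = ρ * Real.sin (ϑ (θ, t)) ∧ σ * (Z θ t).2 = ρ * Real.cos (ϑ (θ, t)) :=
    fun θ hθ t ht => hϑ (θ, t) ⟨hθ, ht⟩
  have hang : ∀ θ ∈ Icc (0 : ℝ) 1, IsClockwiseAngle (fun t => σ * (Z θ t).1)
      (fun t => σ * (Z θ t).2) (fun t => ϑ (θ, t)) T := fun θ hθ =>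
    isClockwiseAngle_of_isFlowLine hH hW (hZ θ hθ).1 (hEZ θ hθ) hσ
      (hϑc.comp (by fun_prop) fun t ht => ⟨hθ, ht⟩) (hpolar θ hθ)
  have IT : T ∈ Icc 0 T := ⟨hT, le_rfl⟩
  let f : ℝ → ℝ := fun θ => ϑ (θ, T)
  have hf : ContinuousOn f (Icc 0 1) := hϑc.comp (by fun_prop) fun θ hθ => ⟨hθ, IT⟩
  have hper : ∀ c j, crossingTime h H K xN xP (Quadrant.next^[j + 4] κ) c =
      crossingTime h H K xN xP (Quadrant.next^[j] κ) c := fun c j => by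
    rw [Quadrant.iterate_next_add_four]
  have hc₁ : c₁ ∈ Icc c₁ c₂ := ⟨le_rfl, hW.lt.le⟩
  have hc₂ : c₂ ∈ Icc c₁ c₂ := ⟨hW.lt.le, le_rfl⟩
  -- An angle beyond `(2n+1)π/2 ≥ (4α+3)π/2` would require crossing the sectors `1, ..., 4α+2`
  -- completely: `α` turns and the quadrants `κ + 1`, `κ + 2`, which on the level `d` takes longer
  -- than `T`.
  have hlow : ∀ θ ∈ Icc (0 : ℝ) 1, H (γ θ).2 + K (γ θ).1 = d →
      f θ ≤ (2 * n + 1) * (Real.pi / 2) := by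
    intro θ hθ hE
    have hdI : d ∈ Icc c₁ c₂ := by rcases hde with ⟨rfl, -⟩ | ⟨rfl, -⟩ <;> assumption
    by_contra! hlt
    have key := (hang θ hθ).sum_le_of_angle_ge (hϑ0 θ hθ).2
      (q := fun j => crossingTime h H K xN xP (Quadrant.next^[j] κ) d)
      (fun j s hs t ht hst hr h3 h4 => (sector_bounds hH hW (hZ θ hθ).1 hdI
        (by rw [(hZ θ hθ).2]; exact hE) hσκ (hpolar θ hθ) j hs ht hst hr).2 h3 h4)
      (4 * α + 2) T IT (by
        have : (2 * α + 1 : ℝ) ≤ n := by exact_mod_cast hn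
        refine le_trans ?_ hlt.le
        push_cast
        nlinarith)
    rw [Finset.sum_range_succ, Finset.sum_range_succ,
      sum_range_four_mul (q := fun j => crossingTime h H K xN xP (Quadrant.next^[j] κ) d)
        (hper d)] at key
    have hper' : ∀ a j, crossingTime h H K xN xP (Quadrant.next^[4 * a + j] κ) d =
        crossingTime h H K xN xP (Quadrant.next^[j] κ) d := fun a j => by
      induction a with
      | zero => simp
      | succ a ih => rw [show 4 * (a + 1) + j = 4 * a + j + 4 by ring, hper, ih]
    rw [add_assoc (4 * α) 1 1, hper', hper'] at key
    simp only [Function.iterate_succ_apply', Function.iterate_zero_apply] at key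
    rw [turningTime_eq κ.next] at hd
    linarith
  -- An angle below `(2n+2)π/2 ≤ (4β+2)π/2` would stay within the sectors `0, ..., 4β+1`: `β` turns
  -- and the quadrants `κ`, `κ + 1`, which on the level `e` are left before `T`.
  have hhigh : ∀ θ ∈ Icc (0 : ℝ) 1, H (γ θ).2 + K (γ θ).1 = e →
      (2 * n + 2) * (Real.pi / 2) ≤ f θ := by
    intro θ hθ hE
    have heI : e ∈ Icc c₁ c₂ := by rcases hde with ⟨-, rfl⟩ | ⟨-, rfl⟩ <;> assumption
    by_contra! hlt
    have key := (hang θ hθ).le_sum_of_angle_le (hϑ0 θ hθ).1 (hϑ0 θ hθ).2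
      (q := fun j => crossingTime h H K xN xP (Quadrant.next^[j] κ) e)
      (fun j => crossingTime_nonneg hH hW heI _)
      (fun j s hs t ht hst hr => (sector_bounds hH hW (hZ θ hθ).1 heI
        (by rw [(hZ θ hθ).2]; exact hE) hσκ (hpolar θ hθ) j hs ht hst hr).1)
      (4 * β + 2) T IT (by
        have : (n : ℝ) ≤ 2 * β := by exact_mod_cast hn'
        refine hlt.le.trans ?_
        push_cast
        nlinarith)
    have hsum := sum_range_four_mul
      (q := fun j => crossingTime h H K xN xP (Quadrant.next^[j] κ) e) (hper e) 0 β
    simp only [add_zero] at hsum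
    rw [Finset.sum_range_succ, Finset.sum_range_succ, hsum] at key
    have hper' : ∀ a j, crossingTime h H K xN xP (Quadrant.next^[4 * a + j] κ) e =
        crossingTime h H K xN xP (Quadrant.next^[j] κ) e := fun a j => by
      induction a with
      | zero => simp
      | succ a ih => rw [show 4 * (a + 1) + j = 4 * a + j + 4 by ring, hper, ih]
    have h40 := hper' β 0
    rw [add_zero] at h40
    rw [hper', h40] at key
    simp only [Function.iterate_succ_apply', Function.iterate_zero_apply] at key
    rw [turningTime_eq κ] at he
    linarith
  have I0 : (0 : ℝ) ∈ Icc (0 : ℝ) 1 := ⟨le_rfl, zero_le_one⟩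
  have I1 : (1 : ℝ) ∈ Icc (0 : ℝ) 1 := ⟨zero_le_one, le_rfl⟩
  -- The piece of the path whose final angle lies in the sector `2n + 1`. It is oriented so that it
  -- starts at the angle `(n + 1)π`, on the `y`-axis, and ends on the `x`-axis.
  obtain ⟨s, hsc, hsm, hs0, hs1, hsI⟩ := exists_reparametrization hf
    (p := (2 * n + 1) * (Real.pi / 2)) (q := (2 * n + 2) * (Real.pi / 2)) (by nlinarith) (by
      rcases hde with ⟨rfl, rfl⟩ | ⟨rfl, rfl⟩
      · exact Or.inl ⟨hlow 0 I0 h0, hhigh 1 I1 h1⟩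
      · exact Or.inr ⟨hhigh 0 I0 h0, hlow 1 I1 h1⟩)
  have hσσ : σ * σ = 1 := by rcases hσ with rfl | rfl <;> norm_num
  refine ⟨fun θ => Z (s θ) T, ?_, ?_, ?_, fun θ hθ => ⟨?_, s θ, hsm hθ, Z (s θ),
    (hZ _ (hsm hθ)).1, (hZ _ (hsm hθ)).2, rfl, ?_⟩⟩
  · exact hZc.comp (hsc.prodMk continuousOn_const) fun θ hθ => ⟨hsm hθ, IT⟩
  · have := ((hang _ (hsm I0)).fst_eq_zero_iff IT).2 ⟨n + 1, by
      change f (s 0) = _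
      rw [hs0]; push_cast; ring⟩
    exact (mul_eq_zero.1 this).resolve_left hσ0
  · have := ((hang _ (hsm I1)).snd_eq_zero_iff IT).2 ⟨n, by
      change f (s 1) = _
      rw [hs1]; push_cast; ring⟩
    exact (mul_eq_zero.1 this).resolve_left hσ0
  · obtain ⟨ρ, hρ, e1, e2⟩ := hpolar _ (hsm hθ) T IT
    have hmem := mem_region_iterate_next hρ.le hσκ (2 * n + 1) (ϑ (s θ, T)) (by
      have := hsI θ hθ
      push_cast
      exact ⟨this.1, this.2.trans_eq (by ring)⟩)
    rw [← e1, ← e2, ← mul_assoc, ← mul_assoc, hσσ, one_mul, one_mul] at hmem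
    exact hmem
  · have := (hang _ (hsm hθ)).zeroCount_eq hT (n := n) (hϑ0 _ (hsm hθ)).1 (hϑ0 _ (hsm hθ)).2
      (hsI θ hθ).1 (hsI θ hθ).2
    rwa [zeroCount_const_mul hσ0, zeroCount_const_mul hσ0] at this

end Twist


/-! ### Saddles: uniqueness and linking paths -/

section Saddle

variable {h H m N : ℝ → ℝ} {T : ℝ} {z w : ℝ → ℝ × ℝ}

/-- The saddle system `x' = h(y)`, `y' = m(x)` is symmetric under exchange of the coordinates;
passages across one axis become passages across the other. -/
theorem IsFlowLine.swap (hz : IsFlowLine (sepField h fun x => -m x) T z) :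
    IsFlowLine (sepField m fun x => -h x) T (fun t => (z t).swap) := by
  refine isFlowLine_sepField_iff.2 fun t ht => ⟨?_, ?_⟩
  · simpa using hz.snd ht
  · simpa using hz.fst ht

theorem IsFlowLine.reflect_saddle (hz : IsFlowLine (sepField h fun x => -m x) T z) :
    IsFlowLine (sepField (fun y => -h (-y)) fun x => -(fun x => -m (-x)) x) T (fun t => -z t) :=
  hz.reflect

theorem IsKinetic.hasDerivAt_neg_primitive (hM : IsKinetic m N) (x : ℝ) :
    HasDerivAt (fun x => -N x) (-m x) x := (hM.hasDerivAt x).neg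

theorem IsFlowLine.saddle_energy_eq (hH : IsKinetic h H) (hM : IsKinetic m N)
    (hz : IsFlowLine (sepField h fun x => -m x) T z) {t : ℝ} (ht : t ∈ Icc 0 T) :
    H (z t).2 - N (z t).1 = H (z 0).2 - N (z 0).1 :=
  hz.energy_eq hH.hasDerivAt hM.hasDerivAt_neg_primitive ht

/-- Uniqueness without a Lipschitz condition: while `y > 0`, time is the integral of a function of
`x` fixed by the energy, so two solutions have equal `x` at equal times, and the energy then
determines `y`. -/
theorem eventually_eq_of_snd_pos (hH : IsKinetic h H) (hM : IsKinetic m N)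
    (hz : IsFlowLine (sepField h fun x => -m x) T z)
    (hw : IsFlowLine (sepField h fun x => -m x) T w) (h0 : z 0 = w 0) (hT : 0 < T)
    (hy : 0 < (z 0).2) : ∃ ε > 0, ε ≤ T ∧ ∀ t ∈ Icc 0 ε, z t = w t := by
  have I0 : (0 : ℝ) ∈ Icc 0 T := ⟨le_rfl, hT.le⟩
  have hpos : ∀ {u : ℝ → ℝ × ℝ}, IsFlowLine (sepField h fun x => -m x) T u → 0 < (u 0).2 →
      ∃ ε > 0, ∀ t ∈ Icc 0 T, t < ε → 0 < (u t).2 := by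
    intro u hu hu0
    have := (continuous_snd.comp_continuousOn hu.continuousOn 0 I0).eventually_const_lt hu0
    obtain ⟨ε, hε, H'⟩ := Metric.mem_nhdsWithin_iff.1 this
    refine ⟨ε, hε, fun t ht hlt => H' ⟨?_, ht⟩⟩
    rw [Metric.mem_ball, Real.dist_eq, sub_zero, abs_of_nonneg ht.1]
    exact hlt
  obtain ⟨ε₁, hε₁, H₁⟩ := hpos hz hy
  obtain ⟨ε₂, hε₂, H₂⟩ := hpos hw (h0 ▸ hy)
  -- If `v` were ahead of `u` at time `t`, it would have passed the abscissa of `u t` at some time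
  -- `s`. One and the same integral gives both `s` and `t`, so `s = t`, a contradiction.
  have key : ∀ {u v : ℝ → ℝ × ℝ}, IsFlowLine (sepField h fun x => -m x) T u →
      IsFlowLine (sepField h fun x => -m x) T v → u 0 = v 0 → ∀ t ∈ Icc 0 T,
      (∀ s ∈ Icc 0 t, 0 < (u s).2) → (∀ s ∈ Icc 0 t, 0 < (v s).2) → ¬ (u t).1 < (v t).1 := by
    intro u v hu hv huv t ht hup hvp hlt
    obtain ⟨h1, h2⟩ := hu.time_eq hH hM.hasDerivAt_neg_primitive le_rfl ht.1 ht.2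
      fun r hr => hup r (Ioo_subset_Icc_self hr)
    obtain ⟨s, hs, hsv⟩ := intermediate_value_Icc ht.1 (f := fun t => (v t).1)
      ((continuous_fst.comp_continuousOn hv.continuousOn).mono (Icc_subset_Icc_right ht.2))
      (show (u t).1 ∈ Icc (v 0).1 (v t).1 from ⟨huv ▸ h1, hlt.le⟩)
    obtain ⟨-, h3⟩ := hv.time_eq hH hM.hasDerivAt_neg_primitive le_rfl hs.1 (hs.2.trans ht.2)
      fun r hr => hvp r ⟨hr.1.le, hr.2.le.trans hs.2⟩
    simp only at hsv
    rw [hsv, ← huv, h2] at h3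
    have : s = t := by linarith
    rw [this] at hsv
    exact hlt.ne' hsv
  refine ⟨min (min ε₁ ε₂ / 2) T, lt_min (half_pos (lt_min hε₁ hε₂)) hT, min_le_right _ _,
    fun t ht => ?_⟩
  have htT : t ∈ Icc 0 T := ⟨ht.1, ht.2.trans (min_le_right _ _)⟩
  have htε : t < min ε₁ ε₂ := (ht.2.trans (min_le_left _ _)).trans_lt
    (half_lt_self (lt_min hε₁ hε₂))
  have hzp : ∀ s ∈ Icc 0 t, 0 < (z s).2 := fun s hs =>
    H₁ s ⟨hs.1, hs.2.trans htT.2⟩ ((hs.2.trans_lt htε).trans_le (min_le_left _ _))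
  have hwp : ∀ s ∈ Icc 0 t, 0 < (w s).2 := fun s hs =>
    H₂ s ⟨hs.1, hs.2.trans htT.2⟩ ((hs.2.trans_lt htε).trans_le (min_le_right _ _))
  have hx : (z t).1 = (w t).1 :=
    le_antisymm (not_lt.1 (key hw hz h0.symm t htT hwp hzp)) (not_lt.1 (key hz hw h0 t htT hzp hwp))
  refine Prod.ext hx (hH.strictMonoOn.injOn (hzp t ⟨ht.1, le_rfl⟩).le (hwp t ⟨ht.1, le_rfl⟩).le ?_)
  have e1 := hz.saddle_energy_eq hH hM htT
  have e2 := hw.saddle_energy_eq hH hM htT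
  rw [hx, h0] at e1
  linarith

theorem eventually_eq_of_snd_ne (hH : IsKinetic h H) (hM : IsKinetic m N)
    (hz : IsFlowLine (sepField h fun x => -m x) T z)
    (hw : IsFlowLine (sepField h fun x => -m x) T w) (h0 : z 0 = w 0) (hT : 0 < T)
    (hy : (z 0).2 ≠ 0) : ∃ ε > 0, ε ≤ T ∧ ∀ t ∈ Icc 0 ε, z t = w t := by
  rcases hy.lt_or_gt with hneg | hpos
  · obtain ⟨ε, hε, hεT, h⟩ := eventually_eq_of_snd_pos hH.reflect hM.reflect hz.reflect_saddle
      hw.reflect_saddle (by rw [h0]) hT (by simpa using hneg)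
    exact ⟨ε, hε, hεT, fun t ht => neg_injective (h t ht)⟩
  · exact eventually_eq_of_snd_pos hH hM hz hw h0 hT hpos

/-- Uniqueness for `x' = h(y)`, `y' = m(x)`, given local uniqueness at the origin. -/
theorem eqOn_of_isFlowLine_saddle (hH : IsKinetic h H) (hM : IsKinetic m N)
    (hO : ∀ T > 0, ∀ z w, IsFlowLine (sepField h fun x => -m x) T z →
      IsFlowLine (sepField h fun x => -m x) T w → z 0 = 0 → w 0 = 0 →
      ∃ ε > 0, ε ≤ T ∧ ∀ t ∈ Icc 0 ε, z t = w t)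
    (hz : IsFlowLine (sepField h fun x => -m x) T z)
    (hw : IsFlowLine (sepField h fun x => -m x) T w) (h0 : z 0 = w 0) : EqOn z w (Icc 0 T) := by
  -- Off the origin some coordinate is nonzero, and the swap covers `x ≠ 0`. Only the equilibrium
  -- needs the hypothesis `hO`.
  have hloc : ∀ T > 0, ∀ z w, IsFlowLine (sepField h fun x => -m x) T z →
      IsFlowLine (sepField h fun x => -m x) T w → z 0 = w 0 →
      ∃ ε > 0, ε ≤ T ∧ ∀ t ∈ Icc 0 ε, z t = w t := by
    intro T hT z w hz hw h0
    by_cases hy : (z 0).2 = 0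
    · by_cases hx : (z 0).1 = 0
      · have : z 0 = 0 := Prod.ext hx hy
        exact hO T hT z w hz hw this (h0 ▸ this)
      · obtain ⟨ε, hε, hεT, h⟩ := eventually_eq_of_snd_ne hM hH hz.swap hw.swap (by rw [h0]) hT hx
        exact ⟨ε, hε, hεT, fun t ht => Prod.swap_injective (h t ht)⟩
    · exact eventually_eq_of_snd_ne hH hM hz hw h0 hT hy
  have hclosed : IsClosed ({t | z t = w t} ∩ Icc 0 T) := by
    have : {t | z t = w t} ∩ Icc 0 T = Icc 0 T ∩ (fun t => z t - w t) ⁻¹' {0} := by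
      ext t; simp [sub_eq_zero, and_comm]
    rw [this]
    exact (hz.continuousOn.sub hw.continuousOn).preimage_isClosed_of_isClosed isClosed_Icc
      isClosed_singleton
  refine hclosed.Icc_subset_of_forall_exists_gt h0 fun t ht y hy => ?_
  obtain ⟨ε, hε, hεT, h⟩ := hloc (T - t) (sub_pos.2 ht.2.2) _ _ (hz.shift ht.2.1)
    (hw.shift ht.2.1) (by simpa using ht.1)
  refine ⟨t + min ε (y - t), ?_, ?_, ?_⟩
  · have := h (min ε (y - t)) ⟨le_min hε.le (sub_nonneg.2 (le_of_lt hy)), min_le_left _ _⟩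
    simpa [add_comm] using this
  · have : 0 < min ε (y - t) := lt_min hε (sub_pos.2 hy)
    linarith
  · linarith [min_le_right ε (y - t)]

/-- Solutions do not reach the origin, given local uniqueness in the past there. -/
theorem ne_zero_of_isFlowLine (hO : ∀ T > 0, ∀ z, IsFlowLine (sepField h fun x => -m x) T z →
      z T = 0 → ∃ t ∈ Ico 0 T, z t = 0)
    (hz : IsFlowLine (sepField h fun x => -m x) T z) (h0 : z 0 ≠ 0) : ∀ t ∈ Icc 0 T, z t ≠ 0 := by
  intro t ht htz
  have hK : IsCompact (Icc 0 T ∩ z ⁻¹' {0}) :=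
    isCompact_Icc.of_isClosed_subset
      (hz.continuousOn.preimage_isClosed_of_isClosed isClosed_Icc isClosed_singleton)
      inter_subset_left
  obtain ⟨s, ⟨hsI, hs0⟩, hmin⟩ := hK.exists_isLeast ⟨t, ht, htz⟩
  have hs : 0 < s := lt_of_le_of_ne hsI.1 (by rintro rfl; exact h0 hs0)
  obtain ⟨r, hr, hr0⟩ := hO s hs z (hz.mono hsI.2) hs0
  exact absurd (hmin ⟨⟨hr.1, hr.2.le.trans hsI.2⟩, hr0⟩) (not_le.2 hr.2)

/-- Positive energy forces `H(y) > 0` for all times, so `y` cannot change sign. -/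
theorem IsFlowLine.snd_pos (hH : IsKinetic h H) (hM : IsKinetic m N)
    (hz : IsFlowLine (sepField h fun x => -m x) T z) (hy : 0 ≤ (z 0).2)
    (he : 0 < H (z 0).2 - N (z 0).1) : ∀ t ∈ Icc 0 T, 0 < (z t).2 := by
  intro t ht
  have hne : ∀ s ∈ Icc 0 t, (z s).2 ≠ 0 := fun s hs h0 => by
    have := hz.saddle_energy_eq hH hM ⟨hs.1, hs.2.trans ht.2⟩
    rw [h0, hH.map_zero] at this
    linarith [hM.primitive_nonneg (z s).1]
  exact gt_of_avoids ht.1 ((continuous_snd.comp_continuousOn hz.continuousOn).mono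
    (Icc_subset_Icc_right ht.2)) hne (lt_of_le_of_ne hy (hne 0 ⟨le_rfl, ht.1⟩).symm)

/-- A solution of positive energy passing from the second to the first quadrant. -/
theorem IsFlowLine.zeroCount_saddle (hH : IsKinetic h H) (hM : IsKinetic m N) (hT : 0 ≤ T)
    (hz : IsFlowLine (sepField h fun x => -m x) T z) (hy : 0 ≤ (z 0).2)
    (he : 0 < H (z 0).2 - N (z 0).1) (h0 : (z 0).1 < 0) (h1 : 0 < (z T).1) :
    zeroCount (fun t => (z t).1) (Icc 0 T) = 1 ∧ zeroCount (fun t => (z t).1) (Ioo 0 T) = 1 ∧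
      zeroCount (fun t => (z t).2) (Icc 0 T) = 0 ∧ zeroCount (fun t => (z t).2) (Ioo 0 T) = 0 := by
  have hpos := hz.snd_pos hH hM hy he
  have hxc : ContinuousOn (fun t => (z t).1) (Icc 0 T) :=
    continuous_fst.comp_continuousOn hz.continuousOn
  have hmono : StrictMonoOn (fun t => (z t).1) (Icc 0 T) := by
    refine strictMonoOn_of_deriv_pos (convex_Icc 0 T) hxc fun t ht => ?_
    rw [interior_Icc] at ht
    have hd : HasDerivAt (fun t => (z t).1) (h (z t).2) t :=
      (hz.fst (Ioo_subset_Icc_self ht)).hasDerivAt (Icc_mem_nhds ht.1 ht.2)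
    rw [hd.deriv]
    exact hH.pos _ (hpos t (Ioo_subset_Icc_self ht))
  obtain ⟨t, ht, ht0⟩ := intermediate_value_Icc hT hxc (show (0 : ℝ) ∈ Icc _ _ from ⟨h0.le, h1.le⟩)
  simp only at ht0
  have htI : t ∈ Ioo 0 T := ⟨lt_of_le_of_ne ht.1 (by rintro rfl; linarith),
    lt_of_le_of_ne ht.2 (by rintro rfl; linarith)⟩
  have e1 : {r ∈ Icc 0 T | (z r).1 = 0} = {t} := by
    ext r
    constructor
    · rintro ⟨hr, hr0⟩
      exact hmono.injOn hr ht (hr0.trans ht0.symm)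
    · rintro rfl
      exact ⟨ht, ht0⟩
  have e2 : {r ∈ Ioo 0 T | (z r).1 = 0} = {t} := by
    ext r
    constructor
    · rintro ⟨hr, hr0⟩
      exact hmono.injOn (Ioo_subset_Icc_self hr) ht (hr0.trans ht0.symm)
    · rintro rfl
      exact ⟨htI, ht0⟩
  have e3 : {r ∈ Icc 0 T | (z r).2 = 0} = ∅ := by
    ext r
    simp only [mem_ofPred_eq, mem_empty_iff_false, iff_false, not_and]
    exact fun hr => (hpos r hr).ne'
  have e4 : {r ∈ Ioo 0 T | (z r).2 = 0} = ∅ := by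
    ext r
    simp only [mem_ofPred_eq, mem_empty_iff_false, iff_false, not_and]
    exact fun hr => (hpos r (Ioo_subset_Icc_self hr)).ne'
  simp only [zeroCount, e1, e2, e3, e4, encard_singleton, encard_empty, and_self]

/-- The part of a path in the second quadrant which a saddle flow carries across the strip
`b₁ ≤ B ≤ b₂` in the first quadrant. -/
theorem exists_linking_reparametrization (hH : IsKinetic h H) (hM : IsKinetic m N) (hT : 0 ≤ T)
    {W : ℝ → ℝ → ℝ × ℝ} (hW : ∀ θ ∈ Icc (0 : ℝ) 1, IsFlowLine (sepField h fun x => -m x) T (W θ))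
    (hW0 : ContinuousOn (fun θ => W θ 0) (Icc 0 1)) (hWT : ContinuousOn (fun θ => W θ T) (Icc 0 1))
    (hstart : ∀ θ ∈ Icc (0 : ℝ) 1, (W θ 0).1 ≤ 0 ∧ 0 ≤ (W θ 0).2)
    (hne : ∀ θ ∈ Icc (0 : ℝ) 1, ∀ t ∈ Icc 0 T, W θ t ≠ 0) {E : ℝ} (hE : 0 < E)
    (haxis : ∀ θ ∈ Icc (0 : ℝ) 1, (W θ 0).1 = 0 → E ≤ H (W θ 0).2 - N (W θ 0).1)
    (hends : (E ≤ H (W 0 0).2 - N (W 0 0).1 ∧ H (W 1 0).2 - N (W 1 0).1 ≤ 0) ∨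
      (H (W 0 0).2 - N (W 0 0).1 ≤ 0 ∧ E ≤ H (W 1 0).2 - N (W 1 0).1))
    {B : ℝ × ℝ → ℝ} (hB : Continuous B) {b₁ b₂ : ℝ} (hb : b₁ < b₂)
    (hout : ∀ θ ∈ Icc (0 : ℝ) 1, H (W θ 0).2 - N (W θ 0).1 = E →
      0 < (W θ T).1 ∧ b₂ ≤ B (W θ T) ∧ ((W θ 0).1 = 0 → b₂ < B (W θ T)))
    (hin : ∀ y > 0, H y < E → B (0, y) < b₁) :
    ∃ s : ℝ → ℝ, ContinuousOn s (Icc 0 1) ∧ MapsTo s (Icc 0 1) (Icc 0 1) ∧ B (W (s 0) T) = b₁ ∧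
      B (W (s 1) T) = b₂ ∧ ∀ θ ∈ Icc (0 : ℝ) 1, B (W (s θ) T) ∈ Icc b₁ b₂ ∧
        0 < (W (s θ) T).1 ∧ (W (s θ) 0).1 < 0 ∧ 0 < H (W (s θ) 0).2 - N (W (s θ) 0).1 := by
  have hNc := hM.continuous_primitive
  have hHc := hH.continuous_primitive
  have I0 : (0 : ℝ) ∈ Icc (0 : ℝ) 1 := ⟨le_rfl, zero_le_one⟩
  have I1 : (1 : ℝ) ∈ Icc (0 : ℝ) 1 := ⟨zero_le_one, le_rfl⟩
  have IT : T ∈ Icc 0 T := ⟨hT, le_rfl⟩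
  have hec : ContinuousOn (fun θ => H (W θ 0).2 - N (W θ 0).1) (Icc 0 1) :=
    (hHc.comp_continuousOn (continuous_snd.comp_continuousOn hW0)).sub
      (hNc.comp_continuousOn (continuous_fst.comp_continuousOn hW0))
  -- The piece of the path whose energies lie in `[0, E]`, run from the level `E` to the level `0`.
  obtain ⟨s, hsc, hsm, hs0, hs1, hsI⟩ := exists_reparametrization hec hE hends.symm
  -- The level `0` meets the `y`-axis only at the origin, which is avoided by `hne`; such
  -- trajectories stay in `x < 0`.
  have hzero : ∀ θ ∈ Icc (0 : ℝ) 1, H (W θ 0).2 - N (W θ 0).1 = 0 → (W θ T).1 < 0 := by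
    intro θ hθ h0
    have hx0 : (W θ 0).1 < 0 := lt_of_le_of_ne (hstart θ hθ).1 fun hx => by
      linarith [haxis θ hθ hx]
    refine lt_of_avoids hT (continuous_fst.comp_continuousOn (hW θ hθ).continuousOn)
      (fun t ht hxt => hne θ hθ t ht (Prod.ext hxt ?_)) hx0
    have := (hW θ hθ).saddle_energy_eq hH hM ht
    simp only [Function.comp] at hxt
    rw [hxt, hM.map_zero, h0, sub_zero, hH.primitive_eq_zero_iff] at this
    exact this
  have hsT : ContinuousOn (fun θ => W (s θ) T) (Icc 0 1) := hWT.comp hsc hsm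
  -- The first parameter at which the end point has fallen back to the `y`-axis. Its energy is
  -- strictly between `0` and `E`, so `hin` places it inside the inner boundary `B = b₁`.
  obtain ⟨c, hcI, hc0, hcpos⟩ := exists_first_zero (f := fun θ => (W (s θ) T).1) zero_le_one
    (continuous_fst.comp_continuousOn hsT) (hout _ (hsm I0) hs0).1 (hzero _ (hsm I1) hs1).le
  have hcI' : c ∈ Icc (0 : ℝ) 1 := ⟨hcI.1.le, hcI.2⟩
  have hBc : B (W (s c) T) < b₁ := by
    have he0 : 0 < H (W (s c) 0).2 - N (W (s c) 0).1 := lt_of_le_of_ne (hsI c hcI').1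
      fun h0 => by linarith [hzero _ (hsm hcI') h0.symm]
    have heE : H (W (s c) 0).2 - N (W (s c) 0).1 < E := lt_of_le_of_ne (hsI c hcI').2
      fun h0 => by linarith [(hout _ (hsm hcI') h0).1]
    have hy := (hW _ (hsm hcI')).snd_pos hH hM (hstart _ (hsm hcI')).2 he0 T IT
    have hen := (hW _ (hsm hcI')).saddle_energy_eq hH hM IT
    rw [hc0, hM.map_zero, sub_zero] at hen
    have := hin _ hy (hen ▸ heE)
    rwa [← hc0] at this
  have hBcont : ContinuousOn (fun θ => B (W (s θ) T)) (Icc 0 c) :=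
    (hB.comp_continuousOn hsT).mono (Icc_subset_Icc_right hcI.2)
  -- Between the parameters `0` and `c` the end point passes from `B ≥ b₂` to `B < b₁` with `x > 0`
  -- before `c`, hence crosses the whole strip.
  obtain ⟨a, b, ha, hab, hbc, hBa, hBb, hBI⟩ := exists_subinterval_decreasing hcI.1.le hBcont hb
    (hout _ (hsm I0) hs0).2.1 hBc.le
  have hr : ∀ θ ∈ Icc (0 : ℝ) 1, b - θ * (b - a) ∈ Icc a b := fun θ hθ =>
    ⟨by nlinarith [hθ.1, hθ.2], by nlinarith [hθ.1, hθ.2]⟩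
  have hsub : Icc a b ⊆ Icc 0 1 := Icc_subset_Icc ha (hbc.trans hcI.2)
  refine ⟨fun θ => s (b - θ * (b - a)), hsc.comp (by fun_prop) fun θ hθ => hsub (hr θ hθ),
    fun θ hθ => hsm (hsub (hr θ hθ)), by simpa using hBb, by simpa using hBa, fun θ hθ => ?_⟩
  set η := b - θ * (b - a)
  have hη := hr θ hθ
  have hη1 := hsm (hsub hη)
  have hxT : 0 < (W (s η) T).1 := by
    refine hcpos η ⟨ha.trans hη.1, lt_of_le_of_ne (hη.2.trans hbc) ?_⟩
    intro hηc
    have := (hBI η hη).1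
    rw [hηc] at this
    linarith
  refine ⟨hBI η hη, hxT, lt_of_le_of_ne (hstart _ hη1).1 fun hx => ?_,
    lt_of_le_of_ne (hsI η (hsub hη)).1 fun h0 => by linarith [hzero _ hη1 h0.symm]⟩
  -- A start on the `y`-axis would have energy exactly `E`, and then the strict clause of `hout`
  -- puts the end point beyond `b₂`. So `x < 0` initially, and the zero of `x` is interior to the
  -- gap.
  have heq := le_antisymm (hsI η (hsub hη)).2 (haxis _ hη1 hx)
  linarith [(hout _ hη1 heq).2.2 hx, (hBI η hη).2]

end Saddle

/-! ### Transition times -/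

section Transition

variable {h H m N : ℝ → ℝ} {T : ℝ} {z : ℝ → ℝ × ℝ}

theorem IsProperKinetic.exists_saddle_eq (hH : IsProperKinetic h H) {e n : ℝ} (he : 0 ≤ e + n) :
    ∃ y ≥ 0, H y + -n = e := by
  obtain ⟨y, hy, h⟩ := hH.exists_nonneg_eq he
  exact ⟨y, hy, by linarith⟩

/-- Time estimate for the passage across the `y`-axis. -/
theorem le_fst_of_integral_le (hH : IsProperKinetic h H) (hM : IsKinetic m N) (hT : 0 ≤ T)
    (hz : IsFlowLine (sepField h fun x => -m x) T z) {E p q : ℝ} (hE : 0 < E)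
    (hzE : H (z 0).2 - N (z 0).1 = E) (hy : 0 ≤ (z 0).2) (hp : p ≤ (z 0).1)
    (hint : ∫ x in p..q, timeWeight h H (fun x => -N x) E x ≤ T) :
    q ≤ (z T).1 ∧ (p < (z 0).1 → q < (z T).1) := by
  have hNc := hM.continuous_primitive
  have hpos : ∀ x, 0 < timeWeight h H (fun x => -N x) E x := fun x =>
    timeWeight_pos hH.toIsKinetic
      (hH.exists_saddle_eq (by linarith [hM.primitive_nonneg x]))
      (by linarith [hM.primitive_nonneg x])
  have hc : Continuous (timeWeight h H (fun x => -N x) E) := by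
    rw [← continuousOn_univ]
    exact continuousOn_timeWeight hH.toIsKinetic hNc.neg.continuousOn
      (fun x _ => hH.exists_saddle_eq (by linarith [hM.primitive_nonneg x]))
      (fun x _ => by linarith [hM.primitive_nonneg x])
  have hi : ∀ a b, IntervalIntegrable (timeWeight h H (fun x => -N x) E) volume a b :=
    fun a b => hc.intervalIntegrable a b
  have hyp := hz.snd_pos hH.toIsKinetic hM hy (hzE ▸ hE)
  obtain ⟨h1, h2⟩ := hz.time_eq hH.toIsKinetic hM.hasDerivAt_neg_primitive le_rfl hT le_rfl
    fun r hr => hyp r (Ioo_subset_Icc_self hr)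
  rw [← sub_eq_add_neg, hzE, sub_zero] at h2
  have hnn : ∀ a b, a ≤ b → 0 ≤ ∫ x in a..b, timeWeight h H (fun x => -N x) E x := fun a b hab =>
    intervalIntegral.integral_nonneg hab fun x _ => (hpos x).le
  have hp' : ∀ a b, a < b → 0 < ∫ x in a..b, timeWeight h H (fun x => -N x) E x := fun a b hab =>
    intervalIntegral.intervalIntegral_pos_of_pos_on (hi a b) (fun x _ => hpos x) hab
  have hsplit : ∫ x in p..q, timeWeight h H (fun x => -N x) E x =
      (∫ x in p..(z 0).1, timeWeight h H (fun x => -N x) E x) + T +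
        ∫ x in (z T).1..q, timeWeight h H (fun x => -N x) E x := by
    have h3 := intervalIntegral.integral_add_adjacent_intervals (hi p (z 0).1) (hi (z 0).1 (z T).1)
    have h4 := intervalIntegral.integral_add_adjacent_intervals (hi p (z T).1) (hi (z T).1 q)
    linarith [h2]
  constructor
  · by_contra! hlt
    linarith [hnn _ _ hp, hp' _ _ hlt]
  · intro hlt
    by_contra! hle
    linarith [hnn _ _ hle, hp' _ _ hlt]

/-- Time estimate for the passage across the positive `x`-axis. -/
theorem le_fst_of_integral_add_le (hH : IsProperKinetic h H) (hM : IsKinetic m N) (hT : 0 ≤ T)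
    (hz : IsFlowLine (sepField h fun x => -m x) T z) {ξ q r : ℝ} (hξ : 0 < ξ)
    (hzE : H (z 0).2 - N (z 0).1 = -N ξ) (hx0 : 0 ≤ (z 0).1) (hy : (z 0).2 ≤ 0)
    (hr : (z 0).1 ≤ r) (hξr : ξ < r) (hξq : ξ < q)
    (hint : (∫ x in ξ..q, timeWeight h H (fun x => -N x) (-N ξ) x) +
      (∫ x in ξ..r, timeWeight (fun y => -h (-y)) (fun y => H (-y)) (fun x => -N x) (-N ξ) x) ≤ T) :
    0 < (z T).2 ∧ q ≤ (z T).1 ∧ ((z 0).2 = 0 → q < (z T).1) := by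
  have I0 : (0 : ℝ) ∈ Icc 0 T := ⟨le_rfl, hT⟩
  have IT : T ∈ Icc 0 T := ⟨hT, le_rfl⟩
  have hNξ : 0 < N ξ := hM.primitive_pos hξ.ne'
  have hen : ∀ t ∈ Icc 0 T, H (z t).2 - N (z t).1 = -N ξ := fun t ht => by
    rw [hz.saddle_energy_eq hH.toIsKinetic hM ht, hzE]
  -- Negative energy excludes the `y`-axis.
  have hxne : ∀ t ∈ Icc 0 T, (z t).1 ≠ 0 := fun t ht h0 => by
    have := hen t ht
    rw [h0, hM.map_zero] at this
    linarith [hH.primitive_nonneg (z t).2]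
  have hxc : ContinuousOn (fun t => (z t).1) (Icc 0 T) :=
    continuous_fst.comp_continuousOn hz.continuousOn
  have hyc : ContinuousOn (fun t => (z t).2) (Icc 0 T) :=
    continuous_snd.comp_continuousOn hz.continuousOn
  have hxpos : ∀ t ∈ Icc 0 T, 0 < (z t).1 := fun t ht =>
    gt_of_avoids ht.1 (hxc.mono (Icc_subset_Icc_right ht.2))
      (fun s hs => hxne s ⟨hs.1, hs.2.trans ht.2⟩) (lt_of_le_of_ne hx0 (hxne 0 I0).symm)
  have hxξ : ∀ t ∈ Icc 0 T, ξ ≤ (z t).1 := fun t ht => by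
    refine (hM.strictMonoOn.le_iff_le hξ.le (hxpos t ht).le).1 ?_
    linarith [hen t ht, hH.primitive_nonneg (z t).2]
  have hymono : StrictMonoOn (fun t => (z t).2) (Icc 0 T) := by
    refine strictMonoOn_of_deriv_pos (convex_Icc 0 T) hyc fun t ht => ?_
    rw [interior_Icc] at ht
    have hd := (hz.snd (Ioo_subset_Icc_self ht)).hasDerivAt (Icc_mem_nhds ht.1 ht.2)
    rw [hd.deriv, neg_neg]
    exact hM.pos _ (hxpos t (Ioo_subset_Icc_self ht))
  have hNlt : ∀ x, ξ < x → -N x < -N ξ := fun x hx =>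
    neg_lt_neg (hM.strictMonoOn hξ.le (hξ.trans hx).le hx)
  have hNle : ∀ x, ξ ≤ x → N ξ ≤ N x := fun x hx =>
    (hM.strictMonoOn.le_iff_le hξ.le (hξ.le.trans hx)).2 hx
  have hg : ∀ h' H', IsProperKinetic h' H' → ∀ b, ξ < b →
      IntervalIntegrable (timeWeight h' H' (fun x => -N x) (-N ξ)) volume ξ b ∧
      (∀ x > ξ, 0 < timeWeight h' H' (fun x => -N x) (-N ξ) x) ∧
      (∀ x ≥ ξ, 0 ≤ timeWeight h' H' (fun x => -N x) (-N ξ) x) := by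
    intro h' H' hH' b hb
    have hrange : ∀ x ≥ ξ, ∃ y ≥ 0, H' y + -N x = -N ξ := fun x hx =>
      hH'.exists_saddle_eq (by linarith [hNle x hx])
    exact ⟨intervalIntegrable_timeWeight_of_left hH'.toIsKinetic hM.continuous.neg
        hM.hasDerivAt_neg_primitive hb (fun x hx => hrange x hx.1) (fun x hx => hNlt x hx.1)
        (neg_neg_iff_pos.2 (hM.pos ξ hξ)),
      fun x hx => timeWeight_pos hH'.toIsKinetic (hrange x hx.le) (hNlt x hx),
      fun x hx => timeWeight_nonneg hH'.toIsKinetic (hrange x hx)⟩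
  obtain ⟨iq, pq, nq⟩ := hg h H hH q hξq
  obtain ⟨ir, pr, nr⟩ := hg _ _ hH.reflect r hξr
  have Iq : 0 < ∫ x in ξ..q, timeWeight h H (fun x => -N x) (-N ξ) x :=
    intervalIntegral.intervalIntegral_pos_of_pos_on iq (fun x hx => pq x hx.1) hξq
  have Ir : 0 < ∫ x in ξ..r,
      timeWeight (fun y => -h (-y)) (fun y => H (-y)) (fun x => -N x) (-N ξ) x :=
    intervalIntegral.intervalIntegral_pos_of_pos_on ir (fun x hx => pr x hx.1) hξr
  -- the arc in the lower half-plane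
  have hlower : ∀ t ∈ Icc 0 T, (z t).2 ≤ 0 → t ≤ ∫ x in ξ..r,
      timeWeight (fun y => -h (-y)) (fun y => H (-y)) (fun x => -N x) (-N ξ) x := by
    intro t ht hyt
    obtain ⟨h1, h2⟩ := hz.reflect_saddle.time_eq hH.reflect.toIsKinetic
      hM.reflect.hasDerivAt_neg_primitive le_rfl ht.1 ht.2 fun s hs => by
        have hs' : s ∈ Icc 0 T := ⟨hs.1.le, hs.2.le.trans ht.2⟩
        have := hymono hs' ht hs.2
        simp only [Prod.snd_neg] at this ⊢
        linarith
    have e : ∀ x, timeWeight (fun y => -h (-y)) (fun y => H (-y)) (fun x => -N (-x))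
        (-N ξ) x = timeWeight (fun y => -h (-y)) (fun y => H (-y)) (fun x => -N x) (-N ξ) (-x) :=
      fun x => rfl
    simp only [Prod.fst_neg, Prod.snd_neg, neg_neg, ← sub_eq_add_neg, hzE, e] at h1 h2
    rw [intervalIntegral.integral_comp_neg, neg_neg, neg_neg] at h2
    have := intervalIntegral.integral_mono_interval (hxξ t ht) (by linarith) hr
      ((ae_restrict_iff' measurableSet_Ioc).2 (Eventually.of_forall fun x hx => nr x hx.1.le)) ir
    linarith
  -- The lower arc lasts at most the integral from `ξ` to `r`, which is less than `T` because the
  -- integral from `ξ` to `q` is positive.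
  have hyT : 0 < (z T).2 := by
    by_contra! hle
    linarith [hlower T IT hle]
  obtain ⟨t, ht, ht0⟩ := intermediate_value_Icc hT hyc
    (show (0 : ℝ) ∈ Icc (z 0).2 (z T).2 from ⟨hy, hyT.le⟩)
  simp only at ht0
  have hxt : (z t).1 = ξ := by
    refine hM.strictMonoOn.injOn (hxpos t ht).le hξ.le ?_
    have := hen t ht
    rw [ht0, hH.map_zero] at this
    linarith
  obtain ⟨h1, h2⟩ := hz.time_eq hH.toIsKinetic hM.hasDerivAt_neg_primitive ht.1 ht.2 le_rfl
    fun s hs => by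
      have := hymono ht ⟨ht.1.trans hs.1.le, hs.2.le⟩ hs.1
      simp only at this
      linarith
  rw [← sub_eq_add_neg, hzE, hxt] at h2
  have htr := hlower t ht ht0.le
  have hmono : ∀ b, ξ ≤ b → b ≤ q → ∫ x in ξ..b, timeWeight h H (fun x => -N x) (-N ξ) x ≤
      ∫ x in ξ..q, timeWeight h H (fun x => -N x) (-N ξ) x := fun b h1 h2 =>
    intervalIntegral.integral_mono_interval le_rfl h1 h2
      ((ae_restrict_iff' measurableSet_Ioc).2 (Eventually.of_forall fun x hx => nq x hx.1.le)) iq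
  refine ⟨hyT, ?_, fun hy0 => ?_⟩
  · by_contra! hlt
    have hsub : IntervalIntegrable (timeWeight h H (fun x => -N x) (-N ξ)) volume (z T).1 q :=
      iq.mono_set (by
        rw [uIcc_of_le hlt.le, uIcc_of_le hξq.le]
        exact Icc_subset_Icc_left (hxξ T IT))
    have hsub' : IntervalIntegrable (timeWeight h H (fun x => -N x) (-N ξ)) volume ξ (z T).1 :=
      iq.mono_set (by
        rw [uIcc_of_le (hxξ T IT), uIcc_of_le hξq.le]
        exact Icc_subset_Icc_right hlt.le)
    have hpos := intervalIntegral.intervalIntegral_pos_of_pos_on hsub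
      (fun x hx => pq x ((hxξ T IT).trans_lt hx.1)) hlt
    have hadd := intervalIntegral.integral_add_adjacent_intervals hsub' hsub
    linarith
  · by_contra! hle
    -- Starting on the `x`-axis there is no lower arc; all of `T` is available for the upper one,
    -- and the positive integral `Ir` is gained. This makes the inequality strict.
    have ht00 : t = 0 := hymono.injOn ht I0 (ht0.trans hy0.symm)
    rw [ht00, sub_zero] at h2
    linarith [hmono _ (hxξ T IT) hle]

end Transition


/-! ### Links between annuli -/

/-- Every point of the path `ζ` is the end point of a flow line on `[0, T]` which starts on the path
`γ` and has the property `Q`. -/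
def IsImagePath (V : ℝ × ℝ → ℝ × ℝ) (T : ℝ) (γ ζ : ℝ → ℝ × ℝ) (Q : (ℝ → ℝ × ℝ) → Prop) : Prop :=
  ∀ θ ∈ Icc (0 : ℝ) 1, ∃ s ∈ Icc (0 : ℝ) 1, ∃ z, IsFlowLine V T z ∧ z 0 = γ s ∧ z T = ζ θ ∧ Q z

/-- Local uniqueness of the equilibrium at the origin. -/
structure IsIsolatedOrigin (h k : ℝ → ℝ) : Prop where
  forward : ∀ T > 0, ∀ z, IsFlowLine (sepField h k) T z → z 0 = 0 →
    ∃ ε > 0, ε ≤ T ∧ ∀ t ∈ Icc 0 ε, z t = 0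
  backward : ∀ T > 0, ∀ z, IsFlowLine (sepField h k) T z → z T = 0 → ∃ t ∈ Ico 0 T, z t = 0

theorem IsIsolatedOrigin.reflect {h k : ℝ → ℝ} (hO : IsIsolatedOrigin h k) :
    IsIsolatedOrigin (fun y => -h (-y)) (fun x => -k (-x)) where
  forward T hT z hz h0 := by
    have hz' := hz.reflect
    simp only [neg_neg] at hz'
    obtain ⟨ε, hε, hεT, H⟩ := hO.forward T hT _ hz' (by simp [h0])
    exact ⟨ε, hε, hεT, fun t ht => neg_eq_zero.1 (H t ht)⟩
  backward T hT z hz h0 := by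
    have hz' := hz.reflect
    simp only [neg_neg] at hz'
    obtain ⟨t, ht, H⟩ := hO.backward T hT _ hz' (by simp [h0])
    exact ⟨t, ht, neg_eq_zero.1 H⟩

section Link

variable {h H m N g G k₁ K₁ k₂ K₂ xN₁ xP₁ xN₂ xP₂ : ℝ → ℝ} {T a₁ b₁ a₂ b₂ μ₁ μ₂ : ℝ}

/-- The saddle flow through a path avoiding the origin. -/
theorem exists_saddle_flow (hH : IsProperKinetic h H) (hM : IsKinetic m N)
    (hO : IsIsolatedOrigin h fun x => -m x) (hT : 0 ≤ T) {γ : ℝ → ℝ × ℝ}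
    (hγ : ContinuousOn γ (Icc 0 1)) (hne : ∀ θ ∈ Icc (0 : ℝ) 1, γ θ ≠ 0) :
    ∃ W : ℝ → ℝ → ℝ × ℝ, (∀ t ∈ Icc 0 T, ContinuousOn (fun θ => W θ t) (Icc 0 1)) ∧
      ∀ θ ∈ Icc (0 : ℝ) 1, IsFlowLine (sepField h fun x => -m x) T (W θ) ∧ W θ 0 = γ θ ∧
        ∀ t ∈ Icc 0 T, W θ t ≠ 0 := by
  obtain ⟨M, hMb⟩ := hH.bounded
  obtain ⟨W, hWc, hW⟩ := exists_continuousOn_flow hT hH.continuous hM.continuous.neg hMb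
    isCompact_Icc hγ fun θ _ z w hz hw hz0 hw0 =>
      eqOn_of_isFlowLine_saddle hH.toIsKinetic hM (fun T hT z w hz hw hz0 hw0 => by
        obtain ⟨ε₁, hε₁, hT₁, H₁⟩ := hO.forward T hT z hz hz0
        obtain ⟨ε₂, hε₂, hT₂, H₂⟩ := hO.forward T hT w hw hw0
        refine ⟨min ε₁ ε₂, lt_min hε₁ hε₂, (min_le_left _ _).trans hT₁, fun t ht => ?_⟩
        rw [H₁ t ⟨ht.1, ht.2.trans (min_le_left _ _)⟩, H₂ t ⟨ht.1, ht.2.trans (min_le_right _ _)⟩])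
        hz hw (hz0.trans hw0.symm)
  refine ⟨W, fun t ht => hWc.comp (f := fun θ => (θ, t)) (by fun_prop) fun θ hθ => ⟨hθ, ht⟩,
    fun θ hθ => ⟨(hW θ hθ).1, (hW θ hθ).2, ?_⟩⟩
  exact ne_zero_of_isFlowLine hO.backward (hW θ hθ).1 ((hW θ hθ).2 ▸ hne θ hθ)

theorem exists_kineticInv_eq (hG : IsKinetic g G) {v b : ℝ} (hv : 0 ≤ v) (hb : 0 ≤ b)
    (hvb : v ≤ G b) : kineticInv G v ∈ Icc 0 b ∧ G (kineticInv G v) = v := by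
  obtain ⟨y, hy, rfl⟩ := hG.exists_eq_of_le hv hb hvb
  rw [hG.kineticInv_apply hy.1]
  exact ⟨hy, rfl⟩

/-- The link from the second quadrant to the first one. -/
theorem exists_link_across_vertical_axis (hH : IsProperKinetic h H) (hM : IsKinetic m N)
    (hO : IsIsolatedOrigin h fun x => -m x) (hG : IsKinetic g G) (hμ₁ : 0 < μ₁) (hμ₂ : 0 < μ₂)
    (hW₁ : IsWell k₁ K₁ a₁ b₁ xN₁ xP₁) (hW₂ : IsWell k₂ K₂ a₂ b₂ xN₂ xP₂)
    (hK₁ : ∀ x ∈ Icc (xN₁ b₁) (xP₁ b₁), K₁ x = μ₁ * G x - N x)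
    (hK₂ : ∀ x ∈ Icc (xN₂ b₂) (xP₂ b₂), K₂ x = μ₂ * G x - N x) (hT : 0 ≤ T)
    (hint : ∫ x in (-kineticInv (fun x => G (-x)) (μ₁⁻¹ * (b₁ - min a₁ a₂)))..
      (kineticInv G (μ₂⁻¹ * (b₂ - min a₁ a₂))), timeWeight h H (fun x => -N x) (min a₁ a₂) x ≤ T)
    {γ : ℝ → ℝ × ℝ} (hγ : ContinuousOn γ (Icc 0 1))
    (hγQ : ∀ θ ∈ Icc (0 : ℝ) 1, γ θ ∈ Quadrant.II.region ∧ H (γ θ).2 + K₁ (γ θ).1 ∈ Icc a₁ b₁)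
    (hends : ((γ 0).1 = 0 ∧ (γ 1).2 = 0) ∨ ((γ 0).2 = 0 ∧ (γ 1).1 = 0)) :
    ∃ ζ : ℝ → ℝ × ℝ, ContinuousOn ζ (Icc 0 1) ∧ H (ζ 0).2 + K₂ (ζ 0).1 = a₂ ∧
      H (ζ 1).2 + K₂ (ζ 1).1 = b₂ ∧
      (∀ θ ∈ Icc (0 : ℝ) 1, ζ θ ∈ Quadrant.I.region ∧ H (ζ θ).2 + K₂ (ζ θ).1 ∈ Icc a₂ b₂) ∧
      IsImagePath (sepField h fun x => -m x) T γ ζ fun z =>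
        zeroCount (fun t => (z t).1) (Icc 0 T) = 1 ∧ zeroCount (fun t => (z t).1) (Ioo 0 T) = 1 ∧
        zeroCount (fun t => (z t).2) (Icc 0 T) = 0 ∧
        zeroCount (fun t => (z t).2) (Ioo 0 T) = 0 := by
  have I0 : (0 : ℝ) ∈ Icc (0 : ℝ) 1 := ⟨le_rfl, zero_le_one⟩
  have I1 : (1 : ℝ) ∈ Icc (0 : ℝ) 1 := ⟨zero_le_one, le_rfl⟩
  have IT : T ∈ Icc 0 T := ⟨hT, le_rfl⟩
  have J₁ : b₁ ∈ Icc a₁ b₁ := ⟨hW₁.lt.le, le_rfl⟩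
  have J₂ : b₂ ∈ Icc a₂ b₂ := ⟨hW₂.lt.le, le_rfl⟩
  -- The level through the link point on the `y`-axis: the points of `γ` on this axis have at least
  -- this energy since `E ≤ a₁`, and the axis points below it are inside the second annulus since `E
  -- ≤ a₂`.
  set E := min a₁ a₂ with hEdef
  have hE : 0 < E := lt_min hW₁.pos hW₂.pos
  have hEa₁ : E ≤ a₁ := min_le_left _ _
  have hEa₂ : E ≤ a₂ := min_le_right _ _
  have hE₁ : E < b₁ := hEa₁.trans_lt hW₁.lt
  have hE₂ : E < b₂ := hEa₂.trans_lt hW₂.lt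
  have hK₂c : Continuous K₂ := continuous_iff_continuousAt.2 fun x => (hW₂.hasDerivAt x).continuousAt
  -- the end points of the interval of integration
  obtain ⟨hp, hGp⟩ := exists_kineticInv_eq hG.reflect (v := μ₁⁻¹ * (b₁ - E)) (b := -xN₁ b₁)
    (mul_nonneg (inv_pos.2 hμ₁).le (by linarith)) (by linarith [hW₁.xN_neg b₁ J₁]) (by
      rw [neg_neg, inv_mul_le_iff₀ hμ₁]
      have := hK₁ (xN₁ b₁) ⟨le_rfl, (hW₁.xN_neg b₁ J₁).le.trans (hW₁.xP_pos b₁ J₁).le⟩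
      rw [hW₁.map_xN b₁ J₁] at this
      linarith [hM.primitive_nonneg (xN₁ b₁)])
  obtain ⟨hq, hGq⟩ := exists_kineticInv_eq hG (v := μ₂⁻¹ * (b₂ - E)) (b := xP₂ b₂)
    (mul_nonneg (inv_pos.2 hμ₂).le (by linarith)) (by linarith [hW₂.xP_pos b₂ J₂]) (by
      rw [inv_mul_le_iff₀ hμ₂]
      have := hK₂ (xP₂ b₂) ⟨(hW₂.xN_neg b₂ J₂).le.trans (hW₂.xP_pos b₂ J₂).le, le_rfl⟩
      rw [hW₂.map_xP b₂ J₂] at this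
      linarith [hM.primitive_nonneg (xP₂ b₂)])
  set p' := kineticInv (fun x => G (-x)) (μ₁⁻¹ * (b₁ - E)) with hp'
  set q := kineticInv G (μ₂⁻¹ * (b₂ - E)) with hqdef
  have hGp' : μ₁ * G (-p') = b₁ - E := by rw [hGp]; field_simp
  have hGq' : μ₂ * G q = b₂ - E := by rw [hGq]; field_simp
  have hp'0 : 0 < p' := lt_of_le_of_ne hp.1 fun h0 => by
    rw [← h0, neg_zero, hG.map_zero] at hGp'
    linarith
  have hq0 : 0 < q := lt_of_le_of_ne hq.1 fun h0 => by
    rw [← h0, hG.map_zero] at hGq'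
    linarith
  -- the flow
  obtain ⟨W, hWc, hW⟩ := exists_saddle_flow hH hM hO hT hγ fun θ hθ h0 => by
    have := (hγQ θ hθ).2.1
    rw [h0, Prod.fst_zero, Prod.snd_zero, hH.map_zero, hW₁.map_zero] at this
    linarith [hW₁.pos]
  have hx₁ : ∀ θ ∈ Icc (0 : ℝ) 1, (γ θ).1 ∈ Icc (xN₁ b₁) (xP₁ b₁) := fun θ hθ =>
    hW₁.mem_Icc_of_le J₁ (by linarith [(hγQ θ hθ).2.2, hH.primitive_nonneg (γ θ).2])
  obtain ⟨s, hsc, hsm, hs0, hs1, hsI⟩ := exists_linking_reparametrization hH.toIsKinetic hM hT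
    (fun θ hθ => (hW θ hθ).1) (hWc 0 ⟨le_rfl, hT⟩) (hWc T IT)
    (fun θ hθ => by rw [(hW θ hθ).2.1]; exact (hγQ θ hθ).1) (fun θ hθ => (hW θ hθ).2.2) hE
    (fun θ hθ h0 => by
      rw [(hW θ hθ).2.1] at h0 ⊢
      have := (hγQ θ hθ).2.1
      rw [h0, hW₁.map_zero] at this
      rw [h0, hM.map_zero]
      linarith)
    (by
      have hx : ∀ θ ∈ Icc (0 : ℝ) 1, (γ θ).1 = 0 → E ≤ H (γ θ).2 - N (γ θ).1 := by
        intro θ hθ h0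
        have := (hγQ θ hθ).2.1
        rw [h0, hW₁.map_zero] at this
        rw [h0, hM.map_zero]
        linarith
      have hy : ∀ θ, (γ θ).2 = 0 → H (γ θ).2 - N (γ θ).1 ≤ 0 := by
        intro θ h0
        rw [h0, hH.map_zero]
        linarith [hM.primitive_nonneg (γ θ).1]
      rw [(hW 0 I0).2.1, (hW 1 I1).2.1]
      exact hends.imp (fun h => ⟨hx 0 I0 h.1, hy 1 h.2⟩) fun h => ⟨hy 0 h.1, hx 1 I1 h.2⟩)
    (B := fun p => H p.2 + K₂ p.1)
    ((hH.continuous_primitive.comp continuous_snd).add (hK₂c.comp continuous_fst)) hW₂.lt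
    (fun θ hθ hen => by
      have hpx : -p' ≤ (W θ 0).1 := by
        rw [(hW θ hθ).2.1] at hen ⊢
        have h1 := (hγQ θ hθ).2.2
        rw [hK₁ _ (hx₁ θ hθ)] at h1
        have h2 : G (γ θ).1 ≤ G (-p') := le_of_mul_le_mul_left (by linarith) hμ₁
        have h3 := (hG.reflect.strictMonoOn.le_iff_le (a := -(γ θ).1) (b := p')
          (neg_nonneg.2 (hγQ θ hθ).1.1) hp.1).1 (by simpa using h2)
        linarith
      obtain ⟨h1, h2⟩ := le_fst_of_integral_le hH hM hT (hW θ hθ).1 hE hen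
        (by rw [(hW θ hθ).2.1]; exact (hγQ θ hθ).1.2) hpx hint
      have henT := (hW θ hθ).1.saddle_energy_eq hH.toIsKinetic hM IT
      rw [hen] at henT
      have hxT : 0 < (W θ T).1 := hq0.trans_le h1
      -- The formula for `K₂` holds only up to `xP₂ b₂`; beyond that point `K₂ > b₂` already.
      rcases le_or_gt (W θ T).1 (xP₂ b₂) with hle | hgt
      · have hK := hK₂ _ ⟨(hW₂.xN_neg b₂ J₂).le.trans hxT.le, hle⟩
        refine ⟨hxT, ?_, fun h0 => ?_⟩
        · have := mul_le_mul_of_nonneg_left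
            ((hG.strictMonoOn.le_iff_le hq0.le hxT.le).2 h1) hμ₂.le
          rw [hK]; linarith
        · have := mul_lt_mul_of_pos_left
            (hG.strictMonoOn hq0.le hxT.le (h2 (by rw [h0]; linarith))) hμ₂
          rw [hK]; linarith
      · have := hW₂.gt_of_gt b₂ J₂ _ hgt
        have := hH.primitive_nonneg (W θ T).2
        exact ⟨hxT, by linarith, fun _ => by linarith⟩)
    (fun y _ hyE => by simp only [hW₂.map_zero]; linarith)
  refine ⟨fun θ => W (s θ) T, (hWc T IT).comp hsc hsm, hs0, hs1, fun θ hθ => ?_, fun θ hθ => ?_⟩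
  · obtain ⟨h1, h2, h3, h4⟩ := hsI θ hθ
    obtain ⟨hf, hf0, -⟩ := hW _ (hsm hθ)
    have hy := hf.snd_pos hH.toIsKinetic hM (by rw [hf0]; exact (hγQ _ (hsm hθ)).1.2) h4 T IT
    exact ⟨⟨h2.le, hy.le⟩, h1⟩
  · obtain ⟨h1, h2, h3, h4⟩ := hsI θ hθ
    obtain ⟨hf, hf0, -⟩ := hW _ (hsm hθ)
    exact ⟨s θ, hsm hθ, W (s θ), hf, hf0, rfl, hf.zeroCount_saddle hH.toIsKinetic hM hT
      (by rw [hf0]; exact (hγQ _ (hsm hθ)).1.2) h4 h3 h2⟩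

/-- The value of `kineticInv` is the abscissa where the gap level through `(ξ, 0)` meets the outer
boundary. It lies beyond `ξ` because `K ξ ≤ a < b`, and not beyond `xP b` because `N ξ ≤ N (xP b)`.
So the integrals defining the transition times run over genuine intervals. -/
theorem IsWell.lt_kineticInv {k K xN xP : ℝ → ℝ} {a b μ ξ : ℝ} (hW : IsWell k K a b xN xP)
    (hM : IsKinetic m N) (hG : IsKinetic g G) (hμ : 0 < μ)
    (hK : ∀ x ∈ Icc (xN b) (xP b), K x = μ * G x - N x) (hξ0 : 0 < ξ) (hξa : ξ ≤ xP a) :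
    ξ < kineticInv G (μ⁻¹ * (b + N ξ)) ∧ kineticInv G (μ⁻¹ * (b + N ξ)) ≤ xP b ∧
      μ * G (kineticInv G (μ⁻¹ * (b + N ξ))) = b + N ξ := by
  have hE : 0 < N ξ := hM.primitive_pos hξ0.ne'
  have Jb : b ∈ Icc a b := ⟨hW.lt.le, le_rfl⟩
  have Ja : a ∈ Icc a b := ⟨le_rfl, hW.lt.le⟩
  have hPb := hW.xP_pos b Jb
  have hNb := hW.xN_neg b Jb
  have hab : xP a < xP b := by
    by_contra! hle
    rcases hle.eq_or_lt with h | h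
    · linarith [hW.map_xP a Ja, h ▸ hW.map_xP b Jb, hW.lt]
    · linarith [hW.map_xP a Ja, hW.gt_of_gt b Jb _ h, hW.lt]
  have hKb := hK (xP b) ⟨hNb.le.trans hPb.le, le_rfl⟩
  rw [hW.map_xP b Jb] at hKb
  have hNξ : N ξ ≤ N (xP b) := (hM.strictMonoOn.le_iff_le hξ0.le hPb.le).2 (by linarith)
  obtain ⟨hr, hGr⟩ := exists_kineticInv_eq hG (v := μ⁻¹ * (b + N ξ)) (b := xP b)
    (mul_nonneg (inv_pos.2 hμ).le (by linarith [hW.pos, hW.lt])) hPb.le (by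
      rw [inv_mul_le_iff₀ hμ]; linarith)
  have hGr' : μ * G (kineticInv G (μ⁻¹ * (b + N ξ))) = b + N ξ := by rw [hGr]; field_simp
  refine ⟨?_, hr.2, hGr'⟩
  refine (hG.strictMonoOn.lt_iff_lt hξ0.le hr.1).1 (lt_of_mul_lt_mul_left ?_ hμ.le)
  rw [hGr']
  have hKξ := hK ξ ⟨by linarith, by linarith⟩
  have : K ξ ≤ a := hW.le_of_mem Ja ⟨by linarith [hW.xN_neg a Ja], hξa⟩
  linarith [hW.lt]

/-- The link from the fourth quadrant to the first one. -/
theorem exists_link_across_horizontal_axis (hH : IsProperKinetic h H) (hM : IsKinetic m N)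
    (hO : IsIsolatedOrigin h fun x => -m x) (hG : IsKinetic g G) (hμ₁ : 0 < μ₁) (hμ₂ : 0 < μ₂)
    (hW₁ : IsWell k₁ K₁ a₁ b₁ xN₁ xP₁) (hW₂ : IsWell k₂ K₂ a₂ b₂ xN₂ xP₂)
    (hK₁ : ∀ x ∈ Icc (xN₁ b₁) (xP₁ b₁), K₁ x = μ₁ * G x - N x)
    (hK₂ : ∀ x ∈ Icc (xN₂ b₂) (xP₂ b₂), K₂ x = μ₂ * G x - N x) (hT : 0 ≤ T) {ξ : ℝ}
    (hξ : ξ = min (xP₁ a₁) (xP₂ a₂))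
    (hint : (∫ x in ξ..(kineticInv G (μ₂⁻¹ * (b₂ + N ξ))),
        timeWeight h H (fun x => -N x) (-N ξ) x) +
      (∫ x in ξ..(kineticInv G (μ₁⁻¹ * (b₁ + N ξ))),
        timeWeight (fun y => -h (-y)) (fun y => H (-y)) (fun x => -N x) (-N ξ) x) ≤ T)
    {γ : ℝ → ℝ × ℝ} (hγ : ContinuousOn γ (Icc 0 1))
    (hγQ : ∀ θ ∈ Icc (0 : ℝ) 1, γ θ ∈ Quadrant.IV.region ∧ H (γ θ).2 + K₁ (γ θ).1 ∈ Icc a₁ b₁)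
    (hends : ((γ 0).1 = 0 ∧ (γ 1).2 = 0) ∨ ((γ 0).2 = 0 ∧ (γ 1).1 = 0)) :
    ∃ ζ : ℝ → ℝ × ℝ, ContinuousOn ζ (Icc 0 1) ∧ H (ζ 0).2 + K₂ (ζ 0).1 = a₂ ∧
      H (ζ 1).2 + K₂ (ζ 1).1 = b₂ ∧
      (∀ θ ∈ Icc (0 : ℝ) 1, ζ θ ∈ Quadrant.I.region ∧ H (ζ θ).2 + K₂ (ζ θ).1 ∈ Icc a₂ b₂) ∧
      IsImagePath (sepField h fun x => -m x) T γ ζ fun z =>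
        zeroCount (fun t => (z t).1) (Icc 0 T) = 0 ∧ zeroCount (fun t => (z t).1) (Ioo 0 T) = 0 ∧
        zeroCount (fun t => (z t).2) (Icc 0 T) = 1 ∧
        zeroCount (fun t => (z t).2) (Ioo 0 T) = 1 := by
  have I0 : (0 : ℝ) ∈ Icc (0 : ℝ) 1 := ⟨le_rfl, zero_le_one⟩
  have I1 : (1 : ℝ) ∈ Icc (0 : ℝ) 1 := ⟨zero_le_one, le_rfl⟩
  have IT : T ∈ Icc 0 T := ⟨hT, le_rfl⟩
  have J₁ : b₁ ∈ Icc a₁ b₁ := ⟨hW₁.lt.le, le_rfl⟩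
  have J₂ : b₂ ∈ Icc a₂ b₂ := ⟨hW₂.lt.le, le_rfl⟩
  have A₁ : a₁ ∈ Icc a₁ b₁ := ⟨le_rfl, hW₁.lt.le⟩
  have A₂ : a₂ ∈ Icc a₂ b₂ := ⟨le_rfl, hW₂.lt.le⟩
  have hξ₁ : ξ ≤ xP₁ a₁ := hξ ▸ min_le_left _ _
  have hξ₂ : ξ ≤ xP₂ a₂ := hξ ▸ min_le_right _ _
  have hξ0 : 0 < ξ := hξ ▸ lt_min (hW₁.xP_pos _ A₁) (hW₂.xP_pos _ A₂)
  have hE : 0 < N ξ := hM.primitive_pos hξ0.ne'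
  have hK₂c : Continuous K₂ := continuous_iff_continuousAt.2 fun x => (hW₂.hasDerivAt x).continuousAt
  obtain ⟨hξr, -, hGr⟩ := hW₁.lt_kineticInv hM hG hμ₁ hK₁ hξ0 hξ₁
  obtain ⟨hξq, -, hGq⟩ := hW₂.lt_kineticInv hM hG hμ₂ hK₂ hξ0 hξ₂
  set r := kineticInv G (μ₁⁻¹ * (b₁ + N ξ)) with hrdef
  set q := kineticInv G (μ₂⁻¹ * (b₂ + N ξ)) with hqdef
  have hr0 : 0 < r := hξ0.trans hξr
  have hq0 : 0 < q := hξ0.trans hξq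
  obtain ⟨W, hWc, hW⟩ := exists_saddle_flow hH hM hO hT hγ fun θ hθ h0 => by
    have := (hγQ θ hθ).2.1
    rw [h0, Prod.fst_zero, Prod.snd_zero, hH.map_zero, hW₁.map_zero] at this
    linarith [hW₁.pos]
  have hx₁ : ∀ θ ∈ Icc (0 : ℝ) 1, (γ θ).1 ∈ Icc (xN₁ b₁) (xP₁ b₁) := fun θ hθ =>
    hW₁.mem_Icc_of_le J₁ (by linarith [(hγQ θ hθ).2.2, hH.primitive_nonneg (γ θ).2])
  -- A point of the annulus on the positive `x`-axis is not inside the inner boundary, so its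
  -- abscissa is at least `xP₁ a₁ ≥ ξ`.
  have hx : ∀ θ ∈ Icc (0 : ℝ) 1, (γ θ).2 = 0 → N ξ ≤ N (γ θ).1 - H (γ θ).2 := by
    intro θ hθ h0
    have h1 := (hγQ θ hθ).2.1
    rw [h0, hH.map_zero] at h1
    rw [h0, hH.map_zero, sub_zero]
    refine (hM.strictMonoOn.le_iff_le hξ0.le (hγQ θ hθ).1.1).2 ?_
    by_contra! hlt
    linarith [hW₁.lt_of_mem a₁ A₁ _
      ⟨(hW₁.xN_neg a₁ A₁).trans_le (hγQ θ hθ).1.1, hlt.trans_le hξ₁⟩]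
  have hswap : Continuous fun p : ℝ × ℝ => p.swap := continuous_swap
  -- Swapping coordinates turns the passage from IV to I into one from II to I. The roles of `H` and
  -- `N` are exchanged, and the energy `N - H` is compared with `N ξ`.
  obtain ⟨s, hsc, hsm, hs0, hs1, hsI⟩ := exists_linking_reparametrization
    (W := fun θ t => (W θ t).swap) hM hH.toIsKinetic hT
    (fun θ hθ => (hW θ hθ).1.swap) (hswap.comp_continuousOn (hWc 0 ⟨le_rfl, hT⟩))
    (hswap.comp_continuousOn (hWc T IT))
    (fun θ hθ => by rw [(hW θ hθ).2.1]; exact ⟨(hγQ θ hθ).1.2, (hγQ θ hθ).1.1⟩)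
    (fun θ hθ t ht h0 => (hW θ hθ).2.2 t ht (Prod.swap_injective h0)) hE
    (fun θ hθ h0 => by
      simp only [(hW θ hθ).2.1, Prod.fst_swap, Prod.snd_swap] at h0 ⊢
      exact hx θ hθ h0)
    (by
      have hy : ∀ θ, (γ θ).1 = 0 → N (γ θ).1 - H (γ θ).2 ≤ 0 := by
        intro θ h0
        rw [h0, hM.map_zero]
        linarith [hH.primitive_nonneg (γ θ).2]
      simp only [(hW 0 I0).2.1, (hW 1 I1).2.1, Prod.fst_swap, Prod.snd_swap]
      exact hends.symm.imp (fun h => ⟨hx 0 I0 h.1, hy 1 h.2⟩) fun h => ⟨hy 0 h.1, hx 1 I1 h.2⟩)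
    (B := fun p => H p.1 + K₂ p.2)
    ((hH.continuous_primitive.comp continuous_fst).add (hK₂c.comp continuous_snd)) hW₂.lt
    (fun θ hθ hen => by
      simp only [Prod.fst_swap, Prod.snd_swap] at hen ⊢
      have hen' : H (W θ 0).2 - N (W θ 0).1 = -N ξ := by linarith
      have hQ := (hγQ θ hθ).1
      have hpx : (W θ 0).1 ≤ r := by
        rw [(hW θ hθ).2.1] at hen' ⊢
        have h1 := (hγQ θ hθ).2.2
        rw [hK₁ _ (hx₁ θ hθ)] at h1
        have h2 : G (γ θ).1 ≤ G r := le_of_mul_le_mul_left (by linarith) hμ₁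
        exact (hG.strictMonoOn.le_iff_le hQ.1 hr0.le).1 h2
      obtain ⟨h0, h1, h2⟩ := le_fst_of_integral_add_le hH hM hT (hW θ hθ).1 hξ0 hen'
        (by rw [(hW θ hθ).2.1]; exact hQ.1) (by rw [(hW θ hθ).2.1]; exact hQ.2) hpx hξr hξq hint
      have henT := (hW θ hθ).1.saddle_energy_eq hH.toIsKinetic hM IT
      rw [hen'] at henT
      have hxT : 0 < (W θ T).1 := hq0.trans_le h1
      refine ⟨h0, ?_⟩
      rcases le_or_gt (W θ T).1 (xP₂ b₂) with hle | hgt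
      · have hK := hK₂ _ ⟨(hW₂.xN_neg b₂ J₂).le.trans hxT.le, hle⟩
        refine ⟨?_, fun h0 => ?_⟩
        · have := mul_le_mul_of_nonneg_left
            ((hG.strictMonoOn.le_iff_le hq0.le hxT.le).2 h1) hμ₂.le
          rw [hK]; linarith
        · have := mul_lt_mul_of_pos_left (hG.strictMonoOn hq0.le hxT.le (h2 h0)) hμ₂
          rw [hK]; linarith
      · have := hW₂.gt_of_gt b₂ J₂ _ hgt
        have := hH.primitive_nonneg (W θ T).2
        exact ⟨by linarith, fun _ => by linarith⟩)
    (fun x hx0 hxE => by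
      simp only [hH.map_zero, zero_add]
      have := (hM.strictMonoOn.lt_iff_lt hx0.le hξ0.le).1 hxE
      exact hW₂.lt_of_mem a₂ A₂ x ⟨(hW₂.xN_neg a₂ A₂).trans hx0, this.trans_le hξ₂⟩)
  simp only [Prod.fst_swap, Prod.snd_swap] at hs0 hs1 hsI
  have hstart : ∀ θ ∈ Icc (0 : ℝ) 1, 0 ≤ (W (s θ) 0).1 := fun θ hθ => by
    rw [(hW _ (hsm hθ)).2.1]; exact (hγQ _ (hsm hθ)).1.1
  refine ⟨fun θ => W (s θ) T, (hWc T IT).comp hsc hsm, hs0, hs1, fun θ hθ => ?_, fun θ hθ => ?_⟩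
  · obtain ⟨h1, h2, h3, h4⟩ := hsI θ hθ
    have hy := (hW _ (hsm hθ)).1.swap.snd_pos hM hH.toIsKinetic (hstart θ hθ) h4 T IT
    exact ⟨⟨hy.le, h2.le⟩, h1⟩
  · obtain ⟨h1, h2, h3, h4⟩ := hsI θ hθ
    obtain ⟨hf, hf0, -⟩ := hW _ (hsm hθ)
    obtain ⟨n1, n2, n3, n4⟩ := hf.swap.zeroCount_saddle hM hH.toIsKinetic hT (hstart θ hθ) h4 h3 h2
    exact ⟨s θ, hsm hθ, W (s θ), hf, hf0, rfl, n3, n4, n1, n2⟩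

end Link


/-! ### Reflected links -/

theorem zeroCount_neg (u : ℝ → ℝ) (A : Set ℝ) : zeroCount (fun t => -u t) A = zeroCount u A := by
  simp only [zeroCount, neg_eq_zero]

theorem IsImagePath.reflect {h k : ℝ → ℝ} {T : ℝ} {γ ζ : ℝ → ℝ × ℝ} {Q Q' : (ℝ → ℝ × ℝ) → Prop}
    (hI : IsImagePath (sepField (fun y => -h (-y)) fun x => -k (-x)) T (fun θ => -γ θ) ζ Q')
    (hQ : ∀ z, Q' z → Q (fun t => -z t)) :
    IsImagePath (sepField h k) T γ (fun θ => -ζ θ) Q := by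
  intro θ hθ
  obtain ⟨s, hs, z, hz, h0, h1, h2⟩ := hI θ hθ
  have hz' := hz.reflect
  simp only [neg_neg] at hz'
  exact ⟨s, hs, _, hz', by rw [h0, neg_neg], by rw [h1], hQ z h2⟩

section Link

variable {h H m N g G k₁ K₁ k₂ K₂ xN₁ xP₁ xN₂ xP₂ : ℝ → ℝ} {T a₁ b₁ a₂ b₂ μ₁ μ₂ : ℝ}

/-- The link from the fourth quadrant to the third one. -/
theorem exists_link_across_vertical_axis_lower (hH : IsProperKinetic h H) (hM : IsKinetic m N)
    (hO : IsIsolatedOrigin h fun x => -m x) (hG : IsKinetic g G) (hμ₁ : 0 < μ₁) (hμ₂ : 0 < μ₂)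
    (hW₁ : IsWell k₁ K₁ a₁ b₁ xN₁ xP₁) (hW₂ : IsWell k₂ K₂ a₂ b₂ xN₂ xP₂)
    (hK₁ : ∀ x ∈ Icc (xN₁ b₁) (xP₁ b₁), K₁ x = μ₁ * G x - N x)
    (hK₂ : ∀ x ∈ Icc (xN₂ b₂) (xP₂ b₂), K₂ x = μ₂ * G x - N x) (hT : 0 ≤ T)
    (hint : ∫ x in (-kineticInv (fun x => G (-x)) (μ₂⁻¹ * (b₂ - min a₁ a₂)))..
      (kineticInv G (μ₁⁻¹ * (b₁ - min a₁ a₂))),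
      timeWeight (fun y => -h (-y)) (fun y => H (-y)) (fun x => -N x) (min a₁ a₂) x ≤ T)
    {γ : ℝ → ℝ × ℝ} (hγ : ContinuousOn γ (Icc 0 1))
    (hγQ : ∀ θ ∈ Icc (0 : ℝ) 1, γ θ ∈ Quadrant.IV.region ∧ H (γ θ).2 + K₁ (γ θ).1 ∈ Icc a₁ b₁)
    (hends : ((γ 0).1 = 0 ∧ (γ 1).2 = 0) ∨ ((γ 0).2 = 0 ∧ (γ 1).1 = 0)) :
    ∃ ζ : ℝ → ℝ × ℝ, ContinuousOn ζ (Icc 0 1) ∧ H (ζ 0).2 + K₂ (ζ 0).1 = a₂ ∧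
      H (ζ 1).2 + K₂ (ζ 1).1 = b₂ ∧
      (∀ θ ∈ Icc (0 : ℝ) 1, ζ θ ∈ Quadrant.III.region ∧ H (ζ θ).2 + K₂ (ζ θ).1 ∈ Icc a₂ b₂) ∧
      IsImagePath (sepField h fun x => -m x) T γ ζ fun z =>
        zeroCount (fun t => (z t).1) (Icc 0 T) = 1 ∧ zeroCount (fun t => (z t).1) (Ioo 0 T) = 1 ∧
        zeroCount (fun t => (z t).2) (Icc 0 T) = 0 ∧
        zeroCount (fun t => (z t).2) (Ioo 0 T) = 0 := by
  have e : ∀ x, timeWeight (fun y => -h (-y)) (fun y => H (-y)) (fun x => -N (-x))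
      (min a₁ a₂) x = timeWeight (fun y => -h (-y)) (fun y => H (-y)) (fun x => -N x)
      (min a₁ a₂) (-x) := fun x => rfl
  obtain ⟨ζ, hζ, h0, h1, h2, h3⟩ := exists_link_across_vertical_axis (γ := fun θ => -γ θ)
    hH.reflect hM.reflect hO.reflect hG.reflect hμ₁ hμ₂ hW₁.reflect hW₂.reflect
    (fun x hx => hK₁ _ ⟨by linarith [hx.2], by linarith [hx.1]⟩)
    (fun x hx => hK₂ _ ⟨by linarith [hx.2], by linarith [hx.1]⟩) hT
    (by
      simp only [e]
      rw [intervalIntegral.integral_comp_neg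
        (fun x => timeWeight (fun y => -h (-y)) (fun y => H (-y)) (fun x => -N x) (min a₁ a₂) x)]
      simpa only [neg_neg] using hint)
    hγ.neg (fun θ hθ => ⟨Quadrant.neg_mem_region.2 (hγQ θ hθ).1, by simpa using (hγQ θ hθ).2⟩)
    (by simpa using hends)
  refine ⟨fun θ => -ζ θ, hζ.neg, h0, h1, fun θ hθ =>
    ⟨(Quadrant.neg_mem_region (κ := .I)).2 (h2 θ hθ).1, (h2 θ hθ).2⟩, h3.reflect fun z hz => ?_⟩
  simpa only [Prod.fst_neg, Prod.snd_neg, zeroCount_neg] using hz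

/-- The link from the second quadrant to the third one. -/
theorem exists_link_across_horizontal_axis_left (hH : IsProperKinetic h H) (hM : IsKinetic m N)
    (hO : IsIsolatedOrigin h fun x => -m x) (hG : IsKinetic g G) (hμ₁ : 0 < μ₁) (hμ₂ : 0 < μ₂)
    (hW₁ : IsWell k₁ K₁ a₁ b₁ xN₁ xP₁) (hW₂ : IsWell k₂ K₂ a₂ b₂ xN₂ xP₂)
    (hK₁ : ∀ x ∈ Icc (xN₁ b₁) (xP₁ b₁), K₁ x = μ₁ * G x - N x)
    (hK₂ : ∀ x ∈ Icc (xN₂ b₂) (xP₂ b₂), K₂ x = μ₂ * G x - N x) (hT : 0 ≤ T) {ξ : ℝ}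
    (hξ : ξ = max (xN₁ a₁) (xN₂ a₂))
    (hint : (∫ x in (-kineticInv (fun x => G (-x)) (μ₁⁻¹ * (b₁ + N ξ)))..ξ,
        timeWeight h H (fun x => -N x) (-N ξ) x) +
      (∫ x in (-kineticInv (fun x => G (-x)) (μ₂⁻¹ * (b₂ + N ξ)))..ξ,
        timeWeight (fun y => -h (-y)) (fun y => H (-y)) (fun x => -N x) (-N ξ) x) ≤ T)
    {γ : ℝ → ℝ × ℝ} (hγ : ContinuousOn γ (Icc 0 1))
    (hγQ : ∀ θ ∈ Icc (0 : ℝ) 1, γ θ ∈ Quadrant.II.region ∧ H (γ θ).2 + K₁ (γ θ).1 ∈ Icc a₁ b₁)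
    (hends : ((γ 0).1 = 0 ∧ (γ 1).2 = 0) ∨ ((γ 0).2 = 0 ∧ (γ 1).1 = 0)) :
    ∃ ζ : ℝ → ℝ × ℝ, ContinuousOn ζ (Icc 0 1) ∧ H (ζ 0).2 + K₂ (ζ 0).1 = a₂ ∧
      H (ζ 1).2 + K₂ (ζ 1).1 = b₂ ∧
      (∀ θ ∈ Icc (0 : ℝ) 1, ζ θ ∈ Quadrant.III.region ∧ H (ζ θ).2 + K₂ (ζ θ).1 ∈ Icc a₂ b₂) ∧
      IsImagePath (sepField h fun x => -m x) T γ ζ fun z =>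
        zeroCount (fun t => (z t).1) (Icc 0 T) = 0 ∧ zeroCount (fun t => (z t).1) (Ioo 0 T) = 0 ∧
        zeroCount (fun t => (z t).2) (Icc 0 T) = 1 ∧
        zeroCount (fun t => (z t).2) (Ioo 0 T) = 1 := by
  have e : ∀ h' H' x, timeWeight h' H' (fun x => -N (-x)) (-N ξ) x =
      timeWeight h' H' (fun x => -N x) (-N ξ) (-x) := fun h' H' x => rfl
  obtain ⟨ζ, hζ, h0, h1, h2, h3⟩ := exists_link_across_horizontal_axis (γ := fun θ => -γ θ)
    hH.reflect hM.reflect hO.reflect hG.reflect hμ₁ hμ₂ hW₁.reflect hW₂.reflect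
    (fun x hx => hK₁ _ ⟨by linarith [hx.2], by linarith [hx.1]⟩)
    (fun x hx => hK₂ _ ⟨by linarith [hx.2], by linarith [hx.1]⟩) hT
    (ξ := -ξ) (by rw [hξ, min_neg_neg])
    (by
      simp only [neg_neg, e]
      rw [intervalIntegral.integral_comp_neg
          (fun x => timeWeight (fun y => -h (-y)) (fun y => H (-y)) (fun x => -N x) (-N ξ) x),
        intervalIntegral.integral_comp_neg
          (fun x => timeWeight h H (fun x => -N x) (-N ξ) x), add_comm]
      simpa only [neg_neg] using hint)
    hγ.neg (fun θ hθ => ⟨(Quadrant.neg_mem_region (κ := .II)).2 (hγQ θ hθ).1, by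
      simpa using (hγQ θ hθ).2⟩)
    (by simpa using hends)
  refine ⟨fun θ => -ζ θ, hζ.neg, h0, h1, fun θ hθ =>
    ⟨(Quadrant.neg_mem_region (κ := .I)).2 (h2 θ hθ).1, (h2 θ hθ).2⟩, h3.reflect fun z hz => ?_⟩
  simpa only [Prod.fst_neg, Prod.snd_neg, zeroCount_neg] using hz

end Link


/-! ### Constant extensions -/

section Clamp

variable {f F : ℝ → ℝ} {a b x y : ℝ}

/-- The function which agrees with `f` on `[a, b]` and is constant on both sides. -/
noncomputable def clampTo (a b : ℝ) (f : ℝ → ℝ) (x : ℝ) : ℝ := f (max a (min b x))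

/-- The primitive of `clampTo a b f` which vanishes at the origin. -/
noncomputable def clampPrimitive (a b : ℝ) (f : ℝ → ℝ) (x : ℝ) : ℝ :=
  ∫ r in (0 : ℝ)..x, clampTo a b f r

theorem clampTo_of_mem (hx : x ∈ Icc a b) : clampTo a b f x = f x := by
  rw [clampTo, min_eq_right hx.2, max_eq_right hx.1]

theorem clampTo_of_ge (hab : a ≤ b) (hx : b ≤ x) : clampTo a b f x = f b := by
  rw [clampTo, min_eq_left hx, max_eq_right hab]

theorem clampTo_of_le (hab : a ≤ b) (hx : x ≤ a) : clampTo a b f x = f a := by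
  rw [clampTo, min_eq_right (hx.trans hab), max_eq_left hx]

theorem continuous_clampTo (hab : a ≤ b) (hf : ContinuousOn f (Icc a b)) :
    Continuous (clampTo a b f) :=
  hf.comp_continuous (by fun_prop) fun x => ⟨le_max_left _ _, max_le hab (min_le_left _ _)⟩

theorem hasDerivAt_clampPrimitive (hab : a ≤ b) (hf : ContinuousOn f (Icc a b)) (x : ℝ) :
    HasDerivAt (clampPrimitive a b f) (clampTo a b f x) x :=
  (continuous_clampTo hab hf).integral_hasStrictDerivAt 0 x |>.hasDerivAt

theorem clampPrimitive_zero : clampPrimitive a b f 0 = 0 := intervalIntegral.integral_same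

theorem clampPrimitive_of_mem (ha : a ≤ 0) (hb : 0 ≤ b) (hx : x ∈ Icc a b) :
    clampPrimitive a b f x = ∫ r in (0 : ℝ)..x, f r :=
  intervalIntegral.integral_congr fun _ hr =>
    clampTo_of_mem (ordConnected_Icc.uIcc_subset ⟨ha, hb⟩ hx hr)

theorem clampPrimitive_of_ge (hab : a ≤ b) (hf : ContinuousOn f (Icc a b)) (hx : b ≤ x) :
    clampPrimitive a b f x = clampPrimitive a b f b + (x - b) * f b := by
  have hi := (continuous_clampTo hab hf).intervalIntegrable (μ := volume)
  rw [clampPrimitive, ← intervalIntegral.integral_add_adjacent_intervals (hi 0 b) (hi b x),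
    clampPrimitive, intervalIntegral.integral_congr (g := fun _ => f b) (a := b) (b := x),
    intervalIntegral.integral_const, smul_eq_mul]
  intro r hr
  rw [uIcc_of_le hx] at hr
  exact clampTo_of_ge hab hr.1

theorem clampPrimitive_of_le (hab : a ≤ b) (hf : ContinuousOn f (Icc a b)) (hx : x ≤ a) :
    clampPrimitive a b f x = clampPrimitive a b f a + (x - a) * f a := by
  have hi := (continuous_clampTo hab hf).intervalIntegrable (μ := volume)
  rw [clampPrimitive, ← intervalIntegral.integral_add_adjacent_intervals (hi 0 a) (hi a x),
    clampPrimitive, intervalIntegral.integral_congr (g := fun _ => f a) (a := a) (b := x),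
    intervalIntegral.integral_const, smul_eq_mul]
  intro r hr
  rw [uIcc_of_ge hx] at hr
  exact clampTo_of_le hab hr.2

/-- Outside `[a, b]` the primitive is affine with nonzero slope, so it is unbounded on both sides
while its derivative stays bounded. Hence every energy level is attained and trajectories cannot
escape in finite time. -/
theorem isProperKinetic_clamp (ha : a < 0) (hb : 0 < b) (hf : ContinuousOn f (Icc a b))
    (hpos : ∀ y ∈ Ioc 0 b, 0 < f y) (hneg : ∀ y ∈ Ico a 0, f y < 0) :
    IsProperKinetic (clampTo a b f) (clampPrimitive a b f) := by
  have hab := (ha.trans hb).le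
  have hK : IsKinetic (clampTo a b f) (clampPrimitive a b f) :=
    { continuous := continuous_clampTo hab hf
      pos := fun y hy => hpos _ ⟨lt_max_of_lt_right (lt_min hb hy), max_le hab (min_le_left _ _)⟩
      neg := fun y hy => hneg _ ⟨le_max_left _ _, max_lt ha (min_lt_of_right_lt hy)⟩
      hasDerivAt := hasDerivAt_clampPrimitive hab hf
      map_zero := clampPrimitive_zero }
  refine ⟨hK, ?_, fun v => ?_, fun v => ?_⟩
  · obtain ⟨M, hM⟩ := isCompact_Icc.exists_bound_of_continuousOn hf
    exact ⟨M, fun y => hM _ ⟨le_max_left _ _, max_le hab (min_le_left _ _)⟩⟩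
  · have hfb := hpos b ⟨hb, le_rfl⟩
    have hv : 0 ≤ |v| / f b := div_nonneg (abs_nonneg _) hfb.le
    -- Past `b` the slope is `f b`, so the length `|v| / f b` adds exactly `|v|`.
    refine ⟨b + |v| / f b, by linarith, ?_⟩
    rw [clampPrimitive_of_ge hab hf (by linarith), add_sub_cancel_left, div_mul_cancel₀ _ hfb.ne']
    linarith [hK.primitive_nonneg b, le_abs_self v]
  · have hfa := hneg a ⟨le_rfl, ha⟩
    have hv : |v| / f a ≤ 0 := div_nonpos_of_nonneg_of_nonpos (abs_nonneg _) hfa.le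
    refine ⟨a + |v| / f a, by linarith, ?_⟩
    rw [clampPrimitive_of_le hab hf (by linarith), add_sub_cancel_left, div_mul_cancel₀ _ hfa.ne]
    linarith [hK.primitive_nonneg a, le_abs_self v]

end Clamp

/-! ### From regular levels to a well -/

section Well

variable {k K : ℝ → ℝ} {c₁ c₂ : ℝ} {xN xP : ℝ → ℝ}

theorem le_of_regular_levels
    (hP : ∀ c ∈ Icc c₁ c₂, 0 < xP c) (hPc : ∀ c ∈ Icc c₁ c₂, K (xP c) = c)
    (hlt : ∀ c ∈ Icc c₁ c₂, ∀ x ∈ Ico 0 (xP c), K x < c) {c : ℝ} (hc : c ∈ Icc c₁ c₂) :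
    xP c ≤ xP c₂ := by
  have hc₂ : c₂ ∈ Icc c₁ c₂ := ⟨hc.1.trans hc.2, le_rfl⟩
  by_contra! h
  have := hlt c hc _ ⟨(hP c₂ hc₂).le, h⟩
  rw [hPc c₂ hc₂] at this
  exact this.not_ge hc.2

/-- `K` rises above `c` just after `xP c`. If it were again at most `c` at `x`, its maximum over
`[xP c, x]` would be interior, with a value that is itself a level in `[c₁, c₂]`. The first point
`xP` of that level would be a local maximum, contradicting `k > 0` there. -/
theorem gt_of_regular_levels (hK : ∀ x, HasDerivAt K (k x) x)
    (hP : ∀ c ∈ Icc c₁ c₂, 0 < xP c) (hPc : ∀ c ∈ Icc c₁ c₂, K (xP c) = c)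
    (hlt : ∀ c ∈ Icc c₁ c₂, ∀ x ∈ Ico 0 (xP c), K x < c) (hd : ∀ c ∈ Icc c₁ c₂, 0 < k (xP c))
    {c x : ℝ} (hc : c ∈ Icc c₁ c₂) (hx : x ∈ Ioc (xP c) (xP c₂)) : c < K x := by
  have hc₂ : c₂ ∈ Icc c₁ c₂ := ⟨hc.1.trans hc.2, le_rfl⟩
  have hKc : Continuous K := continuous_iff_continuousAt.2 fun x => (hK x).continuousAt
  by_contra! hle
  obtain ⟨M, hM, hMmax⟩ := isCompact_Icc.exists_isMaxOn (nonempty_Icc.2 hx.1.le)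
    (hKc.continuousOn (s := Icc (xP c) x))
  -- the maximum is larger than `c`
  have hcM : c < K M := by
    have hev : ∀ᶠ y in 𝓝[>] (xP c), K (xP c) < K y := by
      have := (hasDerivAt_iff_tendsto_slope.1 (hK (xP c))).eventually_const_lt (hd c hc)
      have h2 : ∀ᶠ y in 𝓝[>] (xP c), 0 < slope K (xP c) y :=
        this.filter_mono (nhdsWithin_mono _ fun y hy => ne_of_gt hy)
      filter_upwards [h2, self_mem_nhdsWithin] with y hy hyc
      exact (slope_pos_iff_of_le (le_of_lt hyc)).1 hy
    obtain ⟨y, hy, hyx⟩ := (hev.and (Ioc_mem_nhdsGT hx.1)).exists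
    rw [hPc c hc] at hy
    exact hy.trans_le (hMmax ⟨hyx.1.le, hyx.2⟩)
  have hxlt : x < xP c₂ := by
    refine lt_of_le_of_ne hx.2 fun h => ?_
    rw [h, hPc c₂ hc₂] at hle
    have := hle.antisymm hc.2
    rw [← this] at hx
    exact absurd hx.1 (not_lt.2 hx.2)
  have hM0 : 0 < M := (hP c hc).trans_le hM.1
  have hMx : M < x := lt_of_le_of_ne hM.2 (by rintro rfl; linarith)
  have hMc₂ : K M < c₂ := hlt c₂ hc₂ M ⟨hM0.le, hMx.trans hxlt⟩
  have hC : K M ∈ Icc c₁ c₂ := ⟨hc.1.trans hcM.le, hMc₂.le⟩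
  have hM' : xP (K M) ≤ M := by
    by_contra! h
    exact lt_irrefl _ (hlt _ hC M ⟨hM0.le, h⟩)
  have hM'' : xP c < xP (K M) := by
    by_contra! h
    rcases h.eq_or_lt with h | h
    · have := hPc _ hC
      rw [h, hPc c hc] at this
      linarith
    · have := hlt c hc _ ⟨(hP _ hC).le, h⟩
      rw [hPc _ hC] at this
      linarith
  have hloc : IsLocalMax K (xP (K M)) := by
    filter_upwards [Ioo_mem_nhds hM'' (hM'.trans_lt hMx)] with y hy
    rw [hPc _ hC]
    exact hMmax ⟨hy.1.le, hy.2.le⟩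
  have := hloc.hasDerivAt_eq_zero (hK _)
  linarith [hd _ hC]

/-- A family of regular levels defines a well, after `k` has been extended by constants. -/
theorem isWell_clamp (hk : Continuous k) (hK : ∀ x, HasDerivAt K (k x) x) (h0 : K 0 = 0)
    (hc₁ : 0 < c₁) (hc₁₂ : c₁ < c₂)
    (hN : ∀ c ∈ Icc c₁ c₂, xN c < 0) (hP : ∀ c ∈ Icc c₁ c₂, 0 < xP c)
    (hNc : ∀ c ∈ Icc c₁ c₂, K (xN c) = c) (hPc : ∀ c ∈ Icc c₁ c₂, K (xP c) = c)
    (hlt : ∀ c ∈ Icc c₁ c₂, ∀ x ∈ Ioo (xN c) (xP c), K x < c)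
    (hdN : ∀ c ∈ Icc c₁ c₂, k (xN c) < 0) (hdP : ∀ c ∈ Icc c₁ c₂, 0 < k (xP c)) :
    IsWell (clampTo (xN c₂) (xP c₂) k) (clampPrimitive (xN c₂) (xP c₂) k) c₁ c₂ xN xP ∧
      ∀ x ∈ Icc (xN c₂) (xP c₂), clampPrimitive (xN c₂) (xP c₂) k x = K x := by
  have hc₂ : c₂ ∈ Icc c₁ c₂ := ⟨hc₁₂.le, le_rfl⟩
  have hab := ((hN c₂ hc₂).trans (hP c₂ hc₂)).le
  have hltP : ∀ c ∈ Icc c₁ c₂, ∀ x ∈ Ico 0 (xP c), K x < c := fun c hc x hx =>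
    hlt c hc x ⟨(hN c hc).trans_le hx.1, hx.2⟩
  have hltN : ∀ c ∈ Icc c₁ c₂, ∀ x ∈ Ico 0 (-xN c), K (-x) < c := fun c hc x hx =>
    hlt c hc (-x) ⟨by linarith [hx.2], by linarith [hx.1, hP c hc]⟩
  have hK' : ∀ x, HasDerivAt (fun x => K (-x)) (-k (-x)) x := fun x => by
    have := (hK (-x)).comp x (hasDerivAt_neg x)
    simpa [Function.comp_def] using this
  have hPle : ∀ c ∈ Icc c₁ c₂, xP c ≤ xP c₂ := fun c hc =>
    le_of_regular_levels hP hPc hltP hc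
  have hNle : ∀ c ∈ Icc c₁ c₂, xN c₂ ≤ xN c := fun c hc => neg_le_neg_iff.1
    (le_of_regular_levels (K := fun x => K (-x)) (xP := fun c => -xN c)
      (fun c hc => neg_pos.2 (hN c hc)) (fun c hc => by rw [neg_neg]; exact hNc c hc) hltN hc)
  have heq : ∀ x ∈ Icc (xN c₂) (xP c₂), clampPrimitive (xN c₂) (xP c₂) k x = K x := by
    intro x hx
    rw [clampPrimitive_of_mem (hN c₂ hc₂).le (hP c₂ hc₂).le hx,
      intervalIntegral.integral_eq_sub_of_hasDerivAt (fun r _ => hK r) (hk.intervalIntegrable _ _),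
      h0, sub_zero]
  have hmN : ∀ c ∈ Icc c₁ c₂, xN c ∈ Icc (xN c₂) (xP c₂) := fun c hc =>
    ⟨hNle c hc, (hN c hc).le.trans (hP c₂ hc₂).le⟩
  have hmP : ∀ c ∈ Icc c₁ c₂, xP c ∈ Icc (xN c₂) (xP c₂) := fun c hc =>
    ⟨(hN c₂ hc₂).le.trans (hP c hc).le, hPle c hc⟩
  refine ⟨⟨continuous_clampTo hab hk.continuousOn, hasDerivAt_clampPrimitive hab hk.continuousOn,
    clampPrimitive_zero, hc₁, hc₁₂, hN, hP, fun c hc => by rw [heq _ (hmN c hc), hNc c hc],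
    fun c hc => by rw [heq _ (hmP c hc), hPc c hc],
    fun c hc => by rw [clampTo_of_mem (hmN c hc)]; exact hdN c hc,
    fun c hc => by rw [clampTo_of_mem (hmP c hc)]; exact hdP c hc, fun c hc x hx => ?_,
    fun c hc x hx => ?_, fun c hc x hx => ?_⟩, heq⟩
  · rw [heq x ⟨(hNle c hc).trans hx.1.le, hx.2.le.trans (hPle c hc)⟩]
    exact hlt c hc x hx
  -- Inside the range this is the reflected monotonicity statement; outside, the affine extension
  -- has the favourable slope.
  · rcases le_or_gt (xN c₂) x with h | h
    · rw [heq x ⟨h, hx.le.trans (hmN c hc).2⟩]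
      have := gt_of_regular_levels (xP := fun c => -xN c) hK' (fun c hc => neg_pos.2 (hN c hc))
        (fun c hc => by rw [neg_neg]; exact hNc c hc) hltN
        (fun c hc => by rw [neg_neg]; exact neg_pos.2 (hdN c hc)) hc (x := -x)
        ⟨neg_lt_neg hx, neg_le_neg h⟩
      simpa using this
    · rw [clampPrimitive_of_le hab hk.continuousOn h.le, heq _ (hmN c₂ hc₂), hNc c₂ hc₂]
      nlinarith [hdN c₂ hc₂, hc.2]
  · rcases le_or_gt x (xP c₂) with h | h
    · rw [heq x ⟨(hmP c hc).1.trans hx.le, h⟩]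
      exact gt_of_regular_levels hK hP hPc hltP hdP hc ⟨hx, h⟩
    · rw [clampPrimitive_of_ge hab hk.continuousOn h.le, heq _ (hmP c₂ hc₂), hPc c₂ hc₂]
      nlinarith [hdP c₂ hc₂, hc.2]

end Well

namespace SwitchedProblem

variable {m : ℕ} (P : SwitchedProblem m)

/-! ### The range of the second phase variable -/

theorem J₂_ordConnected : P.J₂.OrdConnected :=
  (P.J₁_ordConnected.isPreconnected.image _ P.φ_continuousOn).ordConnected

theorem zero_mem_J₂ : (0 : ℝ) ∈ P.J₂ := ⟨0, P.zero_mem_J₁, P.φ_zero⟩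

theorem J₂_isOpen : IsOpen P.J₂ := by
  rw [isOpen_iff_mem_nhds]
  rintro _ ⟨x, hx, rfl⟩
  obtain ⟨ε, hε, hball⟩ := Metric.isOpen_iff.1 P.J₁_isOpen x hx
  have h1 : x - ε / 2 ∈ P.J₁ := hball (by
    rw [Metric.mem_ball, Real.dist_eq, abs_lt]; constructor <;> linarith)
  have h2 : x + ε / 2 ∈ P.J₁ := hball (by
    rw [Metric.mem_ball, Real.dist_eq, abs_lt]; constructor <;> linarith)
  exact mem_of_superset (Icc_mem_nhds (P.φ_strictMonoOn h1 hx (by linarith))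
    (P.φ_strictMonoOn hx h2 (by linarith)))
    (P.J₂_ordConnected.out (mem_image_of_mem _ h1) (mem_image_of_mem _ h2))

theorem h_mem {y : ℝ} (hy : y ∈ P.J₂) : P.h y ∈ P.J₁ := Function.invFunOn_mem hy

theorem φ_h {y : ℝ} (hy : y ∈ P.J₂) : P.φ (P.h y) = y := Function.invFunOn_eq hy

theorem h_φ {x : ℝ} (hx : x ∈ P.J₁) : P.h (P.φ x) = x :=
  P.φ_strictMonoOn.injOn.leftInvOn_invFunOn hx

theorem h_strictMonoOn : StrictMonoOn P.h P.J₂ := fun y hy y' hy' hlt =>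
  (P.φ_strictMonoOn.lt_iff_lt (P.h_mem hy) (P.h_mem hy')).1 (by rwa [P.φ_h hy, P.φ_h hy'])

theorem h_zero : P.h 0 = 0 := by
  have := P.h_φ P.zero_mem_J₁
  rwa [P.φ_zero] at this

theorem h_continuousOn : ContinuousOn P.h P.J₂ := by
  intro y hy
  refine (P.h_strictMonoOn.continuousAt_of_image_mem_nhds
    (P.J₂_isOpen.mem_nhds hy) ?_).continuousWithinAt
  exact mem_of_superset (P.J₁_isOpen.mem_nhds (P.h_mem hy)) fun x hx =>
    ⟨P.φ x, mem_image_of_mem _ hx, P.h_φ hx⟩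

theorem h_pos {y : ℝ} (hy : y ∈ P.J₂) (h0 : 0 < y) : 0 < P.h y := by
  have := P.h_strictMonoOn P.zero_mem_J₂ hy h0
  rwa [P.h_zero] at this

theorem h_neg {y : ℝ} (hy : y ∈ P.J₂) (h0 : y < 0) : P.h y < 0 := by
  have := P.h_strictMonoOn hy P.zero_mem_J₂ h0
  rwa [P.h_zero] at this

theorem H_hasDerivAt {y : ℝ} (hy : y ∈ P.J₂) : HasDerivAt P.H (P.h y) y := by
  have hsub := P.J₂_ordConnected.uIcc_subset P.zero_mem_J₂ hy
  exact intervalIntegral.integral_hasDerivAt_right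
    (P.h_continuousOn.mono hsub).intervalIntegrable
    (P.h_continuousOn.stronglyMeasurableAtFilter P.J₂_isOpen y hy)
    (P.h_continuousOn.continuousAt (P.J₂_isOpen.mem_nhds hy))

theorem H_zero : P.H 0 = 0 := intervalIntegral.integral_same

theorem H_strictMonoOn : StrictMonoOn P.H (P.J₂ ∩ Ici 0) := by
  refine strictMonoOn_of_deriv_pos (P.J₂_ordConnected.inter ordConnected_Ici).convex
    (fun y hy => (P.H_hasDerivAt hy.1).continuousAt.continuousWithinAt) fun y hy => ?_
  rw [interior_inter, interior_Ici] at hy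
  have hy1 := interior_subset hy.1
  rw [(P.H_hasDerivAt hy1).deriv]
  exact P.h_pos hy1 hy.2

theorem H_strictAntiOn : StrictAntiOn P.H (P.J₂ ∩ Iic 0) := by
  refine strictAntiOn_of_deriv_neg (P.J₂_ordConnected.inter ordConnected_Iic).convex
    (fun y hy => (P.H_hasDerivAt hy.1).continuousAt.continuousWithinAt) fun y hy => ?_
  rw [interior_inter, interior_Iic] at hy
  have hy1 := interior_subset hy.1
  rw [(P.H_hasDerivAt hy1).deriv]
  exact P.h_neg hy1 hy.2

theorem G_isKinetic : IsKinetic P.g P.G where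
  continuous := P.g_continuous
  pos x hx := pos_of_mul_pos_left (P.g_sign x hx.ne') hx.le
  neg x hx := by
    have := P.g_sign x hx.ne
    by_contra! h
    nlinarith
  hasDerivAt x := (P.g_continuous.integral_hasStrictDerivAt 0 x).hasDerivAt
  map_zero := intervalIntegral.integral_same

theorem f_continuous (i : Fin (m + 1)) : Continuous (P.f i) :=
  (continuous_const.mul continuous_id).add (continuous_const.mul P.g_continuous)

theorem F_hasDerivAt (i : Fin (m + 1)) (x : ℝ) : HasDerivAt (P.F i) (P.f i x) x := by
  have := ((hasDerivAt_pow 2 x).const_mul (P.lam / 2)).add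
    ((P.G_isKinetic.hasDerivAt x).const_mul (P.μ i))
  refine this.congr_deriv ?_
  simp only [f]
  push_cast
  ring

theorem F_zero (i : Fin (m + 1)) : P.F i 0 = 0 := by
  simp [F, P.G_isKinetic.map_zero]

/-- Bounds for the second phase variable on all the annuli. -/
theorem exists_strip {c₁ c₂ : Fin (m + 1) → ℝ} (hann : ∀ i, P.IsAnnulus i (c₁ i) (c₂ i)) :
    ∃ ya ∈ P.J₂, ∃ yb ∈ P.J₂, ya < 0 ∧ 0 < yb ∧
      ∀ i, ∀ x ∈ Icc (P.xNeg i (c₂ i)) (P.xPos i (c₂ i)),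
        c₂ i - P.F i x < P.H ya ∧ c₂ i - P.F i x < P.H yb := by
  have key : ∀ i, ∃ ya ∈ P.J₂, ∃ yb ∈ P.J₂, ya < 0 ∧ 0 < yb ∧
      ∀ x ∈ Icc (P.xNeg i (c₂ i)) (P.xPos i (c₂ i)),
        c₂ i - P.F i x < P.H ya ∧ c₂ i - P.F i x < P.H yb := by
    intro i
    obtain ⟨-, hlt, hreg, hB⟩ := hann i
    obtain ⟨hN, hP, -⟩ := hreg (c₂ i) ⟨hlt.le, le_rfl⟩
    have hFc : Continuous (P.F i) :=
      continuous_iff_continuousAt.2 fun x => (P.F_hasDerivAt i x).continuousAt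
    -- At a minimum of `F` the quantity `c₂ - F` is largest, so the bounds obtained there serve the
    -- whole annulus. The outermost bounds over the finitely many annuli then serve all of them.
    obtain ⟨x₀, hx₀, hmin⟩ := isCompact_Icc.exists_isMinOn (nonempty_Icc.2 (hN.trans hP).le)
      (hFc.continuousOn (s := Icc (P.xNeg i (c₂ i)) (P.xPos i (c₂ i))))
    obtain ⟨⟨yb, hyb, hyb0, hb⟩, ya, hya, hya0, ha⟩ := hB x₀ hx₀
    refine ⟨ya, hya, yb, hyb, hya0, hyb0, fun x hx => ?_⟩
    have : P.F i x₀ ≤ P.F i x := hmin hx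
    constructor <;> linarith
  choose ya hya yb hyb hya0 hyb0 hlt using key
  obtain ⟨i₁, h₁⟩ := Finite.exists_min ya
  obtain ⟨i₂, h₂⟩ := Finite.exists_max yb
  refine ⟨ya i₁, hya i₁, yb i₂, hyb i₂, hya0 i₁, hyb0 i₂, fun i x hx => ⟨?_, ?_⟩⟩
  · exact (hlt i x hx).1.trans_le (P.H_strictAntiOn.antitoneOn ⟨hya i₁, (hya0 i₁).le⟩
      ⟨hya i, (hya0 i).le⟩ (h₁ i))
  · exact (hlt i x hx).2.trans_le (P.H_strictMonoOn.monotoneOn ⟨hyb i, (hyb0 i).le⟩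
      ⟨hyb i₂, (hyb0 i₂).le⟩ (h₂ i))

end SwitchedProblem


/-! ### The system cut off outside the annuli -/

namespace SwitchedProblem

variable {m : ℕ} (P : SwitchedProblem m)

/-- The levels define annuli, which lie in the strip `ya < y < yb`. -/
structure IsStrip (c₁ c₂ : Fin (m + 1) → ℝ) (ya yb : ℝ) : Prop where
  annulus : ∀ i, P.IsAnnulus i (c₁ i) (c₂ i)
  ya_mem : ya ∈ P.J₂
  yb_mem : yb ∈ P.J₂
  ya_neg : ya < 0
  yb_pos : 0 < yb
  lt : ∀ i, ∀ x ∈ Icc (P.xNeg i (c₂ i)) (P.xPos i (c₂ i)),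
    c₂ i - P.F i x < P.H ya ∧ c₂ i - P.F i x < P.H yb

/-- `h` extended by constants outside of the strip. -/
noncomputable def hCut (ya yb : ℝ) : ℝ → ℝ := clampTo ya yb P.h

theorem hCut_eq {ya yb y : ℝ} (hy : y ∈ Icc ya yb) : P.hCut ya yb y = P.h y := clampTo_of_mem hy

/-- The primitive of `hCut`. -/
noncomputable def HCut (ya yb : ℝ) : ℝ → ℝ := clampPrimitive ya yb P.h

/-- `f_i` extended by constants outside of the range of the annulus. -/
noncomputable def fCut (c₂ : Fin (m + 1) → ℝ) (i : Fin (m + 1)) : ℝ → ℝ :=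
  clampTo (P.xNeg i (c₂ i)) (P.xPos i (c₂ i)) (P.f i)

/-- The primitive of `fCut`. -/
noncomputable def FCut (c₂ : Fin (m + 1) → ℝ) (i : Fin (m + 1)) : ℝ → ℝ :=
  clampPrimitive (P.xNeg i (c₂ i)) (P.xPos i (c₂ i)) (P.f i)

/-- The Hamiltonian of the cut off system. -/
noncomputable def hamCut (c₂ : Fin (m + 1) → ℝ) (ya yb : ℝ) (i : Fin (m + 1)) (p : ℝ × ℝ) : ℝ :=
  P.HCut ya yb p.2 + P.FCut c₂ i p.1

namespace IsStrip

variable {P} {c₁ c₂ : Fin (m + 1) → ℝ} {ya yb : ℝ} (S : P.IsStrip c₁ c₂ ya yb)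
include S

theorem Icc_subset : Icc ya yb ⊆ P.J₂ := P.J₂_ordConnected.out S.ya_mem S.yb_mem

theorem isProperKinetic : IsProperKinetic (P.hCut ya yb) (P.HCut ya yb) :=
  isProperKinetic_clamp S.ya_neg S.yb_pos (P.h_continuousOn.mono S.Icc_subset)
    (fun _ hy => P.h_pos (S.Icc_subset ⟨S.ya_neg.le.trans hy.1.le, hy.2⟩) hy.1)
    fun _ hy => P.h_neg (S.Icc_subset ⟨hy.1, hy.2.le.trans S.yb_pos.le⟩) hy.2

theorem HCut_eq {y : ℝ} (hy : y ∈ Icc ya yb) : P.HCut ya yb y = P.H y :=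
  clampPrimitive_of_mem S.ya_neg.le S.yb_pos.le hy

theorem isWell_and_FCut_eq (i : Fin (m + 1)) :
    IsWell (P.fCut c₂ i) (P.FCut c₂ i) (c₁ i) (c₂ i) (P.xNeg i) (P.xPos i) ∧
      ∀ x ∈ Icc (P.xNeg i (c₂ i)) (P.xPos i (c₂ i)), P.FCut c₂ i x = P.F i x := by
  obtain ⟨h1, h2, h3, -⟩ := S.annulus i
  exact isWell_clamp (P.f_continuous i) (P.F_hasDerivAt i) (P.F_zero i) h1 h2
    (fun c hc => (h3 c hc).1) (fun c hc => (h3 c hc).2.1) (fun c hc => (h3 c hc).2.2.1)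
    (fun c hc => (h3 c hc).2.2.2.1) (fun c hc => (h3 c hc).2.2.2.2.1)
    (fun c hc => (h3 c hc).2.2.2.2.2.1) (fun c hc => (h3 c hc).2.2.2.2.2.2)

theorem isWell (i : Fin (m + 1)) :
    IsWell (P.fCut c₂ i) (P.FCut c₂ i) (c₁ i) (c₂ i) (P.xNeg i) (P.xPos i) :=
  (S.isWell_and_FCut_eq i).1

theorem FCut_eq {i : Fin (m + 1)} {x : ℝ} (hx : x ∈ Icc (P.xNeg i (c₂ i)) (P.xPos i (c₂ i))) :
    P.FCut c₂ i x = P.F i x :=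
  (S.isWell_and_FCut_eq i).2 x hx

theorem c₁_mem (i : Fin (m + 1)) : c₁ i ∈ Icc (c₁ i) (c₂ i) := ⟨le_rfl, (S.annulus i).2.1.le⟩

theorem c₂_mem (i : Fin (m + 1)) : c₂ i ∈ Icc (c₁ i) (c₂ i) := ⟨(S.annulus i).2.1.le, le_rfl⟩

theorem zero_mem (i : Fin (m + 1)) : (0 : ℝ) ∈ Icc (P.xNeg i (c₂ i)) (P.xPos i (c₂ i)) :=
  ⟨((S.isWell i).xN_neg _ (S.c₂_mem i)).le, ((S.isWell i).xP_pos _ (S.c₂_mem i)).le⟩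

theorem c₂_lt (i : Fin (m + 1)) : c₂ i < P.H ya ∧ c₂ i < P.H yb := by
  simpa [P.F_zero] using S.lt i 0 (S.zero_mem i)

theorem continuous_hamCut (i : Fin (m + 1)) : Continuous (P.hamCut c₂ ya yb i) :=
  (S.isProperKinetic.continuous_primitive.comp continuous_snd).add
    ((continuous_iff_continuousAt.2 fun x => ((S.isWell i).hasDerivAt x).continuousAt).comp
      continuous_fst)

/-- Where the modified Hamiltonian is at most `c₂`, nothing was modified: the well bounds `x`, and
then `H(y) ≤ c₂ - F(x)` is smaller than the values of `H` at both edges of the strip. -/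
theorem mem_of_hamCut_le {i : Fin (m + 1)} {p : ℝ × ℝ} (hp : P.hamCut c₂ ya yb i p ≤ c₂ i) :
    p.1 ∈ Icc (P.xNeg i (c₂ i)) (P.xPos i (c₂ i)) ∧ p.2 ∈ Ioo ya yb := by
  have hK := S.isProperKinetic
  rw [hamCut] at hp
  have hx : p.1 ∈ Icc (P.xNeg i (c₂ i)) (P.xPos i (c₂ i)) :=
    (S.isWell i).mem_Icc_of_le (S.c₂_mem i) (by linarith [hK.primitive_nonneg p.2])
  obtain ⟨h1, h2⟩ := S.lt i _ hx
  rw [S.FCut_eq hx] at hp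
  rw [← S.HCut_eq ⟨le_rfl, S.ya_neg.le.trans S.yb_pos.le⟩] at h1
  rw [← S.HCut_eq ⟨S.ya_neg.le.trans S.yb_pos.le, le_rfl⟩] at h2
  refine ⟨hx, ?_, ?_⟩
  · by_contra! h
    have := (hK.reflect.strictMonoOn.le_iff_le (neg_nonneg.2 S.ya_neg.le)
      (neg_nonneg.2 (h.trans S.ya_neg.le))).2 (neg_le_neg h)
    simp only [neg_neg] at this
    linarith
  · by_contra! h
    have := (hK.strictMonoOn.le_iff_le S.yb_pos.le (S.yb_pos.le.trans h)).2 h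
    linarith

/-- The extended potential has no other sublevel components, so the annulus becomes a plain band of
levels and the bounds on `x` and `y` are automatic. -/
theorem mem_annulus_iff {i : Fin (m + 1)} {p : ℝ × ℝ} :
    p ∈ P.annulus i (c₁ i) (c₂ i) ↔ P.hamCut c₂ ya yb i p ∈ Icc (c₁ i) (c₂ i) := by
  constructor
  · rintro ⟨hy, hx, hham⟩
    have hlt := S.lt i _ hx
    have hH : P.H p.2 + P.F i p.1 ≤ c₂ i := hham.2
    have hy' : p.2 ∈ Icc ya yb := by
      constructor
      · by_contra! h
        have := P.H_strictAntiOn ⟨hy, (h.trans S.ya_neg).le⟩ ⟨S.ya_mem, S.ya_neg.le⟩ h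
        linarith
      · by_contra! h
        have := P.H_strictMonoOn ⟨S.yb_mem, S.yb_pos.le⟩ ⟨hy, (S.yb_pos.trans h).le⟩ h
        linarith
    rwa [hamCut, S.HCut_eq hy', S.FCut_eq hx]
  · intro h
    obtain ⟨hx, hy⟩ := S.mem_of_hamCut_le h.2
    have hy' := Ioo_subset_Icc_self hy
    refine ⟨S.Icc_subset hy', hx, ?_⟩
    rwa [hamCut, S.HCut_eq hy', S.FCut_eq hx] at h

theorem hamCut_eq {i : Fin (m + 1)} {p : ℝ × ℝ} (hp : p ∈ P.annulus i (c₁ i) (c₂ i)) :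
    P.hamCut c₂ ya yb i p = P.ham i p := by
  obtain ⟨hx, hy⟩ := S.mem_of_hamCut_le (S.mem_annulus_iff.1 hp).2
  rw [hamCut, S.HCut_eq (Ioo_subset_Icc_self hy), S.FCut_eq hx, ham]

/-! ### Solutions -/

theorem hamCut_flow_eq {i : Fin (m + 1)} {T : ℝ} {z : ℝ → ℝ × ℝ}
    (hz : IsFlowLine (sepField (P.hCut ya yb) (P.fCut c₂ i)) T z) {t : ℝ} (ht : t ∈ Icc 0 T) :
    P.hamCut c₂ ya yb i (z t) = P.hamCut c₂ ya yb i (z 0) :=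
  hz.energy_eq S.isProperKinetic.hasDerivAt (S.isWell i).hasDerivAt ht

/-- Conservation of energy keeps the curve in the sublevel where the cut off fields agree with the
original ones. -/
theorem solvesAutonomous {i : Fin (m + 1)} {T : ℝ} {z : ℝ → ℝ × ℝ}
    (hz : IsFlowLine (sepField (P.hCut ya yb) (P.fCut c₂ i)) T z)
    (h0 : P.hamCut c₂ ya yb i (z 0) ≤ c₂ i) :
    P.SolvesAutonomous (P.f i) T (fun t => (z t).1) fun t => (z t).2 := by
  intro t ht
  obtain ⟨hx, hy⟩ := S.mem_of_hamCut_le ((S.hamCut_flow_eq hz ht).trans_le h0)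
  have hy' := Ioo_subset_Icc_self hy
  refine ⟨S.Icc_subset hy', ?_, ?_⟩
  · rw [← P.hCut_eq hy']
    exact hz.fst ht
  · rw [← show P.fCut c₂ i (z t).1 = P.f i (z t).1 from clampTo_of_mem hx]
    exact hz.snd ht

theorem eqOn_of_isFlowLine {i : Fin (m + 1)} (hN : P.UniqueIVP (P.f i)) {T : ℝ} (hT : 0 ≤ T)
    {z w : ℝ → ℝ × ℝ}
    (hz : IsFlowLine (sepField (P.hCut ya yb) (P.fCut c₂ i)) T z)
    (hw : IsFlowLine (sepField (P.hCut ya yb) (P.fCut c₂ i)) T w) (h0 : z 0 = w 0)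
    (hc : P.hamCut c₂ ya yb i (z 0) ≤ c₂ i) : EqOn z w (Icc 0 T) := by
  obtain ⟨h1, h2⟩ := hN T _ _ _ _ (S.solvesAutonomous hz hc) (S.solvesAutonomous hw (h0 ▸ hc))
    0 ⟨le_rfl, hT⟩ (by rw [h0]) (by rw [h0])
  exact fun t ht => Prod.ext (h1 ht) (h2 ht)

theorem solvesAutonomous_of_mem {k : ℝ → ℝ} {T : ℝ} {z : ℝ → ℝ × ℝ}
    (hz : IsFlowLine (sepField (P.hCut ya yb) k) T z) (hy : ∀ t ∈ Icc 0 T, (z t).2 ∈ Icc ya yb) :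
    P.SolvesAutonomous k T (fun t => (z t).1) fun t => (z t).2 := by
  intro t ht
  refine ⟨S.Icc_subset (hy t ht), ?_, hz.snd ht⟩
  rw [← P.hCut_eq (hy t ht)]
  exact hz.fst ht

/-- For times near that of the visit to the origin the curve stays in the strip, so uniqueness can
be applied against the zero solution; backward, the comparison is made at the right end of a short
interval. -/
theorem isIsolatedOrigin {k : ℝ → ℝ} (hk0 : k 0 = 0) (hk : P.UniqueIVP k) :
    IsIsolatedOrigin (P.hCut ya yb) k := by
  have h00 : ∀ T, P.SolvesAutonomous k T (fun _ => 0) fun _ => 0 := fun T t _ => by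
    rw [P.h_zero, hk0, neg_zero]
    exact ⟨P.zero_mem_J₂, hasDerivWithinAt_const _ _ _, hasDerivWithinAt_const _ _ _⟩
  have hnear : ∀ {T : ℝ} {z : ℝ → ℝ × ℝ} {t₀ : ℝ}, IsFlowLine (sepField (P.hCut ya yb) k) T z →
      t₀ ∈ Icc 0 T → z t₀ = 0 → ∃ ε > 0, ∀ t ∈ Icc 0 T, |t - t₀| < ε → (z t).2 ∈ Icc ya yb := by
    intro T z t₀ hz ht₀ h0
    have hc := (continuous_snd.comp_continuousOn hz.continuousOn) t₀ ht₀
    have : Icc ya yb ∈ 𝓝 ((Prod.snd ∘ z) t₀) := by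
      simp only [Function.comp, h0, Prod.snd_zero]
      exact Icc_mem_nhds S.ya_neg S.yb_pos
    obtain ⟨ε, hε, H⟩ := Metric.mem_nhdsWithin_iff.1 (hc this)
    exact ⟨ε, hε, fun t ht hlt => H ⟨by rwa [Metric.mem_ball, Real.dist_eq], ht⟩⟩
  constructor
  · intro T hT z hz h0
    obtain ⟨ε, hε, H⟩ := hnear hz ⟨le_rfl, hT.le⟩ h0
    have hε' : 0 < min (ε / 2) T := lt_min (half_pos hε) hT
    have hsol := S.solvesAutonomous_of_mem (hz.mono (min_le_right (ε / 2) T)) fun t ht =>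
      H t ⟨ht.1, ht.2.trans (min_le_right _ _)⟩ (by
        rw [sub_zero, abs_of_nonneg ht.1]
        linarith [ht.2.trans (min_le_left _ _)])
    obtain ⟨h1, h2⟩ := hk _ _ _ _ _ hsol (h00 _) 0 ⟨le_rfl, hε'.le⟩ (by rw [h0]; rfl)
      (by rw [h0]; rfl)
    exact ⟨_, hε', min_le_right _ _, fun t ht => Prod.ext (h1 ht) (h2 ht)⟩
  · intro T hT z hz h0
    obtain ⟨ε, hε, H⟩ := hnear hz ⟨hT.le, le_rfl⟩ h0
    have hε' : 0 < min (ε / 2) T := lt_min (half_pos hε) hT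
    have hs : 0 ≤ T - min (ε / 2) T := sub_nonneg.2 (min_le_right _ _)
    have hz' := hz.shift hs
    rw [sub_sub_cancel] at hz'
    have hsol := S.solvesAutonomous_of_mem hz' fun t ht =>
      H _ ⟨by linarith [ht.1], by linarith [ht.2]⟩ (by
        rw [abs_lt]
        constructor <;> linarith [ht.1, ht.2, min_le_left (ε / 2) T])
    obtain ⟨h1, h2⟩ := hk _ _ _ _ _ hsol (h00 _) (min (ε / 2) T) ⟨hε'.le, le_rfl⟩
      (by simp [h0]) (by simp [h0])
    refine ⟨T - min (ε / 2) T, ⟨hs, by linarith⟩, ?_⟩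
    have e1 := h1 ⟨le_rfl, hε'.le⟩
    have e2 := h2 ⟨le_rfl, hε'.le⟩
    simp only [zero_add] at e1 e2
    exact Prod.ext e1 e2

/-! ### Inverse functions and crossing times -/

theorem HinvPos_eq {v : ℝ} (hv : 0 ≤ v) (hvb : v ≤ P.H yb) :
    P.HinvPos v = kineticInv (P.HCut ya yb) v ∧ P.HinvPos v ∈ Icc 0 yb ∧ P.H (P.HinvPos v) = v := by
  rw [← S.HCut_eq ⟨S.ya_neg.le.trans S.yb_pos.le, le_rfl⟩] at hvb
  obtain ⟨hy, hyv⟩ := exists_kineticInv_eq S.isProperKinetic.toIsKinetic hv S.yb_pos.le hvb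
  set y := kineticInv (P.HCut ya yb) v
  have hy' : y ∈ Icc ya yb := ⟨S.ya_neg.le.trans hy.1, hy.2⟩
  rw [S.HCut_eq hy'] at hyv
  have : P.HinvPos (P.H y) = y :=
    P.H_strictMonoOn.injOn.leftInvOn_invFunOn ⟨S.Icc_subset hy', hy.1⟩
  rw [hyv] at this
  rw [this]
  exact ⟨rfl, hy, hyv⟩

theorem HinvNeg_eq {v : ℝ} (hv : 0 ≤ v) (hvb : v ≤ P.H ya) :
    P.HinvNeg v = -kineticInv (fun y => P.HCut ya yb (-y)) v ∧ P.HinvNeg v ∈ Icc ya 0 ∧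
      P.H (P.HinvNeg v) = v := by
  rw [← S.HCut_eq ⟨le_rfl, S.ya_neg.le.trans S.yb_pos.le⟩, ← neg_neg ya] at hvb
  rw [neg_neg] at hvb
  obtain ⟨hy, hyv⟩ := exists_kineticInv_eq S.isProperKinetic.toIsKinetic.reflect (b := -ya) hv
    (neg_nonneg.2 S.ya_neg.le) (by rwa [neg_neg])
  set y := kineticInv (fun y => P.HCut ya yb (-y)) v
  have hy' : -y ∈ Icc ya yb := ⟨by linarith [hy.2], by linarith [hy.1, S.yb_pos]⟩
  rw [S.HCut_eq hy'] at hyv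
  have : P.HinvNeg (P.H (-y)) = -y :=
    P.H_strictAntiOn.injOn.leftInvOn_invFunOn ⟨S.Icc_subset hy', neg_nonpos.2 hy.1⟩
  rw [hyv] at this
  rw [this]
  exact ⟨rfl, ⟨hy'.1, neg_nonpos.2 hy.1⟩, hyv⟩

theorem timeWeight_upper {K : ℝ → ℝ} {c x : ℝ} (hv : 0 ≤ c - K x) (hvb : c - K x ≤ P.H yb) :
    timeWeight (P.hCut ya yb) (P.HCut ya yb) K c x = 1 / P.h (P.HinvPos (c - K x)) := by
  obtain ⟨h1, h2, -⟩ := S.HinvPos_eq hv hvb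
  rw [timeWeight, ← h1, P.hCut_eq ⟨S.ya_neg.le.trans h2.1, h2.2⟩]

theorem timeWeight_lower {K : ℝ → ℝ} {c x : ℝ} (hv : 0 ≤ c - K x) (hvb : c - K x ≤ P.H ya) :
    timeWeight (fun y => -P.hCut ya yb (-y)) (fun y => P.HCut ya yb (-y)) K c x =
      1 / -P.h (P.HinvNeg (c - K x)) := by
  obtain ⟨h1, h2, -⟩ := S.HinvNeg_eq hv hvb
  rw [timeWeight, ← h1, P.hCut_eq ⟨h2.1, h2.2.trans S.yb_pos.le⟩]

/-- On levels between `c₁` and `c₂` the arguments `c - F` stay below the values of `H` at the edges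
of the strip, where the inverse functions of the statement and of the cut off system agree. -/
theorem crossingTime_eq (i : Fin (m + 1)) (κ : Quadrant) {c : ℝ} (hc : c ∈ Icc (c₁ i) (c₂ i)) :
    crossingTime (P.hCut ya yb) (P.HCut ya yb) (P.FCut c₂ i) (P.xNeg i) (P.xPos i) κ c =
      P.quarterTime i κ c := by
  have hW := S.isWell i
  have key : ∀ x ∈ Icc (P.xNeg i c) (P.xPos i c), P.FCut c₂ i x = P.F i x ∧
      0 ≤ c - P.FCut c₂ i x ∧ c - P.FCut c₂ i x ≤ P.H ya ∧ c - P.FCut c₂ i x ≤ P.H yb := by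
    intro x hx
    have h1 := hW.le_of_mem hc hx
    have h2 := hW.mem_Icc_of_le (S.c₂_mem i) (h1.trans hc.2)
    have h3 := S.lt i x h2
    rw [← S.FCut_eq h2] at h3 ⊢
    exact ⟨rfl, by linarith, by linarith [h3.1, hc.2], by linarith [h3.2, hc.2]⟩
  have hN := hW.xN_neg c hc
  have hP := hW.xP_pos c hc
  have kP : ∀ x ∈ uIcc 0 (P.xPos i c), x ∈ Icc (P.xNeg i c) (P.xPos i c) := fun x hx => by
    rw [uIcc_of_le hP.le] at hx
    exact ⟨hN.le.trans hx.1, hx.2⟩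
  have kN : ∀ x ∈ uIcc (P.xNeg i c) 0, x ∈ Icc (P.xNeg i c) (P.xPos i c) := fun x hx => by
    rw [uIcc_of_le hN.le] at hx
    exact ⟨hx.1, hx.2.trans hP.le⟩
  cases κ <;> simp only [crossingTime, quarterTime] <;>
    refine intervalIntegral.integral_congr fun x hx => ?_
  · obtain ⟨h1, h2, h3, h4⟩ := key x (kP x hx)
    simp only [S.timeWeight_upper h2 h4, h1]
  · obtain ⟨h1, h2, h3, h4⟩ := key x (kN x hx)
    simp only [S.timeWeight_upper h2 h4, h1]
  · obtain ⟨h1, h2, h3, h4⟩ := key x (kN x hx)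
    simp only [S.timeWeight_lower h2 h3, h1]
  · obtain ⟨h1, h2, h3, h4⟩ := key x (kP x hx)
    simp only [S.timeWeight_lower h2 h3, h1]

theorem turningTime_eq (i : Fin (m + 1)) {c : ℝ} (hc : c ∈ Icc (c₁ i) (c₂ i)) :
    turningTime (P.hCut ya yb) (P.HCut ya yb) (P.FCut c₂ i) (P.xNeg i) (P.xPos i) c =
      P.period i c := by
  simp only [turningTime, period, S.crossingTime_eq i _ hc]

end IsStrip

end SwitchedProblem


/-! ### The gaps -/

namespace SwitchedProblem

variable {m : ℕ} (P : SwitchedProblem m)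

/-- The restoring energy of the linear system in the gaps; it is positive as `λ < 0`. -/
noncomputable def gapEnergy (x : ℝ) : ℝ := -(P.lam / 2 * x ^ 2)

theorem gapEnergy_isKinetic (hlam : P.lam < 0) :
    IsKinetic (fun x => -(P.lam * x)) P.gapEnergy where
  continuous := by fun_prop
  pos x hx := by nlinarith
  neg x hx := by nlinarith
  hasDerivAt x := by
    have := ((hasDerivAt_pow 2 x).const_mul (P.lam / 2)).neg
    refine this.congr_deriv ?_
    push_cast
    ring
  map_zero := by simp [gapEnergy]

theorem gapEnergy_le (hlam : P.lam < 0) {ξ x : ℝ} (h : ξ ^ 2 ≤ x ^ 2) :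
    P.gapEnergy ξ ≤ P.gapEnergy x := by
  rw [gapEnergy, gapEnergy]
  nlinarith

theorem GinvNeg_eq {v b : ℝ} (hv : 0 ≤ v) (hb : b ≤ 0) (hvb : v ≤ P.G b) :
    P.GinvNeg v = -kineticInv (fun x => P.G (-x)) v := by
  have hG := P.G_isKinetic
  obtain ⟨h1, h2⟩ := exists_kineticInv_eq hG.reflect (b := -b) hv (neg_nonneg.2 hb)
    (by rwa [neg_neg])
  have hinj : InjOn P.G (Iic 0) := fun x hx y hy hxy => neg_injective
    (hG.reflect.strictMonoOn.injOn (show (0 : ℝ) ≤ -x from neg_nonneg.2 hx)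
      (show (0 : ℝ) ≤ -y from neg_nonneg.2 hy) (by simpa using hxy))
  have := hinj.leftInvOn_invFunOn (x := -kineticInv (fun x => P.G (-x)) v) (neg_nonpos.2 h1.1)
  rwa [h2] at this

namespace IsStrip

variable {P} {c₁ c₂ : Fin (m + 1) → ℝ} {ya yb : ℝ} (S : P.IsStrip c₁ c₂ ya yb)
include S

theorem FCut_eq_sub {i : Fin (m + 1)} {x : ℝ}
    (hx : x ∈ Icc (P.xNeg i (c₂ i)) (P.xPos i (c₂ i))) :
    P.FCut c₂ i x = P.μ i * P.G x - P.gapEnergy x := by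
  rw [S.FCut_eq hx, F, gapEnergy]; ring

/-- A gap level line inside the outer boundary satisfies `E + N(x) ≤ c₂ - F(x)`, so its ordinates
remain in the strip. This allows the cut off time weights to replace the original integrands in the
transition times. -/
theorem add_gapEnergy_lt {i : Fin (m + 1)} {E x : ℝ}
    (hx : x ∈ Icc (P.xNeg i (c₂ i)) (P.xPos i (c₂ i))) (hE : E + P.μ i * P.G x ≤ c₂ i) :
    E + P.gapEnergy x ≤ P.H ya ∧ E + P.gapEnergy x ≤ P.H yb := by
  have h1 := S.lt i x hx
  rw [← S.FCut_eq hx, S.FCut_eq_sub hx] at h1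
  constructor <;> linarith [h1.1, h1.2]

/-- The point `x ≥ 0` at which a level line of the gap energy meets the outer boundary. -/
theorem meet_pos (i : Fin (m + 1)) {E : ℝ} (hE : E ≤ c₂ i)
    (hE' : -E ≤ P.gapEnergy (P.xPos i (c₂ i))) :
    0 ≤ P.GinvPos ((P.μ i)⁻¹ * (c₂ i - E)) ∧
      ∀ x ∈ Icc 0 (P.GinvPos ((P.μ i)⁻¹ * (c₂ i - E))),
        E + P.gapEnergy x ≤ P.H ya ∧ E + P.gapEnergy x ≤ P.H yb := by
  have hG := P.G_isKinetic
  have hW := S.isWell i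
  have hμ := P.μ_pos i
  have h0 := S.zero_mem i
  have hK := S.FCut_eq_sub (i := i) (x := P.xPos i (c₂ i)) ⟨h0.1.trans h0.2, le_rfl⟩
  rw [hW.map_xP _ (S.c₂_mem i)] at hK
  obtain ⟨h1, h2⟩ := exists_kineticInv_eq hG (v := (P.μ i)⁻¹ * (c₂ i - E))
    (mul_nonneg (inv_pos.2 hμ).le (by linarith)) h0.2 (by rw [inv_mul_le_iff₀ hμ]; linarith)
  refine ⟨h1.1, fun x hx => S.add_gapEnergy_lt ⟨h0.1.trans hx.1, hx.2.trans h1.2⟩ ?_⟩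
  have := mul_le_mul_of_nonneg_left
    ((hG.strictMonoOn.le_iff_le hx.1 (hx.1.trans hx.2)).2 hx.2) hμ.le
  have h3 : P.μ i * P.G (P.GinvPos ((P.μ i)⁻¹ * (c₂ i - E))) = c₂ i - E := by
    rw [show P.G (P.GinvPos ((P.μ i)⁻¹ * (c₂ i - E))) = _ from h2]; field_simp
  linarith

/-- The point `x ≤ 0` at which a level line of the gap energy meets the outer boundary. -/
theorem meet_neg (i : Fin (m + 1)) {E : ℝ} (hE : E ≤ c₂ i)
    (hE' : -E ≤ P.gapEnergy (P.xNeg i (c₂ i))) :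
    P.GinvNeg ((P.μ i)⁻¹ * (c₂ i - E)) =
        -kineticInv (fun x => P.G (-x)) ((P.μ i)⁻¹ * (c₂ i - E)) ∧
      P.GinvNeg ((P.μ i)⁻¹ * (c₂ i - E)) ≤ 0 ∧
      ∀ x ∈ Icc (P.GinvNeg ((P.μ i)⁻¹ * (c₂ i - E))) 0,
        E + P.gapEnergy x ≤ P.H ya ∧ E + P.gapEnergy x ≤ P.H yb := by
  have hG := P.G_isKinetic
  have hW := S.isWell i
  have hμ := P.μ_pos i
  have h0 := S.zero_mem i
  have hK := S.FCut_eq_sub (i := i) (x := P.xNeg i (c₂ i)) ⟨le_rfl, h0.1.trans h0.2⟩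
  rw [hW.map_xN _ (S.c₂_mem i)] at hK
  have hv : 0 ≤ (P.μ i)⁻¹ * (c₂ i - E) := mul_nonneg (inv_pos.2 hμ).le (by linarith)
  have hvb : (P.μ i)⁻¹ * (c₂ i - E) ≤ P.G (P.xNeg i (c₂ i)) := by
    rw [inv_mul_le_iff₀ hμ]; linarith
  obtain ⟨h1, h2⟩ := exists_kineticInv_eq hG.reflect hv (neg_nonneg.2 h0.1) (by rwa [neg_neg])
  have heq := P.GinvNeg_eq hv h0.1 hvb
  rw [heq]
  refine ⟨rfl, neg_nonpos.2 h1.1, fun x hx => S.add_gapEnergy_lt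
    ⟨by linarith [hx.1, h1.2], hx.2.trans h0.2⟩ ?_⟩
  have := mul_le_mul_of_nonneg_left
    ((hG.reflect.strictMonoOn.le_iff_le (a := -x) (neg_nonneg.2 hx.2) h1.1).2
      (by linarith [hx.1])) hμ.le
  rw [h2, neg_neg] at this
  have h3 : P.μ i * ((P.μ i)⁻¹ * (c₂ i - E)) = c₂ i - E := by field_simp
  linarith

theorem H_yPos {i : Fin (m + 1)} {c : ℝ} (hc : c ∈ Icc (c₁ i) (c₂ i)) :
    P.yPos c ∈ P.J₂ ∩ Ici 0 ∧ P.H (P.yPos c) = c := by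
  obtain ⟨-, h1, h2⟩ := S.HinvPos_eq ((S.annulus i).1.le.trans hc.1) (hc.2.trans (S.c₂_lt i).2.le)
  exact ⟨⟨S.Icc_subset ⟨S.ya_neg.le.trans h1.1, h1.2⟩, h1.1⟩, h2⟩

theorem H_yNeg {i : Fin (m + 1)} {c : ℝ} (hc : c ∈ Icc (c₁ i) (c₂ i)) :
    P.yNeg c ∈ P.J₂ ∩ Iic 0 ∧ P.H (P.yNeg c) = c := by
  obtain ⟨-, h1, h2⟩ := S.HinvNeg_eq ((S.annulus i).1.le.trans hc.1) (hc.2.trans (S.c₂_lt i).1.le)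
  exact ⟨⟨S.Icc_subset ⟨h1.1, h1.2.trans S.yb_pos.le⟩, h1.2⟩, h2⟩

theorem H_yLinkPos (i : Fin m) :
    P.H (P.yLinkPos c₁ i) = min (c₁ i.castSucc) (c₁ i.succ) := by
  obtain ⟨h1, h2⟩ := S.H_yPos (S.c₁_mem i.castSucc)
  obtain ⟨h3, h4⟩ := S.H_yPos (S.c₁_mem i.succ)
  rw [yLinkPos, P.H_strictMonoOn.monotoneOn.map_min h1 h3, h2, h4]

theorem H_yLinkNeg (i : Fin m) :
    P.H (P.yLinkNeg c₁ i) = min (c₁ i.castSucc) (c₁ i.succ) := by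
  obtain ⟨h1, h2⟩ := S.H_yNeg (S.c₁_mem i.castSucc)
  obtain ⟨h3, h4⟩ := S.H_yNeg (S.c₁_mem i.succ)
  rw [yLinkNeg, P.H_strictAntiOn.antitoneOn.map_max h1 h3, h2, h4]

/-- `H` carries the link ordinate to `min` of the inner levels, and up to the points where the link
line meets the outer boundaries the line stays in the strip. The next three transition times are
treated in the same way. -/
theorem timeIItoI_eq (hlam : P.lam < 0) (i : Fin m) :
    P.timeIItoI c₁ c₂ i = ∫ x in
      (-kineticInv (fun x => P.G (-x)) ((P.μ i.castSucc)⁻¹ *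
        (c₂ i.castSucc - min (c₁ i.castSucc) (c₁ i.succ))))..
      (kineticInv P.G ((P.μ i.succ)⁻¹ * (c₂ i.succ - min (c₁ i.castSucc) (c₁ i.succ)))),
      timeWeight (P.hCut ya yb) (P.HCut ya yb) (fun x => -P.gapEnergy x)
        (min (c₁ i.castSucc) (c₁ i.succ)) x := by
  have hM := P.gapEnergy_isKinetic hlam
  rw [timeIItoI, meetNegY, meetPosY, S.H_yLinkPos, (S.H_yPos (S.c₂_mem _)).2,
    (S.H_yPos (S.c₂_mem _)).2]
  set E := min (c₁ i.castSucc) (c₁ i.succ)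
  have hE : 0 < E := lt_min (S.annulus _).1 (S.annulus _).1
  obtain ⟨hp, hp0, hpr⟩ := S.meet_neg i.castSucc (E := E)
    ((min_le_left _ _).trans (S.annulus _).2.1.le)
    (by linarith [hM.primitive_nonneg (P.xNeg i.castSucc (c₂ i.castSucc))])
  obtain ⟨hq0, hqr⟩ := S.meet_pos i.succ (E := E)
    ((min_le_right _ _).trans (S.annulus _).2.1.le)
    (by linarith [hM.primitive_nonneg (P.xPos i.succ (c₂ i.succ))])
  rw [← hp]
  refine intervalIntegral.integral_congr fun x hx => ?_
  rw [uIcc_of_le (hp0.trans hq0)] at hx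
  have hub : E + P.gapEnergy x ≤ P.H yb := by
    rcases le_total x 0 with h | h
    · exact (hpr x ⟨hx.1, h⟩).2
    · exact (hqr x ⟨h, hx.2⟩).2
  have hnn := hM.primitive_nonneg x
  rw [S.timeWeight_upper (by linarith) (by linarith)]
  simp only [gapEnergy, neg_neg]

theorem timeIVtoIII_eq (hlam : P.lam < 0) (i : Fin m) :
    P.timeIVtoIII c₁ c₂ i = ∫ x in
      (-kineticInv (fun x => P.G (-x)) ((P.μ i.succ)⁻¹ *
        (c₂ i.succ - min (c₁ i.castSucc) (c₁ i.succ))))..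
      (kineticInv P.G ((P.μ i.castSucc)⁻¹ *
        (c₂ i.castSucc - min (c₁ i.castSucc) (c₁ i.succ)))),
      timeWeight (fun y => -P.hCut ya yb (-y)) (fun y => P.HCut ya yb (-y))
        (fun x => -P.gapEnergy x) (min (c₁ i.castSucc) (c₁ i.succ)) x := by
  have hM := P.gapEnergy_isKinetic hlam
  rw [timeIVtoIII, meetNegY, meetPosY, S.H_yLinkNeg, (S.H_yNeg (S.c₂_mem _)).2,
    (S.H_yNeg (S.c₂_mem _)).2]
  set E := min (c₁ i.castSucc) (c₁ i.succ)
  have hE : 0 < E := lt_min (S.annulus _).1 (S.annulus _).1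
  obtain ⟨hp, hp0, hpr⟩ := S.meet_neg i.succ (E := E)
    ((min_le_right _ _).trans (S.annulus _).2.1.le)
    (by linarith [hM.primitive_nonneg (P.xNeg i.succ (c₂ i.succ))])
  obtain ⟨hq0, hqr⟩ := S.meet_pos i.castSucc (E := E)
    ((min_le_left _ _).trans (S.annulus _).2.1.le)
    (by linarith [hM.primitive_nonneg (P.xPos i.castSucc (c₂ i.castSucc))])
  rw [← hp]
  refine intervalIntegral.integral_congr fun x hx => ?_
  rw [uIcc_of_le (hp0.trans hq0)] at hx
  have hub : E + P.gapEnergy x ≤ P.H ya := by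
    rcases le_total x 0 with h | h
    · exact (hpr x ⟨hx.1, h⟩).1
    · exact (hqr x ⟨h, hx.2⟩).1
  have hnn := hM.primitive_nonneg x
  rw [S.timeWeight_lower (by linarith) (by linarith)]
  simp only [gapEnergy, neg_neg]

/-- The equation `F (xPos c₂) = c₂` eliminates `G (xPos c₂)`, leaving the abscissa at the gap energy
`-gapEnergy ξ`. -/
theorem meetPosX_eq (i : Fin (m + 1)) (ξ : ℝ) :
    P.meetPosX i ξ (c₂ i) = P.GinvPos ((P.μ i)⁻¹ * (c₂ i + P.gapEnergy ξ)) := by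
  have h := (S.isWell i).map_xP _ (S.c₂_mem i)
  have h0 := S.zero_mem i
  rw [S.FCut_eq ⟨h0.1.trans h0.2, le_rfl⟩, F] at h
  have hμ := (P.μ_pos i).ne'
  rw [meetPosX, gapEnergy]
  congr 1
  generalize P.xPos i (c₂ i) = X at h ⊢
  rw [← h]
  field_simp
  ring

theorem meetNegX_eq (i : Fin (m + 1)) (ξ : ℝ) :
    P.meetNegX i ξ (c₂ i) = P.GinvNeg ((P.μ i)⁻¹ * (c₂ i + P.gapEnergy ξ)) := by
  have h := (S.isWell i).map_xN _ (S.c₂_mem i)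
  have h0 := S.zero_mem i
  rw [S.FCut_eq ⟨le_rfl, h0.1.trans h0.2⟩, F] at h
  have hμ := (P.μ_pos i).ne'
  rw [meetNegX, gapEnergy]
  congr 1
  generalize P.xNeg i (c₂ i) = X at h ⊢
  rw [← h]
  field_simp
  ring

theorem lt_GinvPos (hlam : P.lam < 0) (i : Fin (m + 1)) {ξ : ℝ} (h0 : 0 < ξ)
    (hξ : ξ ≤ P.xPos i (c₁ i)) :
    ξ < P.GinvPos ((P.μ i)⁻¹ * (c₂ i + P.gapEnergy ξ)) ∧
      ∀ x ∈ Icc 0 (P.GinvPos ((P.μ i)⁻¹ * (c₂ i + P.gapEnergy ξ))),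
        -P.gapEnergy ξ + P.gapEnergy x ≤ P.H ya ∧ -P.gapEnergy ξ + P.gapEnergy x ≤ P.H yb := by
  have hM := P.gapEnergy_isKinetic hlam
  obtain ⟨h1, h2, -⟩ := (S.isWell i).lt_kineticInv hM P.G_isKinetic (P.μ_pos i)
    (fun x hx => S.FCut_eq_sub hx) h0 hξ
  obtain ⟨-, h3⟩ := S.meet_pos i (E := -P.gapEnergy ξ)
    (by linarith [hM.primitive_nonneg ξ, (S.annulus i).1, (S.annulus i).2.1])
    (by
      rw [neg_neg]
      exact (hM.strictMonoOn.le_iff_le h0.le (h0.trans (h1.trans_le h2)).le).2 (h1.le.trans h2))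
  rw [sub_neg_eq_add] at h3
  exact ⟨h1, h3⟩

theorem GinvNeg_lt (hlam : P.lam < 0) (i : Fin (m + 1)) {ξ : ℝ} (h0 : ξ < 0)
    (hξ : P.xNeg i (c₁ i) ≤ ξ) :
    P.GinvNeg ((P.μ i)⁻¹ * (c₂ i + P.gapEnergy ξ)) =
        -kineticInv (fun x => P.G (-x)) ((P.μ i)⁻¹ * (c₂ i + P.gapEnergy ξ)) ∧
      P.GinvNeg ((P.μ i)⁻¹ * (c₂ i + P.gapEnergy ξ)) < ξ ∧
      ∀ x ∈ Icc (P.GinvNeg ((P.μ i)⁻¹ * (c₂ i + P.gapEnergy ξ))) 0,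
        -P.gapEnergy ξ + P.gapEnergy x ≤ P.H ya ∧ -P.gapEnergy ξ + P.gapEnergy x ≤ P.H yb := by
  have hM := P.gapEnergy_isKinetic hlam
  obtain ⟨h1, h2, -⟩ := (S.isWell i).reflect.lt_kineticInv hM.reflect P.G_isKinetic.reflect
    (P.μ_pos i) (fun x hx => S.FCut_eq_sub ⟨by linarith [hx.2], by linarith [hx.1]⟩)
    (neg_pos.2 h0) (neg_le_neg hξ)
  rw [neg_neg] at h1 h2
  obtain ⟨h3, -, h4⟩ := S.meet_neg i (E := -P.gapEnergy ξ)
    (by linarith [hM.primitive_nonneg ξ, (S.annulus i).1, (S.annulus i).2.1])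
    (by
      rw [neg_neg]
      have := (hM.reflect.strictMonoOn.le_iff_le (a := -ξ) (b := -P.xNeg i (c₂ i))
        (neg_pos.2 h0).le ((neg_pos.2 h0).trans (h1.trans_le h2)).le).2 (h1.le.trans h2)
      simpa using this)
  rw [sub_neg_eq_add] at h3 h4
  exact ⟨h3, by linarith, h4⟩

theorem timeIVtoI_eq (hlam : P.lam < 0) (i : Fin m) :
    P.timeIVtoI c₁ c₂ i =
      (∫ x in (P.xLinkPos c₁ i)..
        (kineticInv P.G ((P.μ i.succ)⁻¹ * (c₂ i.succ + P.gapEnergy (P.xLinkPos c₁ i)))),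
        timeWeight (P.hCut ya yb) (P.HCut ya yb) (fun x => -P.gapEnergy x)
          (-P.gapEnergy (P.xLinkPos c₁ i)) x) +
      ∫ x in (P.xLinkPos c₁ i)..
        (kineticInv P.G ((P.μ i.castSucc)⁻¹ * (c₂ i.castSucc + P.gapEnergy (P.xLinkPos c₁ i)))),
        timeWeight (fun y => -P.hCut ya yb (-y)) (fun y => P.HCut ya yb (-y))
          (fun x => -P.gapEnergy x) (-P.gapEnergy (P.xLinkPos c₁ i)) x := by
  rw [timeIVtoI, S.meetPosX_eq, S.meetPosX_eq]
  have hξ0 : 0 < P.xLinkPos c₁ i :=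
    lt_min ((S.isWell _).xP_pos _ (S.c₁_mem _)) ((S.isWell _).xP_pos _ (S.c₁_mem _))
  have h1 := S.lt_GinvPos hlam i.castSucc hξ0 (min_le_left _ _)
  have h2 := S.lt_GinvPos hlam i.succ hξ0 (min_le_right _ _)
  generalize P.xLinkPos c₁ i = ξ at *
  have e : ∀ x, P.lam / 2 * (ξ ^ 2 - x ^ 2) = -P.gapEnergy ξ - -P.gapEnergy x := fun x => by
    simp only [gapEnergy]; ring
  simp only [e]
  congr 1 <;> refine intervalIntegral.integral_congr fun x hx => ?_
  · rw [uIcc_of_le h2.1.le] at hx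
    have hle := P.gapEnergy_le hlam (show ξ ^ 2 ≤ x ^ 2 by nlinarith [hx.1])
    have hub := (h2.2 x ⟨hξ0.le.trans hx.1, hx.2⟩).2
    exact (S.timeWeight_upper (by linarith) (by linarith)).symm
  · rw [uIcc_of_le h1.1.le] at hx
    have hle := P.gapEnergy_le hlam (show ξ ^ 2 ≤ x ^ 2 by nlinarith [hx.1])
    have hub := (h1.2 x ⟨hξ0.le.trans hx.1, hx.2⟩).1
    exact (S.timeWeight_lower (by linarith) (by linarith)).symm

theorem timeIItoIII_eq (hlam : P.lam < 0) (i : Fin m) :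
    P.timeIItoIII c₁ c₂ i =
      (∫ x in (-kineticInv (fun x => P.G (-x))
          ((P.μ i.castSucc)⁻¹ * (c₂ i.castSucc + P.gapEnergy (P.xLinkNeg c₁ i))))..
        (P.xLinkNeg c₁ i),
        timeWeight (P.hCut ya yb) (P.HCut ya yb) (fun x => -P.gapEnergy x)
          (-P.gapEnergy (P.xLinkNeg c₁ i)) x) +
      ∫ x in (-kineticInv (fun x => P.G (-x))
          ((P.μ i.succ)⁻¹ * (c₂ i.succ + P.gapEnergy (P.xLinkNeg c₁ i))))..
        (P.xLinkNeg c₁ i),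
        timeWeight (fun y => -P.hCut ya yb (-y)) (fun y => P.HCut ya yb (-y))
          (fun x => -P.gapEnergy x) (-P.gapEnergy (P.xLinkNeg c₁ i)) x := by
  rw [timeIItoIII, S.meetNegX_eq, S.meetNegX_eq]
  have hξ0 : P.xLinkNeg c₁ i < 0 :=
    max_lt ((S.isWell _).xN_neg _ (S.c₁_mem _)) ((S.isWell _).xN_neg _ (S.c₁_mem _))
  have h1 := S.GinvNeg_lt hlam i.castSucc hξ0 (le_max_left _ _)
  have h2 := S.GinvNeg_lt hlam i.succ hξ0 (le_max_right _ _)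
  generalize P.xLinkNeg c₁ i = ξ at *
  have e : ∀ x, P.lam / 2 * (ξ ^ 2 - x ^ 2) = -P.gapEnergy ξ - -P.gapEnergy x := fun x => by
    simp only [gapEnergy]; ring
  simp only [e]
  rw [← h1.1, ← h2.1]
  congr 1 <;> refine intervalIntegral.integral_congr fun x hx => ?_
  · rw [uIcc_of_le h1.2.1.le] at hx
    have hle := P.gapEnergy_le hlam (show ξ ^ 2 ≤ x ^ 2 by nlinarith [hx.2])
    have hub := (h1.2.2 x ⟨hx.1, hx.2.trans hξ0.le⟩).2
    exact (S.timeWeight_upper (by linarith) (by linarith)).symm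
  · rw [uIcc_of_le h2.2.1.le] at hx
    have hle := P.gapEnergy_le hlam (show ξ ^ 2 ≤ x ^ 2 by nlinarith [hx.2])
    have hub := (h2.2.2 x ⟨hx.1, hx.2.trans hξ0.le⟩).1
    exact (S.timeWeight_lower (by linarith) (by linarith)).symm

/-- The link from the `i`-th annulus to the next one. -/
theorem exists_link (hlam : P.lam < 0) (hL : P.UniqueIVP fun x => P.lam * x) (i : Fin m)
    (hIItoI : P.timeIItoI c₁ c₂ i ≤ P.gap i) (hIVtoIII : P.timeIVtoIII c₁ c₂ i ≤ P.gap i)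
    (hIVtoI : P.timeIVtoI c₁ c₂ i ≤ P.gap i) (hIItoIII : P.timeIItoIII c₁ c₂ i ≤ P.gap i)
    {κ' κ : Quadrant} (hκ' : κ' = .II ∨ κ' = .IV) (hκ : κ = .I ∨ κ = .III) {γ : ℝ → ℝ × ℝ}
    (hγ : ContinuousOn γ (Icc 0 1))
    (hγQ : ∀ θ ∈ Icc (0 : ℝ) 1, γ θ ∈ κ'.region ∧
      P.hamCut c₂ ya yb i.castSucc (γ θ) ∈ Icc (c₁ i.castSucc) (c₂ i.castSucc))
    (h0 : (γ 0).1 = 0) (h1 : (γ 1).2 = 0) :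
    ∃ ζ : ℝ → ℝ × ℝ, ContinuousOn ζ (Icc 0 1) ∧ P.hamCut c₂ ya yb i.succ (ζ 0) = c₁ i.succ ∧
      P.hamCut c₂ ya yb i.succ (ζ 1) = c₂ i.succ ∧
      (∀ θ ∈ Icc (0 : ℝ) 1, ζ θ ∈ κ.region ∧
        P.hamCut c₂ ya yb i.succ (ζ θ) ∈ Icc (c₁ i.succ) (c₂ i.succ)) ∧
      IsImagePath (sepField (P.hCut ya yb) fun x => P.lam * x) (P.gap i) γ ζ fun z =>
        zeroCount (fun t => (z t).1) (Icc 0 (P.gap i)) = (if κ' = κ.prev then 1 else 0) ∧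
        zeroCount (fun t => (z t).1) (Ioo 0 (P.gap i)) = (if κ' = κ.prev then 1 else 0) ∧
        zeroCount (fun t => (z t).2) (Icc 0 (P.gap i)) = (if κ' = κ.prev then 0 else 1) ∧
        zeroCount (fun t => (z t).2) (Ioo 0 (P.gap i)) = (if κ' = κ.prev then 0 else 1) := by
  have hM := P.gapEnergy_isKinetic hlam
  have hO := S.isIsolatedOrigin (k := fun x => P.lam * x) (mul_zero _) hL
  have efield : (fun x => P.lam * x) = fun x => -(fun x => -(P.lam * x)) x := by
    funext x; rw [neg_neg]
  have hT : 0 ≤ P.gap i := (sub_pos.2 (P.s_lt_t i)).le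
  rw [S.timeIItoI_eq hlam] at hIItoI
  rw [S.timeIVtoIII_eq hlam] at hIVtoIII
  rw [S.timeIVtoI_eq hlam] at hIVtoI
  rw [S.timeIItoIII_eq hlam] at hIItoIII
  rw [efield] at hO ⊢
  have hH := S.isProperKinetic
  have hG := P.G_isKinetic
  have hμ := P.μ_pos
  have hK := fun i x (hx : x ∈ Icc (P.xNeg i (c₂ i)) (P.xPos i (c₂ i))) => S.FCut_eq_sub hx
  rcases hκ' with rfl | rfl <;> rcases hκ with rfl | rfl <;>
    simp only [Quadrant.prev, if_true, reduceCtorEq, if_false]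
  · exact exists_link_across_vertical_axis hH hM hO hG (hμ _) (hμ _) (S.isWell _) (S.isWell _)
      (hK _) (hK _) hT hIItoI hγ hγQ (Or.inl ⟨h0, h1⟩)
  · exact exists_link_across_horizontal_axis_left hH hM hO hG (hμ _) (hμ _) (S.isWell _)
      (S.isWell _) (hK _) (hK _) hT rfl hIItoIII hγ hγQ (Or.inl ⟨h0, h1⟩)
  · exact exists_link_across_horizontal_axis hH hM hO hG (hμ _) (hμ _) (S.isWell _)
      (S.isWell _) (hK _) (hK _) hT rfl hIVtoI hγ hγQ (Or.inl ⟨h0, h1⟩)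
  · exact exists_link_across_vertical_axis_lower hH hM hO hG (hμ _) (hμ _) (S.isWell _)
      (S.isWell _) (hK _) (hK _) hT hIVtoIII hγ hγQ (Or.inl ⟨h0, h1⟩)

end IsStrip

end SwitchedProblem


/-! ### Itineraries -/

theorem zeroCount_congr {u v : ℝ → ℝ} {A : Set ℝ} (h : EqOn u v A) :
    zeroCount u A = zeroCount v A := by
  rw [zeroCount, zeroCount]
  congr 1
  ext r
  exact and_congr_right fun hr => by rw [h hr]

theorem zeroCount_comp_add (u : ℝ → ℝ) (a : ℝ) (A : Set ℝ) :
    zeroCount (fun r => u (a + r)) ((fun r => a + r) ⁻¹' A) = zeroCount u A := by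
  rw [zeroCount, zeroCount, ← (add_right_injective a).encard_image]
  congr 1
  ext r
  simp only [mem_image, mem_ofPred_eq, mem_preimage]
  constructor
  · rintro ⟨s, hs, rfl⟩
    exact hs
  · exact fun hr => ⟨r - a, by simpa using hr, by simp⟩

theorem zeroCount_Icc_comp_add (u : ℝ → ℝ) (a b : ℝ) :
    zeroCount (fun r => u (a + r)) (Icc 0 (b - a)) = zeroCount u (Icc a b) := by
  rw [← zeroCount_comp_add u a (Icc a b)]
  simp

theorem zeroCount_Ioo_comp_add (u : ℝ → ℝ) (a b : ℝ) :
    zeroCount (fun r => u (a + r)) (Ioo 0 (b - a)) = zeroCount u (Ioo a b) := by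
  rw [← zeroCount_comp_add u a (Ioo a b)]
  simp

theorem Quadrant.iterate_next_odd (κ : Quadrant) (p : ℕ) : Quadrant.next^[4 * p + 1] κ = κ.next := by
  induction p with
  | zero => rfl
  | succ p ih => rw [show 4 * (p + 1) + 1 = 4 * p + 1 + 4 by ring, iterate_next_add_four, ih]

theorem Quadrant.iterate_next_add_three (κ : Quadrant) (p : ℕ) :
    Quadrant.next^[4 * p + 3] κ = κ.prev := by
  induction p with
  | zero => cases κ <;> rfl
  | succ p ih => rw [show 4 * (p + 1) + 3 = 4 * p + 3 + 4 by ring, iterate_next_add_four, ih]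

namespace Itinerary

variable {m : ℕ} {α β : Fin (m + 1) → ℕ} {κ₀ κL : Quadrant} (w : Itinerary α β κ₀ κL)

theorem exit_eq_next {i : Fin (m + 1)} (h : w.exit i ≠ (w.entry i).prev) :
    w.exit i = (w.entry i).next := by
  revert h
  rcases w.entry_mem i with h1 | h1 <;> rcases w.exit_mem i with h2 | h2 <;> rw [h1, h2] <;>
    simp [Quadrant.prev, Quadrant.next]

/-- The stretched path ends in the sector `2n + 1` counted from the entry quadrant. Modulo four this
is three quadrants further for odd `n`, that is the predecessor, and one further for even `n`. -/
theorem iterate_next_entry (i : Fin (m + 1)) :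
    Quadrant.next^[2 * w.nodes i + 1] (w.entry i) = w.exit i := by
  rw [nodes]
  split_ifs with h
  · rw [show 2 * (2 * (α i + (w.lap i + 1)) - 1) + 1 = 4 * (α i + w.lap i) + 3 by omega,
      Quadrant.iterate_next_add_three, h]
  · rw [show 2 * (2 * (α i + (w.lap i + 1))) + 1 = 4 * (α i + w.lap i + 1) + 1 by ring,
      Quadrant.iterate_next_odd, w.exit_eq_next h]

/-- As the lap runs over its range, `nodes` takes in each parity the values between `2α + 1` and
`2β`, which are the ones provided by the twist condition. -/
theorem le_nodes (i : Fin (m + 1)) : 2 * α i + 1 ≤ w.nodes i := by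
  rw [nodes]
  split_ifs <;> omega

theorem nodes_le (i : Fin (m + 1)) : w.nodes i ≤ 2 * β i := by
  have := (w.lap i).2
  rw [nodes]
  split_ifs <;> omega

end Itinerary

/-- Along a saddle flow, the second coordinate is largest at one of the ends. -/
theorem IsFlowLine.snd_le_of_saddle {h H m N : ℝ → ℝ} {T b : ℝ} {z : ℝ → ℝ × ℝ}
    (hH : IsKinetic h H) (hM : IsKinetic m N) (hz : IsFlowLine (sepField h fun x => -m x) T z)
    (hb : 0 < b) (h0 : (z 0).2 ≤ b) (hT : (z T).2 ≤ b) : ∀ t ∈ Icc 0 T, (z t).2 ≤ b := by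
  intro t ht
  have hyc : ContinuousOn (fun t => (z t).2) (Icc 0 T) :=
    continuous_snd.comp_continuousOn hz.continuousOn
  obtain ⟨r, hr, hmax⟩ := isCompact_Icc.exists_isMaxOn (nonempty_Icc.2 (ht.1.trans ht.2)) hyc
  refine (hmax ht).trans ?_
  by_contra! hlt
  have hr0 : 0 < r := lt_of_le_of_ne hr.1 (by rintro rfl; exact hlt.not_ge h0)
  have hrT : r < T := lt_of_le_of_ne hr.2 (by rintro rfl; exact hlt.not_ge hT)
  have hx : (z r).1 = 0 := by
    have hd := (hz.snd hr).hasDerivAt (Icc_mem_nhds hr0 hrT)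
    have := (hmax.isLocalMax (Icc_mem_nhds hr0 hrT)).hasDerivAt_eq_zero hd
    rw [neg_neg] at this
    by_contra hne
    rcases lt_or_gt_of_ne hne with h | h
    · exact (hM.neg _ h).ne this
    · exact (hM.pos _ h).ne' this
  -- At an interior maximum of `y` one has `x = 0`, and conservation of energy makes `H(y)` minimal
  -- there. As `H` increases on `y > 0`, this forces `y(0) ≥ y(r)`.
  have hge : ∀ s ∈ Icc 0 T, H (z r).2 ≤ H (z s).2 := fun s hs => by
    have h1 := hz.saddle_energy_eq hH hM hr
    rw [← hz.saddle_energy_eq hH hM hs, hx, hM.map_zero] at h1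
    linarith [hM.primitive_nonneg (z s).1]
  have hrpos : 0 < (z r).2 := hb.trans hlt
  have hne : ∀ s ∈ Icc 0 r, (z s).2 ≠ 0 := fun s hs hs0 => by
    have := hge s ⟨hs.1, hs.2.trans hr.2⟩
    rw [hs0, hH.map_zero] at this
    exact this.not_gt (hH.primitive_pos hrpos.ne')
  have hz0 : 0 < (z 0).2 := by
    by_contra! hle
    obtain ⟨s, hs, hs0⟩ := intermediate_value_Icc hr.1 (hyc.mono (Icc_subset_Icc_right hr.2))
      (show (0 : ℝ) ∈ Icc (z 0).2 (z r).2 from ⟨hle, hrpos.le⟩)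
    exact hne s hs hs0
  have := (hH.strictMonoOn.le_iff_le hrpos.le hz0.le).1 (hge 0 ⟨le_rfl, hr.1.trans hr.2⟩)
  exact absurd (this.trans h0) (not_le.2 hlt)

/-! ### Trajectories following an itinerary -/

namespace SwitchedProblem

variable {m : ℕ} (P : SwitchedProblem m)

theorem s_strictMono : StrictMono P.s := Fin.strictMono_iff_lt_succ.2 fun i =>
  (P.s_lt_t i).trans (P.t_lt_s _)

theorem t_strictMono : StrictMono P.t := Fin.strictMono_iff_lt_succ.2 fun i =>
  (P.t_lt_s _).trans (P.s_lt_t i)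

variable (c₁ c₂ : Fin (m + 1) → ℝ) (ya yb : ℝ)

/-- The behaviour on `[t_i, s_i]`, up to a translation of time. -/
structure IsAnnulusPiece (i : Fin (m + 1)) (κ κ' : Quadrant) (n : ℕ) (z : ℝ → ℝ × ℝ) : Prop where
  flow : IsFlowLine (sepField (P.hCut ya yb) (P.fCut c₂ i)) (P.tau i) z
  start_mem : z 0 ∈ κ.region
  end_mem : z (P.tau i) ∈ κ'.region
  ham_mem : P.hamCut c₂ ya yb i (z 0) ∈ Icc (c₁ i) (c₂ i)
  fst_count : zeroCount (fun t => (z t).1) (Ioo 0 (P.tau i)) = n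
  snd_count : zeroCount (fun t => (z t).2) (Icc 0 (P.tau i)) = n + 1

/-- The behaviour on `[s_i, t_{i+1}]`, up to a translation of time. -/
structure IsGapPiece (i : Fin m) (κ' κ : Quadrant) (z : ℝ → ℝ × ℝ) : Prop where
  flow : IsFlowLine (sepField (P.hCut ya yb) fun x => P.lam * x) (P.gap i) z
  counts : zeroCount (fun t => (z t).1) (Icc 0 (P.gap i)) = (if κ' = κ.prev then 1 else 0) ∧
    zeroCount (fun t => (z t).1) (Ioo 0 (P.gap i)) = (if κ' = κ.prev then 1 else 0) ∧
    zeroCount (fun t => (z t).2) (Icc 0 (P.gap i)) = (if κ' = κ.prev then 0 else 1) ∧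
    zeroCount (fun t => (z t).2) (Ioo 0 (P.gap i)) = (if κ' = κ.prev then 0 else 1)

/-- The trajectory `z` follows the itinerary `w` until the time `s_k`. -/
structure FollowsUntil {α β : Fin (m + 1) → ℕ} {κ₀ κL : Quadrant} (w : Itinerary α β κ₀ κL)
    (k : Fin (m + 1)) (z : ℝ → ℝ × ℝ) : Prop where
  annulus : ∀ i ≤ k, P.IsAnnulusPiece c₁ c₂ ya yb i (w.entry i) (w.exit i) (w.nodes i)
    fun r => z (P.t i + r)
  gap : ∀ i : Fin m, i.castSucc < k → P.IsGapPiece ya yb i (w.exit i.castSucc) (w.entry i.succ)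
    fun r => z (P.s i.castSucc + r)

variable {P c₁ c₂ ya yb}

theorem IsAnnulusPiece.congr {i : Fin (m + 1)} {κ κ' : Quadrant} {n : ℕ} {z z' : ℝ → ℝ × ℝ}
    (hz : P.IsAnnulusPiece c₁ c₂ ya yb i κ κ' n z) (h : EqOn z' z (Icc 0 (P.tau i))) :
    P.IsAnnulusPiece c₁ c₂ ya yb i κ κ' n z' := by
  have hT : 0 ≤ P.tau i := (sub_pos.2 (P.t_lt_s i)).le
  refine ⟨hz.flow.congr h, ?_, ?_, ?_, ?_, ?_⟩
  · rw [h ⟨le_rfl, hT⟩]; exact hz.start_mem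
  · rw [h ⟨hT, le_rfl⟩]; exact hz.end_mem
  · rw [h ⟨le_rfl, hT⟩]; exact hz.ham_mem
  · rw [← hz.fst_count]
    exact zeroCount_congr fun r hr => by rw [h (Ioo_subset_Icc_self hr)]
  · rw [← hz.snd_count]
    exact zeroCount_congr fun r hr => by rw [h hr]

theorem IsGapPiece.congr {i : Fin m} {κ' κ : Quadrant} {z z' : ℝ → ℝ × ℝ}
    (hz : P.IsGapPiece ya yb i κ' κ z) (h : EqOn z' z (Icc 0 (P.gap i))) :
    P.IsGapPiece ya yb i κ' κ z' := by
  have h1 : EqOn (fun t => (z' t).1) (fun t => (z t).1) (Icc 0 (P.gap i)) := fun r hr => by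
    simp only [h hr]
  have h2 : EqOn (fun t => (z' t).2) (fun t => (z t).2) (Icc 0 (P.gap i)) := fun r hr => by
    simp only [h hr]
  refine ⟨hz.flow.congr h, ?_⟩
  rw [zeroCount_congr h1, zeroCount_congr h2, zeroCount_congr (h1.mono Ioo_subset_Icc_self),
    zeroCount_congr (h2.mono Ioo_subset_Icc_self)]
  exact hz.counts

section Glue

variable {α β : Fin (m + 1) → ℕ} {κ₀ κL : Quadrant} {w : Itinerary α β κ₀ κL}

/-- Continuation of a trajectory through a gap and the next annulus. -/
theorem FollowsUntil.extend {k : Fin m} {z v u : ℝ → ℝ × ℝ}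
    (hz : P.FollowsUntil c₁ c₂ ya yb w k.castSucc z)
    (hv : P.IsGapPiece ya yb k (w.exit k.castSucc) (w.entry k.succ) v)
    (hu : P.IsAnnulusPiece c₁ c₂ ya yb k.succ (w.entry k.succ) (w.exit k.succ) (w.nodes k.succ) u)
    (hzv : z (P.s k.castSucc) = v 0) (hvu : v (P.gap k) = u 0) :
    ∃ z', P.FollowsUntil c₁ c₂ ya yb w k.succ z' ∧ z' 0 = z 0 ∧
      z' (P.s k.succ) = u (P.tau k.succ) := by
  have hst := P.s_lt_t k
  have hts := P.t_lt_s k.succ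
  have h0 : 0 < P.s k.castSucc := by
    have := (P.t_strictMono.monotone (Fin.zero_le k.castSucc)).trans_lt (P.t_lt_s k.castSucc)
    rwa [P.t_zero] at this
  let z' : ℝ → ℝ × ℝ := fun r => if r ≤ P.s k.castSucc then z r else
    if r ≤ P.t k.succ then v (r - P.s k.castSucc) else u (r - P.t k.succ)
  have e1 : ∀ r ≤ P.s k.castSucc, z' r = z r := fun r hr => if_pos hr
  have e2 : EqOn (fun r => z' (P.s k.castSucc + r)) v (Icc 0 (P.gap k)) := by
    intro r hr
    rcases hr.1.eq_or_lt with rfl | h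
    · simp only [add_zero]
      rw [e1 _ le_rfl, hzv]
    · have h1 : ¬ P.s k.castSucc + r ≤ P.s k.castSucc := by linarith
      have h2 : P.s k.castSucc + r ≤ P.t k.succ := by
        have := hr.2
        rw [SwitchedProblem.gap] at this
        linarith
      simp only [z', if_neg h1, if_pos h2, add_sub_cancel_left]
  have e3 : EqOn (fun r => z' (P.t k.succ + r)) u (Icc 0 (P.tau k.succ)) := by
    intro r hr
    have h1 : ¬ P.t k.succ + r ≤ P.s k.castSucc := by linarith [hr.1]
    rcases hr.1.eq_or_lt with rfl | h
    · simp only [add_zero] at h1 ⊢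
      simp only [z', if_neg h1, if_pos le_rfl, ← hvu]
      rfl
    · have h2 : ¬ P.t k.succ + r ≤ P.t k.succ := by linarith
      simp only [z', if_neg h1, if_neg h2, add_sub_cancel_left]
  refine ⟨z', ⟨fun i hi => ?_, fun i hi => ?_⟩, e1 0 h0.le, ?_⟩
  · rcases hi.eq_or_lt with rfl | hlt
    · exact hu.congr e3
    · have hik : i ≤ k.castSucc := Fin.le_castSucc_iff.2 hlt
      refine (hz.annulus i hik).congr fun r hr => e1 _ ?_
      have h2 : r ≤ P.s i - P.t i := hr.2
      linarith [P.s_strictMono.monotone hik]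
  · rcases (show i ≤ k by simpa [Fin.castSucc_lt_succ_iff] using hi).eq_or_lt with rfl | hlt
    · exact hv.congr e2
    · refine (hz.gap i (by simpa using hlt)).congr fun r hr => e1 _ ?_
      have h2 : r ≤ P.t i.succ - P.s i.castSucc := hr.2
      have h3 : i.succ ≤ k.castSucc := by
        rw [Fin.le_def]
        simpa using hlt
      linarith [P.t_strictMono.monotone h3, P.t_lt_s k.castSucc]
  · have := e3 (x := P.tau k.succ) ⟨(sub_pos.2 hts).le, le_rfl⟩
    simpa [tau] using this

namespace IsStrip

variable (S : P.IsStrip c₁ c₂ ya yb)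
include S

/-- The crossing of the `i`-th annulus. -/
theorem exists_crossing (i : Fin (m + 1)) (hN : P.UniqueIVP (P.f i)) {d e : ℝ}
    (hde : (d = c₁ i ∧ e = c₂ i) ∨ (d = c₂ i ∧ e = c₁ i))
    (htwist : P.Twist i (α i) (β i) d e (w.entry i)) {γ : ℝ → ℝ × ℝ}
    (hγ : ContinuousOn γ (Icc 0 1))
    (hγκ : ∀ θ ∈ Icc (0 : ℝ) 1, γ θ ∈ (w.entry i).region ∧
      P.hamCut c₂ ya yb i (γ θ) ∈ Icc (c₁ i) (c₂ i))
    (h0 : P.hamCut c₂ ya yb i (γ 0) = c₁ i) (h1 : P.hamCut c₂ ya yb i (γ 1) = c₂ i) :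
    ∃ ζ : ℝ → ℝ × ℝ, ContinuousOn ζ (Icc 0 1) ∧ (ζ 0).1 = 0 ∧ (ζ 1).2 = 0 ∧
      ∀ θ ∈ Icc (0 : ℝ) 1, ζ θ ∈ (w.exit i).region ∧
        P.hamCut c₂ ya yb i (ζ θ) ∈ Icc (c₁ i) (c₂ i) ∧
        ∃ s ∈ Icc (0 : ℝ) 1, ∃ u, P.IsAnnulusPiece c₁ c₂ ya yb i (w.entry i) (w.exit i)
          (w.nodes i) u ∧ u 0 = γ s ∧ u (P.tau i) = ζ θ := by
  have hT : 0 ≤ P.tau i := (sub_pos.2 (P.t_lt_s i)).le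
  have hd : d ∈ Icc (c₁ i) (c₂ i) := by
    rcases hde with h | h
    · exact h.1 ▸ S.c₁_mem i
    · exact h.1 ▸ S.c₂_mem i
  have he : e ∈ Icc (c₁ i) (c₂ i) := by
    rcases hde with h | h
    · exact h.2 ▸ S.c₂_mem i
    · exact h.2 ▸ S.c₁_mem i
  obtain ⟨ht1, ht2⟩ := htwist
  rw [← S.crossingTime_eq i _ hd, ← S.crossingTime_eq i _ hd, ← S.turningTime_eq i hd] at ht1
  rw [← S.crossingTime_eq i _ he, ← S.crossingTime_eq i _ he, ← S.turningTime_eq i he] at ht2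
  obtain ⟨ζ, hζ, hζ0, hζ1, hζs⟩ := exists_stretching_across_annulus S.isProperKinetic (S.isWell i)
    hT (fun z w hz hw h hc => S.eqOn_of_isFlowLine hN hT hz hw h hc.2) (w.entry_mem i) hγ hγκ h0 h1
    hde ht1 ht2 (w.le_nodes i) (w.nodes_le i)
  rw [w.iterate_next_entry] at hζs
  refine ⟨ζ, hζ, hζ0, hζ1, fun θ hθ => ?_⟩
  obtain ⟨hreg, s, hs, u, hu, hu0, huT, hc1, hc2⟩ := hζs θ hθ
  refine ⟨hreg, ?_, s, hs, u, ⟨hu, ?_, ?_, ?_, hc1, hc2⟩, hu0, huT⟩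
  · rw [← huT, S.hamCut_flow_eq hu ⟨hT, le_rfl⟩, hu0]
    exact (hγκ s hs).2
  · rw [hu0]; exact (hγκ s hs).1
  · rw [huT]; exact hreg
  · rw [hu0]; exact (hγκ s hs).2

/-- The points reached at the time `s_k` along a prescribed itinerary contain a path which joins the
axes inside of the exit quadrant. -/
theorem exists_path (hlam : P.lam < 0) (hN : ∀ i, P.UniqueIVP (P.f i))
    (hL : P.UniqueIVP (fun x => P.lam * x)) {r₀ : Set (ℝ × ℝ)}
    (hr₀ : P.IsLinkingArc 0 (c₁ 0) (c₂ 0) κ₀ r₀) {d e : Fin (m + 1) → ℝ}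
    (hde : ∀ i, (d i = c₁ i ∧ e i = c₂ i) ∨ (d i = c₂ i ∧ e i = c₁ i))
    (htwist : ∀ i, P.Twist i (α i) (β i) (d i) (e i) .I ∧ P.Twist i (α i) (β i) (d i) (e i) .III)
    (hIItoI : ∀ i, P.timeIItoI c₁ c₂ i ≤ P.gap i)
    (hIVtoIII : ∀ i, P.timeIVtoIII c₁ c₂ i ≤ P.gap i)
    (hIVtoI : ∀ i, P.timeIVtoI c₁ c₂ i ≤ P.gap i)
    (hIItoIII : ∀ i, P.timeIItoIII c₁ c₂ i ≤ P.gap i)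
    (w : Itinerary α β κ₀ κL) (k : Fin (m + 1)) :
    ∃ ζ : ℝ → ℝ × ℝ, ContinuousOn ζ (Icc 0 1) ∧ (ζ 0).1 = 0 ∧ (ζ 1).2 = 0 ∧
      ∀ θ ∈ Icc (0 : ℝ) 1, ζ θ ∈ (w.exit k).region ∧
        P.hamCut c₂ ya yb k (ζ θ) ∈ Icc (c₁ k) (c₂ k) ∧
        ∃ z, P.FollowsUntil c₁ c₂ ya yb w k z ∧ z 0 ∈ r₀ ∧ z (P.s k) = ζ θ := by
  have htw : ∀ i, P.Twist i (α i) (β i) (d i) (e i) (w.entry i) := fun i => by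
    rcases w.entry_mem i with h | h <;> rw [h]
    exacts [(htwist i).1, (htwist i).2]
  induction k using Fin.induction with
  | zero =>
    -- The initial arc is itself the path which is stretched across the first annulus.
    obtain ⟨γ, hγ, -, hγr, hr, hγ0, hγ1⟩ := hr₀
    have hmem : ∀ θ ∈ Icc (0 : ℝ) 1, γ θ ∈ P.annulusPart 0 (c₁ 0) (c₂ 0) κ₀ := fun θ hθ =>
      hr (hγr ▸ mem_image_of_mem _ hθ)
    have hham : ∀ θ ∈ Icc (0 : ℝ) 1, P.hamCut c₂ ya yb 0 (γ θ) = P.ham 0 (γ θ) := fun θ hθ =>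
      S.hamCut_eq (hmem θ hθ).1
    obtain ⟨ζ, hζ, hζ0, hζ1, hζs⟩ := S.exists_crossing (w := w) 0 (hN 0) (hde 0) (htw 0) hγ
      (fun θ hθ => ⟨by rw [w.entry_zero]; exact (hmem θ hθ).2,
        S.mem_annulus_iff.1 (hmem θ hθ).1⟩)
      (by rw [hham 0 ⟨le_rfl, zero_le_one⟩, hγ0]) (by rw [hham 1 ⟨zero_le_one, le_rfl⟩, hγ1])
    refine ⟨ζ, hζ, hζ0, hζ1, fun θ hθ => ?_⟩
    obtain ⟨h1, h2, s, hs, u, hu, hu0, huT⟩ := hζs θ hθ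
    refine ⟨h1, h2, u, ⟨fun i hi => ?_, fun i hi => absurd hi (Fin.not_lt_zero _)⟩, ?_, ?_⟩
    · obtain rfl := Fin.le_zero_iff.1 hi
      simpa [P.t_zero] using hu
    · rw [hu0, ← hγr]
      exact mem_image_of_mem _ hs
    · rw [← huT, tau, P.t_zero, sub_zero]
  | succ k ih =>
    obtain ⟨ζ, hζ, hζ0, hζ1, hζs⟩ := ih
    obtain ⟨γ, hγ, hγ0, hγ1, hγQ, hγI⟩ := S.exists_link hlam hL k (hIItoI k) (hIVtoIII k)
      (hIVtoI k) (hIItoIII k) (w.exit_mem k.castSucc) (w.entry_mem k.succ) hζ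
      (fun θ hθ => ⟨(hζs θ hθ).1, (hζs θ hθ).2.1⟩) hζ0 hζ1
    obtain ⟨η, hη, hη0, hη1, hηs⟩ := S.exists_crossing (w := w) k.succ (hN _) (hde _) (htw _) hγ
      hγQ hγ0 hγ1
    refine ⟨η, hη, hη0, hη1, fun θ hθ => ?_⟩
    obtain ⟨h1, h2, s, hs, u, hu, hu0, huT⟩ := hηs θ hθ
    obtain ⟨s', hs', v, hv, hv0, hvT, hvc⟩ := hγI s hs
    obtain ⟨-, -, z, hz, hz0, hzT⟩ := hζs s' hs'
    -- A point of the new path is traced back through the crossing, the link and the earlier path,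
    -- and the three pieces of trajectory are glued.
    obtain ⟨z', hz', hz'0, hz'T⟩ := hz.extend ⟨hv, hvc⟩ hu (hzT.trans hv0.symm)
      (hvT.trans hu0.symm)
    exact ⟨h1, h2, z', hz', hz'0 ▸ hz0, hz'T.trans huT⟩

end IsStrip

end Glue

end SwitchedProblem


/-! ### Trajectories as solutions -/

theorem hasDerivWithinAt_Icc_union {x : ℝ → ℝ} {v a b c r : ℝ} (hab : a ≤ b) (hbc : b ≤ c)
    (h1 : r ∈ Icc a b → HasDerivWithinAt x v (Icc a b) r)
    (h2 : r ∈ Icc b c → HasDerivWithinAt x v (Icc b c) r) (hr : r ∈ Icc a c) :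
    HasDerivWithinAt x v (Icc a c) r := by
  rcases lt_trichotomy r b with h | rfl | h
  · refine (h1 ⟨hr.1, h.le⟩).mono_of_mem_nhdsWithin ?_
    filter_upwards [self_mem_nhdsWithin, mem_nhdsWithin_of_mem_nhds (Iio_mem_nhds h)] with s hs hsb
    exact ⟨hs.1, le_of_lt hsb⟩
  · rw [← Icc_union_Icc_eq_Icc hab hbc]
    exact (h1 ⟨hab, le_rfl⟩).union (h2 ⟨le_rfl, hbc⟩)
  · refine (h2 ⟨h.le, hr.2⟩).mono_of_mem_nhdsWithin ?_
    filter_upwards [self_mem_nhdsWithin, mem_nhdsWithin_of_mem_nhds (Ioi_mem_nhds h)] with s hs hsb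
    exact ⟨le_of_lt hsb, hs.2⟩

theorem hasDerivWithinAt_of_comp_add {x : ℝ → ℝ} {v a b r : ℝ}
    (h : HasDerivWithinAt (fun s => x (a + s)) v (Icc 0 (b - a)) (r - a)) :
    HasDerivWithinAt x v (Icc a b) r := by
  have h1 : HasDerivWithinAt (fun s : ℝ => s - a) 1 (Icc a b) r :=
    ((hasDerivAt_id r).sub_const a).hasDerivWithinAt
  have := h.scomp r h1 fun s (hs : s ∈ Icc a b) =>
    (⟨by linarith [hs.1], by linarith [hs.2]⟩ : s - a ∈ Icc 0 (b - a))
  simpa [Function.comp_def] using this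

theorem exists_sign_change {x : ℝ → ℝ} {v a b r : ℝ} (hx : HasDerivAt x v r) (hv : v ≠ 0)
    (h0 : x r = 0) (hr : r ∈ Ioo a b) : (∃ p ∈ Ioo a b, x p < 0) ∧ ∃ q ∈ Ioo a b, 0 < x q := by
  have key : ∀ {x : ℝ → ℝ} {v : ℝ}, HasDerivAt x v r → 0 < v → x r = 0 →
      (∃ p ∈ Ioo a b, x p < 0) ∧ ∃ q ∈ Ioo a b, 0 < x q := by
    intro x v hx hv h0
    have hs := (eventually_nhdsWithin_sign_eq_of_deriv_pos (hx.deriv.symm ▸ hv) h0).and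
      (Ioo_mem_nhds hr.1 hr.2)
    constructor
    · obtain ⟨p, ⟨hp, hpI⟩, hpr⟩ := ((hs.filter_mono (nhdsWithin_le_nhds (s := Iio r))).and
        self_mem_nhdsWithin).exists
      refine ⟨p, hpI, ?_⟩
      rw [sign_neg (sub_neg.2 hpr), sign_eq_neg_one_iff] at hp
      exact hp
    · obtain ⟨p, ⟨hp, hpI⟩, hpr⟩ := ((hs.filter_mono (nhdsWithin_le_nhds (s := Ioi r))).and
        self_mem_nhdsWithin).exists
      refine ⟨p, hpI, ?_⟩
      rw [sign_pos (sub_pos.2 hpr), sign_eq_one_iff] at hp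
      exact hp
  rcases lt_or_gt_of_ne hv with h | h
  · obtain ⟨⟨p, hp, hp'⟩, q, hq, hq'⟩ := key hx.neg (neg_pos.2 h) (by simp [h0])
    exact ⟨⟨q, hq, neg_pos.1 hq'⟩, p, hp, neg_neg_iff_pos.1 hp'⟩
  · exact key hx h h0

namespace SwitchedProblem

variable {m : ℕ} {P : SwitchedProblem m}

theorem s_lt_t_of_lt {i k : Fin (m + 1)} (h : i < k) : P.s i < P.t k := by
  obtain ⟨j, rfl⟩ := Fin.exists_succ_eq.2 (Fin.ne_zero_of_lt h)
  exact (P.s_strictMono.monotone (Fin.le_castSucc_iff.2 h)).trans_lt (P.s_lt_t j)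

theorem weight_of_mem {k : Fin (m + 1)} {r : ℝ} (hr : r ∈ Ioo (P.t k) (P.s k)) :
    P.weight r = P.μ k := by
  rw [weight, Finset.sum_eq_single k, indicator_of_mem (Ioo_subset_Icc_self hr)]
  · intro i _ hi
    refine indicator_of_notMem (fun hri => ?_) _
    rcases lt_or_gt_of_ne hi with h | h
    · linarith [s_lt_t_of_lt (P := P) h, hr.1, hri.2]
    · linarith [s_lt_t_of_lt (P := P) h, hr.2, hri.1]
  · simp

theorem weight_of_mem_gap {k : Fin m} {r : ℝ} (hr : r ∈ Ioo (P.s k.castSucc) (P.t k.succ)) :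
    P.weight r = 0 := by
  rw [weight]
  refine Finset.sum_eq_zero fun i _ => indicator_of_notMem (fun hri => ?_) _
  rcases le_or_gt i k.castSucc with h | h
  · linarith [P.s_strictMono.monotone h, hr.1, hri.2]
  · have h' : k.succ ≤ i := Fin.castSucc_lt_iff_succ_le.1 h
    linarith [P.t_strictMono.monotone h', hr.2, hri.1]

/-- Every time lies in the domain of an annulus or of a gap. -/
theorem mem_annulus_or_gap (k : Fin (m + 1)) {r : ℝ} (hr : r ∈ Icc 0 (P.s k)) :
    (∃ i ≤ k, r ∈ Icc (P.t i) (P.s i)) ∨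
      ∃ i : Fin m, i.castSucc < k ∧ r ∈ Icc (P.s i.castSucc) (P.t i.succ) := by
  induction k using Fin.induction with
  | zero => exact Or.inl ⟨0, le_rfl, by rwa [P.t_zero]⟩
  | succ k ih =>
    rcases le_or_gt r (P.s k.castSucc) with h | h
    · rcases ih ⟨hr.1, h⟩ with ⟨i, hi, hri⟩ | ⟨i, hi, hri⟩
      · exact Or.inl ⟨i, hi.trans (Fin.castSucc_le_succ k), hri⟩
      · exact Or.inr ⟨i, hi.trans Fin.castSucc_lt_succ, hri⟩
    · rcases le_or_gt r (P.t k.succ) with h' | h'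
      · exact Or.inr ⟨k, Fin.castSucc_lt_succ, h.le, h'⟩
      · exact Or.inl ⟨k.succ, le_rfl, h'.le, hr.2⟩

variable (P) in
/-- `(x, y)` solves the switched system on `[a, b]`. -/
def IsSolutionOn (a b : ℝ) (x y : ℝ → ℝ) : Prop :=
  ContinuousOn y (Icc a b) ∧
  ∀ r ∈ Icc a b, y r ∈ P.J₂ ∧ HasDerivWithinAt x (P.h (y r)) (Icc a b) r ∧
    ((∀ i, r ≠ P.t i ∧ r ≠ P.s i) →
      HasDerivWithinAt y (-P.lam * x r - P.weight r * P.g (x r)) (Icc a b) r)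

theorem IsSolutionOn.union {a b c : ℝ} {x y : ℝ → ℝ} (hab : a ≤ b) (hbc : b ≤ c)
    (h1 : P.IsSolutionOn a b x y) (h2 : P.IsSolutionOn b c x y) : P.IsSolutionOn a c x y := by
  refine ⟨?_, fun r hr => ⟨?_, ?_, fun hsw => ?_⟩⟩
  · rw [← Icc_union_Icc_eq_Icc hab hbc]
    exact h1.1.union_of_isClosed h2.1 isClosed_Icc isClosed_Icc
  · rcases le_total r b with h | h
    · exact (h1.2 r ⟨hr.1, h⟩).1
    · exact (h2.2 r ⟨h, hr.2⟩).1
  · exact hasDerivWithinAt_Icc_union hab hbc (fun h => (h1.2 r h).2.1) (fun h => (h2.2 r h).2.1) hr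
  · exact hasDerivWithinAt_Icc_union hab hbc (fun h => (h1.2 r h).2.2 hsw)
      (fun h => (h2.2 r h).2.2 hsw) hr

theorem SolvesAutonomous.isSolutionOn {k : ℝ → ℝ} {a b : ℝ} {x y : ℝ → ℝ}
    (hS : P.SolvesAutonomous k (b - a) (fun r => x (a + r)) fun r => y (a + r))
    (ha : ∃ i, a = P.t i ∨ a = P.s i) (hb : ∃ i, b = P.t i ∨ b = P.s i)
    (hk : ∀ r ∈ Ioo a b, -k (x r) = -P.lam * x r - P.weight r * P.g (x r)) :
    P.IsSolutionOn a b x y := by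
  have key : ∀ r ∈ Icc a b, y r ∈ P.J₂ ∧ HasDerivWithinAt x (P.h (y r)) (Icc a b) r ∧
      HasDerivWithinAt y (-k (x r)) (Icc a b) r := by
    intro r hr
    obtain ⟨h1, h2, h3⟩ := hS (r - a) ⟨by linarith [hr.1], by linarith [hr.2]⟩
    simp only [add_sub_cancel] at h1 h2 h3
    exact ⟨h1, hasDerivWithinAt_of_comp_add h2, hasDerivWithinAt_of_comp_add h3⟩
  refine ⟨fun r hr => (key r hr).2.2.continuousWithinAt, fun r hr =>
    ⟨(key r hr).1, (key r hr).2.1, fun hsw => ?_⟩⟩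
  have hra : r ≠ a := by
    rintro rfl
    obtain ⟨i, h | h⟩ := ha
    exacts [(hsw i).1 h, (hsw i).2 h]
  have hrb : r ≠ b := by
    rintro rfl
    obtain ⟨i, h | h⟩ := hb
    exacts [(hsw i).1 h, (hsw i).2 h]
  rw [← hk r ⟨lt_of_le_of_ne hr.1 hra.symm, lt_of_le_of_ne hr.2 hrb⟩]
  exact (key r hr).2.2

section Trajectory

variable {c₁ c₂ : Fin (m + 1) → ℝ} {ya yb : ℝ} {α β : Fin (m + 1) → ℕ} {κ₀ κL : Quadrant}
  {w : Itinerary α β κ₀ κL} {z : ℝ → ℝ × ℝ}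

namespace IsStrip

variable (S : P.IsStrip c₁ c₂ ya yb)
include S

theorem hamCut_piece {i : Fin (m + 1)} {κ κ' : Quadrant} {n : ℕ} {u : ℝ → ℝ × ℝ}
    (hu : P.IsAnnulusPiece c₁ c₂ ya yb i κ κ' n u) {t : ℝ} (ht : t ∈ Icc 0 (P.tau i)) :
    P.hamCut c₂ ya yb i (u t) ∈ Icc (c₁ i) (c₂ i) := by
  rw [S.hamCut_flow_eq hu.flow ht]
  exact hu.ham_mem

variable {k : Fin (m + 1)} (hz : P.FollowsUntil c₁ c₂ ya yb w k z)
include hz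

theorem hamCut_mem {i : Fin (m + 1)} (hi : i ≤ k) {r : ℝ} (hr : r ∈ Icc (P.t i) (P.s i)) :
    P.hamCut c₂ ya yb i (z r) ∈ Icc (c₁ i) (c₂ i) := by
  have := S.hamCut_piece (hz.annulus i hi) (t := r - P.t i)
    ⟨by linarith [hr.1], by rw [tau]; linarith [hr.2]⟩
  simpa using this

theorem snd_mem {i : Fin (m + 1)} (hi : i ≤ k) {r : ℝ} (hr : r ∈ Icc (P.t i) (P.s i)) :
    (z r).2 ∈ Icc ya yb :=
  Ioo_subset_Icc_self (S.mem_of_hamCut_le (S.hamCut_mem hz hi hr).2).2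

/-- The annulus energies do not control the motion in a gap. However, both ends of the gap piece lie
in annuli, hence in the strip, and along a saddle flow a positive `y` is largest, and a negative one
smallest, at an end. So the gap pieces solve the original system. -/
theorem snd_mem_gap (hlam : P.lam < 0) {i : Fin m} (hi : i.castSucc < k) {r : ℝ}
    (hr : r ∈ Icc 0 (P.gap i)) : (z (P.s i.castSucc + r)).2 ∈ Icc ya yb := by
  have hH := S.isProperKinetic.toIsKinetic
  have hM := P.gapEnergy_isKinetic hlam
  have hf := (hz.gap i hi).flow
  have efield : (fun x => P.lam * x) = fun x => -(fun x => -(P.lam * x)) x := by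
    funext x; rw [neg_neg]
  rw [efield] at hf
  have h0 : (z (P.s i.castSucc + 0)).2 ∈ Icc ya yb := by
    rw [add_zero]
    exact S.snd_mem hz hi.le ⟨(P.t_lt_s _).le, le_rfl⟩
  have h1 : (z (P.s i.castSucc + P.gap i)).2 ∈ Icc ya yb := by
    rw [gap, add_sub_cancel]
    exact S.snd_mem hz (Fin.castSucc_lt_iff_succ_le.1 hi) ⟨le_rfl, (P.t_lt_s _).le⟩
  refine ⟨?_, hf.snd_le_of_saddle hH hM S.yb_pos h0.2 h1.2 r hr⟩
  have := hf.reflect_saddle.snd_le_of_saddle hH.reflect hM.reflect (neg_pos.2 S.ya_neg)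
    (neg_le_neg h0.1) (neg_le_neg h1.1) r hr
  exact neg_le_neg_iff.1 this

theorem isSolutionOn_annulus {i : Fin (m + 1)} (hi : i ≤ k) :
    P.IsSolutionOn (P.t i) (P.s i) (fun r => (z r).1) fun r => (z r).2 := by
  refine (S.solvesAutonomous (hz.annulus i hi).flow (hz.annulus i hi).ham_mem.2).isSolutionOn
    ⟨i, Or.inl rfl⟩ ⟨i, Or.inr rfl⟩ fun r hr => ?_
  rw [weight_of_mem hr, f]
  ring

theorem isSolutionOn_gap (hlam : P.lam < 0) {i : Fin m} (hi : i.castSucc < k) :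
    P.IsSolutionOn (P.s i.castSucc) (P.t i.succ) (fun r => (z r).1) fun r => (z r).2 := by
  refine (S.solvesAutonomous_of_mem (hz.gap i hi).flow fun t ht =>
    S.snd_mem_gap hz hlam hi ht).isSolutionOn ⟨_, Or.inr rfl⟩ ⟨_, Or.inl rfl⟩ fun r hr => ?_
  rw [weight_of_mem_gap hr]
  ring

theorem isSolutionOn (hlam : P.lam < 0) {i : Fin (m + 1)} (hi : i ≤ k) :
    P.IsSolutionOn 0 (P.s i) (fun r => (z r).1) fun r => (z r).2 := by
  induction i using Fin.induction with
  | zero =>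
    have := S.isSolutionOn_annulus hz hi
    rwa [P.t_zero] at this
  | succ i ih =>
    have hi' : i.castSucc < k := Fin.castSucc_lt_iff_succ_le.2 hi
    have h0 : 0 ≤ P.s i.castSucc := by
      have := (P.t_strictMono.monotone (Fin.zero_le i.castSucc)).trans (P.t_lt_s _).le
      rwa [P.t_zero] at this
    have h1 := (ih hi'.le).union h0 (P.s_lt_t i).le (S.isSolutionOn_gap hz hlam hi')
    exact h1.union (h0.trans (P.s_lt_t i).le) (P.t_lt_s _).le (S.isSolutionOn_annulus hz hi)

omit hz in
theorem ne_zero_of_hamCut {i : Fin (m + 1)} {p : ℝ × ℝ}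
    (hp : P.hamCut c₂ ya yb i p ∈ Icc (c₁ i) (c₂ i)) : p ≠ 0 := by
  rintro rfl
  rw [hamCut, Prod.snd_zero, Prod.fst_zero, S.isProperKinetic.map_zero, (S.isWell i).map_zero,
    add_zero] at hp
  exact hp.1.not_gt (S.annulus i).1

-- In each gap one of `x`, `y` has no zero at all, so they do not vanish together.
omit S in
theorem ne_zero_of_mem_gap {i : Fin m} (hi : i.castSucc < k) {r : ℝ}
    (hr : r ∈ Icc (P.s i.castSucc) (P.t i.succ)) (hx : (z r).1 = 0) : (z r).2 ≠ 0 := by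
  intro hy
  obtain ⟨h1, -, h3, -⟩ := (hz.gap i hi).counts
  rw [gap] at h1 h3
  rw [zeroCount_Icc_comp_add (fun t => (z t).1)] at h1
  rw [zeroCount_Icc_comp_add (fun t => (z t).2)] at h3
  split_ifs at h1 h3
  · exact (encard_eq_zero.1 h3).subset ⟨hr, hy⟩
  · exact (encard_eq_zero.1 h1).subset ⟨hr, hx⟩

/-- A trajectory which follows an itinerary up to the end is a nodal solution. -/
theorem isNodalSolution (hlam : P.lam < 0) (hk : k = Fin.last m) {r₀ rL : Set (ℝ × ℝ)}
    (h0 : z 0 ∈ r₀) (hL : z P.L ∈ rL) :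
    P.IsNodalSolution r₀ rL (fun r => (z r).1) fun r => (z r).2 := by
  subst hk
  have hle : ∀ i : Fin (m + 1), i ≤ Fin.last m := Fin.le_last
  have hlt : ∀ i : Fin m, i.castSucc < Fin.last m := Fin.castSucc_lt_last
  have hsol : P.IsSolution (fun r => (z r).1) fun r => (z r).2 := S.isSolutionOn hz hlam le_rfl
  have hsimple : ∀ r ∈ Icc 0 P.L, (z r).1 = 0 → (z r).2 ≠ 0 := by
    intro r hr hx hy
    rcases mem_annulus_or_gap (Fin.last m) hr with ⟨i, hi, hri⟩ | ⟨i, hi, hri⟩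
    · exact S.ne_zero_of_hamCut (S.hamCut_mem hz hi hri) (Prod.ext hx hy)
    · exact ne_zero_of_mem_gap hz hi hri hx hy
  -- a sign change in the first annulus
  obtain ⟨r, hr, hxr⟩ : ∃ r ∈ Ioo (P.t 0) (P.s 0), (z r).1 = 0 := by
    have h1 := (hz.annulus 0 (hle 0)).fst_count
    rw [tau, zeroCount_Ioo_comp_add (fun t => (z t).1)] at h1
    have hpos : {r ∈ Ioo (P.t 0) (P.s 0) | (z r).1 = 0}.Nonempty := by
      rw [← encard_ne_zero]
      rw [zeroCount] at h1
      rw [h1]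
      have := w.le_nodes 0
      exact_mod_cast (by omega : w.nodes 0 ≠ 0)
    obtain ⟨r, hr, hxr⟩ := hpos
    exact ⟨r, hr, hxr⟩
  have hsub : Ioo (P.t 0) (P.s 0) ⊆ Ioo 0 P.L := by
    rw [P.t_zero]
    exact Ioo_subset_Ioo_right (P.s_strictMono.monotone (hle 0))
  have hrI := hsub hr
  obtain ⟨hyJ, hdx, -⟩ := hsol.2 r (Ioo_subset_Icc_self hrI)
  have hv : P.h (z r).2 ≠ 0 := by
    have hy := hsimple r (Ioo_subset_Icc_self hrI) hxr
    rcases lt_or_gt_of_ne hy with h | h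
    · exact (P.h_neg hyJ h).ne
    · exact (P.h_pos hyJ h).ne'
  obtain ⟨hneg, hpos⟩ := exists_sign_change (hdx.hasDerivAt (Icc_mem_nhds hrI.1 hrI.2)) hv hxr hrI
  refine ⟨hsol, h0, hL, hneg, hpos, ?_, hsimple⟩
  -- finitely many zeros
  have hA : ∀ i, {r ∈ Icc (P.t i) (P.s i) | (z r).1 = 0}.Finite := by
    intro i
    have h1 := (hz.annulus i (hle i)).fst_count
    rw [tau, zeroCount_Ioo_comp_add (fun t => (z t).1), zeroCount] at h1
    refine ((finite_of_encard_eq_coe h1).union (toFinite {P.t i, P.s i})).subset ?_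
    rintro r ⟨hr, hx⟩
    rcases hr.1.eq_or_lt with h | h
    · exact Or.inr (Or.inl h.symm)
    rcases hr.2.eq_or_lt with h' | h'
    · exact Or.inr (Or.inr h')
    exact Or.inl ⟨⟨h, h'⟩, hx⟩
  have hG : ∀ i : Fin m, {r ∈ Icc (P.s i.castSucc) (P.t i.succ) | (z r).1 = 0}.Finite := by
    intro i
    have h1 := (hz.gap i (hlt i)).counts.1
    rw [gap, zeroCount_Icc_comp_add (fun t => (z t).1), zeroCount] at h1
    refine finite_of_encard_le_coe (k := 1) (h1.trans_le ?_)
    split_ifs <;> simp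
  refine ((finite_iUnion hA).union (finite_iUnion hG)).subset ?_
  rintro r ⟨hr, hx⟩
  rcases mem_annulus_or_gap (Fin.last m) hr with ⟨i, -, hri⟩ | ⟨i, -, hri⟩
  · exact Or.inl (mem_iUnion.2 ⟨i, hri, hx⟩)
  · exact Or.inr (mem_iUnion.2 ⟨i, hri, hx⟩)

theorem follows (hk : k = Fin.last m) :
    P.Follows c₁ c₂ w (fun r => (z r).1) fun r => (z r).2 := by
  subst hk
  have hle : ∀ i : Fin (m + 1), i ≤ Fin.last m := Fin.le_last
  have hlt : ∀ i : Fin m, i.castSucc < Fin.last m := Fin.castSucc_lt_last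
  refine ⟨fun i => ⟨⟨?_, ?_⟩, ⟨?_, ?_⟩, ?_, ?_⟩, fun i => ?_⟩
  · exact S.mem_annulus_iff.2 (S.hamCut_mem hz (hle i) ⟨le_rfl, (P.t_lt_s i).le⟩)
  · simpa using (hz.annulus i (hle i)).start_mem
  · exact S.mem_annulus_iff.2 (S.hamCut_mem hz (hle i) ⟨(P.t_lt_s i).le, le_rfl⟩)
  · simpa [tau] using (hz.annulus i (hle i)).end_mem
  · rw [← (hz.annulus i (hle i)).fst_count, tau]
    exact (zeroCount_Ioo_comp_add (fun t => (z t).1) _ _).symm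
  · rw [← (hz.annulus i (hle i)).snd_count, tau]
    exact (zeroCount_Icc_comp_add (fun t => (z t).2) _ _).symm
  · have h := (hz.gap i (hlt i)).counts
    rw [gap, zeroCount_Icc_comp_add (fun t => (z t).1), zeroCount_Ioo_comp_add (fun t => (z t).1),
      zeroCount_Icc_comp_add (fun t => (z t).2), zeroCount_Ioo_comp_add (fun t => (z t).2)] at h
    exact h

end IsStrip

end Trajectory

end SwitchedProblem


/-! ### The number of itineraries -/

namespace Itinerary

variable {m : ℕ} {α β : Fin (m + 1) → ℕ} {κ₀ κL : Quadrant}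

theorem card_subtype_or {X : Type*} {a b : X} (hab : a ≠ b) :
    Nat.card {κ : X // κ = a ∨ κ = b} = 2 := by
  rw [Nat.card_eq_two_iff]
  refine ⟨⟨a, Or.inl rfl⟩, ⟨b, Or.inr rfl⟩, fun h => hab (congrArg Subtype.val h), ?_⟩
  ext ⟨x, hx⟩
  rcases hx with rfl | rfl <;> simp

/-- Functions with a prescribed first value. -/
def headEquiv (X : Type*) (a : X) : {f : Fin (m + 1) → X // f 0 = a} ≃ (Fin m → X) where
  toFun f i := f.1 i.succ
  invFun g := ⟨Fin.cons a g, rfl⟩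
  left_inv f := Subtype.ext (by
    funext i
    refine Fin.cases ?_ (fun j => ?_) i
    · simpa using f.2.symm
    · simp)
  right_inv g := by
    funext i
    simp

/-- Functions with a prescribed last value. -/
def lastEquiv (X : Type*) (a : X) :
    {f : Fin (m + 1) → X // f (Fin.last m) = a} ≃ (Fin m → X) where
  toFun f i := f.1 i.castSucc
  invFun g := ⟨Fin.snoc (α := fun _ => X) g a, by simp⟩
  left_inv f := Subtype.ext (by
    funext i
    refine Fin.lastCases ?_ (fun j => ?_) i
    · simpa using f.2.symm
    · simp)
  right_inv g := by
    funext i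
    simp

/-- An itinerary is given by the free entries, the free exits and the laps. -/
def equivProd (hκ₀ : κ₀ = .I ∨ κ₀ = .III) (hκL : κL = .II ∨ κL = .IV) :
    Itinerary α β κ₀ κL ≃
      {f : Fin (m + 1) → {κ : Quadrant // κ = .I ∨ κ = .III} // f 0 = ⟨κ₀, hκ₀⟩} ×
      {f : Fin (m + 1) → {κ : Quadrant // κ = .II ∨ κ = .IV} // f (Fin.last m) = ⟨κL, hκL⟩} ×
      ((i : Fin (m + 1)) → Fin (β i - α i)) where
  toFun w := ⟨⟨fun i => ⟨w.entry i, w.entry_mem i⟩, Subtype.ext w.entry_zero⟩,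
    ⟨fun i => ⟨w.exit i, w.exit_mem i⟩, Subtype.ext w.exit_last⟩, w.lap⟩
  invFun q := ⟨fun i => (q.1.1 i).1, fun i => (q.2.1.1 i).1, q.2.2, fun i => (q.1.1 i).2,
    fun i => (q.2.1.1 i).2, congrArg Subtype.val q.1.2, congrArg Subtype.val q.2.1.2⟩
  left_inv _ := rfl
  right_inv _ := rfl

/-- With the first entry and the last exit prescribed, `m` entries and `m` exits remain free, each
with two values: `2 ^ m * 2 ^ m = 4 ^ m`. -/
theorem finite_and_card (hκ₀ : κ₀ = .I ∨ κ₀ = .III) (hκL : κL = .II ∨ κL = .IV) :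
    Finite (Itinerary α β κ₀ κL) ∧
      Nat.card (Itinerary α β κ₀ κL) = 4 ^ m * ∏ i, (β i - α i) := by
  have e := (equivProd (α := α) (β := β) hκ₀ hκL).trans
    ((headEquiv _ _).prodCongr ((lastEquiv _ _).prodCongr (Equiv.refl _)))
  have h1 : Nat.card {κ : Quadrant // κ = .I ∨ κ = .III} = 2 := card_subtype_or (by decide)
  have h2 : Nat.card {κ : Quadrant // κ = .II ∨ κ = .IV} = 2 := card_subtype_or (by decide)
  have : Finite {κ : Quadrant // κ = .I ∨ κ = .III} := Nat.finite_of_card_ne_zero (by omega)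
  have : Finite {κ : Quadrant // κ = .II ∨ κ = .IV} := Nat.finite_of_card_ne_zero (by omega)
  refine ⟨Finite.of_equiv _ e.symm, ?_⟩
  rw [Nat.card_congr e, Nat.card_prod, Nat.card_prod, Nat.card_fun, Nat.card_fun, Nat.card_pi, h1,
    h2]
  simp only [Nat.card_eq_fintype_card, Fintype.card_fin]
  rw [← mul_assoc, ← mul_pow, show 2 * 2 = 4 from rfl]

end Itinerary

/-! ### The boundary value problem -/

namespace SwitchedProblem

variable {m : ℕ} {P : SwitchedProblem m} {c₁ c₂ : Fin (m + 1) → ℝ} {ya yb : ℝ}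
  {α β : Fin (m + 1) → ℕ} {κ₀ κL : Quadrant}

/-- A path joining the axes inside of an annular sector meets every arc which joins the boundary
components of the annulus inside of this sector. -/
theorem IsStrip.exists_mem_arc (S : P.IsStrip c₁ c₂ ya yb) {i : Fin (m + 1)} {κ : Quadrant}
    (hκ : κ = .II ∨ κ = .IV) {r : Set (ℝ × ℝ)} (hr : P.IsLinkingArc i (c₁ i) (c₂ i) κ r)
    {ζ : ℝ → ℝ × ℝ} (hζ : ContinuousOn ζ (Icc 0 1)) (h0 : (ζ 0).1 = 0) (h1 : (ζ 1).2 = 0)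
    (hζQ : ∀ θ ∈ Icc (0 : ℝ) 1, ζ θ ∈ κ.region ∧
      P.hamCut c₂ ya yb i (ζ θ) ∈ Icc (c₁ i) (c₂ i)) : ∃ θ ∈ Icc (0 : ℝ) 1, ζ θ ∈ r := by
  have I1 : (1 : ℝ) ∈ Icc (0 : ℝ) 1 := ⟨zero_le_one, le_rfl⟩
  have I0 : (0 : ℝ) ∈ Icc (0 : ℝ) 1 := ⟨le_rfl, zero_le_one⟩
  obtain ⟨γ, hγ, -, hγr, hrsub, hγ0, hγ1⟩ := hr
  have hmem : ∀ t ∈ Icc (0 : ℝ) 1, γ t ∈ P.annulusPart i (c₁ i) (c₂ i) κ := fun t ht =>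
    hrsub (hγr ▸ mem_image_of_mem _ ht)
  have hW := S.isWell i
  have hH := S.isProperKinetic
  rw [← S.hamCut_eq (hmem 0 I0).1] at hγ0
  rw [← S.hamCut_eq (hmem 1 I1).1] at hγ1
  obtain ⟨σ, hσ⟩ : ∃ σ : ℝ, (κ = .II ∧ σ = 1) ∨ (κ = .IV ∧ σ = -1) := by
    rcases hκ with h | h
    exacts [⟨1, Or.inl ⟨h, rfl⟩⟩, ⟨-1, Or.inr ⟨h, rfl⟩⟩]
  have hham : ContinuousOn (fun θ => P.hamCut c₂ ya yb i (ζ θ)) (Icc 0 1) :=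
    (S.continuous_hamCut i).comp_continuousOn hζ
  have hham' : ContinuousOn (fun θ => P.hamCut c₂ ya yb i (γ θ)) (Icc 0 1) :=
    (S.continuous_hamCut i).comp_continuousOn hγ
  have hfst : MapsTo Prod.fst (Icc (0 : ℝ) 1 ×ˢ Icc (0 : ℝ) 1) (Icc (0 : ℝ) 1) := fun p hp => hp.1
  have hsnd : MapsTo Prod.snd (Icc (0 : ℝ) 1 ×ˢ Icc (0 : ℝ) 1) (Icc (0 : ℝ) 1) := fun p hp => hp.2
  -- Energy and abscissa are coordinates inside one quadrant, so the differences of both are to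
  -- vanish. The arc `γ` runs from the lowest to the highest energy. At the left edge `ζ` is on the
  -- `y`-axis; at the right edge it is on the `x`-axis, at the extreme abscissa of its level. The
  -- sign `σ` treats II and IV together.
  obtain ⟨⟨s, t⟩, hst, hD₁, hD₂⟩ := exists_common_zero_of_boundary
    (D₁ := fun p => P.hamCut c₂ ya yb i (ζ p.1) - P.hamCut c₂ ya yb i (γ p.2))
    (D₂ := fun p => σ * ((γ p.2).1 - (ζ p.1).1))
    ((hham.comp continuousOn_fst hfst).sub (hham'.comp continuousOn_snd hsnd))
    (continuousOn_const.mul (((continuous_fst.comp_continuousOn hγ).comp continuousOn_snd hsnd).sub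
      ((continuous_fst.comp_continuousOn hζ).comp continuousOn_fst hfst)))
    (fun s hs => by
      simp only [hγ0]
      linarith [(hζQ s hs).2.1])
    (fun s hs => by
      simp only [hγ1]
      linarith [(hζQ s hs).2.2])
    (fun t ht _ => by
      have hreg := (hmem t ht).2
      rcases hσ with ⟨rfl, rfl⟩ | ⟨rfl, rfl⟩
      · simp only [h0]; linarith [hreg.1]
      · simp only [h0]; linarith [hreg.1])
    (fun t ht hD => by
      have hreg := (hmem t ht).2
      obtain ⟨hreg1, hc⟩ := hζQ 1 I1
      simp only [hamCut, h1, hH.map_zero, zero_add] at hc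
      have hx : P.FCut c₂ i (γ t).1 ≤ P.FCut c₂ i (ζ 1).1 := by
        simp only [hamCut, h1, hH.map_zero, zero_add] at hD
        linarith [hH.primitive_nonneg (γ t).2]
      have hmem' := hW.mem_Icc_of_le hc hx
      rcases hσ with ⟨rfl, rfl⟩ | ⟨rfl, rfl⟩
      · have := hW.eq_xN hc rfl hreg1.1
        simp only
        linarith [hmem'.1]
      · have := hW.eq_xP hc rfl hreg1.1
        simp only
        linarith [hmem'.2])
  refine ⟨s, hst.1, hγr ▸ ⟨t, hst.2, ?_⟩⟩
  have hx : (γ t).1 = (ζ s).1 := by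
    have hσ0 : σ ≠ 0 := by rcases hσ with ⟨-, rfl⟩ | ⟨-, rfl⟩ <;> norm_num
    have := (mul_eq_zero.1 hD₂).resolve_left hσ0
    simpa [sub_eq_zero] using this
  refine Prod.ext hx ?_
  simp only [hamCut, hx] at hD₁
  have hHy : P.HCut ya yb (γ t).2 = P.HCut ya yb (ζ s).2 := by linarith
  have ha := (hmem t hst.2).2
  have hb := (hζQ s hst.1).1
  rcases hσ with ⟨rfl, -⟩ | ⟨rfl, -⟩
  · exact hH.strictMonoOn.injOn ha.2 hb.2 hHy
  · exact neg_injective (hH.reflect.strictMonoOn.injOn (mem_Ici.2 (neg_nonneg.2 ha.2))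
      (mem_Ici.2 (neg_nonneg.2 hb.2)) (by simpa using hHy))

/-! ### Recovering the itinerary from the solution -/

/-- The second component of a solution is determined by the first one. -/
theorem IsSolution.snd_eq {x y u v : ℝ → ℝ} (h1 : P.IsSolution x y) (h2 : P.IsSolution u v)
    (hP : 0 < P.L) (hxu : EqOn x u (Icc 0 P.L)) : EqOn y v (Icc 0 P.L) := by
  intro r hr
  obtain ⟨hy, hx, -⟩ := h1.2 r hr
  obtain ⟨hv, hu, -⟩ := h2.2 r hr
  have := (uniqueDiffOn_Icc hP r hr).eq_deriv _ hx (hu.congr hxu (hxu hr))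
  exact P.h_strictMonoOn.injOn hy hv this

/-- The closed quadrants I and III, like II and IV, share only the origin, which is in no annulus;
the positions at `t_i` and `s_i` thus determine the entries and exits. The number of zeros of `x`
then determines the lap. -/
theorem Follows.itinerary_eq (hc₁ : ∀ i, 0 < c₁ i) {w w' : Itinerary α β κ₀ κL}
    {x y u v : ℝ → ℝ} (hw : P.Follows c₁ c₂ w x y) (hw' : P.Follows c₁ c₂ w' u v)
    (hxu : EqOn x u (Icc 0 P.L)) (hyv : EqOn y v (Icc 0 P.L)) : w = w' := by
  have ht0 : ∀ i, 0 ≤ P.t i := fun i => by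
    rw [← P.t_zero]; exact P.t_strictMono.monotone (Fin.zero_le i)
  have hsL : ∀ i, P.s i ≤ P.L := fun i => P.s_strictMono.monotone (Fin.le_last i)
  have htI : ∀ i, P.t i ∈ Icc 0 P.L := fun i => ⟨ht0 i, (P.t_lt_s i).le.trans (hsL i)⟩
  have hsI : ∀ i, P.s i ∈ Icc 0 P.L := fun i => ⟨(ht0 i).trans (P.t_lt_s i).le, hsL i⟩
  have hne : ∀ i (p : ℝ × ℝ), p ∈ P.annulus i (c₁ i) (c₂ i) → p ≠ 0 := by
    rintro i p hp rfl
    have := hp.2.2.1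
    rw [ham, Prod.snd_zero, Prod.fst_zero, P.H_zero, P.F_zero, add_zero] at this
    exact this.not_gt (hc₁ i)
  have hentry : ∀ i, w.entry i = w'.entry i := by
    intro i
    have h1 := (hw.1 i).1
    have h2 := (hw'.1 i).1
    rw [← hxu (htI i), ← hyv (htI i)] at h2
    have h0 := hne i _ h1.1
    have h1' := h1.2
    have h2' := h2.2
    rcases w.entry_mem i with e | e <;> rcases w'.entry_mem i with e' | e' <;> rw [e, e'] <;>
      rw [e] at h1' <;> rw [e'] at h2'
    · exact absurd (Prod.ext (le_antisymm h2'.1 h1'.1) (le_antisymm h2'.2 h1'.2)) h0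
    · exact absurd (Prod.ext (le_antisymm h1'.1 h2'.1) (le_antisymm h1'.2 h2'.2)) h0
  have hexit : ∀ i, w.exit i = w'.exit i := by
    intro i
    have h1 := (hw.1 i).2.1
    have h2 := (hw'.1 i).2.1
    rw [← hxu (hsI i), ← hyv (hsI i)] at h2
    have h0 := hne i _ h1.1
    have h1' := h1.2
    have h2' := h2.2
    rcases w.exit_mem i with e | e <;> rcases w'.exit_mem i with e' | e' <;> rw [e, e'] <;>
      rw [e] at h1' <;> rw [e'] at h2'
    · exact absurd (Prod.ext (le_antisymm h1'.1 h2'.1) (le_antisymm h2'.2 h1'.2)) h0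
    · exact absurd (Prod.ext (le_antisymm h2'.1 h1'.1) (le_antisymm h1'.2 h2'.2)) h0
  have hlap : ∀ i, w.lap i = w'.lap i := by
    intro i
    have h1 := (hw.1 i).2.2.1
    have h2 := (hw'.1 i).2.2.1
    rw [zeroCount_congr (hxu.mono (Ioo_subset_Icc_self.trans (Icc_subset_Icc (ht0 i) (hsL i)))), h2]
      at h1
    have hn : w'.nodes i = w.nodes i := by exact_mod_cast h1
    simp only [Itinerary.nodes, hentry i, hexit i] at hn
    refine Fin.ext ?_
    split_ifs at hn <;> omega
  cases w
  cases w'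
  simp only [Itinerary.mk.injEq]
  exact ⟨funext hentry, funext hexit, funext hlap⟩

end SwitchedProblem

theorem theorem6p2 {m : ℕ} (P : SwitchedProblem m) (hlam : P.lam < 0)
    (hN : ∀ i, P.UniqueIVP (P.f i)) (hL : P.UniqueIVP (fun x => P.lam * x))
    (c₁ c₂ : Fin (m + 1) → ℝ) (hann : ∀ i, P.IsAnnulus i (c₁ i) (c₂ i))
    (κ₀ κL : Quadrant) (hκ₀ : κ₀ = .I ∨ κ₀ = .III) (hκL : κL = .II ∨ κL = .IV)
    (r₀ rL : Set (ℝ × ℝ)) (hr₀ : P.IsLinkingArc 0 (c₁ 0) (c₂ 0) κ₀ r₀)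
    (hrL : P.IsLinkingArc (Fin.last m) (c₁ (Fin.last m)) (c₂ (Fin.last m)) κL rL)
    (α β : Fin (m + 1) → ℕ) (hαβ : ∀ i, α i < β i)
    (d e : Fin (m + 1) → ℝ)
    (hde : ∀ i, (d i = c₁ i ∧ e i = c₂ i) ∨ (d i = c₂ i ∧ e i = c₁ i))
    (htwist : ∀ i, P.Twist i (α i) (β i) (d i) (e i) .I ∧ P.Twist i (α i) (β i) (d i) (e i) .III)
    (hIItoI : ∀ i, P.timeIItoI c₁ c₂ i ≤ P.gap i)
    (hIVtoIII : ∀ i, P.timeIVtoIII c₁ c₂ i ≤ P.gap i)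
    (hIVtoI : ∀ i, P.timeIVtoI c₁ c₂ i ≤ P.gap i)
    (hIItoIII : ∀ i, P.timeIItoIII c₁ c₂ i ≤ P.gap i) :
    ((4 ^ m * ∏ i, (β i - α i) : ℕ) : ℕ∞) ≤ (P.nodalSolutions r₀ rL).encard ∧
    Nat.card (Itinerary α β κ₀ κL) = 4 ^ m * ∏ i, (β i - α i) ∧
    ∃ x y : Itinerary α β κ₀ κL → ℝ → ℝ,
      (∀ w, P.IsNodalSolution r₀ rL (x w) (y w) ∧ P.Follows c₁ c₂ w (x w) (y w)) ∧
      ∀ w w', w ≠ w' → ∃ r ∈ Icc 0 P.L, x w r ≠ x w' r := by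
  obtain ⟨ya, hya, yb, hyb, hya0, hyb0, hlt⟩ := P.exists_strip hann
  have S : P.IsStrip c₁ c₂ ya yb := ⟨hann, hya, hyb, hya0, hyb0, hlt⟩
  have hP : 0 < P.L := by
    have := (P.t_strictMono.monotone (Fin.zero_le (Fin.last m))).trans_lt (P.t_lt_s _)
    rwa [P.t_zero] at this
  have hex : ∀ w : Itinerary α β κ₀ κL, ∃ z : ℝ → ℝ × ℝ,
      P.IsNodalSolution r₀ rL (fun r => (z r).1) (fun r => (z r).2) ∧
        P.Follows c₁ c₂ w (fun r => (z r).1) fun r => (z r).2 := by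
    intro w
    obtain ⟨ζ, hζ, hζ0, hζ1, hζs⟩ := S.exists_path hlam hN hL hr₀ hde htwist hIItoI hIVtoIII hIVtoI
      hIItoIII w (Fin.last m)
    obtain ⟨θ, hθ, hθr⟩ := S.exists_mem_arc hκL hrL hζ hζ0 hζ1 fun θ hθ =>
      ⟨by rw [← w.exit_last]; exact (hζs θ hθ).1, (hζs θ hθ).2.1⟩
    obtain ⟨-, -, z, hz, hz0, hzT⟩ := hζs θ hθ
    refine ⟨z, S.isNodalSolution hz hlam rfl hz0 ?_, S.follows hz rfl⟩
    rw [SwitchedProblem.L, hzT]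
    exact hθr
  choose z hzn hzf using hex
  -- The first components alone already differ, since `x' = h(y)` with `h` injective recovers `y`
  -- from `x`.
  have hdist : ∀ w w', w ≠ w' → ∃ r ∈ Icc 0 P.L, (z w r).1 ≠ (z w' r).1 := by
    intro w w' hne
    by_contra! hxu
    exact hne ((hzf w).itinerary_eq (fun i => (hann i).1) (hzf w') hxu
      ((hzn w).1.snd_eq (hzn w').1 hP hxu))
  obtain ⟨hfin, hcard⟩ := Itinerary.finite_and_card (α := α) (β := β) hκ₀ hκL
  refine ⟨?_, hcard, fun w r => (z w r).1, fun w r => (z w r).2, fun w => ⟨hzn w, hzf w⟩, hdist⟩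
  have hinj : Function.Injective fun w : Itinerary α β κ₀ κL =>
      (Icc 0 P.L).domRestrict fun r => ((z w r).1, (z w r).2) := by
    intro w w' heq
    by_contra hne
    obtain ⟨r, hr, hxr⟩ := hdist w w' hne
    exact hxr (congrArg Prod.fst (congrFun heq ⟨r, hr⟩))
  rw [← hcard, ← ENat.card_eq_coe_natCard, ← encard_univ, ← hinj.encard_image]
  refine encard_le_encard ?_
  rintro _ ⟨w, -, rfl⟩
  exact ⟨_, _, hzn w, rfl⟩
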